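/- **Model.** For $i,j,k\ge 1$ let $$y_{ijk}=\mu(\mathbf x_{ijk})+\alpha_i+\beta_j+\gamma_{ij}+e_{ijk},\qquad \mu(\mathbf x_{ijk})=\xi_0+\mathbf x_i^{(a)T}\boldsymbol\xi_1+\mathbf x_j^{(b)T}\boldsymbol\xi_2+\mathbf x_{ij}^{(ab)T}\boldsymbol\xi_3+\mathbf x_{ijk}^{(w)T}\boldsymbol\xi_4 ,$$ with fixed covariate vectors of dimensions $p_a,p_b,p_{ab},p_w\ge 0$; one observes $i\le g$, $j\le h$, $k\le m$, and $n=ghm$. The parameter is $\boldsymbol\omega=(\boldsymbol\xi,\boldsymbol\theta)$ with $\boldsymbol\xi=(\xi_0,\boldsymbol\xi_1,\dots,\boldsymbol\xi_4)$ and $\boldsymbol\theta=(\sigma_\alpha^2,\sigma_\beta^2,\sigma_\gamma^2,\sigma_e^2)$; the parameter space is $\Omega=\{\sigma_\alpha^2,\sigma_\beta^2,\sigma_\gamma^2\ge 0,\ \sigma_e^2>0\}$, and a dot marks true values. Bars denote averages over the missing indices. The centred variables are: $\mathbf x^{(a)}_{i(c)}=\mathbf x^{(a)}_i-\bar{\mathbf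 x}^{(a)}$; $\mathbf x^{(b)}_{j(c)}=\mathbf x^{(b)}_j-\bar{\mathbf x}^{(b)}$; for $z=\mathbf x^{(ab)},\mathbf x^{(w)}$, $\bar z_{i.(c)}=\bar z_{i.}-\bar z$, $\bar z_{.j(c)}=\bar z_{.j}-\bar z$ and $\bar z_{ij(c)}=\bar z_{ij}-\bar z_{i.}-\bar z_{.j}+\bar z$ (written $\mathbf x^{(ab)}_{ij(c)}$ for $z=\mathbf x^{(ab)}$, where $\bar z_{ij}=\mathbf x^{(ab)}_{ij}$); and $\mathbf x^{(w)}_{ijk(c)}=\mathbf x^{(w)}_{ijk}-\bar{\mathbf x}^{(w)}_{ij}$. **Condition B.** 1. The model holds with $\dot{\boldsymbol\omega}$ an interior point of $\Omega$. 2. $g,h,m\to\infty$ along a sequence with $g/h\to\eta$, $g/m\to\eta_1$, $h/m\to\eta_2$, where $\eta,\eta_1,\eta_2\in[0,\infty]$. 3. All $\alpha_i,\beta_j,\gamma_{ij},e_{ijk}$ are mutually independent, identically distributed within each of the four families, with means $0$ and variances $\dot\sigma_\alpha^2,\dot\sigma_\beta^2,\dot\sigma_\gamma^2,\dot\sigma_e^2$;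 for some $\delta>0$ their absolute moments of order $4+\delta$ are finite. 4. The limits of $g^{-1}\sum_i\mathbf x^{(a)}_i$ and $h^{-1}\sum_j\mathbf x^{(b)}_j$ exist. With $\mathbf X^{(a)}_{i(c)}=[\mathbf x^{(a)T}_{i(c)},\bar{\mathbf x}^{(ab)T}_{i.(c)},\bar{\mathbf x}^{(w)T}_{i.(c)}]^T$, $\mathbf X^{(b)}_{j(c)}=[\mathbf x^{(b)T}_{j(c)},\bar{\mathbf x}^{(ab)T}_{.j(c)},\bar{\mathbf x}^{(w)T}_{.j(c)}]^T$ and $\mathbf X^{(ab)}_{ij(c)}=[\mathbf x^{(ab)T}_{ij(c)},\bar{\mathbf x}^{(w)T}_{ij(c)}]^T$, the matrices $g^{-1}\sum_i\mathbf X^{(a)}_{i(c)}\mathbf X^{(a)T}_{i(c)}$, $h^{-1}\sum_j\mathbf X^{(b)}_{j(c)}\mathbf X^{(b)T}_{j(c)}$, $(gh)^{-1}\sum_{i,j}\mathbf X^{(ab)}_{ij(c)}\mathbf X^{(ab)T}_{ij(c)}$ and $n^{-1}\sum_{i,j,k}\mathbf x^{(w)}_{ijk(c)}\mathbf x^{(w)T}_{ijk(c)}$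 have positive definite limits, and for some $\delta>0$ the averages of $|\mathbf x^{(a)}_{i(c)}|^{2+\delta}$, $|\mathbf x^{(b)}_{j(c)}|^{2+\delta}$, $|\mathbf x^{(ab)}_{ij(c)}|^{2+\delta}$, $|\mathbf x^{(w)}_{ijk(c)}|^{2+\delta}$ (over rows, columns, cells and observations, respectively) have finite limits. In this item the limits are taken as the sizes involved tend to infinity without restriction on their relative rates. **EBLUPs.** Put $\lambda_1=\sigma_e^2+m\sigma_\gamma^2$, $\lambda_2=\lambda_1+hm\sigma_\alpha^2$, $\lambda_3=\lambda_1+gm\sigma_\beta^2$, $\lambda_4=\lambda_1+hm\sigma_\alpha^2+gm\sigma_\beta^2$ and $r_{ijk}=y_{ijk}-\mu(\mathbf x_{ijk})$. The BLUPs at $\boldsymbol\omega$ are $$\hat\alpha_i=\tfrac{hm\sigma_\alpha^2}{\lambda_2}\bar r_{i.}-hm\sigma_\alpha^2\big(\tfrac1{\lambda_2}-\tfrac1{\lambda_4}\big)\bar r,\qquad \hat\beta_j=\tfrac{gm\sigma_\beta^2}{\lambda_3}\bar r_{.j}-gm\sigma_\beta^2\big(\tfrac1{\lambda_3}-\tfrac1{\lambda_4}\big)\bar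 r,$$ $$\hat\gamma_{ij}=\tfrac{m\sigma_\gamma^2}{\lambda_1}\bar r_{ij}-m\sigma_\gamma^2\big(\tfrac1{\lambda_1}-\tfrac1{\lambda_2}\big)\bar r_{i.}-m\sigma_\gamma^2\big(\tfrac1{\lambda_1}-\tfrac1{\lambda_3}\big)\bar r_{.j}+m\sigma_\gamma^2\big(\tfrac1{\lambda_1}-\tfrac1{\lambda_2}-\tfrac1{\lambda_3}+\tfrac1{\lambda_4}\big)\bar r .$$ The EBLUPs are the BLUPs at $\boldsymbol\omega=\hat{\boldsymbol\omega}$, where $\hat{\boldsymbol\omega}$ is a consistent sequence of (measurable) estimators that, with probability tending to one, lie in $\Omega$ and solve either the normal maximum likelihood estimating equations (the gradient of the normal log-likelihood vanishes) or the normal REML estimating equations (the gradient of the REML criterion in $\boldsymbol\theta$ vanishes, and $\boldsymbol\xi$ solves the maximum likelihood equations for this $\boldsymbol\theta$). **Claim.** Suppose Condition B. Consistent solution sequences $\hat{\boldsymbol\omega}$ as above exist, both for maximum likelihood and for REML. For every such sequence, and all $i\ne i'$, $j\ne j'$, let $\hat{\boldsymbol\chi}=[\hat\alpha_i-\alpha_i,\hat\alpha_{i'}-\alpha_{i'},\hat\beta_j-\beta_j,\hat\beta_{j'}-\beta_{j'},\hat\gamma_{ij}-\gamma_{ij},\hat\gamma_{i'j}-\gamma_{i'j},\hat\gamma_{ij'}-\gamma_{ij'},\hat\gamma_{i'j'}-\gamma_{i'j'}]^T$.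 Let $\mathbf D_1=\lim g^{-1}\sum_i\mathbf x^{(a)}_{i(c)}\mathbf x^{(a)T}_{i(c)}$, $\mathbf D_2=\lim h^{-1}\sum_j\mathbf x^{(b)}_{j(c)}\mathbf x^{(b)T}_{j(c)}$, $\mathbf c_a=\lim\bar{\mathbf x}^{(a)}$, $\mathbf c_b=\lim\bar{\mathbf x}^{(b)}$, $H^{(a)}_{su}=1+(\mathbf x^{(a)}_s-\mathbf c_a)^T\mathbf D_1^{-1}(\mathbf x^{(a)}_u-\mathbf c_a)$ and $H^{(b)}_{tv}=1+(\mathbf x^{(b)}_t-\mathbf c_b)^T\mathbf D_2^{-1}(\mathbf x^{(b)}_v-\mathbf c_b)$. For $\kappa_1,\kappa_2,\kappa_3\ge0$ put $$\Sigma(\kappa_1,\kappa_2,\kappa_3)=\begin{bmatrix}\operatorname{diag}(\boldsymbol F,\boldsymbol G)&\boldsymbol U\\ \boldsymbol U^T&\kappa_3\dot\sigma_e^2\boldsymbol I_4+\boldsymbol Q\end{bmatrix},$$ where $\boldsymbol F=[F_{su}]_{s,u\in\{i,i'\}}$, $\boldsymbol G=[G_{tv}]_{t,v\in\{j,j'\}}$,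 $F_{su}=\kappa_2\dot\sigma_\gamma^2I(s=u)+\kappa_1\dot\sigma_\alpha^2H^{(a)}_{su}$, $G_{tv}=\kappa_1\dot\sigma_\gamma^2I(t=v)+\kappa_2\dot\sigma_\beta^2H^{(b)}_{tv}$, $$\boldsymbol U=-\dot\sigma_\gamma^2\begin{bmatrix}\kappa_2&0&\kappa_2&0\\0&\kappa_2&0&\kappa_2\\ \kappa_1&\kappa_1&0&0\\0&0&\kappa_1&\kappa_1\end{bmatrix},\quad \boldsymbol Q=\dot\sigma_\gamma^2\begin{bmatrix}\kappa_1+\kappa_2&\kappa_1&\kappa_2&0\\ \kappa_1&\kappa_1+\kappa_2&0&\kappa_2\\ \kappa_2&0&\kappa_1+\kappa_2&\kappa_1\\0&\kappa_2&\kappa_1&\kappa_1+\kappa_2\end{bmatrix}.$$ Then, with $\infty^{-1}=0$ and $\xrightarrow{D}$ denoting convergence in distribution (the limiting covariance matrices being positive semidefinite): 1. if $0\le\eta,\eta_1<\infty$, then $g^{1/2}\hat{\boldsymbol\chi}\xrightarrow{D}N(\mathbf 0,\Sigma(1,\eta,\eta_1))$; 2. if $0<\eta\le\infty$ and $0\le\eta_2<\infty$,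 then $h^{1/2}\hat{\boldsymbol\chi}\xrightarrow{D}N(\mathbf 0,\Sigma(\eta^{-1},1,\eta_2))$; 3. if $0<\eta_1,\eta_2\le\infty$, then $m^{1/2}\hat{\boldsymbol\chi}\xrightarrow{D}N(\mathbf 0,\Sigma(\eta_1^{-1},\eta_2^{-1},1))$. -/

import Mathlib

open MeasureTheory ProbabilityTheory Filter Topology
open scoped Matrix ENNReal

noncomputable section

namespace CrossedEffects

/-! ### Averages and centred arrays

Rows, columns and replicates are indexed by `ℕ` starting at `0`; in a table of size `g × h × m` only
the indices `i < g`, `j < h`, `k < m` are used. -/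

section Averages

variable {E : Type*} [AddCommGroup E] [Module ℝ E]

/-- `n⁻¹ ∑_{i < n} f i`. -/
def avg (n : ℕ) (f : ℕ → E) : E := (n : ℝ)⁻¹ • ∑ i ∈ Finset.range n, f i

/-- Cell averages of a three-index array. -/
def cellAvg (m : ℕ) (f : ℕ → ℕ → ℕ → E) (i j : ℕ) : E := avg m (f i j)

/-- Row averages of a two-index array. For a three-index array use `rowAvg h (cellAvg m f)`. -/
def rowAvg (h : ℕ) (z : ℕ → ℕ → E) (i : ℕ) : E := avg h (z i)

/-- Column averages of a two-index array. -/
def colAvg (g : ℕ) (z : ℕ → ℕ → E) (j : ℕ) : E := avg g (fun i => z i j)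

/-- Overall average of a two-index array. -/
def grandAvg (g h : ℕ) (z : ℕ → ℕ → E) : E := avg g (fun i => avg h (z i))

/-- Centred one-index array. -/
def ctr (n : ℕ) (f : ℕ → E) (i : ℕ) : E := f i - avg n f

/-- Centred row averages. -/
def rowCtr (g h : ℕ) (z : ℕ → ℕ → E) (i : ℕ) : E := rowAvg h z i - grandAvg g h z

/-- Centred column averages. -/
def colCtr (g h : ℕ) (z : ℕ → ℕ → E) (j : ℕ) : E := colAvg g z j - grandAvg g h z

/-- Doubly centred two-index array. -/
def intCtr (g h : ℕ) (z : ℕ → ℕ → E) (i j : ℕ) : E :=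
  z i j - rowAvg h z i - colAvg g z j + grandAvg g h z

/-- Within-cell centred three-index array. -/
def withinCtr (m : ℕ) (f : ℕ → ℕ → ℕ → E) (i j k : ℕ) : E := f i j k - cellAvg m f i j

end Averages

/-! ### Covariates, parameters, model -/

/-- The (non-random) row, column, interaction and within-cell covariates. -/
structure Covariates (pa pb pab pw : ℕ) where
  a : ℕ → EuclideanSpace ℝ (Fin pa)
  b : ℕ → EuclideanSpace ℝ (Fin pb)
  ab : ℕ → ℕ → EuclideanSpace ℝ (Fin pab)
  w : ℕ → ℕ → ℕ → EuclideanSpace ℝ (Fin pw)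

/-- Index set of the fixed effects `ξ = (ξ₀, ξ₁, ξ₂, ξ₃, ξ₄)`. -/
abbrev FixedIdx (pa pb pab pw : ℕ) : Type := Unit ⊕ Fin pa ⊕ Fin pb ⊕ Fin pab ⊕ Fin pw

/-- Variance components `θ = (σ_α², σ_β², σ_γ², σ_e²)`, in this order. -/
abbrev VarComp : Type := Fin 4 → ℝ

/-- Parameters `ω = (ξ, θ)`. -/
abbrev Param (pa pb pab pw : ℕ) : Type := (FixedIdx pa pb pab pw → ℝ) × VarComp

/-- The parameter space: arbitrary fixed effects, `σ_α², σ_β², σ_γ² ≥ 0` and `σ_e² > 0`. -/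
def paramSpace (pa pb pab pw : ℕ) : Set (Param pa pb pab pw) :=
  {ω | 0 ≤ ω.2 0 ∧ 0 ≤ ω.2 1 ∧ 0 ≤ ω.2 2 ∧ 0 < ω.2 3}

/-- The observations of a table with `g` rows, `h` columns and `m` replicates per cell. -/
abbrev Obs (g h m : ℕ) : Type := Fin g × Fin h × Fin m

section Model

variable {pa pb pab pw : ℕ} (x : Covariates pa pb pab pw)

/-- The regressors `(1, xᵢ⁽ᵃ⁾, xⱼ⁽ᵇ⁾, xᵢⱼ⁽ᵃᵇ⁾, xᵢⱼₖ⁽ʷ⁾)` of observation `(i, j, k)`. -/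
def regressor (i j k : ℕ) : FixedIdx pa pb pab pw → ℝ :=
  Sum.elim (fun _ => 1) (Sum.elim (x.a i).ofLp
    (Sum.elim (x.b j).ofLp (Sum.elim (x.ab i j).ofLp (x.w i j k).ofLp)))

/-- The regression function
`ξ₀ + xᵢ⁽ᵃ⁾ᵀ ξ₁ + xⱼ⁽ᵇ⁾ᵀ ξ₂ + xᵢⱼ⁽ᵃᵇ⁾ᵀ ξ₃ + xᵢⱼₖ⁽ʷ⁾ᵀ ξ₄`. -/
def regMean (ξ : FixedIdx pa pb pab pw → ℝ) (i j k : ℕ) : ℝ := regressor x i j k ⬝ᵥ ξ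

/-- The response `y_{ijk} = μ(x_{ijk}) + αᵢ + βⱼ + γᵢⱼ + e_{ijk}` (all at a sample point `s`). -/
def response {S : Type*} (ξ : FixedIdx pa pb pab pw → ℝ) (α β : ℕ → S → ℝ) (γ : ℕ → ℕ → S → ℝ)
    (e : ℕ → ℕ → ℕ → S → ℝ) (s : S) (i j k : ℕ) : ℝ :=
  regMean x ξ i j k + α i s + β j s + γ i j s + e i j k s

/-- The data vector of a `g × h × m` table. -/
def table (g h m : ℕ) (y : ℕ → ℕ → ℕ → ℝ) : Obs g h m → ℝ := fun o => y o.1 o.2.1 o.2.2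

/-- The design matrix `X`. -/
def design (g h m : ℕ) : Matrix (Obs g h m) (FixedIdx pa pb pab pw) ℝ :=
  Matrix.of fun o => regressor x o.1 o.2.1 o.2.2

/-- `Z₁ = I_g ⊗ 1_h ⊗ 1_m`. -/
def Z₁ (g h m : ℕ) : Matrix (Obs g h m) (Fin g) ℝ :=
  Matrix.of fun o i => if o.1 = i then 1 else 0

/-- `Z₂ = 1_g ⊗ I_h ⊗ 1_m`. -/
def Z₂ (g h m : ℕ) : Matrix (Obs g h m) (Fin h) ℝ :=
  Matrix.of fun o j => if o.2.1 = j then 1 else 0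

/-- `Z₃ = I_g ⊗ I_h ⊗ 1_m`. -/
def Z₃ (g h m : ℕ) : Matrix (Obs g h m) (Fin g × Fin h) ℝ :=
  Matrix.of fun o c => if (o.1, o.2.1) = c then 1 else 0

/-- The covariance matrix `V(θ)` of the data vector. -/
def V (g h m : ℕ) (θ : VarComp) : Matrix (Obs g h m) (Obs g h m) ℝ :=
  θ 0 • (Z₁ g h m * (Z₁ g h m)ᵀ) + θ 1 • (Z₂ g h m * (Z₂ g h m)ᵀ)
    + θ 2 • (Z₃ g h m * (Z₃ g h m)ᵀ) + θ 3 • (1 : Matrix (Obs g h m) (Obs g h m) ℝ)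

/-! ### Normal likelihood and REML criterion -/

/-- The (working) normal log-likelihood. -/
def logLik (g h m : ℕ) (y : Obs g h m → ℝ) (ω : Param pa pb pab pw) : ℝ :=
  -(((g * h * m : ℕ) : ℝ) / 2) * Real.log (2 * Real.pi)
    - (1 / 2) * Real.log (V g h m ω.2).det
    - (1 / 2) * ((y - design x g h m *ᵥ ω.1) ⬝ᵥ
        ((V g h m ω.2)⁻¹ *ᵥ (y - design x g h m *ᵥ ω.1)))

/-- `P(θ) = V⁻¹ - V⁻¹ X (Xᵀ V⁻¹ X)⁻¹ Xᵀ V⁻¹`. -/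
def projP (g h m : ℕ) (θ : VarComp) : Matrix (Obs g h m) (Obs g h m) ℝ :=
  (V g h m θ)⁻¹ - (V g h m θ)⁻¹ * design x g h m *
    ((design x g h m)ᵀ * (V g h m θ)⁻¹ * design x g h m)⁻¹ * (design x g h m)ᵀ * (V g h m θ)⁻¹

/-- The normal REML criterion (up to an additive constant). -/
def remlCrit (g h m : ℕ) (y : Obs g h m → ℝ) (θ : VarComp) : ℝ :=
  -(1 / 2) * Real.log (V g h m θ).det
    - (1 / 2) * Real.log ((design x g h m)ᵀ * (V g h m θ)⁻¹ * design x g h m).det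
    - (1 / 2) * (y ⬝ᵥ (projP x g h m θ *ᵥ y))

/-- `ω` solves the normal maximum likelihood estimating equations. -/
def SolvesML (g h m : ℕ) (y : Obs g h m → ℝ) (ω : Param pa pb pab pw) : Prop :=
  ω ∈ paramSpace pa pb pab pw ∧ HasFDerivAt (logLik x g h m y) (0 : Param pa pb pab pw →L[ℝ] ℝ) ω

/-- `ω = (ξ, θ)` solves the normal REML estimating equations: `θ` is a critical point of the REML
criterion and `ξ` solves the maximum likelihood estimating equations with `θ` fixed. -/
def SolvesREML (g h m : ℕ) (y : Obs g h m → ℝ) (ω : Param pa pb pab pw) : Prop :=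
  ω ∈ paramSpace pa pb pab pw ∧ HasFDerivAt (remlCrit x g h m y) (0 : VarComp →L[ℝ] ℝ) ω.2 ∧
    HasFDerivAt (fun ξ : FixedIdx pa pb pab pw → ℝ => logLik x g h m y (ξ, ω.2))
      (0 : (FixedIdx pa pb pab pw → ℝ) →L[ℝ] ℝ) ω.1

/-- `est N` is a (measurable) estimator computed from the `g N × h N × m N` table of the data `y`;
the estimators solve the estimating equations `Solves` with probability tending to one, and they are
consistent for `ω₀`. -/
structure IsConsistentRoot {S : Type*} [MeasurableSpace S] (P : Measure S)
    (Solves : ∀ g h m : ℕ, (Obs g h m → ℝ) → Param pa pb pab pw → Prop)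
    (ω₀ : Param pa pb pab pw) (y : S → ℕ → ℕ → ℕ → ℝ) (g h m : ℕ → ℕ)
    (est : ∀ N, (Obs (g N) (h N) (m N) → ℝ) → Param pa pb pab pw) : Prop where
  measurable : ∀ N, Measurable (est N)
  solves : Tendsto (fun N => P {s | ¬ Solves (g N) (h N) (m N) (table (g N) (h N) (m N) (y s))
    (est N (table (g N) (h N) (m N) (y s)))}) atTop (𝓝 0)
  consistent : TendstoInMeasure P (fun N s => est N (table (g N) (h N) (m N) (y s))) atTop
    (fun _ => ω₀)

/-! ### Best linear unbiased predictors -/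

/-- `λ₁ = σ_e² + m σ_γ²`. -/
def lam₁ (m : ℕ) (θ : VarComp) : ℝ := θ 3 + m * θ 2

/-- `λ₂ = σ_e² + m σ_γ² + h m σ_α²`. -/
def lam₂ (h m : ℕ) (θ : VarComp) : ℝ := θ 3 + m * θ 2 + h * m * θ 0

/-- `λ₃ = σ_e² + m σ_γ² + g m σ_β²`. -/
def lam₃ (g m : ℕ) (θ : VarComp) : ℝ := θ 3 + m * θ 2 + g * m * θ 1

/-- `λ₄ = σ_e² + m σ_γ² + h m σ_α² + g m σ_β²`. -/
def lam₄ (g h m : ℕ) (θ : VarComp) : ℝ := θ 3 + m * θ 2 + h * m * θ 0 + g * m * θ 1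

/-- Cell averages of the residuals `y_{ijk} - μ(x_{ijk})`. -/
def resid (m : ℕ) (ξ : FixedIdx pa pb pab pw → ℝ) (y : ℕ → ℕ → ℕ → ℝ) : ℕ → ℕ → ℝ :=
  cellAvg m (fun i j k => y i j k - regMean x ξ i j k)

/-- The BLUP of `αᵢ` at the parameter `ω`. -/
def blupα (g h m : ℕ) (ω : Param pa pb pab pw) (y : ℕ → ℕ → ℕ → ℝ) (i : ℕ) : ℝ :=
  h * m * ω.2 0 / lam₂ h m ω.2 * rowAvg h (resid x m ω.1 y) i
    - h * m * ω.2 0 * (1 / lam₂ h m ω.2 - 1 / lam₄ g h m ω.2) * grandAvg g h (resid x m ω.1 y)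

/-- The BLUP of `βⱼ` at the parameter `ω`. -/
def blupβ (g h m : ℕ) (ω : Param pa pb pab pw) (y : ℕ → ℕ → ℕ → ℝ) (j : ℕ) : ℝ :=
  g * m * ω.2 1 / lam₃ g m ω.2 * colAvg g (resid x m ω.1 y) j
    - g * m * ω.2 1 * (1 / lam₃ g m ω.2 - 1 / lam₄ g h m ω.2) * grandAvg g h (resid x m ω.1 y)

/-- The BLUP of `γᵢⱼ` at the parameter `ω`. -/
def blupγ (g h m : ℕ) (ω : Param pa pb pab pw) (y : ℕ → ℕ → ℕ → ℝ) (i j : ℕ) : ℝ :=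
  m * ω.2 2 / lam₁ m ω.2 * resid x m ω.1 y i j
    - m * ω.2 2 * (1 / lam₁ m ω.2 - 1 / lam₂ h m ω.2) * rowAvg h (resid x m ω.1 y) i
    - m * ω.2 2 * (1 / lam₁ m ω.2 - 1 / lam₃ g m ω.2) * colAvg g (resid x m ω.1 y) j
    + m * ω.2 2 * (1 / lam₁ m ω.2 - 1 / lam₂ h m ω.2 - 1 / lam₃ g m ω.2 + 1 / lam₄ g h m ω.2)
      * grandAvg g h (resid x m ω.1 y)

/-- The vector `χ̂` of prediction errors of the EBLUPs (the BLUPs at the estimated parameter `ω`) of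
`αᵢ, αᵢ', βⱼ, βⱼ', γᵢⱼ, γᵢ'ⱼ, γᵢⱼ', γᵢ'ⱼ'`, at the sample point `s`. -/
def predError {S : Type*} (g h m : ℕ) (ω : Param pa pb pab pw) (y : ℕ → ℕ → ℕ → ℝ)
    (α β : ℕ → S → ℝ) (γ : ℕ → ℕ → S → ℝ) (i i' j j' : ℕ) (s : S) :
    EuclideanSpace ℝ ((Fin 2 ⊕ Fin 2) ⊕ Fin 4) :=
  WithLp.toLp 2 (Sum.elim
    (Sum.elim
      ![blupα x g h m ω y i - α i s, blupα x g h m ω y i' - α i' s]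
      ![blupβ x g h m ω y j - β j s, blupβ x g h m ω y j' - β j' s])
    ![blupγ x g h m ω y i j - γ i j s, blupγ x g h m ω y i' j - γ i' j s,
      blupγ x g h m ω y i j' - γ i j' s, blupγ x g h m ω y i' j' - γ i' j' s])

/-! ### The regularity conditions -/

/-- `X_{i(c)}⁽ᵃ⁾`: centred row covariates and centred row averages of the interaction and within-cell
covariates. -/
def rowVec (g h m i : ℕ) : Fin pa ⊕ Fin pab ⊕ Fin pw → ℝ :=
  Sum.elim (ctr g x.a i).ofLp
    (Sum.elim (rowCtr g h x.ab i).ofLp (rowCtr g h (cellAvg m x.w) i).ofLp)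

/-- `X_{j(c)}⁽ᵇ⁾`. -/
def colVec (g h m j : ℕ) : Fin pb ⊕ Fin pab ⊕ Fin pw → ℝ :=
  Sum.elim (ctr h x.b j).ofLp
    (Sum.elim (colCtr g h x.ab j).ofLp (colCtr g h (cellAvg m x.w) j).ofLp)

/-- `X_{ij(c)}⁽ᵃᵇ⁾`. -/
def intVec (g h m i j : ℕ) : Fin pab ⊕ Fin pw → ℝ :=
  Sum.elim (intCtr g h x.ab i j).ofLp (intCtr g h (cellAvg m x.w) i j).ofLp

/-- The outer product `v vᵀ`. -/
def outer {ι : Type*} (v : ι → ℝ) : Matrix ι ι ℝ := Matrix.vecMulVec v v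

/-- All random terms of the model, as one family. -/
def allEffects {S : Type*} (α β : ℕ → S → ℝ) (γ : ℕ → ℕ → S → ℝ) (e : ℕ → ℕ → ℕ → S → ℝ) :
    ℕ ⊕ ℕ ⊕ (ℕ × ℕ) ⊕ (ℕ × ℕ × ℕ) → S → ℝ :=
  Sum.elim α (Sum.elim β (Sum.elim (fun c => γ c.1 c.2) (fun o => e o.1 o.2.1 o.2.2)))

/-- The standing assumptions on the crossed random effect model with interaction. Limits of covariate averages are taken as the sizes occurring in them tend to infinity, without
restriction on their relative rates. -/
structure RegularityConditions {S : Type*} [MeasurableSpace S] (P : Measure S) (ω₀ : Param pa pb pab pw)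
    (α β : ℕ → S → ℝ) (γ : ℕ → ℕ → S → ℝ) (e : ℕ → ℕ → ℕ → S → ℝ)
    (g h m : ℕ → ℕ) (η η₁ η₂ : ℝ≥0∞) : Prop where
  -- the true parameter
  interior : ω₀ ∈ interior (paramSpace pa pb pab pw)
  -- the sizes of the table
  g_top : Tendsto g atTop atTop
  h_top : Tendsto h atTop atTop
  m_top : Tendsto m atTop atTop
  g_div_h : Tendsto (fun N => (g N : ℝ≥0∞) / (h N : ℝ≥0∞)) atTop (𝓝 η)
  g_div_m : Tendsto (fun N => (g N : ℝ≥0∞) / (m N : ℝ≥0∞)) atTop (𝓝 η₁)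
  h_div_m : Tendsto (fun N => (h N : ℝ≥0∞) / (m N : ℝ≥0∞)) atTop (𝓝 η₂)
  -- the random effects and errors
  measurable : ∀ c, Measurable (allEffects α β γ e c)
  indep : iIndepFun (allEffects α β γ e) P
  ident_α : ∀ i, IdentDistrib (α i) (α 0) P P
  ident_β : ∀ j, IdentDistrib (β j) (β 0) P P
  ident_γ : ∀ i j, IdentDistrib (γ i j) (γ 0 0) P P
  ident_e : ∀ i j k, IdentDistrib (e i j k) (e 0 0 0) P P
  mean_α : ∫ s, α 0 s ∂P = 0
  mean_β : ∫ s, β 0 s ∂P = 0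
  mean_γ : ∫ s, γ 0 0 s ∂P = 0
  mean_e : ∫ s, e 0 0 0 s ∂P = 0
  var_α : Var[α 0; P] = ω₀.2 0
  var_β : Var[β 0; P] = ω₀.2 1
  var_γ : Var[γ 0 0; P] = ω₀.2 2
  var_e : Var[e 0 0 0; P] = ω₀.2 3
  moments : ∃ δ : ℝ, 0 < δ ∧
    Integrable (fun s => |α 0 s| ^ (4 + δ)) P ∧ Integrable (fun s => |β 0 s| ^ (4 + δ)) P ∧
    Integrable (fun s => |γ 0 0 s| ^ (4 + δ)) P ∧ Integrable (fun s => |e 0 0 0 s| ^ (4 + δ)) P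
  -- the covariates
  lim_a : ∃ l, Tendsto (fun g => avg g x.a) atTop (𝓝 l)
  lim_b : ∃ l, Tendsto (fun h => avg h x.b) atTop (𝓝 l)
  lim_row : ∃ M : Matrix (Fin pa ⊕ Fin pab ⊕ Fin pw) (Fin pa ⊕ Fin pab ⊕ Fin pw) ℝ, M.PosDef ∧
    Tendsto (fun q : ℕ × ℕ × ℕ => avg q.1 (fun i => outer (rowVec x q.1 q.2.1 q.2.2 i)))
      atTop (𝓝 M)
  lim_col : ∃ M : Matrix (Fin pb ⊕ Fin pab ⊕ Fin pw) (Fin pb ⊕ Fin pab ⊕ Fin pw) ℝ, M.PosDef ∧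
    Tendsto (fun q : ℕ × ℕ × ℕ => avg q.2.1 (fun j => outer (colVec x q.1 q.2.1 q.2.2 j)))
      atTop (𝓝 M)
  lim_int : ∃ M : Matrix (Fin pab ⊕ Fin pw) (Fin pab ⊕ Fin pw) ℝ, M.PosDef ∧
    Tendsto (fun q : ℕ × ℕ × ℕ =>
      grandAvg q.1 q.2.1 (fun i j => outer (intVec x q.1 q.2.1 q.2.2 i j))) atTop (𝓝 M)
  lim_within : ∃ M : Matrix (Fin pw) (Fin pw) ℝ, M.PosDef ∧
    Tendsto (fun q : ℕ × ℕ × ℕ => grandAvg q.1 q.2.1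
      (cellAvg q.2.2 (fun i j k => outer (withinCtr q.2.2 x.w i j k).ofLp))) atTop (𝓝 M)
  lim_moments : ∃ δ : ℝ, 0 < δ ∧
    (∃ l : ℝ, Tendsto (fun g : ℕ => avg g (fun i => ‖ctr g x.a i‖ ^ (2 + δ))) atTop (𝓝 l)) ∧
    (∃ l : ℝ, Tendsto (fun h : ℕ => avg h (fun j => ‖ctr h x.b j‖ ^ (2 + δ))) atTop (𝓝 l)) ∧
    (∃ l : ℝ, Tendsto (fun q : ℕ × ℕ =>
      grandAvg q.1 q.2 (fun i j => ‖intCtr q.1 q.2 x.ab i j‖ ^ (2 + δ))) atTop (𝓝 l)) ∧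
    (∃ l : ℝ, Tendsto (fun q : ℕ × ℕ × ℕ => grandAvg q.1 q.2.1
      (cellAvg q.2.2 (fun i j k => ‖withinCtr q.2.2 x.w i j k‖ ^ (2 + δ)))) atTop (𝓝 l))

end Model

/-! ### The limiting covariance matrix -/

/-- `1 + (z_s - c)ᵀ D⁻¹ (z_u - c)`. -/
def leverage {p : ℕ} (z : ℕ → EuclideanSpace ℝ (Fin p)) (c : EuclideanSpace ℝ (Fin p))
    (D : Matrix (Fin p) (Fin p) ℝ) (s u : ℕ) : ℝ :=
  1 + (z s - c).ofLp ⬝ᵥ (D⁻¹ *ᵥ (z u - c).ofLp)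

/-- The 2 × 2 matrix with entries `v I(s = u) + w H s u`, for `s, u ∈ {r, r'}`. -/
def blockFG (v w : ℝ) (H : ℕ → ℕ → ℝ) (r r' : ℕ) : Matrix (Fin 2) (Fin 2) ℝ :=
  !![v + w * H r r, w * H r r'; w * H r' r, v + w * H r' r']

/-- The block matrix `[diag(F, G), U; Uᵀ, κ₃ σ_e² I₄ + Q]`, where
`F_{su} = κ₂ σ_γ² I(s = u) + κ₁ σ_α² H⁽ᵃ⁾_{su}`, `G_{tv} = κ₁ σ_γ² I(t = v) + κ₂ σ_β² H⁽ᵇ⁾_{tv}`.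
For the normalisation by `r^{1/2}`, `r ∈ {g, h, m}`, the constants `κ₁, κ₂, κ₃` are the limits of
`r / g`, `r / h`, `r / m`. -/
def limitCov (κ₁ κ₂ κ₃ : ℝ) (θ : VarComp) (Ha Hb : ℕ → ℕ → ℝ) (i i' j j' : ℕ) :
    Matrix ((Fin 2 ⊕ Fin 2) ⊕ Fin 4) ((Fin 2 ⊕ Fin 2) ⊕ Fin 4) ℝ :=
  let F := blockFG (κ₂ * θ 2) (κ₁ * θ 0) Ha i i'
  let G := blockFG (κ₁ * θ 2) (κ₂ * θ 1) Hb j j'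
  let U : Matrix (Fin 2 ⊕ Fin 2) (Fin 4) ℝ := -(θ 2) • Matrix.fromRows
    !![κ₂, 0, κ₂, 0;
       0, κ₂, 0, κ₂]
    !![κ₁, κ₁, 0, 0;
       0, 0, κ₁, κ₁]
  let Q : Matrix (Fin 4) (Fin 4) ℝ := θ 2 •
    !![κ₁ + κ₂, κ₁, κ₂, 0;
       κ₁, κ₁ + κ₂, 0, κ₂;
       κ₂, 0, κ₁ + κ₂, κ₁;
       0, κ₂, κ₁, κ₁ + κ₂]
  Matrix.fromBlocks (Matrix.fromBlocks F 0 0 G) U Uᵀ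
    ((κ₃ * θ 3) • (1 : Matrix (Fin 4) (Fin 4) ℝ) + Q)

/-- `T N` converges in distribution to the normal distribution `N(0, C)` (and `C` is a covariance
matrix). -/
def ConvergesToNormal {S ι : Type*} [MeasurableSpace S] [Fintype ι] [DecidableEq ι]
    (P : Measure S) [IsProbabilityMeasure P] (T : ℕ → S → EuclideanSpace ℝ ι)
    (C : Matrix ι ι ℝ) : Prop :=
  C.PosSemidef ∧
    TendstoInDistribution T atTop (id : EuclideanSpace ℝ ι → EuclideanSpace ℝ ι) (fun _ => P)
      (multivariateGaussian 0 C)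

end CrossedEffects

end

open MeasureTheory ProbabilityTheory Filter Topology
open scoped Matrix ENNReal

namespace CrossedEffects

/-! ### Symmetric families of orthogonal idempotent matrices -/

section Idempotents

variable {ι b : Type*} [Fintype ι] [DecidableEq ι] [Fintype b]

lemma log_det_one_add_smul_of_isIdempotentElem {Q : Matrix ι ι ℝ} (hQ : Qᵀ = Q)
    (hi : IsIdempotentElem Q) {c : ℝ} (hc : 0 < 1 + c) :
    0 < (1 + c • Q).det ∧ Real.log (1 + c • Q).det = Q.trace * Real.log (1 + c) := by
  have hH : Q.IsHermitian := by simpa [Matrix.IsHermitian] using hQ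
  set φ := Unitary.conjStarAlgAut ℝ (Matrix ι ι ℝ) hH.eigenvectorUnitary
  set d := hH.eigenvalues
  have hφ : Q = φ (Matrix.diagonal d) := hH.spectral_theorem
  have hdd : Matrix.diagonal d * Matrix.diagonal d = Matrix.diagonal d := by
    apply φ.injective
    change φ _ = φ _
    rw [map_mul, ← hφ]
    exact hi
  have hd : ∀ i, d i = 0 ∨ d i = 1 := by
    intro i
    have := congrFun (congrFun hdd i) i
    rw [Matrix.diagonal_mul_diagonal, Matrix.diagonal_apply_eq, Matrix.diagonal_apply_eq] at this
    rcases eq_or_ne (d i) 0 with h0 | h0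
    · exact Or.inl h0
    · exact Or.inr (mul_left_cancel₀ h0 (by linarith))
  have hpos : ∀ i, 0 < 1 + c * d i := by
    intro i
    rcases hd i with h | h <;> rw [h] <;> linarith
  have hdet : (1 + c • Q).det = ∏ i, (1 + c * d i) := by
    have h1 : 1 + c • Q = φ (Matrix.diagonal fun i => 1 + c * d i) := by
      have : (Matrix.diagonal fun i => 1 + c * d i) = 1 + c • Matrix.diagonal d := by
        rw [← Matrix.diagonal_one, ← Matrix.diagonal_smul, Matrix.diagonal_add]
        rfl
      rw [this, map_add, map_one, map_smul, ← hφ]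
    rw [h1, Unitary.conjStarAlgAut_apply, Matrix.det_conj_of_mul_eq_one
      (Unitary.mul_star_self_of_mem hH.eigenvectorUnitary.2)
      (Unitary.star_mul_self_of_mem hH.eigenvectorUnitary.2), Matrix.det_diagonal]
  refine ⟨hdet ▸ Finset.prod_pos fun i _ => hpos i, ?_⟩
  rw [hdet, Real.log_prod fun i _ => (hpos i).ne', hH.trace_eq_sum_eigenvalues, Finset.sum_mul]
  refine Finset.sum_congr rfl fun i _ => ?_
  change Real.log (1 + c * d i) = d i * _
  rcases hd i with h | h <;> simp [h]

variable {Q : b → Matrix ι ι ℝ}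

lemma sum_smul_mul_sum_smul (hQ : OrthogonalIdempotents Q) (c d : b → ℝ) :
    (∑ i, c i • Q i) * ∑ i, d i • Q i = ∑ i, (c i * d i) • Q i := by
  rw [Finset.sum_mul_sum]
  refine Finset.sum_congr rfl fun i _ => ?_
  rw [Finset.sum_eq_single i]
  · rw [smul_mul_smul_comm, hQ.idem i]
  · intro j _ hj
    rw [smul_mul_smul_comm, hQ.ortho hj.symm, smul_zero]
  · simp

lemma inv_sum_smul (hQ : CompleteOrthogonalIdempotents Q) {c : b → ℝ} (hc : ∀ i, c i ≠ 0) :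
    (∑ i, c i • Q i)⁻¹ = ∑ i, (c i)⁻¹ • Q i := by
  refine Matrix.inv_eq_right_inv ?_
  rw [sum_smul_mul_sum_smul hQ.toOrthogonalIdempotents, ← hQ.complete]
  exact Finset.sum_congr rfl fun i _ => by rw [mul_inv_cancel₀ (hc i), one_smul]

lemma log_det_sum_smul [DecidableEq b] (hQ : CompleteOrthogonalIdempotents Q) (hs : ∀ i, (Q i)ᵀ = Q i)
    {c : b → ℝ} (hc : ∀ i, 0 < c i) :
    0 < (∑ i, c i • Q i).det ∧
      Real.log (∑ i, c i • Q i).det = ∑ i, (Q i).trace * Real.log (c i) := by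
  have key : ∀ s : Finset b, 0 < (1 + ∑ i ∈ s, (c i - 1) • Q i).det ∧
      Real.log (1 + ∑ i ∈ s, (c i - 1) • Q i).det = ∑ i ∈ s, (Q i).trace * Real.log (c i) := by
    intro s
    induction s using Finset.induction_on with
    | empty => simp
    | insert a s ha ih =>
      have h0 : (∑ i ∈ s, (c i - 1) • Q i) * Q a = 0 := by
        rw [Finset.sum_mul]
        refine Finset.sum_eq_zero fun i hi => ?_
        rw [smul_mul_assoc, hQ.ortho (ne_of_mem_of_not_mem hi ha), smul_zero]
      have h1 : 1 + ∑ i ∈ insert a s, (c i - 1) • Q i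
          = (1 + ∑ i ∈ s, (c i - 1) • Q i) * (1 + (c a - 1) • Q a) := by
        rw [Finset.sum_insert ha, mul_add, mul_one, mul_smul_comm, add_mul, h0, one_mul, add_zero]
        abel
      obtain ⟨p, hp⟩ := log_det_one_add_smul_of_isIdempotentElem (hs a) (hQ.idem a)
        (c := c a - 1) (by linarith [hc a])
      rw [h1, Matrix.det_mul, Finset.sum_insert ha]
      refine ⟨mul_pos ih.1 p, ?_⟩
      rw [Real.log_mul ih.1.ne' p.ne', ih.2, hp, add_sub_cancel, add_comm]
  have h2 : ∑ i, c i • Q i = 1 + ∑ i, (c i - 1) • Q i := by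
    simp_rw [sub_smul, one_smul, Finset.sum_sub_distrib, hQ.complete]
    abel
  rw [h2]
  exact key Finset.univ

end Idempotents

/-! ### The strata of a crossed table -/

open scoped Kronecker

/-- The matrix with all entries `1 / n`. -/
noncomputable def avgMat (n : ℕ) : Matrix (Fin n) (Fin n) ℝ := Matrix.of fun _ _ => (n : ℝ)⁻¹

/-- The centring matrix. -/
noncomputable def ctrMat (n : ℕ) : Matrix (Fin n) (Fin n) ℝ := 1 - avgMat n

lemma avgMat_mul_avgMat (n : ℕ) : avgMat n * avgMat n = avgMat n := by
  ext i j
  have : (n : ℝ) ≠ 0 := by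
    have := i.pos
    positivity
  simp [Matrix.mul_apply, avgMat, this]

lemma ctrMat_mul_avgMat (n : ℕ) : ctrMat n * avgMat n = 0 := by
  rw [ctrMat, sub_mul, one_mul, avgMat_mul_avgMat, sub_self]

lemma avgMat_mul_ctrMat (n : ℕ) : avgMat n * ctrMat n = 0 := by
  rw [ctrMat, mul_sub, mul_one, avgMat_mul_avgMat, sub_self]

lemma ctrMat_mul_ctrMat (n : ℕ) : ctrMat n * ctrMat n = ctrMat n := by
  nth_rw 2 [ctrMat]
  rw [mul_sub, mul_one, ctrMat_mul_avgMat, sub_zero]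

lemma avgMat_transpose (n : ℕ) : (avgMat n)ᵀ = avgMat n := rfl

lemma ctrMat_transpose (n : ℕ) : (ctrMat n)ᵀ = ctrMat n := by
  rw [ctrMat, Matrix.transpose_sub, avgMat_transpose, Matrix.transpose_one]

lemma avgMat_add_ctrMat (n : ℕ) : avgMat n + ctrMat n = 1 := by
  rw [ctrMat]; abel

lemma trace_avgMat {n : ℕ} (hn : n ≠ 0) : (avgMat n).trace = 1 := by
  simp [Matrix.trace, avgMat, hn]

lemma trace_ctrMat {n : ℕ} (hn : n ≠ 0) : (ctrMat n).trace = n - 1 := by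
  rw [ctrMat, Matrix.trace_sub, trace_avgMat hn, Matrix.trace_one, Fintype.card_fin]

/-- The orthogonal projections onto the strata of a `g × h × m` table: overall mean, rows, columns,
interaction, within cells. -/
noncomputable def strat (g h m : ℕ) : Fin 5 → Matrix (Obs g h m) (Obs g h m) ℝ :=
  ![avgMat g ⊗ₖ (avgMat h ⊗ₖ avgMat m), ctrMat g ⊗ₖ (avgMat h ⊗ₖ avgMat m),
    avgMat g ⊗ₖ (ctrMat h ⊗ₖ avgMat m), ctrMat g ⊗ₖ (ctrMat h ⊗ₖ avgMat m),
    1 ⊗ₖ (1 ⊗ₖ ctrMat m)]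

lemma strat_transpose (g h m : ℕ) (b : Fin 5) : (strat g h m b)ᵀ = strat g h m b := by
  fin_cases b <;>
    simp [strat, ← Matrix.kroneckerMap_transpose, avgMat_transpose, ctrMat_transpose]

lemma strat_idem (g h m : ℕ) : CompleteOrthogonalIdempotents (strat g h m) where
  idem b := by
    fin_cases b <;>
      simp [strat, IsIdempotentElem, ← Matrix.mul_kronecker_mul, avgMat_mul_avgMat,
        ctrMat_mul_ctrMat]
  ortho b b' hb := by
    fin_cases b <;> fin_cases b' <;>
      first
      | exact absurd rfl hb
      | simp [strat, ← Matrix.mul_kronecker_mul, avgMat_mul_ctrMat, ctrMat_mul_avgMat]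
  complete := by
    have h1 : (1 : Matrix (Obs g h m) (Obs g h m) ℝ)
        = (avgMat g + ctrMat g) ⊗ₖ ((avgMat h + ctrMat h) ⊗ₖ (avgMat m + ctrMat m)) := by
      simp [avgMat_add_ctrMat]
    have h2 : (strat g h m 4)
        = (avgMat g + ctrMat g) ⊗ₖ ((avgMat h + ctrMat h) ⊗ₖ (ctrMat m)) := by
      simp [strat, avgMat_add_ctrMat]
    rw [h1, Fin.sum_univ_five, h2]
    simp only [strat, Matrix.add_kronecker, Matrix.kronecker_add]
    simp
    abel

/-- The eigenvalues of `V(θ)` on the strata. -/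
noncomputable def lam (g h m : ℕ) (θ : VarComp) : Fin 5 → ℝ :=
  ![lam₄ g h m θ, lam₂ h m θ, lam₃ g m θ, lam₁ m θ, θ 3]

lemma Z₁_mul_transpose (g h m : ℕ) : Z₁ g h m * (Z₁ g h m)ᵀ
    = ((h : ℝ) * m) • (strat g h m 0 + strat g h m 1) := by
  have : strat g h m 0 + strat g h m 1 = 1 ⊗ₖ (avgMat h ⊗ₖ avgMat m) := by
    simp [strat, ← Matrix.add_kronecker, avgMat_add_ctrMat]
  rw [this]
  ext ⟨i, j, k⟩ ⟨i', j', k'⟩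
  have hh : (h : ℝ) ≠ 0 := by have := j.pos; positivity
  have hm : (m : ℝ) ≠ 0 := by have := k.pos; positivity
  simp [Matrix.mul_apply, Z₁, Matrix.one_apply, avgMat, eq_comm]
  congr 1
  field_simp

lemma Z₂_mul_transpose (g h m : ℕ) : Z₂ g h m * (Z₂ g h m)ᵀ
    = ((g : ℝ) * m) • (strat g h m 0 + strat g h m 2) := by
  have : strat g h m 0 + strat g h m 2 = avgMat g ⊗ₖ (1 ⊗ₖ avgMat m) := by
    simp [strat, ← Matrix.add_kronecker, ← Matrix.kronecker_add, avgMat_add_ctrMat]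
  rw [this]
  ext ⟨i, j, k⟩ ⟨i', j', k'⟩
  have hh : (g : ℝ) ≠ 0 := by have := i.pos; positivity
  have hm : (m : ℝ) ≠ 0 := by have := k.pos; positivity
  simp [Matrix.mul_apply, Z₂, Matrix.one_apply, avgMat, eq_comm]
  congr 1
  field_simp

lemma strat_sum_cells (g h m : ℕ) :
    strat g h m 0 + strat g h m 1 + strat g h m 2 + strat g h m 3 = 1 ⊗ₖ (1 ⊗ₖ avgMat m) := by
  have h1 : (1 : Matrix (Fin g) (Fin g) ℝ) = avgMat g + ctrMat g := (avgMat_add_ctrMat g).symm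
  have h2 : (1 : Matrix (Fin h) (Fin h) ℝ) = avgMat h + ctrMat h := (avgMat_add_ctrMat h).symm
  rw [h1, h2]
  simp only [strat, Matrix.add_kronecker, Matrix.kronecker_add]
  simp
  abel

lemma Z₃_mul_transpose (g h m : ℕ) : Z₃ g h m * (Z₃ g h m)ᵀ
    = (m : ℝ) • (strat g h m 0 + strat g h m 1 + strat g h m 2 + strat g h m 3) := by
  rw [strat_sum_cells]
  ext ⟨i, j, k⟩ ⟨i', j', k'⟩
  have hm : (m : ℝ) ≠ 0 := by have := k.pos; positivity
  simp only [Matrix.mul_apply, Z₃, Matrix.transpose_apply, Matrix.of_apply, Matrix.smul_apply,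
    Matrix.kroneckerMap_apply, Matrix.one_apply, avgMat, smul_eq_mul, mul_ite, mul_one, mul_zero,
    Finset.sum_ite_eq, Finset.mem_univ, if_true, Prod.mk.injEq]
  by_cases h1 : i = i' <;> by_cases h2 : j = j' <;> simp [h1, h2, hm]

lemma V_eq_sum (g h m : ℕ) (θ : VarComp) : V g h m θ = ∑ b, lam g h m θ b • strat g h m b := by
  rw [V, Z₁_mul_transpose, Z₂_mul_transpose, Z₃_mul_transpose, ← (strat_idem g h m).complete]
  simp only [Fin.sum_univ_five, lam, lam₁, lam₂, lam₃, lam₄]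
  simp
  module

lemma V_inv_eq_sum {g h m : ℕ} {θ : VarComp} (hθ : ∀ b, lam g h m θ b ≠ 0) :
    (V g h m θ)⁻¹ = ∑ b, (lam g h m θ b)⁻¹ • strat g h m b := by
  rw [V_eq_sum, inv_sum_smul (strat_idem g h m) hθ]

/-- The dimensions of the strata. -/
noncomputable def stratDim (g h m : ℕ) : Fin 5 → ℝ :=
  ![1, g - 1, h - 1, (g - 1) * (h - 1), g * h * (m - 1)]

lemma trace_strat {g h m : ℕ} (hg : g ≠ 0) (hh : h ≠ 0) (hm : m ≠ 0) (b : Fin 5) :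
    (strat g h m b).trace = stratDim g h m b := by
  fin_cases b <;>
    simp [strat, stratDim, Matrix.trace_kronecker, trace_avgMat, trace_ctrMat, hg, hh, hm, mul_assoc]

lemma log_det_V {g h m : ℕ} (hg : g ≠ 0) (hh : h ≠ 0) (hm : m ≠ 0) {θ : VarComp}
    (hθ : ∀ b, 0 < lam g h m θ b) :
    Real.log (V g h m θ).det = ∑ b, stratDim g h m b * Real.log (lam g h m θ b) := by
  rw [V_eq_sum, (log_det_sum_smul (strat_idem g h m) (strat_transpose g h m) hθ).2]
  simp_rw [trace_strat hg hh hm]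

lemma lam_pos {g h m : ℕ} {θ : VarComp} (hθ : ∀ k, 0 < θ k) (b : Fin 5) : 0 < lam g h m θ b := by
  have h0 := hθ 0
  have h1 := hθ 1
  have h2 := hθ 2
  have h3 := hθ 3
  fin_cases b <;> simp [lam, lam₁, lam₂, lam₃, lam₄] <;> positivity

lemma lam_mono (g h m : ℕ) {θ θ' : VarComp} (hθ : ∀ k, θ k ≤ θ' k) (b : Fin 5) :
    lam g h m θ b ≤ lam g h m θ' b := by
  have h0 := hθ 0
  have h1 := hθ 1
  have h2 := hθ 2
  have h3 := hθ 3
  fin_cases b <;> simp [lam, lam₁, lam₂, lam₃, lam₄] <;> gcongr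

lemma lam_smul (g h m : ℕ) (c : ℝ) (θ : VarComp) (b : Fin 5) :
    lam g h m (c • θ) b = c * lam g h m θ b := by
  fin_cases b <;> simp [lam, lam₁, lam₂, lam₃, lam₄] <;> ring

open scoped Kronecker

/-! ### Averages -/

section AverageLemmas

variable {E F : Type*} [AddCommGroup E] [Module ℝ E] [AddCommGroup F] [Module ℝ F]

lemma avg_add (n : ℕ) (f f' : ℕ → E) : avg n (fun i => f i + f' i) = avg n f + avg n f' := by
  simp [avg, Finset.sum_add_distrib]

lemma avg_sub (n : ℕ) (f f' : ℕ → E) : avg n (fun i => f i - f' i) = avg n f - avg n f' := by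
  simp [avg, Finset.sum_sub_distrib, smul_sub]

lemma avg_const {n : ℕ} (hn : n ≠ 0) (c : E) : avg n (fun _ => c) = c := by
  have : (n : ℝ) ≠ 0 := by exact_mod_cast hn
  simp [avg, ← Nat.cast_smul_eq_nsmul ℝ, smul_smul, this]

lemma avg_map (φ : E →ₗ[ℝ] F) (n : ℕ) (f : ℕ → E) : avg n (fun i => φ (f i)) = φ (avg n f) := by
  simp [avg]

lemma avg_smul (n : ℕ) (c : ℝ) (f : ℕ → E) : avg n (fun i => c • f i) = c • avg n f := by
  simp only [avg, ← Finset.smul_sum]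
  rw [smul_comm]

lemma avg_comm (n n' : ℕ) (f : ℕ → ℕ → E) :
    avg n (fun i => avg n' (fun j => f i j)) = avg n' (fun j => avg n (fun i => f i j)) := by
  simp only [avg, ← Finset.smul_sum]
  rw [Finset.sum_comm, smul_comm]

lemma smul_avg {n : ℕ} (hn : n ≠ 0) (f : ℕ → E) :
    (n : ℝ) • avg n f = ∑ i ∈ Finset.range n, f i := by
  have : (n : ℝ) ≠ 0 := by exact_mod_cast hn
  rw [avg, smul_smul, mul_inv_cancel₀ this, one_smul]

lemma avg_ctr {n : ℕ} (hn : n ≠ 0) (f : ℕ → E) : avg n (ctr n f) = 0 := by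
  unfold ctr
  rw [avg_sub, avg_const hn, sub_self]

lemma intCtr_eq (g h : ℕ) (z : ℕ → ℕ → E) (i j : ℕ) :
    intCtr g h z i j = z i j - grandAvg g h z - rowCtr g h z i - colCtr g h z j := by
  simp only [intCtr, rowCtr, colCtr]
  abel

lemma avg_eq_fin_sum (n : ℕ) (f : ℕ → ℝ) : avg n f = ∑ i : Fin n, (n : ℝ)⁻¹ * f i := by
  rw [avg, smul_eq_mul, Finset.mul_sum, Finset.sum_range]

end AverageLemmas

/-! ### The strata acting on tables -/

lemma kronecker_mulVec {g h m : ℕ} (A : Matrix (Fin g) (Fin g) ℝ) (B : Matrix (Fin h) (Fin h) ℝ)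
    (C : Matrix (Fin m) (Fin m) ℝ) (t : Obs g h m → ℝ) (i : Fin g) (j : Fin h) (k : Fin m) :
    ((A ⊗ₖ (B ⊗ₖ C)) *ᵥ t) (i, j, k)
      = ∑ i', A i i' * ∑ j', B j j' * ∑ k', C k k' * t (i', j', k') := by
  simp only [Matrix.mulVec, dotProduct, Fintype.sum_prod_type, Matrix.kroneckerMap_apply,
    Finset.mul_sum]
  refine Finset.sum_congr rfl fun i' _ => Finset.sum_congr rfl fun j' _ =>
    Finset.sum_congr rfl fun k' _ => ?_
  ring

lemma sum_avgMat_mul (n : ℕ) (f : ℕ → ℝ) (i : Fin n) :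
    ∑ i' : Fin n, avgMat n i i' * f i' = avg n f := by
  rw [avg_eq_fin_sum]
  rfl

lemma sum_one_mul (n : ℕ) (f : ℕ → ℝ) (i : Fin n) :
    ∑ i' : Fin n, (1 : Matrix (Fin n) (Fin n) ℝ) i i' * f i' = f i := by
  simp [Matrix.one_apply]

lemma sum_ctrMat_mul (n : ℕ) (f : ℕ → ℝ) (i : Fin n) :
    ∑ i' : Fin n, ctrMat n i i' * f i' = f i - avg n f := by
  simp_rw [ctrMat, Matrix.sub_apply, sub_mul, Finset.sum_sub_distrib, sum_one_mul, sum_avgMat_mul]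

section Strata

variable {g h m : ℕ} (z z' : ℕ → ℕ → ℕ → ℝ)

lemma strat_grand_mulVec (o : Obs g h m) :
    (strat g h m 0 *ᵥ table g h m z) o = grandAvg g h (cellAvg m z) := by
  obtain ⟨i, j, k⟩ := o
  simp only [strat, Matrix.cons_val_zero]
  rw [kronecker_mulVec]
  simp only [table]
  simp_rw [fun (i' : Fin g) (j' : Fin h) => sum_avgMat_mul m (fun k' => z i' j' k') k,
    fun (i' : Fin g) => sum_avgMat_mul h (fun j' => avg m fun k' => z i' j' k') j]
  rw [sum_avgMat_mul g (fun i' => avg h fun j' => avg m fun k' => z i' j' k') i]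
  rfl

lemma strat_row_mulVec (o : Obs g h m) :
    (strat g h m 1 *ᵥ table g h m z) o = rowCtr g h (cellAvg m z) o.1 := by
  obtain ⟨i, j, k⟩ := o
  simp only [strat, Matrix.cons_val_one, Matrix.cons_val_zero]
  rw [kronecker_mulVec]
  simp only [table]
  simp_rw [fun (i' : Fin g) (j' : Fin h) => sum_avgMat_mul m (fun k' => z i' j' k') k,
    fun (i' : Fin g) => sum_avgMat_mul h (fun j' => avg m fun k' => z i' j' k') j]
  rw [sum_ctrMat_mul g (fun i' => avg h fun j' => avg m fun k' => z i' j' k') i]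
  rfl

lemma strat_col_mulVec (o : Obs g h m) :
    (strat g h m 2 *ᵥ table g h m z) o = colCtr g h (cellAvg m z) o.2.1 := by
  obtain ⟨i, j, k⟩ := o
  simp only [strat, Matrix.cons_val]
  rw [kronecker_mulVec]
  simp only [table]
  simp_rw [fun (i' : Fin g) (j' : Fin h) => sum_avgMat_mul m (fun k' => z i' j' k') k,
    fun (i' : Fin g) => sum_ctrMat_mul h (fun j' => avg m fun k' => z i' j' k') j]
  rw [sum_avgMat_mul g (fun i' => (avg m fun k' => z i' j k')
    - avg h fun j' => avg m fun k' => z i' j' k') i, avg_sub]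
  rfl

lemma strat_int_mulVec (o : Obs g h m) :
    (strat g h m 3 *ᵥ table g h m z) o = intCtr g h (cellAvg m z) o.1 o.2.1 := by
  obtain ⟨i, j, k⟩ := o
  simp only [strat, Matrix.cons_val]
  rw [kronecker_mulVec]
  simp only [table]
  simp_rw [fun (i' : Fin g) (j' : Fin h) => sum_avgMat_mul m (fun k' => z i' j' k') k,
    fun (i' : Fin g) => sum_ctrMat_mul h (fun j' => avg m fun k' => z i' j' k') j]
  rw [sum_ctrMat_mul g (fun i' => (avg m fun k' => z i' j k')
    - avg h fun j' => avg m fun k' => z i' j' k') i, avg_sub]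
  change _ - (_ - _) = avg m (z i j) - avg h (fun j' => avg m (z i j'))
    - avg g (fun i' => avg m (z i' j)) + avg g (fun i' => avg h (fun j' => avg m (z i' j')))
  ring

lemma strat_within_mulVec (o : Obs g h m) :
    (strat g h m 4 *ᵥ table g h m z) o = withinCtr m z o.1 o.2.1 o.2.2 := by
  obtain ⟨i, j, k⟩ := o
  simp only [strat, Matrix.cons_val]
  rw [kronecker_mulVec]
  simp only [table]
  simp_rw [fun (i' : Fin g) (j' : Fin h) => sum_ctrMat_mul m (fun k' => z i' j' k') k,
    fun (i' : Fin g) => sum_one_mul h (fun j' => z i' j' k - avg m fun k' => z i' j' k') j]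
  rw [sum_one_mul g (fun i' => z i' j k - avg m fun k' => z i' j k') i]
  rfl

/-- The bilinear form `zᵀ P z'` of a stratum with projection `P`. -/
noncomputable def stratForm (g h m : ℕ) (b : Fin 5) (z z' : ℕ → ℕ → ℕ → ℝ) : ℝ :=
  table g h m z ⬝ᵥ (strat g h m b *ᵥ table g h m z')

lemma dotProduct_strat_mulVec (b : Fin 5) (t t' : Obs g h m → ℝ) :
    t ⬝ᵥ (strat g h m b *ᵥ t') = (strat g h m b *ᵥ t) ⬝ᵥ (strat g h m b *ᵥ t') := by
  have h1 : strat g h m b * strat g h m b = strat g h m b := (strat_idem g h m).idem b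
  nth_rw 1 [← h1]
  rw [← Matrix.mulVec_mulVec, Matrix.dotProduct_mulVec, ← Matrix.mulVec_transpose,
    strat_transpose]

lemma sum_obs (f : ℕ → ℕ → ℕ → ℝ) : ∑ o : Obs g h m, f o.1 o.2.1 o.2.2
    = ∑ i ∈ Finset.range g, ∑ j ∈ Finset.range h, ∑ k ∈ Finset.range m, f i j k := by
  simp only [Fintype.sum_prod_type, Finset.sum_range]

lemma stratForm_grand : stratForm g h m 0 z z'
    = ((g : ℝ) * h * m) * (grandAvg g h (cellAvg m z) * grandAvg g h (cellAvg m z')) := by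
  rw [stratForm, dotProduct_strat_mulVec, dotProduct]
  simp only [strat_grand_mulVec]
  simp [mul_assoc]

lemma stratForm_row : stratForm g h m 1 z z' = ((h : ℝ) * m) *
    ∑ i ∈ Finset.range g, rowCtr g h (cellAvg m z) i * rowCtr g h (cellAvg m z') i := by
  rw [stratForm, dotProduct_strat_mulVec, dotProduct]
  simp only [strat_row_mulVec]
  rw [sum_obs (fun i _ _ => rowCtr g h (cellAvg m z) i * rowCtr g h (cellAvg m z') i)]
  simp [Finset.mul_sum, mul_assoc]

lemma stratForm_col : stratForm g h m 2 z z' = ((g : ℝ) * m) *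
    ∑ j ∈ Finset.range h, colCtr g h (cellAvg m z) j * colCtr g h (cellAvg m z') j := by
  rw [stratForm, dotProduct_strat_mulVec, dotProduct]
  simp only [strat_col_mulVec]
  rw [sum_obs (fun _ j _ => colCtr g h (cellAvg m z) j * colCtr g h (cellAvg m z') j)]
  simp [Finset.mul_sum, mul_assoc]

lemma stratForm_int : stratForm g h m 3 z z' = (m : ℝ) *
    ∑ i ∈ Finset.range g, ∑ j ∈ Finset.range h,
      intCtr g h (cellAvg m z) i j * intCtr g h (cellAvg m z') i j := by
  rw [stratForm, dotProduct_strat_mulVec, dotProduct]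
  simp only [strat_int_mulVec]
  rw [sum_obs (fun i j _ => intCtr g h (cellAvg m z) i j * intCtr g h (cellAvg m z') i j)]
  simp [Finset.mul_sum]

lemma stratForm_within : stratForm g h m 4 z z' =
    ∑ i ∈ Finset.range g, ∑ j ∈ Finset.range h, ∑ k ∈ Finset.range m,
      withinCtr m z i j k * withinCtr m z' i j k := by
  rw [stratForm, dotProduct_strat_mulVec, dotProduct]
  simp only [strat_within_mulVec]
  rw [sum_obs (fun i j k => withinCtr m z i j k * withinCtr m z' i j k)]

lemma stratForm_nonneg (b : Fin 5) : 0 ≤ stratForm g h m b z z := by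
  rw [stratForm, dotProduct_strat_mulVec]
  exact dotProduct_self_star_nonneg _

lemma stratForm_comm (b : Fin 5) : stratForm g h m b z z' = stratForm g h m b z' z := by
  rw [stratForm, dotProduct_strat_mulVec, dotProduct_comm, ← dotProduct_strat_mulVec, stratForm]

lemma stratForm_sub_right (b : Fin 5) (z'' : ℕ → ℕ → ℕ → ℝ) :
    stratForm g h m b z (z' - z'') = stratForm g h m b z z' - stratForm g h m b z z'' := by
  simp only [stratForm]
  rw [show table g h m (z' - z'') = table g h m z' - table g h m z'' from rfl, Matrix.mulVec_sub,
    dotProduct_sub]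

end Strata

/-! ### The regression function -/

section Regression

variable {pa pb pab pw : ℕ} (x : Covariates pa pb pab pw)

/-- The components of a vector of fixed effects. -/
def fixA (v : FixedIdx pa pb pab pw → ℝ) : Fin pa → ℝ := fun t => v (.inr (.inl t))
/-- The components of a vector of fixed effects. -/
def fixB (v : FixedIdx pa pb pab pw → ℝ) : Fin pb → ℝ := fun t => v (.inr (.inr (.inl t)))
/-- The components of a vector of fixed effects. -/
def fixAB (v : FixedIdx pa pb pab pw → ℝ) : Fin pab → ℝ :=
  fun t => v (.inr (.inr (.inr (.inl t))))
/-- The components of a vector of fixed effects. -/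
def fixW (v : FixedIdx pa pb pab pw → ℝ) : Fin pw → ℝ := fun t => v (.inr (.inr (.inr (.inr t))))

/-- The linear form `z ↦ z ⬝ᵥ v` on a Euclidean space. -/
noncomputable def dotLin {p : ℕ} (v : Fin p → ℝ) : EuclideanSpace ℝ (Fin p) →ₗ[ℝ] ℝ where
  toFun z := z.ofLp ⬝ᵥ v
  map_add' z z' := by simp [add_dotProduct]
  map_smul' c z := by simp [smul_dotProduct]

lemma dotLin_apply {p : ℕ} (v : Fin p → ℝ) (z : EuclideanSpace ℝ (Fin p)) :
    dotLin v z = z.ofLp ⬝ᵥ v := rfl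

lemma regMean_eq (v : FixedIdx pa pb pab pw → ℝ) (i j k : ℕ) :
    regMean x v i j k = v (.inl ()) + dotLin (fixA v) (x.a i) + dotLin (fixB v) (x.b j)
      + dotLin (fixAB v) (x.ab i j) + dotLin (fixW v) (x.w i j k) := by
  simp only [regMean, dotProduct, Fintype.sum_sum_type, regressor, dotLin_apply, fixA, fixB, fixAB,
    fixW, Sum.elim_inl, Sum.elim_inr]
  simp
  ring

lemma design_mulVec (g h m : ℕ) (v : FixedIdx pa pb pab pw → ℝ) :
    design x g h m *ᵥ v = table g h m (regMean x v) := rfl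

lemma regMean_sub (v v' : FixedIdx pa pb pab pw → ℝ) :
    regMean x (v - v') = regMean x v - regMean x v' := by
  ext i j k
  simp [regMean, dotProduct_sub]

variable {g h m : ℕ}

lemma cellAvg_regMean (hm : m ≠ 0) (v : FixedIdx pa pb pab pw → ℝ) (i j : ℕ) :
    cellAvg m (regMean x v) i j = v (.inl ()) + dotLin (fixA v) (x.a i) + dotLin (fixB v) (x.b j)
      + dotLin (fixAB v) (x.ab i j) + dotLin (fixW v) (cellAvg m x.w i j) := by
  simp only [cellAvg]
  rw [show regMean x v i j = fun k => regMean x v i j k from rfl]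
  simp_rw [regMean_eq]
  rw [avg_add, avg_const hm, avg_map]

lemma rowAvg_regMean (hh : h ≠ 0) (hm : m ≠ 0) (v : FixedIdx pa pb pab pw → ℝ) (i : ℕ) :
    rowAvg h (cellAvg m (regMean x v)) i = v (.inl ()) + dotLin (fixA v) (x.a i)
      + dotLin (fixB v) (avg h x.b) + dotLin (fixAB v) (rowAvg h x.ab i)
      + dotLin (fixW v) (rowAvg h (cellAvg m x.w) i) := by
  simp only [rowAvg]
  rw [show cellAvg m (regMean x v) i = fun j => cellAvg m (regMean x v) i j from rfl]
  simp_rw [cellAvg_regMean x hm]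
  rw [avg_add, avg_add, avg_add, avg_const hh, avg_map, avg_map, avg_map]

lemma grandAvg_regMean (hg : g ≠ 0) (hh : h ≠ 0) (hm : m ≠ 0)
    (v : FixedIdx pa pb pab pw → ℝ) :
    grandAvg g h (cellAvg m (regMean x v)) = v (.inl ()) + dotLin (fixA v) (avg g x.a)
      + dotLin (fixB v) (avg h x.b) + dotLin (fixAB v) (grandAvg g h x.ab)
      + dotLin (fixW v) (grandAvg g h (cellAvg m x.w)) := by
  change avg g (fun i => rowAvg h (cellAvg m (regMean x v)) i) = _
  simp_rw [rowAvg_regMean x hh hm]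
  rw [avg_add, avg_add, avg_add, avg_add, avg_const hg, avg_const hg, avg_map, avg_map, avg_map]
  rfl

lemma colAvg_regMean (hg : g ≠ 0) (hm : m ≠ 0) (v : FixedIdx pa pb pab pw → ℝ) (j : ℕ) :
    colAvg g (cellAvg m (regMean x v)) j = v (.inl ()) + dotLin (fixA v) (avg g x.a)
      + dotLin (fixB v) (x.b j) + dotLin (fixAB v) (colAvg g x.ab j)
      + dotLin (fixW v) (colAvg g (cellAvg m x.w) j) := by
  simp only [colAvg]
  simp_rw [cellAvg_regMean x hm]
  rw [avg_add, avg_add, avg_add, avg_add, avg_const hg, avg_const hg, avg_map, avg_map, avg_map]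

lemma rowCtr_regMean (hg : g ≠ 0) (hh : h ≠ 0) (hm : m ≠ 0) (v : FixedIdx pa pb pab pw → ℝ)
    (i : ℕ) : rowCtr g h (cellAvg m (regMean x v)) i = dotLin (fixA v) (ctr g x.a i)
      + dotLin (fixAB v) (rowCtr g h x.ab i) + dotLin (fixW v) (rowCtr g h (cellAvg m x.w) i) := by
  rw [rowCtr, rowAvg_regMean x hh hm, grandAvg_regMean x hg hh hm]
  simp only [ctr, rowCtr, map_sub]
  ring

lemma colCtr_regMean (hg : g ≠ 0) (hh : h ≠ 0) (hm : m ≠ 0) (v : FixedIdx pa pb pab pw → ℝ)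
    (j : ℕ) : colCtr g h (cellAvg m (regMean x v)) j = dotLin (fixB v) (ctr h x.b j)
      + dotLin (fixAB v) (colCtr g h x.ab j) + dotLin (fixW v) (colCtr g h (cellAvg m x.w) j) := by
  rw [colCtr, colAvg_regMean x hg hm, grandAvg_regMean x hg hh hm]
  simp only [ctr, colCtr, map_sub]
  ring

lemma intCtr_regMean (hg : g ≠ 0) (hh : h ≠ 0) (hm : m ≠ 0) (v : FixedIdx pa pb pab pw → ℝ)
    (i j : ℕ) : intCtr g h (cellAvg m (regMean x v)) i j = dotLin (fixAB v) (intCtr g h x.ab i j)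
      + dotLin (fixW v) (intCtr g h (cellAvg m x.w) i j) := by
  rw [intCtr, colAvg_regMean x hg hm, rowAvg_regMean x hh hm, cellAvg_regMean x hm,
    grandAvg_regMean x hg hh hm]
  simp only [intCtr, map_sub, map_add]
  ring

lemma withinCtr_regMean (hm : m ≠ 0) (v : FixedIdx pa pb pab pw → ℝ) (i j k : ℕ) :
    withinCtr m (regMean x v) i j k = dotLin (fixW v) (withinCtr m x.w i j k) := by
  rw [withinCtr, cellAvg_regMean x hm, regMean_eq]
  simp only [withinCtr, map_sub]
  ring

end Regression

/-! ### Convergence in probability as convergence along a filter -/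

section ProbFilter

variable {S : Type*} [MeasurableSpace S]

/-- The filter on `ℕ × S` of the sequences of events whose probability tends to one. Convergence in
probability is convergence along this filter. -/
def probFilter (P : Measure S) : Filter (ℕ × S) where
  sets := {A | Tendsto (fun N => P {s | (N, s) ∉ A}) atTop (𝓝 0)}
  univ_sets := by simp
  sets_of_superset {A B} hA hAB := by
    refine tendsto_of_tendsto_of_tendsto_of_le_of_le tendsto_const_nhds hA (fun _ => zero_le) ?_
    exact fun N => measure_mono fun s hs hA => hs (hAB hA)
  inter_sets {A B} hA hB := by
    have hAB := Tendsto.add hA hB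
    rw [add_zero] at hAB
    refine tendsto_of_tendsto_of_tendsto_of_le_of_le tendsto_const_nhds hAB (fun _ => zero_le) ?_
    intro N
    refine le_trans (measure_mono fun s hs => ?_) (measure_union_le _ _)
    by_contra h
    simp only [Set.mem_union, Set.mem_ofPred_eq, not_or, not_not] at h
    exact hs ⟨h.1, h.2⟩

variable {P : Measure S}

lemma eventually_probFilter {p : ℕ × S → Prop} : (∀ᶠ q in probFilter P, p q) ↔
    Tendsto (fun N => P {s | ¬ p (N, s)}) atTop (𝓝 0) := Iff.rfl

lemma tendsto_fst_probFilter : Tendsto Prod.fst (probFilter P) atTop := by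
  rw [tendsto_atTop]
  intro N₀
  rw [eventually_probFilter]
  refine tendsto_const_nhds.congr' ?_
  filter_upwards [eventually_ge_atTop N₀] with N hN
  simp [hN]

lemma eventually_fst_probFilter {p : ℕ → Prop} (hp : ∀ᶠ N in atTop, p N) :
    ∀ᶠ q in probFilter P, p q.1 := tendsto_fst_probFilter.eventually hp

lemma tendsto_probFilter_iff {E : Type*} [PseudoMetricSpace E] {X : ℕ → S → E} {c : E} :
    TendstoInMeasure P X atTop (fun _ => c) ↔
      Tendsto (fun q : ℕ × S => X q.1 q.2) (probFilter P) (𝓝 c) := by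
  rw [tendstoInMeasure_iff_dist, Metric.tendsto_nhds]
  simp only [eventually_probFilter, not_lt]

lemma tendsto_probFilter_of_integral {X : ℕ → S → ℝ} (h0 : ∀ N s, 0 ≤ X N s)
    (hi : ∀ N, Integrable (X N) P) (hX : Tendsto (fun N => ∫ s, X N s ∂P) atTop (𝓝 0)) :
    Tendsto (fun q : ℕ × S => X q.1 q.2) (probFilter P) (𝓝 0) := by
  rw [Metric.tendsto_nhds]
  intro ε hε
  rw [eventually_probFilter]
  have h1 : Tendsto (fun N => ENNReal.ofReal (ε⁻¹ * ∫ s, X N s ∂P)) atTop (𝓝 0) := by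
    have := ENNReal.tendsto_ofReal (hX.const_mul ε⁻¹)
    simpa using this
  refine tendsto_of_tendsto_of_tendsto_of_le_of_le tendsto_const_nhds h1 (fun _ => zero_le) ?_
  intro N
  have h2 : {s | ¬ dist (X N s) 0 < ε} = {s | ENNReal.ofReal ε ≤ ENNReal.ofReal (X N s)} := by
    ext s
    simp only [Set.mem_ofPred_eq, not_lt, dist_zero_right, Real.norm_eq_abs, abs_of_nonneg (h0 N s)]
    rw [ENNReal.ofReal_le_ofReal_iff (h0 N s)]
  have h3 := mul_meas_ge_le_lintegral₀ (hi N).aemeasurable.ennreal_ofReal (ENNReal.ofReal ε)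
  rw [← ofReal_integral_eq_lintegral_ofReal (hi N) (ae_of_all _ (h0 N))] at h3
  change P {s | ¬ dist (X N s) 0 < ε} ≤ ENNReal.ofReal (ε⁻¹ * ∫ s, X N s ∂P)
  rw [h2, ENNReal.ofReal_mul (by positivity), ENNReal.ofReal_inv_of_pos hε,
    ← ENNReal.div_eq_inv_mul]
  rw [ENNReal.le_div_iff_mul_le (Or.inl (by simpa using hε)) (Or.inl ENNReal.ofReal_ne_top)]
  rwa [mul_comm]

lemma tendsto_probFilter_of_integral_sq {X : ℕ → S → ℝ}
    (hi : ∀ N, Integrable (fun s => X N s ^ 2) P)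
    (hX : Tendsto (fun N => ∫ s, X N s ^ 2 ∂P) atTop (𝓝 0)) :
    Tendsto (fun q : ℕ × S => X q.1 q.2) (probFilter P) (𝓝 0) := by
  have h := tendsto_probFilter_of_integral (fun N s => sq_nonneg (X N s)) hi hX
  have h2 := (Real.continuous_sqrt.tendsto _).comp h
  rw [Real.sqrt_zero] at h2
  rw [tendsto_zero_iff_abs_tendsto_zero]
  refine h2.congr fun q => ?_
  simp [Real.sqrt_sq_eq_abs]

/-- Boundedness in probability. -/
def IsBoundedInProb (P : Measure S) (X : ℕ × S → ℝ) : Prop :=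
  ∀ a : ℕ → ℝ, Tendsto a atTop (𝓝 0) → Tendsto (fun q => a q.1 * X q) (probFilter P) (𝓝 0)

namespace IsBoundedInProb

variable {X Y : ℕ × S → ℝ}

lemma of_tendsto {c : ℝ} (hX : Tendsto X (probFilter P) (𝓝 c)) : IsBoundedInProb P X := by
  intro a ha
  have := (ha.comp tendsto_fst_probFilter).mul hX
  simpa using this

lemma add (hX : IsBoundedInProb P X) (hY : IsBoundedInProb P Y) :
    IsBoundedInProb P (fun q => X q + Y q) := by
  intro a ha
  have := (hX a ha).add (hY a ha)
  rw [add_zero] at this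
  exact this.congr fun q => by ring

lemma const_mul (hX : IsBoundedInProb P X) (c : ℝ) : IsBoundedInProb P (fun q => c * X q) := by
  intro a ha
  have := (hX a ha).const_mul c
  rw [mul_zero] at this
  exact this.congr fun q => by ring

lemma mono (hX : IsBoundedInProb P X) (hY : ∀ᶠ q in probFilter P, |Y q| ≤ |X q|) :
    IsBoundedInProb P Y := by
  intro a ha
  have h := hX a ha
  rw [tendsto_zero_iff_abs_tendsto_zero] at h ⊢
  refine tendsto_of_tendsto_of_tendsto_of_le_of_le' tendsto_const_nhds h
    (Eventually.of_forall fun q => abs_nonneg _) ?_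
  filter_upwards [hY] with q hq
  simp only [Function.comp_apply, abs_mul]
  gcongr

lemma sqrt (hX : IsBoundedInProb P X) : IsBoundedInProb P (fun q => √(X q)) := by
  intro a ha
  have h := hX (fun N => a N ^ 2) (by simpa using ha.pow 2)
  have h2 := (Real.continuous_sqrt.tendsto _).comp h
  rw [Real.sqrt_zero] at h2
  rw [tendsto_zero_iff_abs_tendsto_zero]
  refine h2.congr fun q => ?_
  simp only [Function.comp_apply]
  rw [Real.sqrt_mul (sq_nonneg _), Real.sqrt_sq_eq_abs, abs_mul, abs_of_nonneg (Real.sqrt_nonneg _)]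

lemma of_integral {X : ℕ → S → ℝ} {C : ℝ} (h0 : ∀ N s, 0 ≤ X N s)
    (hi : ∀ N, Integrable (X N) P) (hX : ∀ᶠ N in atTop, ∫ s, X N s ∂P ≤ C) :
    IsBoundedInProb P (fun q => X q.1 q.2) := by
  intro a ha
  rw [tendsto_zero_iff_abs_tendsto_zero]
  have ha' := (tendsto_zero_iff_abs_tendsto_zero _).1 ha
  have h := tendsto_probFilter_of_integral (P := P) (X := fun N s => |a N| * X N s)
    (fun N s => mul_nonneg (abs_nonneg _) (h0 N s)) (fun N => (hi N).const_mul _) ?_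
  · refine h.congr fun q => ?_
    simp [abs_mul, abs_of_nonneg (h0 _ _)]
  · simp_rw [integral_const_mul]
    have h2 := ha'.mul_const C
    rw [zero_mul] at h2
    refine tendsto_of_tendsto_of_tendsto_of_le_of_le' tendsto_const_nhds h2
      (Eventually.of_forall fun N => mul_nonneg (abs_nonneg _) (integral_nonneg (h0 N))) ?_
    filter_upwards [hX] with N hN
    exact mul_le_mul_of_nonneg_left hN (abs_nonneg _)

lemma mul_tendsto (hX : IsBoundedInProb P X) {a : ℕ → ℝ} (ha : Tendsto a atTop (𝓝 0)) :
    Tendsto (fun q => a q.1 * X q) (probFilter P) (𝓝 0) := hX a ha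

end IsBoundedInProb

end ProbFilter

/-! ### Linear forms in uncorrelated random variables -/

section Uncorrelated

variable {S I : Type*} [MeasurableSpace S] {P : Measure S} {Z : I → S → ℝ}
  {v : I → ℝ}

lemma integrable_sq_sum (hL : ∀ c, MemLp (Z c) 2 P) (T : Finset I) (a : I → ℝ) :
    Integrable (fun s => (∑ c ∈ T, a c * Z c s) ^ 2) P := by
  have : MemLp (fun s => ∑ c ∈ T, a c * Z c s) 2 P :=
    memLp_finsetSum T fun c _ => (hL c).const_mul (a c)
  exact this.integrable_sq

lemma integral_sq_sum [DecidableEq I] (hL : ∀ c, MemLp (Z c) 2 P)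
    (hv : ∀ c c', ∫ s, Z c s * Z c' s ∂P = if c = c' then v c else 0) (T : Finset I) (a : I → ℝ) :
    ∫ s, (∑ c ∈ T, a c * Z c s) ^ 2 ∂P = ∑ c ∈ T, a c ^ 2 * v c := by
  have h1 : ∀ s, (∑ c ∈ T, a c * Z c s) ^ 2
      = ∑ c ∈ T, ∑ c' ∈ T, (a c * a c') * (Z c s * Z c' s) := by
    intro s
    rw [sq, Finset.sum_mul_sum]
    exact Finset.sum_congr rfl fun c _ => Finset.sum_congr rfl fun c' _ => by ring
  simp_rw [h1]
  have hi : ∀ c c', Integrable (fun s => (a c * a c') * (Z c s * Z c' s)) P := fun c c' =>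
    ((hL c).integrable_mul (hL c')).const_mul _
  rw [integral_finsetSum _ fun c _ => integrable_finsetSum _ fun c' _ => hi c c']
  refine Finset.sum_congr rfl fun c hc => ?_
  rw [integral_finsetSum _ fun c' _ => hi c c', Finset.sum_eq_single c]
  · rw [integral_const_mul, hv, if_pos rfl, sq]
  · intro c' _ hc'
    rw [integral_const_mul, hv, if_neg hc'.symm, mul_zero]
  · exact fun h => absurd hc h

lemma tendsto_sum_of_variance [DecidableEq I] (hL : ∀ c, MemLp (Z c) 2 P)
    (hv : ∀ c c', ∫ s, Z c s * Z c' s ∂P = if c = c' then v c else 0) (T : ℕ → Finset I)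
    (a : ℕ → I → ℝ) (ha : Tendsto (fun N => ∑ c ∈ T N, a N c ^ 2 * v c) atTop (𝓝 0)) :
    Tendsto (fun q : ℕ × S => ∑ c ∈ T q.1, a q.1 c * Z c q.2) (probFilter P) (𝓝 0) :=
  tendsto_probFilter_of_integral_sq (X := fun N s => ∑ c ∈ T N, a N c * Z c s)
    (fun N => integrable_sq_sum hL (T N) (a N)) (by simpa only [integral_sq_sum hL hv] using ha)

end Uncorrelated

/-! ### Moments of the random effects -/

section Effects

/-- The index set of the random effects. -/
abbrev EffIdx : Type := ℕ ⊕ ℕ ⊕ (ℕ × ℕ) ⊕ (ℕ × ℕ × ℕ)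

/-- The type of a random effect. -/
def effType : EffIdx → Fin 4 :=
  Sum.elim (fun _ => 0) (Sum.elim (fun _ => 1) (Sum.elim (fun _ => 2) (fun _ => 3)))

/-- A representative of each type of random effects. -/
def effRep : Fin 4 → EffIdx :=
  ![.inl 0, .inr (.inl 0), .inr (.inr (.inl (0, 0))), .inr (.inr (.inr (0, 0, 0)))]

variable {S : Type*} [MeasurableSpace S] {P : Measure S}
  {pa pb pab pw : ℕ} {x : Covariates pa pb pab pw} {ω₀ : Param pa pb pab pw}
  {α β : ℕ → S → ℝ} {γ : ℕ → ℕ → S → ℝ} {e : ℕ → ℕ → ℕ → S → ℝ}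
  {g h m : ℕ → ℕ} {η η₁ η₂ : ℝ≥0∞}

namespace RegularityConditions

lemma ident (hB : RegularityConditions x P ω₀ α β γ e g h m η η₁ η₂) (c : EffIdx) :
    IdentDistrib (allEffects α β γ e c) (allEffects α β γ e (effRep (effType c))) P P := by
  rcases c with i | j | ⟨i, j⟩ | ⟨i, j, k⟩
  · exact hB.ident_α i
  · exact hB.ident_β j
  · exact hB.ident_γ i j
  · exact hB.ident_e i j k

lemma integral_eq_zero (hB : RegularityConditions x P ω₀ α β γ e g h m η η₁ η₂) (c : EffIdx) :
    ∫ s, allEffects α β γ e c s ∂P = 0 := by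
  rw [(hB.ident c).integral_eq]
  generalize effType c = t
  fin_cases t
  · exact hB.mean_α
  · exact hB.mean_β
  · exact hB.mean_γ
  · exact hB.mean_e

lemma variance_eq (hB : RegularityConditions x P ω₀ α β γ e g h m η η₁ η₂) (c : EffIdx) :
    Var[allEffects α β γ e c; P] = ω₀.2 (effType c) := by
  rw [(hB.ident c).variance_eq]
  generalize effType c = t
  fin_cases t
  · exact hB.var_α
  · exact hB.var_β
  · exact hB.var_γ
  · exact hB.var_e

lemma integral_sq (hB : RegularityConditions x P ω₀ α β γ e g h m η η₁ η₂) (c : EffIdx) :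
    ∫ s, allEffects α β γ e c s ^ 2 ∂P = ω₀.2 (effType c) := by
  rw [← hB.variance_eq c, variance_of_integral_eq_zero (hB.measurable c).aemeasurable
    (hB.integral_eq_zero c)]

lemma integral_mul (hB : RegularityConditions x P ω₀ α β γ e g h m η η₁ η₂) (c c' : EffIdx) :
    ∫ s, allEffects α β γ e c s * allEffects α β γ e c' s ∂P
      = if c = c' then ω₀.2 (effType c) else 0 := by
  split_ifs with hc
  · subst hc
    rw [← hB.integral_sq c]
    exact integral_congr_ae (ae_of_all _ fun s => by simp [sq])
  · rw [(hB.indep.indepFun hc).integral_fun_mul_eq_mul_integral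
      (hB.measurable c).aestronglyMeasurable (hB.measurable c').aestronglyMeasurable,
      hB.integral_eq_zero, zero_mul]

variable [IsProbabilityMeasure P]

lemma memLp_four (hB : RegularityConditions x P ω₀ α β γ e g h m η η₁ η₂) (c : EffIdx) :
    MemLp (allEffects α β γ e c) 4 P := by
  obtain ⟨δ, hδ, h0, h1, h2, h3⟩ := hB.moments
  have key : ∀ X : S → ℝ, Measurable X → Integrable (fun s => |X s| ^ (4 + δ)) P → MemLp X 4 P := by
    intro X hX hi
    have hp : (ENNReal.ofReal (4 + δ)).toReal = 4 + δ := ENNReal.toReal_ofReal (by positivity)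
    have h4 : MemLp X (ENNReal.ofReal (4 + δ)) P := by
      rw [← integrable_norm_rpow_iff hX.aestronglyMeasurable (by simp; positivity)
        ENNReal.ofReal_ne_top, hp]
      exact hi
    refine h4.mono_exponent ?_
    rw [show (4 : ℝ≥0∞) = ENNReal.ofReal 4 by norm_num]
    exact ENNReal.ofReal_le_ofReal (by linarith)
  rw [(hB.ident c).memLp_iff]
  refine key _ (hB.measurable _) ?_
  generalize effType c = t
  fin_cases t
  · exact h0
  · exact h1
  · exact h2
  · exact h3

lemma memLp_two (hB : RegularityConditions x P ω₀ α β γ e g h m η η₁ η₂) (c : EffIdx) :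
    MemLp (allEffects α β γ e c) 2 P :=
  (hB.memLp_four c).mono_exponent (by norm_num)

/-- The variance of the square of a random effect of a given type. -/
lemma sq_sub_integral_mul (hB : RegularityConditions x P ω₀ α β γ e g h m η η₁ η₂) :
    ∃ κ : Fin 4 → ℝ, (∀ c, MemLp (fun s => allEffects α β γ e c s ^ 2 - ω₀.2 (effType c)) 2 P) ∧
      ∀ c c', ∫ s, (allEffects α β γ e c s ^ 2 - ω₀.2 (effType c)) *
        (allEffects α β γ e c' s ^ 2 - ω₀.2 (effType c')) ∂P
          = if c = c' then κ (effType c) else 0 := by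
  have hL : ∀ c, MemLp (fun s => allEffects α β γ e c s ^ 2 - ω₀.2 (effType c)) 2 P := by
    intro c
    refine MemLp.sub ?_ (memLp_const _)
    have h1 : MemLp (fun s => allEffects α β γ e c s * allEffects α β γ e c s) 2 P :=
      (hB.memLp_four c).mul (hB.memLp_four c) (hpqr := ⟨by
        rw [← two_mul, show (4 : ℝ≥0∞) = 2 * 2 by norm_num, ENNReal.mul_inv (by simp) (by simp),
          ← mul_assoc, ENNReal.mul_inv_cancel (by simp) (by simp), one_mul]⟩)
    simpa only [sq] using h1
  refine ⟨fun t => ∫ s, (allEffects α β γ e (effRep t) s ^ 2 - ω₀.2 t) ^ 2 ∂P, hL, ?_⟩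
  intro c c'
  split_ifs with hc
  · subst hc
    have h1 := ((hB.ident c).comp (u := fun y : ℝ => (y ^ 2 - ω₀.2 (effType c)) ^ 2)
      (by fun_prop)).integral_eq
    simp only [Function.comp_def] at h1
    exact (integral_congr_ae (ae_of_all _ fun s => by simp [sq])).trans h1
  · have hi : IndepFun (fun s => allEffects α β γ e c s ^ 2 - ω₀.2 (effType c))
        (fun s => allEffects α β γ e c' s ^ 2 - ω₀.2 (effType c')) P :=
      (hB.indep.indepFun hc).comp (φ := fun y : ℝ => y ^ 2 - ω₀.2 (effType c))
        (ψ := fun y : ℝ => y ^ 2 - ω₀.2 (effType c')) (by fun_prop) (by fun_prop)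
    rw [hi.integral_fun_mul_eq_mul_integral (hL c).1 (hL c').1,
      integral_sub (hB.memLp_two c).integrable_sq (integrable_const _), hB.integral_sq]
    simp

/-- The law of large numbers for the squares of the random effects of one type. -/
lemma tendsto_sum_sq (hB : RegularityConditions x P ω₀ α β γ e g h m η η₁ η₂) (t : Fin 4)
    (T : ℕ → Finset EffIdx) (hT : ∀ N, ∀ c ∈ T N, effType c = t)
    (hcard : Tendsto (fun N => (T N).card) atTop atTop) :
    Tendsto (fun q : ℕ × S => ((T q.1).card : ℝ)⁻¹ * ∑ c ∈ T q.1, allEffects α β γ e c q.2 ^ 2)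
      (probFilter P) (𝓝 (ω₀.2 t)) := by
  obtain ⟨κ, hL, hκ⟩ := hB.sq_sub_integral_mul
  have hc' : Tendsto (fun N => ((T N).card : ℝ)) atTop atTop :=
    tendsto_natCast_atTop_atTop.comp hcard
  have h1 := tendsto_sum_of_variance (v := fun c => κ (effType c)) hL hκ T
    (fun N _ => ((T N).card : ℝ)⁻¹) ?_
  · have h2 := h1.add_const (ω₀.2 t)
    rw [zero_add] at h2
    refine h2.congr' ?_
    filter_upwards [eventually_fst_probFilter (hcard.eventually_gt_atTop 0)] with q hq
    have hq' : ((T q.1).card : ℝ) ≠ 0 := by positivity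
    have h4 : ∑ c ∈ T q.1, ω₀.2 (effType c) = (T q.1).card * ω₀.2 t := by
      rw [Finset.sum_congr rfl fun c hc => by rw [hT _ c hc], Finset.sum_const, nsmul_eq_mul]
    rw [← Finset.mul_sum, Finset.sum_sub_distrib, h4]
    field_simp
    ring
  · have h3 := (tendsto_inv_atTop_zero.comp hc').mul_const (κ t)
    rw [zero_mul] at h3
    refine h3.congr' ?_
    filter_upwards [hcard.eventually_gt_atTop 0] with N hN
    have hN' : ((T N).card : ℝ) ≠ 0 := by positivity
    rw [Finset.sum_congr rfl fun c hc => by rw [hT _ c hc], Finset.sum_const, nsmul_eq_mul]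
    simp only [Function.comp_apply]
    field_simp

end RegularityConditions

/-- The random part of the model, with the four types of random effects multiplied by constants. -/
def randPart (κ : Fin 4 → ℝ) (α β : ℕ → S → ℝ) (γ : ℕ → ℕ → S → ℝ) (e : ℕ → ℕ → ℕ → S → ℝ)
    (s : S) (i j k : ℕ) : ℝ := κ 0 * α i s + κ 1 * β j s + κ 2 * γ i j s + κ 3 * e i j k s

lemma V_apply {G H M : ℕ} (θ : VarComp) (i i' : Fin G) (j j' : Fin H) (k k' : Fin M) :
    V G H M θ (i, j, k) (i', j', k') = (if i = i' then θ 0 else 0) + (if j = j' then θ 1 else 0)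
      + (if i = i' ∧ j = j' then θ 2 else 0) + (if i = i' ∧ j = j' ∧ k = k' then θ 3 else 0) := by
  simp only [V, Z₁, Z₂, Z₃, Matrix.add_apply, Matrix.smul_apply, Matrix.mul_apply,
    Matrix.transpose_apply, Matrix.of_apply, Matrix.one_apply, smul_eq_mul, mul_ite, mul_one,
    mul_zero, Finset.sum_ite_eq, Finset.mem_univ, if_true, Prod.mk.injEq]

namespace RegularityConditions

variable [IsProbabilityMeasure P]

lemma memLp_randPart (hB : RegularityConditions x P ω₀ α β γ e g h m η η₁ η₂) (κ : Fin 4 → ℝ)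
    (i j k : ℕ) : MemLp (fun s => randPart κ α β γ e s i j k) 2 P :=
  ((((hB.memLp_two (.inl i)).const_mul (κ 0)).add
    ((hB.memLp_two (.inr (.inl j))).const_mul (κ 1))).add
    ((hB.memLp_two (.inr (.inr (.inl (i, j))))).const_mul (κ 2))).add
    ((hB.memLp_two (.inr (.inr (.inr (i, j, k))))).const_mul (κ 3))

lemma integral_randPart_mul (hB : RegularityConditions x P ω₀ α β γ e g h m η η₁ η₂)
    (κ : Fin 4 → ℝ) {G H M : ℕ} (o o' : Obs G H M) :
    ∫ s, table G H M (randPart κ α β γ e s) o * table G H M (randPart κ α β γ e s) o' ∂P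
      = V G H M (fun k => κ k ^ 2 * ω₀.2 k) o o' := by
  obtain ⟨i, j, k⟩ := o
  obtain ⟨i', j', k'⟩ := o'
  have hI : ∀ c c' : EffIdx, Integrable
      (fun s => allEffects α β γ e c s * allEffects α β γ e c' s) P :=
    fun c c' => (hB.memLp_two c).integrable_mul (hB.memLp_two c')
  let C : ℕ → ℕ → ℕ → Fin 4 → EffIdx := fun i j k =>
    ![.inl i, .inr (.inl j), .inr (.inr (.inl (i, j))), .inr (.inr (.inr (i, j, k)))]
  have hexp : ∀ s, table G H M (randPart κ α β γ e s) (i, j, k)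
      * table G H M (randPart κ α β γ e s) (i', j', k')
      = ∑ a, ∑ b, (κ a * κ b) * (allEffects α β γ e (C i j k a) s
        * allEffects α β γ e (C i' j' k' b) s) := by
    intro s
    simp [Fin.sum_univ_four, table, randPart, allEffects, C]
    ring
  simp_rw [hexp]
  rw [integral_finsetSum _ fun a _ => integrable_finsetSum _ fun b _ => (hI _ _).const_mul _]
  simp_rw [integral_finsetSum _ fun b _ => (hI _ _).const_mul _, integral_const_mul,
    hB.integral_mul]
  rw [V_apply]
  simp only [Fin.sum_univ_four, C, Matrix.cons_val_zero, Matrix.cons_val_one, Matrix.cons_val,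
    Sum.inl.injEq, Sum.inr.injEq, reduceCtorEq, if_false, mul_zero, add_zero, zero_add,
    Prod.mk.injEq, effType, Sum.elim_inl, Sum.elim_inr, mul_ite, ← Fin.ext_iff, sq]

lemma integrable_quadForm (hB : RegularityConditions x P ω₀ α β γ e g h m η η₁ η₂)
    (κ : Fin 4 → ℝ) {G H M : ℕ} (A : Matrix (Obs G H M) (Obs G H M) ℝ) :
    Integrable (fun s => table G H M (randPart κ α β γ e s) ⬝ᵥ
      (A *ᵥ table G H M (randPart κ α β γ e s))) P := by
  simp only [dotProduct, Matrix.mulVec, Finset.mul_sum]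
  refine integrable_finsetSum _ fun o _ => integrable_finsetSum _ fun o' _ => ?_
  have h1 : Integrable (fun s => A o o' * (table G H M (randPart κ α β γ e s) o
      * table G H M (randPart κ α β γ e s) o')) P :=
    ((hB.memLp_randPart κ _ _ _).integrable_mul (hB.memLp_randPart κ _ _ _)).const_mul _
  exact h1.congr (ae_of_all _ fun s => by ring)

lemma integral_quadForm (hB : RegularityConditions x P ω₀ α β γ e g h m η η₁ η₂)
    (κ : Fin 4 → ℝ) {G H M : ℕ} (A : Matrix (Obs G H M) (Obs G H M) ℝ) :
    ∫ s, table G H M (randPart κ α β γ e s) ⬝ᵥ (A *ᵥ table G H M (randPart κ α β γ e s)) ∂P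
      = (A * V G H M (fun k => κ k ^ 2 * ω₀.2 k)).trace := by
  have hI : ∀ o o' : Obs G H M, Integrable (fun s => A o o' *
      (table G H M (randPart κ α β γ e s) o' * table G H M (randPart κ α β γ e s) o)) P :=
    fun o o' => ((hB.memLp_randPart κ _ _ _).integrable_mul (hB.memLp_randPart κ _ _ _)).const_mul _
  have h1 : ∀ s, table G H M (randPart κ α β γ e s) ⬝ᵥ (A *ᵥ table G H M (randPart κ α β γ e s))
      = ∑ o, ∑ o', A o o' *
        (table G H M (randPart κ α β γ e s) o' * table G H M (randPart κ α β γ e s) o) := by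
    intro s
    simp only [dotProduct, Matrix.mulVec, Finset.mul_sum]
    exact Finset.sum_congr rfl fun o _ => Finset.sum_congr rfl fun o' _ => by ring
  simp_rw [h1]
  rw [integral_finsetSum _ fun o _ => integrable_finsetSum _ fun o' _ => hI o o']
  simp_rw [integral_finsetSum _ fun o' _ => hI _ o', integral_const_mul, hB.integral_randPart_mul,
    Matrix.trace, Matrix.diag, Matrix.mul_apply]

end RegularityConditions

end Effects

/-! ### A central limit theorem for weighted sums -/

section CentralLimit

lemma norm_prod_sub_prod_le {I : Type*} (T : Finset I) (z w : I → ℂ) (hz : ∀ c ∈ T, ‖z c‖ ≤ 1)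
    (hw : ∀ c ∈ T, ‖w c‖ ≤ 1) : ‖∏ c ∈ T, z c - ∏ c ∈ T, w c‖ ≤ ∑ c ∈ T, ‖z c - w c‖ := by
  classical
  induction T using Finset.induction_on with
  | empty => simp
  | insert a s ha ih =>
    rw [Finset.prod_insert ha, Finset.prod_insert ha, Finset.sum_insert ha]
    have ih' := ih (fun c hc => hz c (Finset.mem_insert_of_mem hc))
      (fun c hc => hw c (Finset.mem_insert_of_mem hc))
    have hw' : ‖∏ c ∈ s, w c‖ ≤ 1 := by
      rw [norm_prod]
      exact Finset.prod_le_one (fun _ _ => norm_nonneg _)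
        fun c hc => hw c (Finset.mem_insert_of_mem hc)
    have hza := hz a (Finset.mem_insert_self a s)
    calc ‖z a * ∏ c ∈ s, z c - w a * ∏ c ∈ s, w c‖
        = ‖z a * (∏ c ∈ s, z c - ∏ c ∈ s, w c) + (z a - w a) * ∏ c ∈ s, w c‖ := by ring_nf
      _ ≤ ‖z a‖ * ‖∏ c ∈ s, z c - ∏ c ∈ s, w c‖ + ‖z a - w a‖ * ‖∏ c ∈ s, w c‖ := by
          rw [← norm_mul, ← norm_mul]
          exact norm_add_le _ _
      _ ≤ 1 * (∑ c ∈ s, ‖z c - w c‖) + ‖z a - w a‖ * 1 := by gcongr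
      _ = ‖z a - w a‖ + ∑ c ∈ s, ‖z c - w c‖ := by ring

lemma charFun_sub_isLittleO {S : Type*} [MeasurableSpace S] {P : Measure S}
    [IsProbabilityMeasure P] {X : S → ℝ} (hX : Measurable X) (hL : MemLp X 2 P)
    (h0 : ∫ s, X s ∂P = 0) {v : ℝ} (hv : ∫ s, X s ^ 2 ∂P = v) :
    (fun t : ℝ => charFun (P.map X) t - (1 - v * t ^ 2 / 2)) =o[𝓝 0] fun t : ℝ => t ^ 2 := by
  have : IsProbabilityMeasure (P.map X) := Measure.isProbabilityMeasure_map hX.aemeasurable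
  have hid : MemLp id 2 (P.map X) := by
    rw [memLp_map_measure_iff (by fun_prop) hX.aemeasurable]
    exact hL
  have h := taylor_isLittleO_univ (f := charFun (P.map X)) (x₀ := 0) (n := 2)
    (contDiff_charFun (by exact_mod_cast hid))
  simp only [taylorWithinEval_charFun_two_zero hX.aemeasurable hid, sub_zero] at h
  refine h.congr_left fun t => ?_
  rw [h0, show ∫ s, (X ^ 2) s ∂P = v from hv]
  push_cast
  ring

lemma charFun_sub_exp_isLittleO {S : Type*} [MeasurableSpace S] {P : Measure S}
    [IsProbabilityMeasure P] {X : S → ℝ} (hX : Measurable X) (hL : MemLp X 2 P)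
    (h0 : ∫ s, X s ∂P = 0) {v : ℝ} (hv : ∫ s, X s ^ 2 ∂P = v) :
    (fun t : ℝ => charFun (P.map X) t - Complex.exp (-(v * t ^ 2 / 2)))
      =o[𝓝 0] fun t : ℝ => t ^ 2 := by
  have hv0 : 0 ≤ v := hv ▸ integral_nonneg fun s => sq_nonneg _
  have h1 := charFun_sub_isLittleO hX hL h0 hv
  have h2 := charFun_sub_isLittleO (P := gaussianReal 0 v.toNNReal) (X := id) measurable_id
    (memLp_id_gaussianReal 2) (by simp) (v := v) (by
      have := variance_id_gaussianReal (μ := 0) (v := v.toNNReal)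
      rw [variance_of_integral_eq_zero (by fun_prop) (by simp)] at this
      simpa [hv0] using this)
  refine (h1.sub h2).congr_left fun t => ?_
  rw [Measure.map_id, charFun_gaussianReal]
  simp [hv0]

variable {S I : Type*} [MeasurableSpace S] {P : Measure S} [IsProbabilityMeasure P]
  {Z : I → S → ℝ} {ty : I → Fin 4} {rep : Fin 4 → I} {v : Fin 4 → ℝ}

/-- A central limit theorem for weighted sums of independent random variables of finitely many
types. -/
theorem tendsto_charFun_sum (hm : ∀ c, Measurable (Z c)) (hind : iIndepFun Z P)
    (hid : ∀ c, IdentDistrib (Z c) (Z (rep (ty c))) P P) (hL : ∀ c, MemLp (Z c) 2 P)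
    (h0 : ∀ c, ∫ s, Z c s ∂P = 0) (h2 : ∀ t, ∫ s, Z (rep t) s ^ 2 ∂P = v t) (hv : ∀ t, 0 < v t)
    (T : ℕ → Finset I) (a : ℕ → I → ℝ) {q : ℝ}
    (hmax : ∀ ε : ℝ, 0 < ε → ∀ᶠ N in atTop, ∀ c ∈ T N, |a N c| < ε)
    (hq : Tendsto (fun N => ∑ c ∈ T N, a N c ^ 2 * v (ty c)) atTop (𝓝 q)) :
    Tendsto (fun N => charFun (P.map fun s => ∑ c ∈ T N, a N c * Z c s) 1) atTop
      (𝓝 (Complex.exp (-(q / 2)))) := by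
  have hprod : ∀ N, charFun (P.map fun s => ∑ c ∈ T N, a N c * Z c s) 1
      = ∏ c ∈ T N, charFun (P.map (Z (rep (ty c)))) (a N c) := by
    intro N
    have hi : iIndepFun (fun c s => a N c * Z c s) P :=
      hind.comp (fun c y => a N c * y) fun c => by fun_prop
    rw [(hi.restrict (T N)).charFun_map_fun_finsetSum_eq_prod
      fun c _ => ((hm c).const_mul _).aemeasurable, Finset.prod_apply]
    refine Finset.prod_congr rfl fun c _ => ?_
    rw [charFun_map_mul_comp (hm c).aemeasurable, mul_one, (hid c).map_eq]
  have hexp : Tendsto (fun N => ∏ c ∈ T N, Complex.exp (-(v (ty c) * a N c ^ 2 / 2)))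
      atTop (𝓝 (Complex.exp (-(q / 2)))) := by
    have h3 : ∀ N, ∏ c ∈ T N, Complex.exp (-(v (ty c) * a N c ^ 2 / 2))
        = Complex.exp (((-((∑ c ∈ T N, a N c ^ 2 * v (ty c)) / 2) : ℝ) : ℂ)) := by
      intro N
      rw [← Complex.exp_sum]
      congr 1
      push_cast
      rw [Finset.sum_neg_distrib, Finset.sum_div]
      refine congrArg _ (Finset.sum_congr rfl fun c _ => ?_)
      ring
    simp_rw [h3]
    have h4 := (Complex.continuous_exp.comp Complex.continuous_ofReal).tendsto (-(q / 2))
    have h5 := h4.comp ((hq.div_const 2).neg)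
    simpa [Function.comp_def] using h5
  have hdiff : Tendsto (fun N => ∏ c ∈ T N, charFun (P.map (Z (rep (ty c)))) (a N c)
      - ∏ c ∈ T N, Complex.exp (-(v (ty c) * a N c ^ 2 / 2))) atTop (𝓝 0) := by
    obtain ⟨w, hw0, hw⟩ : ∃ w : ℝ, 0 < w ∧ ∀ t, w ≤ v t := by
      obtain ⟨t, ht⟩ := Finite.exists_min v
      exact ⟨v t, hv t, ht⟩
    rw [Metric.tendsto_nhds]
    intro ε hε
    set ε' := ε * w / (2 * (|q| + 1)) with hε'
    have hε'0 : 0 < ε' := by positivity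
    have hsmall : ∃ δ > 0, ∀ t, ∀ y : ℝ, |y| < δ →
        ‖charFun (P.map (Z (rep t))) y - Complex.exp (-(v t * y ^ 2 / 2))‖ ≤ ε' * y ^ 2 := by
      have h6 : ∀ᶠ y : ℝ in 𝓝 0, ∀ t,
          ‖charFun (P.map (Z (rep t))) y - Complex.exp (-(v t * y ^ 2 / 2))‖ ≤ ε' * y ^ 2 := by
        rw [eventually_all]
        intro t
        have := (charFun_sub_exp_isLittleO (hm (rep t)) (hL _) (h0 _) (h2 t)).def hε'0
        filter_upwards [this] with y hy
        simpa using hy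
      obtain ⟨δ, hδ, h7⟩ := Metric.eventually_nhds_iff.1 h6
      exact ⟨δ, hδ, fun t y hy => h7 (by simpa using hy) t⟩
    obtain ⟨δ, hδ, hsm⟩ := hsmall
    have hq' : ∀ᶠ N in atTop, ∑ c ∈ T N, a N c ^ 2 * v (ty c) < |q| + 1 :=
      hq.eventually_lt_const (by linarith [le_abs_self q])
    filter_upwards [hmax δ hδ, hq'] with N hN1 hN2
    rw [dist_zero_right]
    have hcf : ∀ c, ‖charFun (P.map (Z (rep (ty c)))) (a N c)‖ ≤ 1 := fun c => by
      have : IsProbabilityMeasure (P.map (Z (rep (ty c)))) :=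
        Measure.isProbabilityMeasure_map (hm _).aemeasurable
      exact norm_charFun_le_one _
    have hex : ∀ c, ‖Complex.exp (-(v (ty c) * a N c ^ 2 / 2))‖ ≤ 1 := fun c => by
      rw [Complex.norm_exp]
      have h8 : (-(v (ty c) * a N c ^ 2 / 2) : ℂ) = ((-(v (ty c) * a N c ^ 2 / 2) : ℝ) : ℂ) := by
        push_cast
        ring
      rw [h8, Complex.ofReal_re, Real.exp_le_one_iff]
      have := mul_nonneg (hv (ty c)).le (sq_nonneg (a N c))
      linarith
    calc _ ≤ ∑ c ∈ T N, ‖charFun (P.map (Z (rep (ty c)))) (a N c)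
            - Complex.exp (-(v (ty c) * a N c ^ 2 / 2))‖ :=
          norm_prod_sub_prod_le _ _ _ (fun c _ => hcf c) fun c _ => hex c
      _ ≤ ∑ c ∈ T N, ε' * a N c ^ 2 := Finset.sum_le_sum fun c hc => hsm _ _ (hN1 c hc)
      _ ≤ ∑ c ∈ T N, (ε' / w) * (a N c ^ 2 * v (ty c)) := by
          refine Finset.sum_le_sum fun c _ => ?_
          have : ε' * a N c ^ 2 = (ε' / w) * (a N c ^ 2 * w) := by field_simp
          rw [this]
          gcongr
          exact hw _
      _ = (ε' / w) * ∑ c ∈ T N, a N c ^ 2 * v (ty c) := by rw [Finset.mul_sum]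
      _ ≤ (ε' / w) * (|q| + 1) := by gcongr
      _ = ε / 2 := by rw [hε']; field_simp
      _ < ε := by linarith
  have := hdiff.add hexp
  rw [zero_add] at this
  refine this.congr fun N => ?_
  rw [hprod]
  ring

end CentralLimit

section CramerWold

variable {S : Type*} [MeasurableSpace S] {P : Measure S} [IsProbabilityMeasure P]
  {ι : Type*} [Fintype ι] [DecidableEq ι]

/-- Convergence to a normal distribution from the characteristic functions of the linear
combinations of the components, up to a term which vanishes in probability. -/
theorem convergesToNormal_of_charFun {X L : ℕ → S → EuclideanSpace ℝ ι} {C : Matrix ι ι ℝ}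
    (hC : C.PosSemidef) (hX : ∀ N, Measurable (X N)) (hL : ∀ N, Measurable (L N))
    (hXL : ∀ r, Tendsto (fun q : ℕ × S => X q.1 q.2 r - L q.1 q.2 r) (probFilter P) (𝓝 0))
    (hchar : ∀ t : ι → ℝ, Tendsto (fun N => charFun (P.map fun s => ∑ r, t r * L N s r) 1) atTop
      (𝓝 (Complex.exp (-((t ⬝ᵥ (C *ᵥ t) : ℝ) / 2))))) :
    ConvergesToNormal P X C := by
  refine ⟨hC, ?_⟩
  have hLd : TendstoInDistribution L atTop (id : EuclideanSpace ℝ ι → EuclideanSpace ℝ ι)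
      (fun _ => P) (multivariateGaussian 0 C) := by
    refine ⟨fun N => (hL N).aemeasurable, aemeasurable_id, ?_⟩
    refine ProbabilityMeasure.tendsto_iff_tendsto_charFun.2 fun t => ?_
    simp only [ProbabilityMeasure.coe_mk, Measure.map_id]
    rw [charFun_multivariateGaussian hC]
    have h1 := hchar t.ofLp
    have h2 : (Complex.exp (((inner ℝ t (0 : EuclideanSpace ℝ ι) : ℝ) : ℂ) * Complex.I
        - ((t.ofLp ⬝ᵥ (C *ᵥ t.ofLp) : ℝ) : ℂ) / 2))
        = Complex.exp (-((t.ofLp ⬝ᵥ (C *ᵥ t.ofLp) : ℝ) / 2)) := by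
      simp
    rw [h2]
    refine h1.congr fun N => ?_
    have hm : Measurable fun s => ∑ r, t.ofLp r * L N s r := by
      refine Finset.measurable_sum _ fun r _ => Measurable.const_mul ?_ _
      exact (EuclideanSpace.proj (𝕜 := ℝ) r).continuous.measurable.comp (hL N)
    rw [charFun_apply, charFun_apply, integral_map hm.aemeasurable (by fun_prop),
      integral_map (hL N).aemeasurable (by fun_prop)]
    refine integral_congr_ae (ae_of_all _ fun s => ?_)
    simp [PiLp.inner_apply]
  refine tendstoInDistribution_of_tendstoInMeasure_sub X id hLd ?_ fun N => (hX N).aemeasurable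
  rw [show (0 : S → EuclideanSpace ℝ ι) = fun _ => 0 from rfl, tendsto_probFilter_iff]
  have h3 : Tendsto (fun q : ℕ × S => fun r => X q.1 q.2 r - L q.1 q.2 r) (probFilter P)
      (𝓝 (0 : ι → ℝ)) := tendsto_pi_nhds.2 hXL
  have h4 := ((PiLp.continuous_toLp 2 (fun _ : ι => ℝ)).tendsto 0).comp h3
  refine h4.congr fun q => ?_
  ext r
  simp

end CramerWold

/-! ### Measurable minimisers -/

section Argmin

/-- A function which is continuous on a compact metric space and depends measurably on a parameter
has a measurable minimiser. -/
theorem exists_measurable_argmin {Y K : Type*} [MeasurableSpace Y] [MetricSpace K] [CompactSpace K]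
    [Nonempty K] [MeasurableSpace K] [BorelSpace K] (f : Y → K → ℝ) (hc : ∀ y, Continuous (f y))
    (hm : ∀ k, Measurable fun y => f y k) :
    ∃ T : Y → K, Measurable T ∧ ∀ y k, f y (T y) ≤ f y k := by
  obtain ⟨q₀, hq₀, hs₀⟩ := exists_nat_bool_continuous_surjective_of_compact K
  let q : cantorSet → K := q₀ ∘ cantorSetHomeomorphNatToBool
  have hq : Continuous q := hq₀.comp cantorSetHomeomorphNatToBool.continuous
  have hs : Function.Surjective q := hs₀.comp cantorSetHomeomorphNatToBool.surjective
  have : CompactSpace cantorSet := isCompact_iff_compactSpace.1 isCompact_cantorSet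
  let A : Y → Set cantorSet := fun y => {t | ∀ k, f y (q t) ≤ f y k}
  have hA : ∀ y, IsCompact (A y) := by
    intro y
    refine IsClosed.isCompact ?_
    simp only [A, Set.ofPred_forall]
    exact isClosed_iInter fun k => isClosed_le ((hc y).comp hq) continuous_const
  have hne : ∀ y, (A y).Nonempty := by
    intro y
    obtain ⟨k, -, hk⟩ := isCompact_univ.exists_isMinOn Set.univ_nonempty (hc y).continuousOn
    obtain ⟨t, rfl⟩ := hs k
    exact ⟨t, fun k => hk (Set.mem_univ k)⟩
  choose T hT hTmin using fun y => (hA y).exists_isLeast (hne y)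
  refine ⟨fun y => q (T y), hq.measurable.comp ?_, fun y k => hT y k⟩
  suffices h : Measurable fun y => (T y : ℝ) from h.subtype_mk (h := fun y => (T y).2)
  refine measurable_of_Iic fun c => ?_
  let B : Set cantorSet := {t | (t : ℝ) ≤ c}
  have hB : IsClosed B := isClosed_le continuous_subtype_val continuous_const
  obtain ⟨D, hDc, hD⟩ := TopologicalSpace.exists_countable_dense B
  obtain ⟨E, hEc, hE⟩ := TopologicalSpace.exists_countable_dense K
  have key : (fun y => (T y : ℝ)) ⁻¹' Set.Iic c = ⋂ n : ℕ, ⋃ d ∈ D, ⋂ k ∈ E,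
      {y | f y (q d) ≤ f y k + 1 / (n + 1)} := by
    ext y
    simp only [Set.mem_preimage, Set.mem_Iic, Set.mem_iInter, Set.mem_iUnion, Set.mem_ofPred_eq,
      exists_prop]
    constructor
    · intro hy n
      have hn : (0 : ℝ) < 1 / (n + 1) := by positivity
      have hopen : IsOpen {d : B | f y (q d) < f y (q (T y)) + 1 / (n + 1)} :=
        isOpen_lt ((hc y).comp (hq.comp continuous_subtype_val)) continuous_const
      obtain ⟨d, hd1, hd2⟩ := hD.exists_mem_open hopen ⟨⟨T y, hy⟩, lt_add_of_pos_right _ hn⟩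
      refine ⟨d, hd1, fun k _ => ?_⟩
      have h1 := hT y k
      simp only [Set.mem_ofPred_eq] at hd2
      linarith
    · intro hy
      choose d hdD hd using hy
      have hcomp : IsCompact B := hB.isCompact
      have hall : ∀ n k, f y (q (d n)) ≤ f y k + 1 / (n + 1) := by
        intro n k
        have hcl : IsClosed {k | f y (q (d n)) ≤ f y k + 1 / ((n : ℝ) + 1)} :=
          isClosed_le continuous_const ((hc y).add continuous_const)
        have hsub : E ⊆ {k | f y (q (d n)) ≤ f y k + 1 / ((n : ℝ) + 1)} := fun k hk => hd n k hk
        have := hcl.closure_subset_iff.2 hsub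
        rw [hE.closure_eq] at this
        exact this (Set.mem_univ k)
      obtain ⟨t, ht, φ, hφ, hlim⟩ := hcomp.tendsto_subseq fun n => (d n).2
      have hmem : t ∈ A y := by
        intro k
        have h1 : Tendsto (fun n => f y (q (d (φ n)))) atTop (𝓝 (f y (q t))) :=
          (((hc y).comp hq).tendsto t).comp hlim
        have h2 : Tendsto (fun n => f y k + 1 / ((φ n : ℝ) + 1)) atTop (𝓝 (f y k + 0)) :=
          tendsto_const_nhds.add (tendsto_one_div_add_atTop_nhds_zero_nat.comp hφ.tendsto_atTop)
        rw [add_zero] at h2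
        exact le_of_tendsto_of_tendsto' h1 h2 fun n => hall _ k
      exact (show (T y : ℝ) ≤ t from hTmin y hmem).trans ht
  rw [key]
  refine MeasurableSet.iInter fun n => MeasurableSet.biUnion hDc fun d _ =>
    MeasurableSet.biInter hEc fun k _ => measurableSet_le (hm _) ((hm k).add_const _)

end Argmin

/-! ### Limits of second moment matrices -/

section SecondMoments

variable {ι : Type*} [Fintype ι]

lemma outer_quadForm (z v : ι → ℝ) : v ⬝ᵥ (outer z *ᵥ v) = (z ⬝ᵥ v) ^ 2 := by
  rw [outer, Matrix.vecMulVec_mulVec]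
  simp [dotProduct_comm v z, sq]

lemma trace_outer (z : ι → ℝ) : (outer z).trace = z ⬝ᵥ z := by
  simp [outer, Matrix.trace, Matrix.vecMulVec_apply, dotProduct]

/-- The quadratic form of a matrix, as a linear function of the matrix. -/
def quadLin (v : ι → ℝ) : Matrix ι ι ℝ →ₗ[ℝ] ℝ where
  toFun A := v ⬝ᵥ (A *ᵥ v)
  map_add' A B := by rw [Matrix.add_mulVec, dotProduct_add]
  map_smul' c A := by simp [Matrix.smul_mulVec]

lemma avg_outer_quadForm (n : ℕ) (z : ℕ → ι → ℝ) (v : ι → ℝ) :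
    v ⬝ᵥ (avg n (fun i => outer (z i)) *ᵥ v) = avg n (fun i => (z i ⬝ᵥ v) ^ 2) := by
  have := avg_map (quadLin v) n (fun i => outer (z i))
  rw [show v ⬝ᵥ (avg n (fun i => outer (z i)) *ᵥ v) = quadLin v (avg n fun i => outer (z i)) from rfl,
    ← this]
  congr 1
  ext i
  exact outer_quadForm _ _

lemma avg_outer_trace (n : ℕ) (z : ℕ → ι → ℝ) :
    (avg n (fun i => outer (z i))).trace = avg n (fun i => z i ⬝ᵥ z i) := by
  have := avg_map (Matrix.traceLinearMap ι ℝ ℝ) n (fun i => outer (z i))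
  rw [Matrix.traceLinearMap_apply] at this
  rw [← this]
  exact congrArg (avg n) (funext fun i => trace_outer _)

lemma abs_quadForm_le (A : Matrix ι ι ℝ) (v : ι → ℝ) :
    |v ⬝ᵥ (A *ᵥ v)| ≤ (∑ i, ∑ j, |A i j|) * (v ⬝ᵥ v) := by
  have hle : ∀ i, v i ^ 2 ≤ v ⬝ᵥ v := fun i => by
    rw [dotProduct, sq]
    exact Finset.single_le_sum (f := fun i => v i * v i) (fun i _ => mul_self_nonneg _)
      (Finset.mem_univ i)
  have h0 : v ⬝ᵥ (A *ᵥ v) = ∑ i, ∑ j, v i * (A i j * v j) := by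
    simp only [dotProduct, Matrix.mulVec, Finset.mul_sum]
  rw [h0]
  refine (Finset.abs_sum_le_sum_abs _ _).trans ?_
  rw [Finset.sum_mul]
  refine Finset.sum_le_sum fun i _ => (Finset.abs_sum_le_sum_abs _ _).trans ?_
  rw [Finset.sum_mul]
  refine Finset.sum_le_sum fun j _ => ?_
  have h1 : |v i * v j| ≤ v ⬝ᵥ v := by
    rw [abs_le]
    constructor <;> nlinarith [hle i, hle j, sq_nonneg (v i - v j), sq_nonneg (v i + v j)]
  calc |v i * (A i j * v j)| = |A i j| * |v i * v j| := by
        rw [← abs_mul]; congr 1; ring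
    _ ≤ _ := mul_le_mul_of_nonneg_left h1 (abs_nonneg _)

lemma exists_quadForm_lower_bound {M : Matrix ι ι ℝ} (hM : M.PosDef) :
    ∃ c : ℝ, 0 < c ∧ ∀ v : ι → ℝ, c * (v ⬝ᵥ v) ≤ v ⬝ᵥ (M *ᵥ v) := by
  have hpos : ∀ v : ι → ℝ, v ≠ 0 → 0 < v ⬝ᵥ (M *ᵥ v) := fun v hv => by
    simpa using hM.dotProduct_mulVec_pos hv
  have hcont : Continuous fun v : ι → ℝ => v ⬝ᵥ (M *ᵥ v) :=
    continuous_id.dotProduct (continuous_const.matrix_mulVec continuous_id)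
  have hK : IsCompact {v : ι → ℝ | v ⬝ᵥ v = 1} := by
    refine Metric.isCompact_of_isClosed_isBounded
      (isClosed_eq (continuous_id.dotProduct continuous_id) continuous_const) ?_
    refine (Metric.isBounded_closedBall (x := (0 : ι → ℝ)) (r := 1)).subset fun v hv => ?_
    rw [mem_closedBall_zero_iff, pi_norm_le_iff_of_nonneg zero_le_one]
    intro i
    have h1 : v i ^ 2 ≤ v ⬝ᵥ v := by
      rw [dotProduct, sq]
      exact Finset.single_le_sum (f := fun i => v i * v i) (fun i _ => mul_self_nonneg _)
        (Finset.mem_univ i)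
    rw [show v ⬝ᵥ v = 1 from hv] at h1
    rw [Real.norm_eq_abs]
    exact (sq_le_one_iff_abs_le_one _).1 h1
  have hscale : ∀ c : ℝ, (∀ v ∈ {v : ι → ℝ | v ⬝ᵥ v = 1}, c ≤ v ⬝ᵥ (M *ᵥ v)) →
      ∀ v : ι → ℝ, c * (v ⬝ᵥ v) ≤ v ⬝ᵥ (M *ᵥ v) := by
    intro c hc v
    by_cases hv : v = 0
    · simp [hv]
    have hvv : 0 < v ⬝ᵥ v := by simpa using Matrix.dotProduct_star_self_pos_iff.2 hv
    have hs : √(v ⬝ᵥ v) * √(v ⬝ᵥ v) = v ⬝ᵥ v := Real.mul_self_sqrt hvv.le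
    have hs0 : 0 < √(v ⬝ᵥ v) := Real.sqrt_pos.2 hvv
    have h2 := hc ((√(v ⬝ᵥ v))⁻¹ • v) (by
      simp only [Set.mem_ofPred_eq, smul_dotProduct, dotProduct_smul, smul_eq_mul]
      nth_rw 3 [← hs]
      field_simp)
    simp only [smul_dotProduct, dotProduct_smul, Matrix.mulVec_smul, smul_eq_mul] at h2
    rw [← mul_assoc, ← mul_inv, hs] at h2
    rwa [inv_mul_eq_div, le_div_iff₀ hvv] at h2
  rcases Set.eq_empty_or_nonempty {v : ι → ℝ | v ⬝ᵥ v = 1} with he | hne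
  · exact ⟨1, one_pos, hscale 1 fun v hv => by rw [he] at hv; exact absurd hv (Set.notMem_empty _)⟩
  · obtain ⟨v₀, hv₀, hmin⟩ := hK.exists_isMinOn hne hcont.continuousOn
    refine ⟨v₀ ⬝ᵥ (M *ᵥ v₀), hpos v₀ ?_, hscale _ fun v hv => hmin hv⟩
    rintro rfl
    simp at hv₀

lemma eventually_quadForm_lower_bound {Q : Type*} {l : Filter Q} {A : Q → Matrix ι ι ℝ}
    {M : Matrix ι ι ℝ} (hM : M.PosDef) (hA : Tendsto A l (𝓝 M)) :
    ∃ c : ℝ, 0 < c ∧ ∀ᶠ q in l, ∀ v : ι → ℝ, c * (v ⬝ᵥ v) ≤ v ⬝ᵥ (A q *ᵥ v) := by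
  obtain ⟨c, hc, hcM⟩ := exists_quadForm_lower_bound hM
  refine ⟨c / 2, half_pos hc, ?_⟩
  have h1 : Tendsto (fun q => ∑ i, ∑ j, |(A q - M) i j|) l (𝓝 0) := by
    have : Tendsto (fun q => ∑ i, ∑ j, |(A q - M) i j|) l (𝓝 (∑ i, ∑ j, |(M - M) i j|)) := by
      have hcc : Continuous fun B : Matrix ι ι ℝ => ∑ i, ∑ j, |(B - M) i j| := by
        refine continuous_finsetSum _ fun i _ => continuous_finsetSum _ fun j _ => ?_
        exact ((continuous_id.sub continuous_const).matrix_elem i j).abs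
      exact (hcc.tendsto M).comp hA
    simpa using this
  filter_upwards [h1.eventually_lt_const (half_pos hc)] with q hq v
  have h2 := abs_quadForm_le (A q - M) v
  rw [Matrix.sub_mulVec, dotProduct_sub] at h2
  have h3 := (abs_le.1 h2).1
  have h4 := hcM v
  have hvv : 0 ≤ v ⬝ᵥ v := dotProduct_self_star_nonneg v
  nlinarith

lemma eventually_trace_le {Q : Type*} {l : Filter Q} {A : Q → Matrix ι ι ℝ}
    {M : Matrix ι ι ℝ} (hA : Tendsto A l (𝓝 M)) :
    ∀ᶠ q in l, (A q).trace ≤ |M.trace| + 1 := by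
  have h : Tendsto (fun q => (A q).trace) l (𝓝 M.trace) :=
    ((continuous_id.matrix_trace).tendsto M).comp hA
  exact (h.eventually_lt_const (by linarith [le_abs_self M.trace] : M.trace < |M.trace| + 1)).mono
    fun q hq => hq.le

end SecondMoments

/-! ### Growth of centred averages -/

section Growth

variable {E : Type*} [NormedAddCommGroup E] [NormedSpace ℝ E]

lemma norm_avg_sq_le (n : ℕ) (f : ℕ → E) : ‖avg n f‖ ^ 2 ≤ avg n (fun i => ‖f i‖ ^ 2) := by
  rcases Nat.eq_zero_or_pos n with rfl | hn
  · simp [avg]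
  have hn' : (0 : ℝ) < n := by exact_mod_cast hn
  have h1 := sq_sum_le_card_mul_sum_sq (s := Finset.range n) (f := fun i => ‖f i‖)
  rw [Finset.card_range] at h1
  have h2 : ‖∑ i ∈ Finset.range n, f i‖ ^ 2 ≤ n * ∑ i ∈ Finset.range n, ‖f i‖ ^ 2 :=
    (pow_le_pow_left₀ (norm_nonneg _) (norm_sum_le _ _) 2).trans h1
  rw [avg, avg, norm_smul, mul_pow, Real.norm_of_nonneg (by positivity), smul_eq_mul]
  calc (n : ℝ)⁻¹ ^ 2 * ‖∑ i ∈ Finset.range n, f i‖ ^ 2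
      ≤ (n : ℝ)⁻¹ ^ 2 * (n * ∑ i ∈ Finset.range n, ‖f i‖ ^ 2) := by gcongr
    _ = _ := by field_simp

lemma colCtr_eq_rowCtr (g h : ℕ) (z : ℕ → ℕ → E) (j : ℕ) :
    colCtr g h z j = rowCtr h g (fun j i => z i j) j := by
  simp only [colCtr, rowCtr, colAvg, rowAvg, grandAvg]
  rw [avg_comm]

lemma grandAvg_comm (g h : ℕ) (z : ℕ → ℕ → E) :
    grandAvg g h z = grandAvg h g (fun j i => z i j) := avg_comm _ _ _

lemma grandAvg_sub_eq {g₀ : ℕ} (hg₀ : g₀ ≠ 0) (g h : ℕ) (z : ℕ → ℕ → E) :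
    grandAvg g₀ h z - grandAvg g h z = avg g₀ (rowCtr g h z) := by
  unfold rowCtr
  rw [avg_sub, avg_const hg₀]
  rfl

lemma norm_grandAvg_sub_le {g₀ g h : ℕ} {z : ℕ → ℕ → E} {C : ℝ} (hg₀ : 0 < g₀) (hg : g₀ ≤ g)
    (hz : avg g (fun i => ‖rowCtr g h z i‖ ^ 2) ≤ C) :
    ‖grandAvg g₀ h z - grandAvg g h z‖ ≤ √(C / g₀) * √g := by
  have hg₀' : (0 : ℝ) < g₀ := by exact_mod_cast hg₀
  have hg' : (0 : ℝ) < g := by exact_mod_cast hg₀.trans_le hg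
  rw [avg, smul_eq_mul, inv_mul_le_iff₀ hg'] at hz
  rw [grandAvg_sub_eq hg₀.ne', ← Real.sqrt_mul' _ hg'.le]
  refine Real.le_sqrt_of_sq_le ((norm_avg_sq_le _ _).trans ?_)
  rw [avg, smul_eq_mul, inv_mul_le_iff₀ hg₀']
  calc ∑ i ∈ Finset.range g₀, ‖rowCtr g h z i‖ ^ 2 ≤ ∑ i ∈ Finset.range g, ‖rowCtr g h z i‖ ^ 2 :=
        Finset.sum_le_sum_of_subset_of_nonneg (Finset.range_mono hg) fun _ _ _ => sq_nonneg _
    _ ≤ g * C := hz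
    _ = g₀ * (C / g₀ * g) := by field_simp

omit [NormedSpace ℝ E] in
lemma norm_le_of_avg_le {n i : ℕ} (hi : i < n) {f : ℕ → E} {C : ℝ}
    (hf : avg n (fun i => ‖f i‖ ^ 2) ≤ C) : ‖f i‖ ≤ √(C * n) := by
  have hn : (0 : ℝ) < n := by exact_mod_cast (Nat.zero_le i).trans_lt hi
  refine Real.le_sqrt_of_sq_le ?_
  rw [avg, smul_eq_mul, inv_mul_le_iff₀ hn] at hf
  rw [mul_comm]
  exact (Finset.single_le_sum (f := fun i => ‖f i‖ ^ 2) (fun _ _ => sq_nonneg _)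
    (Finset.mem_range.2 hi)).trans hf

/-- Bounds, uniform in the sizes `g', h' ≥ N₀`, of the mean squares of the row effects of a sequence
of two-index arrays. -/
def RowBounded (z : ℕ → ℕ → ℕ → E) : Prop :=
  ∃ C : ℝ, ∃ N₀ : ℕ, 0 < N₀ ∧ ∀ᶠ N in atTop, ∀ g' ≥ N₀, ∀ h' ≥ N₀,
    avg g' (fun i => ‖rowCtr g' h' (z N) i‖ ^ 2) ≤ C

variable {z : ℕ → ℕ → ℕ → E} {g h : ℕ → ℕ}

lemma tendsto_sqrt_natCast {g : ℕ → ℕ} (hg : Tendsto g atTop atTop) :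
    Tendsto (fun N => √(g N : ℝ)) atTop atTop :=
  Real.tendsto_sqrt_atTop.comp (tendsto_natCast_atTop_atTop.comp hg)

/-- `X` is bounded by a constant plus an arbitrarily small multiple of `s`. -/
def AlmostBounded (X s : ℕ → ℝ) : Prop :=
  ∀ ε : ℝ, 0 < ε → ∃ B : ℝ, ∀ᶠ N in atTop, X N ≤ B + ε * s N

lemma AlmostBounded.add {X Y s t : ℕ → ℝ} (hX : AlmostBounded X s) (hY : AlmostBounded Y t) :
    AlmostBounded (fun N => X N + Y N) (fun N => s N + t N) := by
  intro ε hε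
  obtain ⟨B, hB⟩ := hX ε hε
  obtain ⟨B', hB'⟩ := hY ε hε
  refine ⟨B + B', ?_⟩
  filter_upwards [hB, hB'] with N h1 h2
  linarith

lemma AlmostBounded.mono {X Y s t : ℕ → ℝ} (hX : AlmostBounded X s) {c : ℝ} (hc : 0 < c)
    (hY : ∀ᶠ N in atTop, Y N ≤ X N) (hst : ∀ N, s N ≤ c * t N) : AlmostBounded Y t := by
  intro ε hε
  obtain ⟨B, hB⟩ := hX (ε / c) (by positivity)
  refine ⟨B, ?_⟩
  filter_upwards [hB, hY] with N h1 h2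
  have := mul_le_mul_of_nonneg_left (hst N) (div_pos hε hc).le
  rw [← mul_assoc, div_mul_cancel₀ _ hc.ne'] at this
  linarith

lemma AlmostBounded.tendsto {X s : ℕ → ℝ} (hb : AlmostBounded X s) (hX : ∀ N, 0 ≤ X N)
    (hs : Tendsto s atTop atTop) : Tendsto (fun N => X N / s N) atTop (𝓝 0) := by
  rw [Metric.tendsto_nhds]
  intro ε hε
  obtain ⟨B, hB⟩ := hb (ε / 3) (by positivity)
  filter_upwards [hB, hs.eventually_gt_atTop (3 * |B| / ε), hs.eventually_gt_atTop 0] with N h1 h2 h3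
  rw [Real.dist_0_eq_abs, abs_of_nonneg (div_nonneg (hX N) h3.le), div_lt_iff₀ h3]
  rw [div_lt_iff₀ hε] at h2
  have := le_abs_self B
  nlinarith [mul_pos hε h3]

lemma exists_sqrt_div_le (C : ℝ) {ε : ℝ} (hε : 0 < ε) (n₀ : ℕ) :
    ∃ g₀ : ℕ, n₀ ≤ g₀ ∧ 0 < g₀ ∧ √(C / g₀) ≤ ε := by
  have h1 : Tendsto (fun n : ℕ => √(C / n)) atTop (𝓝 √0) :=
    (Real.continuous_sqrt.tendsto 0).comp (tendsto_const_div_atTop_nhds_zero_nat C)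
  rw [Real.sqrt_zero] at h1
  obtain ⟨g₀, h2, h3, h4⟩ := ((h1.eventually_lt_const hε).and
    ((eventually_ge_atTop n₀).and (eventually_gt_atTop 0))).exists
  exact ⟨g₀, h3, h4, h2.le⟩

lemma RowBounded.rowCtr (hz : RowBounded z) (hg : Tendsto g atTop atTop)
    (hh : Tendsto h atTop atTop) (i : ℕ) :
    AlmostBounded (fun N => ‖rowCtr (g N) (h N) (z N) i‖) (fun N => √(g N)) := by
  obtain ⟨C, N₀, hN₀, hz⟩ := hz
  intro ε hε
  obtain ⟨g₀, h1, h2, h3⟩ := exists_sqrt_div_le C hε (max N₀ (i + 1))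
  refine ⟨√(C * g₀), ?_⟩
  filter_upwards [hz, hg.eventually_ge_atTop g₀, hh.eventually_ge_atTop N₀] with N h4 h5 h6
  have hgN : N₀ ≤ g₀ := (le_max_left _ _).trans h1
  have h7 : ‖CrossedEffects.rowCtr g₀ (h N) (z N) i‖ ≤ √(C * g₀) :=
    norm_le_of_avg_le ((le_max_right _ _).trans h1) (h4 g₀ hgN (h N) h6)
  have h8 := norm_grandAvg_sub_le h2 h5 (h4 (g N) (hgN.trans h5) (h N) h6)
  have h9 : CrossedEffects.rowCtr (g N) (h N) (z N) i = CrossedEffects.rowCtr g₀ (h N) (z N) i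
      + (grandAvg g₀ (h N) (z N) - grandAvg (g N) (h N) (z N)) := by
    simp only [CrossedEffects.rowCtr]; abel
  rw [h9]
  refine (norm_add_le _ _).trans (add_le_add h7 (h8.trans ?_))
  gcongr

/-- The change of the overall average when the number of rows is increased. -/
lemma RowBounded.grandAvg_sub (hz : RowBounded z) : ∃ n₁, ∀ n₀ ≥ n₁, ∀ g h : ℕ → ℕ,
    Tendsto g atTop atTop → (∀ᶠ N in atTop, n₁ ≤ h N) →
      AlmostBounded (fun N => ‖grandAvg n₀ (h N) (z N) - grandAvg (g N) (h N) (z N)‖)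
        (fun N => √(g N)) := by
  obtain ⟨C, N₀, hN₀, hz⟩ := hz
  refine ⟨N₀, fun n₀ hn₀ g h hg hh ε hε => ?_⟩
  obtain ⟨g₀, h1, h2, h3⟩ := exists_sqrt_div_le C hε n₀
  refine ⟨√(C / n₀) * √g₀, ?_⟩
  filter_upwards [hz, hg.eventually_ge_atTop g₀, hh] with N h4 h5 h6
  have h7 := norm_grandAvg_sub_le (hN₀.trans_le hn₀) h1 (h4 g₀ (hn₀.trans h1) (h N) h6)
  have h8 := norm_grandAvg_sub_le h2 h5 (h4 (g N) ((hn₀.trans h1).trans h5) (h N) h6)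
  have h9 : grandAvg n₀ (h N) (z N) - grandAvg (g N) (h N) (z N)
      = (grandAvg n₀ (h N) (z N) - grandAvg g₀ (h N) (z N))
        + (grandAvg g₀ (h N) (z N) - grandAvg (g N) (h N) (z N)) := by abel
  rw [h9]
  refine (norm_add_le _ _).trans (add_le_add h7 (h8.trans ?_))
  gcongr

/-- The transposes of a sequence of two-index arrays. -/
def transp (z : ℕ → ℕ → ℕ → E) (N j i : ℕ) : E := z N i j

/-- The change of the overall average when both sizes are increased. -/
lemma RowBounded.grandAvg_sub_grandAvg (hz : RowBounded z) (hz' : RowBounded (transp z)) :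
    ∃ n₁, ∀ n₀ ≥ n₁, ∀ g h : ℕ → ℕ, Tendsto g atTop atTop → Tendsto h atTop atTop →
      AlmostBounded (fun N => ‖grandAvg n₀ n₀ (z N) - grandAvg (g N) (h N) (z N)‖)
        (fun N => √(g N) + √(h N)) := by
  obtain ⟨n₁, h1⟩ := hz.grandAvg_sub
  obtain ⟨n₂, h2⟩ := hz'.grandAvg_sub
  refine ⟨max n₁ n₂, fun n₀ hn₀ g h hg hh => ?_⟩
  have h3 := h1 n₀ ((le_max_left _ _).trans hn₀) g h hg (hh.eventually_ge_atTop n₁)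
  have h4 := h2 n₀ ((le_max_right _ _).trans hn₀) h (fun _ => n₀) hh
    (Eventually.of_forall fun _ => (le_max_right _ _).trans hn₀)
  refine (h3.add h4).mono one_pos (Eventually.of_forall fun N => ?_) fun N => (one_mul _).ge
  rw [show grandAvg n₀ n₀ (transp z N) = grandAvg n₀ n₀ (z N) from (grandAvg_comm _ _ _).symm,
    show grandAvg (h N) n₀ (transp z N) = grandAvg n₀ (h N) (z N) from (grandAvg_comm _ _ _).symm]
  have h9 : grandAvg n₀ n₀ (z N) - grandAvg (g N) (h N) (z N)
      = (grandAvg n₀ (h N) (z N) - grandAvg (g N) (h N) (z N))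
        + (grandAvg n₀ n₀ (z N) - grandAvg n₀ (h N) (z N)) := by abel
  rw [h9]
  exact norm_add_le _ _

/-- Bounds, uniform in the sizes `g', h' ≥ N₀`, of the mean squares of the interactions of a
sequence of two-index arrays. -/
def IntBounded (z : ℕ → ℕ → ℕ → E) : Prop :=
  ∃ C : ℝ, ∃ N₀ : ℕ, ∀ᶠ N in atTop, ∀ g' ≥ N₀, ∀ h' ≥ N₀,
    grandAvg g' h' (fun i j => ‖intCtr g' h' (z N) i j‖ ^ 2) ≤ C

omit [NormedSpace ℝ E] in
lemma norm_le_of_grandAvg_le {g h i j : ℕ} (hi : i < g) (hj : j < h) {f : ℕ → ℕ → E} {C : ℝ}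
    (hf : grandAvg g h (fun i j => ‖f i j‖ ^ 2) ≤ C) : ‖f i j‖ ≤ √(C * g * h) := by
  have h0 : ∀ i, 0 ≤ avg h (fun j => ‖f i j‖ ^ 2) := fun i => by
    rw [avg, smul_eq_mul]
    positivity
  change avg g (fun i => avg h fun j => ‖f i j‖ ^ 2) ≤ C at hf
  have h1 : avg g (fun i => ‖√(avg h fun j => ‖f i j‖ ^ 2)‖ ^ 2) ≤ C := by
    simpa only [Real.norm_eq_abs, sq_abs, Real.sq_sqrt (h0 _)] using hf
  have h2 := norm_le_of_avg_le hi h1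
  rw [Real.norm_of_nonneg (Real.sqrt_nonneg _)] at h2
  by_cases hC : 0 ≤ C * g
  · exact norm_le_of_avg_le hj ((Real.sqrt_le_sqrt_iff hC).1 h2)
  · rw [Real.sqrt_eq_zero_of_nonpos (not_le.1 hC).le] at h2
    have h3 : avg h (fun j => ‖f i j‖ ^ 2) ≤ 0 := by
      by_contra h4
      exact absurd h2 (not_le.2 (Real.sqrt_pos.2 (not_le.1 h4)))
    have := norm_le_of_avg_le hj h3
    rw [zero_mul, Real.sqrt_zero] at this
    exact this.trans (Real.sqrt_nonneg _)

lemma IntBounded.intCtr (hz : RowBounded z) (hz' : RowBounded (transp z)) (hi : IntBounded z)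
    (hg : Tendsto g atTop atTop) (hh : Tendsto h atTop atTop) (i j : ℕ) :
    AlmostBounded (fun N => ‖intCtr (g N) (h N) (z N) i j‖) (fun N => √(g N) + √(h N)) := by
  obtain ⟨n₁, h1⟩ := hz.grandAvg_sub_grandAvg hz'
  have hr := hz.rowCtr hg hh i
  have hc := hz'.rowCtr hh hg j
  obtain ⟨C₁, n₂, -, h2⟩ := hz
  obtain ⟨C₂, n₃, -, h3⟩ := hz'
  obtain ⟨C₃, n₄, h4⟩ := hi
  set n₀ := max (max n₁ n₂) (max (max n₃ n₄) (max (i + 1) (j + 1))) with hn₀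
  have hn : n₁ ≤ n₀ ∧ n₂ ≤ n₀ ∧ n₃ ≤ n₀ ∧ n₄ ≤ n₀ ∧ i < n₀ ∧ j < n₀ := by omega
  obtain ⟨hn1, hn2, hn3, hn4, hin, hjn⟩ := hn
  have hG := h1 n₀ hn1 g h hg hh
  have hfix : AlmostBounded (fun N => ‖CrossedEffects.intCtr n₀ n₀ (z N) i j‖
      + ‖CrossedEffects.rowCtr n₀ n₀ (z N) i‖ + ‖CrossedEffects.rowCtr n₀ n₀ (transp z N) j‖)
      (fun _ => 0) := by
    intro ε _
    refine ⟨√(C₃ * n₀ * n₀) + √(C₁ * n₀) + √(C₂ * n₀), ?_⟩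
    filter_upwards [h2, h3, h4] with N h2 h3 h4
    rw [mul_zero, add_zero]
    exact add_le_add (add_le_add (norm_le_of_grandAvg_le hin hjn (h4 _ hn4 _ hn4))
      (norm_le_of_avg_le hin (h2 _ hn2 _ hn2))) (norm_le_of_avg_le hjn (h3 _ hn3 _ hn3))
  refine (((hfix.add hr).add hc).add hG).mono two_pos (Eventually.of_forall fun N => ?_)
    fun N => by linarith
  have h9 : CrossedEffects.intCtr (g N) (h N) (z N) i j
      = CrossedEffects.intCtr n₀ n₀ (z N) i j + CrossedEffects.rowCtr n₀ n₀ (z N) i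
        + CrossedEffects.rowCtr n₀ n₀ (transp z N) j - CrossedEffects.rowCtr (g N) (h N) (z N) i
        - CrossedEffects.rowCtr (h N) (g N) (transp z N) j
        + (grandAvg n₀ n₀ (z N) - grandAvg (g N) (h N) (z N)) := by
    have e1 : ∀ g h, CrossedEffects.rowCtr h g (transp z N) j = colCtr g h (z N) j :=
      fun g h => (colCtr_eq_rowCtr g h (z N) j).symm
    rw [e1, e1, intCtr_eq, intCtr_eq]
    abel
  rw [h9]
  refine (norm_add_le _ _).trans (add_le_add_left ?_ _)
  refine (norm_sub_le _ _).trans (add_le_add_left ?_ _)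
  refine (norm_sub_le _ _).trans (add_le_add_left ?_ _)
  exact norm_add₃_le

/-- The Lindeberg condition for centred covariates. -/
lemma eventually_norm_ctr_le {f : ℕ → E} {δ l : ℝ} (hδ : 0 < δ)
    (hf : Tendsto (fun n : ℕ => avg n (fun i => ‖ctr n f i‖ ^ (2 + δ))) atTop (𝓝 l)) {ε : ℝ}
    (hε : 0 < ε) : ∀ᶠ n : ℕ in atTop, ∀ i < n, ‖ctr n f i‖ ≤ ε * √n := by
  have h1 : Tendsto (fun n : ℕ => ε ^ (2 + δ) * (n : ℝ) ^ (δ / 2)) atTop atTop :=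
    ((tendsto_rpow_atTop (half_pos hδ)).comp tendsto_natCast_atTop_atTop).const_mul_atTop
      (Real.rpow_pos_of_pos hε _)
  filter_upwards [hf.eventually_lt_const (lt_add_one l), h1.eventually_gt_atTop (l + 1),
    eventually_gt_atTop 0] with n h2 h3 hn i hi
  by_contra hcon
  rw [not_le] at hcon
  have hn' : (0 : ℝ) < n := by exact_mod_cast hn
  rw [avg, smul_eq_mul, inv_mul_lt_iff₀ hn'] at h2
  have h4 : ‖ctr n f i‖ ^ (2 + δ) ≤ ∑ i ∈ Finset.range n, ‖ctr n f i‖ ^ (2 + δ) :=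
    Finset.single_le_sum (f := fun i => ‖ctr n f i‖ ^ (2 + δ))
      (fun _ _ => Real.rpow_nonneg (norm_nonneg _) _) (Finset.mem_range.2 hi)
  have h5 : (ε * √n) ^ (2 + δ) ≤ ‖ctr n f i‖ ^ (2 + δ) :=
    Real.rpow_le_rpow (by positivity) hcon.le (by positivity)
  have h6 : (ε * √n) ^ (2 + δ) = n * (ε ^ (2 + δ) * (n : ℝ) ^ (δ / 2)) := by
    rw [Real.mul_rpow hε.le (Real.sqrt_nonneg _), Real.sqrt_eq_rpow, ← Real.rpow_mul hn'.le,
      show 1 / 2 * (2 + δ) = 1 + δ / 2 by ring, Real.rpow_add hn', Real.rpow_one]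
    ring
  have h7 := mul_lt_mul_of_pos_left h3 hn'
  linarith

end Growth

section Bounds

variable {S : Type*} [MeasurableSpace S] {P : Measure S}
  {pa pb pab pw : ℕ} {x : Covariates pa pb pab pw} {ω₀ : Param pa pb pab pw}
  {α β : ℕ → S → ℝ} {γ : ℕ → ℕ → S → ℝ} {e : ℕ → ℕ → ℕ → S → ℝ}
  {g h m : ℕ → ℕ} {η η₁ η₂ : ℝ≥0∞}

/-- Bounds for the second moments of the covariates of a `g × h × m` table. -/
structure MomentBounds (x : Covariates pa pb pab pw) (c C : ℝ) (g h m : ℕ) : Prop where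
  row_lower : ∀ v, c * (v ⬝ᵥ v) ≤ avg g (fun i => (rowVec x g h m i ⬝ᵥ v) ^ 2)
  row_upper : avg g (fun i => rowVec x g h m i ⬝ᵥ rowVec x g h m i) ≤ C
  col_lower : ∀ v, c * (v ⬝ᵥ v) ≤ avg h (fun j => (colVec x g h m j ⬝ᵥ v) ^ 2)
  col_upper : avg h (fun j => colVec x g h m j ⬝ᵥ colVec x g h m j) ≤ C
  int_lower : ∀ v, c * (v ⬝ᵥ v) ≤ grandAvg g h (fun i j => (intVec x g h m i j ⬝ᵥ v) ^ 2)
  int_upper : grandAvg g h (fun i j => intVec x g h m i j ⬝ᵥ intVec x g h m i j) ≤ C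
  within_lower : ∀ v, c * (v ⬝ᵥ v) ≤ grandAvg g h
    (cellAvg m fun i j k => ((withinCtr m x.w i j k).ofLp ⬝ᵥ v) ^ 2)
  within_upper : grandAvg g h (cellAvg m fun i j k =>
    (withinCtr m x.w i j k).ofLp ⬝ᵥ (withinCtr m x.w i j k).ofLp) ≤ C

lemma grandAvg_outer_quadForm {ι : Type*} [Fintype ι] (g h : ℕ) (z : ℕ → ℕ → ι → ℝ) (v : ι → ℝ) :
    v ⬝ᵥ (grandAvg g h (fun i j => outer (z i j)) *ᵥ v)
      = grandAvg g h (fun i j => (z i j ⬝ᵥ v) ^ 2) := by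
  change quadLin v _ = _
  simp only [grandAvg]
  rw [← avg_map]
  exact congrArg (avg g) (funext fun i => avg_outer_quadForm h (z i) v)

lemma grandAvg_outer_trace {ι : Type*} [Fintype ι] (g h : ℕ) (z : ℕ → ℕ → ι → ℝ) :
    (grandAvg g h (fun i j => outer (z i j))).trace = grandAvg g h (fun i j => z i j ⬝ᵥ z i j) := by
  change Matrix.traceLinearMap ι ℝ ℝ _ = _
  simp only [grandAvg]
  rw [← avg_map]
  exact congrArg (avg g) (funext fun i => avg_outer_trace h (z i))

lemma cellAvg_outer_quadForm {ι : Type*} [Fintype ι] (g h m : ℕ) (z : ℕ → ℕ → ℕ → ι → ℝ)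
    (v : ι → ℝ) : v ⬝ᵥ (grandAvg g h (cellAvg m fun i j k => outer (z i j k)) *ᵥ v)
      = grandAvg g h (cellAvg m fun i j k => (z i j k ⬝ᵥ v) ^ 2) := by
  change quadLin v _ = _
  simp only [grandAvg]
  rw [← avg_map]
  refine congrArg (avg g) (funext fun i => ?_)
  rw [← avg_map]
  exact congrArg (avg h) (funext fun j => avg_outer_quadForm m (z i j) v)

lemma cellAvg_outer_trace {ι : Type*} [Fintype ι] (g h m : ℕ) (z : ℕ → ℕ → ℕ → ι → ℝ) :
    (grandAvg g h (cellAvg m fun i j k => outer (z i j k))).trace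
      = grandAvg g h (cellAvg m fun i j k => z i j k ⬝ᵥ z i j k) := by
  change Matrix.traceLinearMap ι ℝ ℝ _ = _
  simp only [grandAvg]
  rw [← avg_map]
  refine congrArg (avg g) (funext fun i => ?_)
  rw [← avg_map]
  exact congrArg (avg h) (funext fun j => avg_outer_trace m (z i j))

namespace RegularityConditions

/-- The moment bounds hold, with the same constants, in all tables with sufficiently many rows,
columns and replicates. -/
lemma momentBounds (hB : RegularityConditions x P ω₀ α β γ e g h m η η₁ η₂) :
    ∃ c C : ℝ, 0 < c ∧ ∃ N₀ : ℕ, 0 < N₀ ∧ ∀ g' ≥ N₀, ∀ h' ≥ N₀, ∀ m' ≥ N₀,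
      MomentBounds x c C g' h' m' := by
  obtain ⟨M₁, hM₁, h1⟩ := hB.lim_row
  obtain ⟨M₂, hM₂, h2⟩ := hB.lim_col
  obtain ⟨M₃, hM₃, h3⟩ := hB.lim_int
  obtain ⟨M₄, hM₄, h4⟩ := hB.lim_within
  obtain ⟨c₁, hc₁, l1⟩ := eventually_quadForm_lower_bound hM₁ h1
  obtain ⟨c₂, hc₂, l2⟩ := eventually_quadForm_lower_bound hM₂ h2
  obtain ⟨c₃, hc₃, l3⟩ := eventually_quadForm_lower_bound hM₃ h3
  obtain ⟨c₄, hc₄, l4⟩ := eventually_quadForm_lower_bound hM₄ h4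
  have u1 := eventually_trace_le h1
  have u2 := eventually_trace_le h2
  have u3 := eventually_trace_le h3
  have u4 := eventually_trace_le h4
  obtain ⟨⟨a, b, d⟩, hall⟩ := eventually_atTop.1
    (((l1.and l2).and (l3.and l4)).and ((u1.and u2).and (u3.and u4)))
  set c := min (min c₁ c₂) (min c₃ c₄)
  set C := |M₁.trace| + 1 + (|M₂.trace| + 1) + (|M₃.trace| + 1) + (|M₄.trace| + 1)
  have hc : c ≤ c₁ ∧ c ≤ c₂ ∧ c ≤ c₃ ∧ c ≤ c₄ :=
    ⟨(min_le_left _ _).trans (min_le_left _ _), (min_le_left _ _).trans (min_le_right _ _),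
      (min_le_right _ _).trans (min_le_left _ _), (min_le_right _ _).trans (min_le_right _ _)⟩
  have a1 := abs_nonneg M₁.trace
  have a2 := abs_nonneg M₂.trace
  have a3 := abs_nonneg M₃.trace
  have a4 := abs_nonneg M₄.trace
  refine ⟨c, C, by simp only [c, lt_min_iff]; exact ⟨⟨hc₁, hc₂⟩, hc₃, hc₄⟩,
    max 1 (max a (max b d)), by omega, fun g' hg' h' hh' m' hm' => ?_⟩
  obtain ⟨⟨⟨l1, l2⟩, l3, l4⟩, ⟨u1, u2⟩, u3, u4⟩ := hall (g', h', m')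
    ⟨by simp only; omega, by simp only; omega, by simp only; omega⟩
  have low : ∀ {ι : Type} [Fintype ι] {c' : ℝ} (v : ι → ℝ) {r : ℝ}, c ≤ c' → c' * (v ⬝ᵥ v) ≤ r →
      c * (v ⬝ᵥ v) ≤ r := by
    intro ι _ c' v r hcc hr
    exact (mul_le_mul_of_nonneg_right hcc (dotProduct_self_star_nonneg v)).trans hr
  simp only [avg_outer_quadForm, grandAvg_outer_quadForm, cellAvg_outer_quadForm] at l1 l2 l3 l4
  simp only [avg_outer_trace, grandAvg_outer_trace, cellAvg_outer_trace] at u1 u2 u3 u4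
  exact ⟨fun v => low v hc.1 (l1 v), u1.trans (by simp only [C]; linarith),
    fun v => low v hc.2.1 (l2 v), u2.trans (by simp only [C]; linarith),
    fun v => low v hc.2.2.1 (l3 v), u3.trans (by simp only [C]; linarith),
    fun v => low v hc.2.2.2 (l4 v), u4.trans (by simp only [C]; linarith)⟩

end RegularityConditions

lemma avg_mono {n : ℕ} {f f' : ℕ → ℝ} (hf : ∀ i, f i ≤ f' i) : avg n f ≤ avg n f' := by
  rw [avg, avg, smul_eq_mul, smul_eq_mul]
  exact mul_le_mul_of_nonneg_left (Finset.sum_le_sum fun i _ => hf i) (by positivity)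

lemma norm_sq_eq_dotProduct {p : ℕ} (z : EuclideanSpace ℝ (Fin p)) :
    ‖z‖ ^ 2 = z.ofLp ⬝ᵥ z.ofLp := by
  rw [EuclideanSpace.real_norm_sq_eq, dotProduct]
  exact Finset.sum_congr rfl fun i _ => sq _

lemma norm_dotLin_le {p : ℕ} (v : Fin p → ℝ) (z : EuclideanSpace ℝ (Fin p)) :
    |dotLin v z| ≤ ‖z‖ * ‖WithLp.toLp 2 v‖ := by
  have h := abs_real_inner_le_norm z (WithLp.toLp 2 v)
  have h2 : inner ℝ z (WithLp.toLp 2 v) = dotLin v z := by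
    simp [PiLp.inner_apply, dotLin_apply, dotProduct, mul_comm]
  rwa [h2] at h

lemma sumElim_dotProduct_self {ι κ : Type*} [Fintype ι] [Fintype κ] (a : ι → ℝ) (b : κ → ℝ) :
    Sum.elim a b ⬝ᵥ Sum.elim a b = a ⬝ᵥ a + b ⬝ᵥ b := by
  simp [dotProduct]

namespace MomentBounds

variable {c C : ℝ} {g' h' m' : ℕ}

lemma row_a (hM : MomentBounds x c C g' h' m') : avg g' (fun i => ‖ctr g' x.a i‖ ^ 2) ≤ C := by
  refine (avg_mono fun i => ?_).trans hM.row_upper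
  rw [rowVec, sumElim_dotProduct_self, sumElim_dotProduct_self, ← norm_sq_eq_dotProduct,
    ← norm_sq_eq_dotProduct, ← norm_sq_eq_dotProduct]
  nlinarith [sq_nonneg ‖rowCtr g' h' x.ab i‖, sq_nonneg ‖rowCtr g' h' (cellAvg m' x.w) i‖]

lemma row_ab (hM : MomentBounds x c C g' h' m') :
    avg g' (fun i => ‖rowCtr g' h' x.ab i‖ ^ 2) ≤ C := by
  refine (avg_mono fun i => ?_).trans hM.row_upper
  rw [rowVec, sumElim_dotProduct_self, sumElim_dotProduct_self, ← norm_sq_eq_dotProduct,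
    ← norm_sq_eq_dotProduct, ← norm_sq_eq_dotProduct]
  nlinarith [sq_nonneg ‖ctr g' x.a i‖, sq_nonneg ‖rowCtr g' h' (cellAvg m' x.w) i‖]

lemma row_w (hM : MomentBounds x c C g' h' m') :
    avg g' (fun i => ‖rowCtr g' h' (cellAvg m' x.w) i‖ ^ 2) ≤ C := by
  refine (avg_mono fun i => ?_).trans hM.row_upper
  rw [rowVec, sumElim_dotProduct_self, sumElim_dotProduct_self, ← norm_sq_eq_dotProduct,
    ← norm_sq_eq_dotProduct, ← norm_sq_eq_dotProduct]
  nlinarith [sq_nonneg ‖ctr g' x.a i‖, sq_nonneg ‖rowCtr g' h' x.ab i‖]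

lemma col_b (hM : MomentBounds x c C g' h' m') : avg h' (fun j => ‖ctr h' x.b j‖ ^ 2) ≤ C := by
  refine (avg_mono fun j => ?_).trans hM.col_upper
  rw [colVec, sumElim_dotProduct_self, sumElim_dotProduct_self, ← norm_sq_eq_dotProduct,
    ← norm_sq_eq_dotProduct, ← norm_sq_eq_dotProduct]
  nlinarith [sq_nonneg ‖colCtr g' h' x.ab j‖, sq_nonneg ‖colCtr g' h' (cellAvg m' x.w) j‖]

lemma col_ab (hM : MomentBounds x c C g' h' m') :
    avg h' (fun j => ‖colCtr g' h' x.ab j‖ ^ 2) ≤ C := by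
  refine (avg_mono fun j => ?_).trans hM.col_upper
  rw [colVec, sumElim_dotProduct_self, sumElim_dotProduct_self, ← norm_sq_eq_dotProduct,
    ← norm_sq_eq_dotProduct, ← norm_sq_eq_dotProduct]
  nlinarith [sq_nonneg ‖ctr h' x.b j‖, sq_nonneg ‖colCtr g' h' (cellAvg m' x.w) j‖]

lemma col_w (hM : MomentBounds x c C g' h' m') :
    avg h' (fun j => ‖colCtr g' h' (cellAvg m' x.w) j‖ ^ 2) ≤ C := by
  refine (avg_mono fun j => ?_).trans hM.col_upper
  rw [colVec, sumElim_dotProduct_self, sumElim_dotProduct_self, ← norm_sq_eq_dotProduct,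
    ← norm_sq_eq_dotProduct, ← norm_sq_eq_dotProduct]
  nlinarith [sq_nonneg ‖ctr h' x.b j‖, sq_nonneg ‖colCtr g' h' x.ab j‖]

lemma int_ab (hM : MomentBounds x c C g' h' m') :
    grandAvg g' h' (fun i j => ‖intCtr g' h' x.ab i j‖ ^ 2) ≤ C := by
  refine (avg_mono fun i => avg_mono fun j => ?_).trans hM.int_upper
  rw [intVec, sumElim_dotProduct_self, ← norm_sq_eq_dotProduct, ← norm_sq_eq_dotProduct]
  nlinarith [sq_nonneg ‖intCtr g' h' (cellAvg m' x.w) i j‖]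

lemma int_w (hM : MomentBounds x c C g' h' m') :
    grandAvg g' h' (fun i j => ‖intCtr g' h' (cellAvg m' x.w) i j‖ ^ 2) ≤ C := by
  refine (avg_mono fun i => avg_mono fun j => ?_).trans hM.int_upper
  rw [intVec, sumElim_dotProduct_self, ← norm_sq_eq_dotProduct, ← norm_sq_eq_dotProduct]
  nlinarith [sq_nonneg ‖intCtr g' h' x.ab i j‖]

lemma within_w (hM : MomentBounds x c C g' h' m') :
    grandAvg g' h' (cellAvg m' fun i j k => ‖withinCtr m' x.w i j k‖ ^ 2) ≤ C := by
  refine (avg_mono fun i => avg_mono fun j => avg_mono fun k => ?_).trans hM.within_upper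
  rw [norm_sq_eq_dotProduct]

end MomentBounds

namespace RegularityConditions

lemma rowBounded_ab (hB : RegularityConditions x P ω₀ α β γ e g h m η η₁ η₂) :
    RowBounded (fun _ => x.ab) := by
  obtain ⟨c, C, -, N₀, hN, hM⟩ := hB.momentBounds
  exact ⟨C, N₀, hN, Eventually.of_forall fun N g' hg h' hh => (hM g' hg h' hh N₀ le_rfl).row_ab⟩

lemma rowBounded_transp_ab (hB : RegularityConditions x P ω₀ α β γ e g h m η η₁ η₂) :
    RowBounded (transp fun _ => x.ab) := by
  obtain ⟨c, C, -, N₀, hN, hM⟩ := hB.momentBounds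
  refine ⟨C, N₀, hN, Eventually.of_forall fun N h' hh g' hg => ?_⟩
  have := (hM g' hg h' hh N₀ le_rfl).col_ab
  simp only [colCtr_eq_rowCtr] at this
  exact this

lemma intBounded_ab (hB : RegularityConditions x P ω₀ α β γ e g h m η η₁ η₂) :
    IntBounded (fun _ => x.ab) := by
  obtain ⟨c, C, -, N₀, hN, hM⟩ := hB.momentBounds
  exact ⟨C, N₀, Eventually.of_forall fun N g' hg h' hh => (hM g' hg h' hh N₀ le_rfl).int_ab⟩

lemma rowBounded_w (hB : RegularityConditions x P ω₀ α β γ e g h m η η₁ η₂) :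
    RowBounded (fun N => cellAvg (m N) x.w) := by
  obtain ⟨c, C, -, N₀, hN, hM⟩ := hB.momentBounds
  refine ⟨C, N₀, hN, ?_⟩
  filter_upwards [hB.m_top.eventually_ge_atTop N₀] with N hm g' hg h' hh
  exact (hM g' hg h' hh _ hm).row_w

lemma rowBounded_transp_w (hB : RegularityConditions x P ω₀ α β γ e g h m η η₁ η₂) :
    RowBounded (transp fun N => cellAvg (m N) x.w) := by
  obtain ⟨c, C, -, N₀, hN, hM⟩ := hB.momentBounds
  refine ⟨C, N₀, hN, ?_⟩
  filter_upwards [hB.m_top.eventually_ge_atTop N₀] with N hm h' hh g' hg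
  have := (hM g' hg h' hh _ hm).col_w
  simp only [colCtr_eq_rowCtr] at this
  exact this

lemma intBounded_w (hB : RegularityConditions x P ω₀ α β γ e g h m η η₁ η₂) :
    IntBounded (fun N => cellAvg (m N) x.w) := by
  obtain ⟨c, C, -, N₀, hN, hM⟩ := hB.momentBounds
  refine ⟨C, N₀, ?_⟩
  filter_upwards [hB.m_top.eventually_ge_atTop N₀] with N hm g' hg h' hh
  exact (hM g' hg h' hh _ hm).int_w

/-- The overall averages of the within-cell covariates grow at most as the square roots of the
sizes. -/
lemma almostBounded_grandAvg_w (hB : RegularityConditions x P ω₀ α β γ e g h m η η₁ η₂) :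
    AlmostBounded (fun N => ‖grandAvg (g N) (h N) (cellAvg (m N) x.w)‖)
      (fun N => √(g N) + √(h N) + √(m N)) := by
  obtain ⟨n₁, h1⟩ := hB.rowBounded_w.grandAvg_sub_grandAvg hB.rowBounded_transp_w
  obtain ⟨c, C, -, N₀, hN, hM⟩ := hB.momentBounds
  set n₀ := max n₁ N₀ with hn₀
  have h2 := h1 n₀ (le_max_left _ _) g h hB.g_top hB.h_top
  have h3 : AlmostBounded (fun N => ‖grandAvg n₀ n₀ (cellAvg (m N) x.w)‖) (fun N => √(m N)) := by
    intro ε hε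
    have hn : 0 < n₀ := hN.trans_le (le_max_right _ _)
    obtain ⟨m₀, hm₀, hm₀', hs⟩ := exists_sqrt_div_le C hε N₀
    refine ⟨‖grandAvg n₀ n₀ (cellAvg m₀ x.w)‖, ?_⟩
    filter_upwards [hB.m_top.eventually_ge_atTop m₀] with N hmN
    have hm' : (0 : ℝ) < m₀ := by exact_mod_cast hm₀'
    have hmN' : (0 : ℝ) < m N := by exact_mod_cast hm₀'.trans_le hmN
    have hb := (hM n₀ (le_max_right _ _) n₀ (le_max_right _ _) (m N) (hm₀.trans hmN)).within_w
    have e1 : grandAvg n₀ n₀ (cellAvg m₀ x.w) - grandAvg n₀ n₀ (cellAvg (m N) x.w)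
        = avg n₀ (fun i => avg n₀ fun j => avg m₀ (withinCtr (m N) x.w i j)) := by
      simp only [grandAvg]
      rw [← avg_sub]
      refine congrArg (avg n₀) (funext fun i => ?_)
      rw [← avg_sub]
      refine congrArg (avg n₀) (funext fun j => ?_)
      unfold withinCtr
      rw [avg_sub, avg_const hm₀'.ne']
      rfl
    have e2 : ‖grandAvg n₀ n₀ (cellAvg m₀ x.w) - grandAvg n₀ n₀ (cellAvg (m N) x.w)‖ ^ 2
        ≤ C / m₀ * m N := by
      rw [e1]
      refine (norm_avg_sq_le _ _).trans ((avg_mono fun i => norm_avg_sq_le _ _).trans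
        ((avg_mono fun i => avg_mono fun j => norm_avg_sq_le _ _).trans ?_))
      have e3 : ∀ i j, avg m₀ (fun k => ‖withinCtr (m N) x.w i j k‖ ^ 2)
          ≤ (m N / m₀ : ℝ) • avg (m N) (fun k => ‖withinCtr (m N) x.w i j k‖ ^ 2) := by
        intro i j
        simp only [avg, smul_eq_mul]
        rw [show (m N / m₀ : ℝ) * ((m N : ℝ)⁻¹ * ∑ k ∈ Finset.range (m N),
          ‖withinCtr (m N) x.w i j k‖ ^ 2) = (m₀ : ℝ)⁻¹ * ∑ k ∈ Finset.range (m N),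
          ‖withinCtr (m N) x.w i j k‖ ^ 2 by field_simp]
        refine mul_le_mul_of_nonneg_left ?_ (by positivity)
        exact Finset.sum_le_sum_of_subset_of_nonneg (Finset.range_mono hmN)
          fun _ _ _ => sq_nonneg _
      refine (avg_mono fun i => avg_mono fun j => e3 i j).trans ?_
      simp_rw [avg_smul]
      rw [smul_eq_mul]
      calc (m N / m₀ : ℝ) * _ ≤ (m N / m₀ : ℝ) * C := mul_le_mul_of_nonneg_left hb (by positivity)
        _ = _ := by ring
    have e4 : ‖grandAvg n₀ n₀ (cellAvg m₀ x.w) - grandAvg n₀ n₀ (cellAvg (m N) x.w)‖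
        ≤ ε * √(m N) := by
      refine (Real.le_sqrt_of_sq_le e2).trans ?_
      rw [Real.sqrt_mul' _ hmN'.le]
      gcongr
    have e5 := norm_sub_norm_le (grandAvg n₀ n₀ (cellAvg (m N) x.w))
      (grandAvg n₀ n₀ (cellAvg m₀ x.w))
    rw [norm_sub_rev] at e5
    linarith
  refine (h2.add h3).mono one_pos (Eventually.of_forall fun N => ?_) fun N => (one_mul _).ge
  have e5 := norm_sub_norm_le (grandAvg (g N) (h N) (cellAvg (m N) x.w))
    (grandAvg n₀ n₀ (cellAvg (m N) x.w))
  rw [norm_sub_rev] at e5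
  linarith

lemma almostBounded_grandAvg_ab (hB : RegularityConditions x P ω₀ α β γ e g h m η η₁ η₂) :
    AlmostBounded (fun N => ‖grandAvg (g N) (h N) x.ab‖) (fun N => √(g N) + √(h N)) := by
  obtain ⟨n₁, h1⟩ := hB.rowBounded_ab.grandAvg_sub_grandAvg hB.rowBounded_transp_ab
  have h2 := h1 n₁ le_rfl g h hB.g_top hB.h_top
  intro ε hε
  obtain ⟨B, hb⟩ := h2 ε hε
  refine ⟨B + ‖grandAvg n₁ n₁ x.ab‖, ?_⟩
  filter_upwards [hb] with N hN
  have e5 := norm_sub_norm_le (grandAvg (g N) (h N) x.ab) (grandAvg n₁ n₁ x.ab)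
  rw [norm_sub_rev] at e5
  linarith

end RegularityConditions

end Bounds

/-! ### Generalised least squares -/

section GLS

variable {pa pb pab pw : ℕ} (x : Covariates pa pb pab pw) (g h m : ℕ)

/-- The information matrix `Xᵀ V(θ)⁻¹ X` of the fixed effects. -/
noncomputable def info (θ : VarComp) : Matrix (FixedIdx pa pb pab pw) (FixedIdx pa pb pab pw) ℝ :=
  (design x g h m)ᵀ * (V g h m θ)⁻¹ * design x g h m

/-- The inner product `zᵀ V(θ)⁻¹ z'`. -/
noncomputable def wForm (θ : VarComp) (z z' : ℕ → ℕ → ℕ → ℝ) : ℝ :=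
  ∑ b, (lam g h m θ b)⁻¹ * stratForm g h m b z z'

variable {x g h m}

lemma dotProduct_V_inv_mulVec {θ : VarComp} (hθ : ∀ b, lam g h m θ b ≠ 0)
    (z z' : ℕ → ℕ → ℕ → ℝ) :
    table g h m z ⬝ᵥ ((V g h m θ)⁻¹ *ᵥ table g h m z') = wForm g h m θ z z' := by
  rw [V_inv_eq_sum hθ, wForm, Matrix.sum_mulVec, dotProduct_sum]
  simp only [Matrix.smul_mulVec, dotProduct_smul, smul_eq_mul, stratForm]

lemma wForm_sub_right (θ : VarComp) (z z' z'' : ℕ → ℕ → ℕ → ℝ) :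
    wForm g h m θ z (z' - z'') = wForm g h m θ z z' - wForm g h m θ z z'' := by
  simp only [wForm, stratForm_sub_right, mul_sub, Finset.sum_sub_distrib]

lemma wForm_nonneg {θ : VarComp} (hθ : ∀ b, 0 < lam g h m θ b) (z : ℕ → ℕ → ℕ → ℝ) :
    0 ≤ wForm g h m θ z z :=
  Finset.sum_nonneg fun b _ => mul_nonneg (inv_pos.2 (hθ b)).le (stratForm_nonneg z b)

lemma transpose_mulVec_dotProduct {ι κ : Type*} [Fintype ι] [Fintype κ] (A : Matrix ι κ ℝ)
    (w : κ → ℝ) (t : ι → ℝ) : w ⬝ᵥ (Aᵀ *ᵥ t) = (A *ᵥ w) ⬝ᵥ t := by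
  rw [Matrix.mulVec_transpose, dotProduct_comm, ← Matrix.dotProduct_mulVec, dotProduct_comm]

lemma info_quadForm {θ : VarComp} (hθ : ∀ b, lam g h m θ b ≠ 0) (v v' : FixedIdx pa pb pab pw → ℝ) :
    v ⬝ᵥ (info x g h m θ *ᵥ v') = wForm g h m θ (regMean x v) (regMean x v') := by
  rw [info, ← Matrix.mulVec_mulVec, ← Matrix.mulVec_mulVec, transpose_mulVec_dotProduct,
    design_mulVec, design_mulVec, dotProduct_V_inv_mulVec hθ]

lemma V_inv_transpose (θ : VarComp) : ((V g h m θ)⁻¹)ᵀ = (V g h m θ)⁻¹ := by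
  rw [Matrix.transpose_nonsing_inv]
  congr 1
  rw [V_eq_sum, Matrix.transpose_sum]
  exact Finset.sum_congr rfl fun b _ => by rw [Matrix.transpose_smul, strat_transpose]

lemma info_transpose (θ : VarComp) : (info x g h m θ)ᵀ = info x g h m θ := by
  rw [info, Matrix.transpose_mul, Matrix.transpose_mul, Matrix.transpose_transpose,
    V_inv_transpose, Matrix.mul_assoc]

lemma info_eq_sum {θ : VarComp} (hθ : ∀ b, lam g h m θ b ≠ 0) : info x g h m θ
    = ∑ b, (lam g h m θ b)⁻¹ • ((design x g h m)ᵀ * strat g h m b * design x g h m) := by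
  rw [info, V_inv_eq_sum hθ, Matrix.mul_sum, Matrix.sum_mul]
  exact Finset.sum_congr rfl fun b _ => by rw [Matrix.mul_smul, Matrix.smul_mul]

/-- The solution of the normal equations. -/
noncomputable def gls (x : Covariates pa pb pab pw) (g h m : ℕ) (θ : VarComp)
    (y : Obs g h m → ℝ) : FixedIdx pa pb pab pw → ℝ :=
  (info x g h m θ)⁻¹ *ᵥ ((design x g h m)ᵀ *ᵥ ((V g h m θ)⁻¹ *ᵥ y))

lemma info_mulVec_gls {θ : VarComp} (hM : (info x g h m θ).PosDef) (y : Obs g h m → ℝ) :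
    info x g h m θ *ᵥ gls x g h m θ y = (design x g h m)ᵀ *ᵥ ((V g h m θ)⁻¹ *ᵥ y) := by
  rw [gls, Matrix.mulVec_mulVec, Matrix.mul_nonsing_inv _ hM.det_pos.ne'.isUnit, Matrix.one_mulVec]

lemma projP_mulVec {θ : VarComp} (y : Obs g h m → ℝ) :
    projP x g h m θ *ᵥ y = (V g h m θ)⁻¹ *ᵥ y
      - (V g h m θ)⁻¹ *ᵥ (design x g h m *ᵥ gls x g h m θ y) := by
  rw [projP, Matrix.sub_mulVec, gls, info]
  congr 1
  rw [← Matrix.mulVec_mulVec, ← Matrix.mulVec_mulVec, ← Matrix.mulVec_mulVec,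
    ← Matrix.mulVec_mulVec]

/-- The weighted residual sum of squares at `ξ` is the minimal one plus a quadratic form in the
distance of `ξ` from the solution of the normal equations. -/
lemma weighted_rss_eq {θ : VarComp} (hM : (info x g h m θ).PosDef) (y : Obs g h m → ℝ)
    (ξ : FixedIdx pa pb pab pw → ℝ) :
    (y - design x g h m *ᵥ ξ) ⬝ᵥ ((V g h m θ)⁻¹ *ᵥ (y - design x g h m *ᵥ ξ))
      = y ⬝ᵥ (projP x g h m θ *ᵥ y)
        + (ξ - gls x g h m θ y) ⬝ᵥ (info x g h m θ *ᵥ (ξ - gls x g h m θ y)) := by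
  set X := design x g h m
  set W := (V g h m θ)⁻¹
  set M := info x g h m θ
  set c := gls x g h m θ y
  have hc : M *ᵥ c = Xᵀ *ᵥ (W *ᵥ y) := info_mulVec_gls hM y
  have hW : ∀ a b : Obs g h m → ℝ, a ⬝ᵥ (W *ᵥ b) = b ⬝ᵥ (W *ᵥ a) := fun a b => by
    rw [Matrix.dotProduct_mulVec, ← Matrix.mulVec_transpose, V_inv_transpose, dotProduct_comm]
  have hMs : ∀ a b : FixedIdx pa pb pab pw → ℝ, a ⬝ᵥ (M *ᵥ b) = b ⬝ᵥ (M *ᵥ a) := fun a b => by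
    rw [Matrix.dotProduct_mulVec, ← Matrix.mulVec_transpose, info_transpose, dotProduct_comm]
  have hMX : ∀ a b : FixedIdx pa pb pab pw → ℝ, (X *ᵥ a) ⬝ᵥ (W *ᵥ (X *ᵥ b)) = a ⬝ᵥ (M *ᵥ b) := by
    intro a b
    rw [← transpose_mulVec_dotProduct, Matrix.mulVec_mulVec, Matrix.mulVec_mulVec]
    rfl
  have hP : y ⬝ᵥ (projP x g h m θ *ᵥ y) = y ⬝ᵥ (W *ᵥ y) - c ⬝ᵥ (M *ᵥ c) := by
    have h1 : projP x g h m θ *ᵥ y = W *ᵥ y - W *ᵥ (X *ᵥ c) := projP_mulVec y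
    rw [h1, dotProduct_sub, hW y (X *ᵥ c), ← transpose_mulVec_dotProduct, hc]
  rw [hP, Matrix.mulVec_sub, dotProduct_sub, sub_dotProduct, sub_dotProduct, hW y (X *ᵥ ξ), hMX,
    ← transpose_mulVec_dotProduct, ← hc, Matrix.mulVec_sub, dotProduct_sub, sub_dotProduct,
    sub_dotProduct, hMs c ξ]
  ring

end GLS

/-! ### The energy of the estimated fixed effects -/

section Energy

variable {pa pb pab pw : ℕ} {x : Covariates pa pb pab pw} {g h m : ℕ}

/-- The score of a stratum for the fixed effects. -/
noncomputable def stratScore (x : Covariates pa pb pab pw) (g h m : ℕ) (b : Fin 5)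
    (t : Obs g h m → ℝ) : FixedIdx pa pb pab pw → ℝ :=
  (design x g h m)ᵀ *ᵥ (strat g h m b *ᵥ t)

lemma dotProduct_stratScore (b : Fin 5) (w : FixedIdx pa pb pab pw → ℝ) (z : ℕ → ℕ → ℕ → ℝ) :
    w ⬝ᵥ stratScore x g h m b (table g h m z) = stratForm g h m b (regMean x w) z := by
  rw [stratScore, transpose_mulVec_dotProduct, design_mulVec, stratForm]

/-- A bound for the energy of the estimation error of the fixed effects, which does not depend on
the estimate of the variance components. -/
noncomputable def energyBound (x : Covariates pa pb pab pw) (g h m : ℕ) (θ : VarComp)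
    (t : Obs g h m → ℝ) : ℝ :=
  ∑ b, ((lam g h m θ b)⁻¹) ^ 2 *
    (stratScore x g h m b t ⬝ᵥ ((info x g h m θ)⁻¹ *ᵥ stratScore x g h m b t))

lemma two_mul_dotProduct_le {ι : Type*} [Fintype ι] [DecidableEq ι] {M : Matrix ι ι ℝ}
    (hM : M.PosDef) (κ : ℝ) (v s : ι → ℝ) :
    2 * κ * (v ⬝ᵥ s) ≤ κ ^ 2 * (v ⬝ᵥ (M *ᵥ v)) + s ⬝ᵥ (M⁻¹ *ᵥ s) := by
  have hsym : Mᵀ = M := by simpa [Matrix.IsHermitian] using hM.isHermitian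
  have h1 : M *ᵥ (M⁻¹ *ᵥ s) = s := by
    rw [Matrix.mulVec_mulVec, Matrix.mul_nonsing_inv _ hM.det_pos.ne'.isUnit, Matrix.one_mulVec]
  have h2 : (M⁻¹ *ᵥ s) ⬝ᵥ (M *ᵥ v) = v ⬝ᵥ s := by
    rw [Matrix.dotProduct_mulVec, ← Matrix.mulVec_transpose, hsym, h1, dotProduct_comm]
  have h3 : 0 ≤ (κ • v - M⁻¹ *ᵥ s) ⬝ᵥ (M *ᵥ (κ • v - M⁻¹ *ᵥ s)) := by
    simpa using hM.posSemidef.dotProduct_mulVec_nonneg (κ • v - M⁻¹ *ᵥ s)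
  rw [Matrix.mulVec_sub, h1, Matrix.mulVec_smul, dotProduct_sub, sub_dotProduct, sub_dotProduct,
    dotProduct_smul, dotProduct_smul, smul_dotProduct, smul_dotProduct, h2,
    dotProduct_comm (M⁻¹ *ᵥ s) s] at h3
  simp only [smul_eq_mul] at h3
  nlinarith

/-- The box of variance components between half and three halves of the given ones. -/
def box (θ : VarComp) : Set VarComp := {θ' | ∀ k, θ k / 2 ≤ θ' k ∧ θ' k ≤ 3 / 2 * θ k}

lemma lam_mem_of_box {θ θ' : VarComp} (h' : θ' ∈ box θ) (b : Fin 5) :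
    lam g h m θ b / 2 ≤ lam g h m θ' b ∧ lam g h m θ' b ≤ 3 / 2 * lam g h m θ b := by
  have h1 := lam_mono g h m (θ := (1 / 2 : ℝ) • θ) (θ' := θ')
    (fun k => by have := (h' k).1; simp only [Pi.smul_apply, smul_eq_mul]; linarith) b
  have h2 := lam_mono g h m (θ := θ') (θ' := (3 / 2 : ℝ) • θ)
    (fun k => by have := (h' k).2; simpa using this) b
  rw [lam_smul] at h1 h2
  exact ⟨by linarith, h2⟩

lemma box_pos {θ θ' : VarComp} (hθ : ∀ k, 0 < θ k) (h' : θ' ∈ box θ) (k : Fin 4) : 0 < θ' k :=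
  (half_pos (hθ k)).trans_le (h' k).1

lemma wForm_regMean_le {θ θ' : VarComp} (hθ : ∀ k, 0 < θ k) (h' : θ' ∈ box θ)
    (hM : (info x g h m θ).PosDef) {v : FixedIdx pa pb pab pw → ℝ} {z : ℕ → ℕ → ℕ → ℝ}
    (hv : wForm g h m θ' (regMean x v) (z - regMean x v) = 0) :
    wForm g h m θ' (regMean x v) (regMean x v) ≤ 30 * energyBound x g h m θ (table g h m z) ∧
      wForm g h m θ (regMean x v) (regMean x v)
        ≤ 45 * energyBound x g h m θ (table g h m z) := by
  have hl := fun b => lam_pos (g := g) (h := h) (m := m) hθ b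
  have hl' := fun b => lam_pos (g := g) (h := h) (m := m) (box_pos hθ h') b
  set E := energyBound x g h m θ (table g h m z) with hE
  set Q' := wForm g h m θ' (regMean x v) (regMean x v) with hQ'
  set Q := wForm g h m θ (regMean x v) (regMean x v) with hQ
  have hQQ : Q ≤ 3 / 2 * Q' := by
    rw [hQ, hQ', wForm, wForm, Finset.mul_sum]
    refine Finset.sum_le_sum fun b _ => ?_
    rw [← mul_assoc]
    refine mul_le_mul_of_nonneg_right ?_ (stratForm_nonneg _ b)
    have h1 := (lam_mem_of_box (g := g) (h := h) (m := m) h' b).2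
    have h3 := hl b
    have h4 := hl' b
    rw [inv_le_iff_one_le_mul₀ h3]
    calc (1 : ℝ) = lam g h m θ' b * (lam g h m θ' b)⁻¹ := (mul_inv_cancel₀ h4.ne').symm
      _ ≤ (3 / 2 * lam g h m θ b) * (lam g h m θ' b)⁻¹ :=
          mul_le_mul_of_nonneg_right h1 (inv_pos.2 h4).le
      _ = _ := by ring
  have h1 : Q' = ∑ b, (lam g h m θ b * (lam g h m θ' b)⁻¹) *
      (v ⬝ᵥ ((lam g h m θ b)⁻¹ • stratScore x g h m b (table g h m z))) := by
    rw [wForm_sub_right, sub_eq_zero] at hv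
    rw [hQ', ← hv, wForm]
    refine Finset.sum_congr rfl fun b _ => ?_
    rw [dotProduct_smul, dotProduct_stratScore, smul_eq_mul]
    have := (hl b).ne'
    field_simp
  have h2 : ∀ b, (lam g h m θ b * (lam g h m θ' b)⁻¹) *
      (v ⬝ᵥ ((lam g h m θ b)⁻¹ • stratScore x g h m b (table g h m z)))
      ≤ 1 / 15 * Q + 15 * (((lam g h m θ b)⁻¹) ^ 2 * (stratScore x g h m b (table g h m z) ⬝ᵥ
        ((info x g h m θ)⁻¹ *ᵥ stratScore x g h m b (table g h m z)))) := by
    intro b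
    have hρ : 0 ≤ lam g h m θ b * (lam g h m θ' b)⁻¹ :=
      mul_nonneg (hl b).le (inv_pos.2 (hl' b)).le
    have hρ2 : lam g h m θ b * (lam g h m θ' b)⁻¹ ≤ 2 := by
      rw [mul_inv_le_iff₀ (hl' b)]
      linarith [(lam_mem_of_box (g := g) (h := h) (m := m) h' b).1]
    have h3 := two_mul_dotProduct_le hM (1 / 15) v
      ((lam g h m θ b)⁻¹ • stratScore x g h m b (table g h m z))
    rw [info_quadForm fun b => (hl b).ne'] at h3
    simp only [← hQ, smul_dotProduct, Matrix.mulVec_smul, dotProduct_smul, smul_eq_mul] at h3 ⊢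
    rw [← mul_assoc (lam g h m θ b)⁻¹ (lam g h m θ b)⁻¹, ← sq] at h3
    have h4 := mul_le_mul_of_nonneg_left h3 hρ
    set D := ((lam g h m θ b)⁻¹) ^ 2 * (stratScore x g h m b (table g h m z) ⬝ᵥ
        ((info x g h m θ)⁻¹ *ᵥ stratScore x g h m b (table g h m z)))
    have hD : 0 ≤ (1 / 15) ^ 2 * Q + D := by
      refine add_nonneg (mul_nonneg (by positivity) (wForm_nonneg hl _))
        (mul_nonneg (by positivity) ?_)
      simpa using hM.inv.posSemidef.dotProduct_mulVec_nonneg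
        (stratScore x g h m b (table g h m z))
    have h5 := mul_le_mul_of_nonneg_right hρ2 hD
    linarith
  have h3 : Q' ≤ 1 / 3 * Q + 15 * E := by
    rw [h1]
    refine (Finset.sum_le_sum fun b _ => h2 b).trans (le_of_eq ?_)
    rw [Finset.sum_add_distrib, ← Finset.mul_sum, ← Finset.mul_sum, hE, energyBound]
    simp
    ring
  constructor <;> linarith

end Energy

section EnergyMoment

variable {S : Type*} [MeasurableSpace S] {P : Measure S} [IsProbabilityMeasure P]
  {pa pb pab pw : ℕ} {x : Covariates pa pb pab pw} {ω₀ : Param pa pb pab pw}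
  {α β : ℕ → S → ℝ} {γ : ℕ → ℕ → S → ℝ} {e : ℕ → ℕ → ℕ → S → ℝ}
  {g h m : ℕ → ℕ} {η η₁ η₂ : ℝ≥0∞}

lemma energyBound_eq (G H M : ℕ) (θ : VarComp) (t : Obs G H M → ℝ) :
    energyBound x G H M θ t = t ⬝ᵥ ((∑ b, ((lam G H M θ b)⁻¹) ^ 2 •
      (strat G H M b * design x G H M * (info x G H M θ)⁻¹ * (design x G H M)ᵀ * strat G H M b))
        *ᵥ t) := by
  rw [energyBound, Matrix.sum_mulVec, dotProduct_sum]
  refine Finset.sum_congr rfl fun b _ => ?_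
  rw [Matrix.smul_mulVec, dotProduct_smul, smul_eq_mul, stratScore, dotProduct_comm,
    transpose_mulVec_dotProduct, dotProduct_comm]
  nth_rw 1 [← strat_transpose]
  rw [Matrix.mulVec_transpose, ← Matrix.dotProduct_mulVec]
  simp only [Matrix.mulVec_mulVec, Matrix.mul_assoc]

namespace RegularityConditions

lemma integrable_energyBound (hB : RegularityConditions x P ω₀ α β γ e g h m η η₁ η₂)
    (G H M : ℕ) : Integrable (fun s => energyBound x G H M ω₀.2
      (table G H M (randPart (fun _ => 1) α β γ e s))) P := by
  simp_rw [energyBound_eq]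
  exact hB.integrable_quadForm _ _

lemma integral_energyBound (hB : RegularityConditions x P ω₀ α β γ e g h m η η₁ η₂)
    (hθ : ∀ k, 0 < ω₀.2 k) {G H M : ℕ} (hM : (info x G H M ω₀.2).PosDef) :
    ∫ s, energyBound x G H M ω₀.2 (table G H M (randPart (fun _ => 1) α β γ e s)) ∂P
      = Fintype.card (FixedIdx pa pb pab pw) := by
  have hl := fun b => lam_pos (g := G) (h := H) (m := M) hθ b
  simp_rw [energyBound_eq]
  rw [hB.integral_quadForm, Finset.sum_mul, Matrix.trace_sum]
  have h1 : (fun k : Fin 4 => (1 : ℝ) ^ 2 * ω₀.2 k) = ω₀.2 := by ext k; simp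
  have h2 : ∀ b, strat G H M b * V G H M ω₀.2 = lam G H M ω₀.2 b • strat G H M b := by
    intro b
    rw [V_eq_sum, Finset.mul_sum, Finset.sum_eq_single b]
    · rw [mul_smul_comm, (strat_idem G H M).idem b]
    · intro b' _ hb
      rw [mul_smul_comm, (strat_idem G H M).ortho hb.symm, smul_zero]
    · simp
  rw [h1]
  have h3 : ∀ b, ((((lam G H M ω₀.2 b)⁻¹) ^ 2 • (strat G H M b * design x G H M *
      (info x G H M ω₀.2)⁻¹ * (design x G H M)ᵀ * strat G H M b)) * V G H M ω₀.2).trace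
      = ((info x G H M ω₀.2)⁻¹ * ((lam G H M ω₀.2 b)⁻¹ • ((design x G H M)ᵀ * strat G H M b
        * design x G H M))).trace := by
    intro b
    rw [smul_mul_assoc, Matrix.mul_assoc _ (strat G H M b) (V G H M ω₀.2), h2, mul_smul_comm,
      smul_smul, Matrix.trace_smul, mul_smul_comm, Matrix.trace_smul, sq, mul_assoc,
      inv_mul_cancel₀ (hl b).ne', mul_one]
    congr 1
    rw [Matrix.trace_mul_comm]
    simp only [← Matrix.mul_assoc]
    rw [show strat G H M b * strat G H M b = strat G H M b from (strat_idem G H M).idem b]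
    rw [Matrix.mul_assoc, Matrix.trace_mul_comm]
    simp only [← Matrix.mul_assoc]
  simp_rw [h3]
  rw [← Matrix.trace_sum, ← Finset.mul_sum, ← info_eq_sum fun b => (hl b).ne',
    Matrix.nonsing_inv_mul _ hM.det_pos.ne'.isUnit, Matrix.trace_one]

end RegularityConditions

end EnergyMoment

/-! ### The energy controls the fixed effects -/

section EnergyBounds

variable {pa pb pab pw : ℕ} {x : Covariates pa pb pab pw} {g h m : ℕ} {c C : ℝ}

lemma stratForm_le_wForm {θ : VarComp} (hθ : ∀ b, 0 < lam g h m θ b) (z : ℕ → ℕ → ℕ → ℝ)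
    (b : Fin 5) : stratForm g h m b z z ≤ lam g h m θ b * wForm g h m θ z z := by
  have h1 : (lam g h m θ b)⁻¹ * stratForm g h m b z z ≤ wForm g h m θ z z :=
    Finset.single_le_sum (f := fun b => (lam g h m θ b)⁻¹ * stratForm g h m b z z)
      (fun b _ => mul_nonneg (inv_pos.2 (hθ b)).le (stratForm_nonneg z b)) (Finset.mem_univ b)
  rwa [inv_mul_le_iff₀ (hθ b)] at h1

lemma mul_avg {n : ℕ} (hn : n ≠ 0) (f : ℕ → ℝ) : (n : ℝ) * avg n f = ∑ i ∈ Finset.range n, f i :=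
  smul_avg hn f

lemma mul_grandAvg (hg : g ≠ 0) (hh : h ≠ 0) (f : ℕ → ℕ → ℝ) : (g : ℝ) * h * grandAvg g h f
    = ∑ i ∈ Finset.range g, ∑ j ∈ Finset.range h, f i j := by
  rw [mul_comm (g : ℝ), mul_assoc, grandAvg, mul_avg hg, Finset.mul_sum]
  exact Finset.sum_congr rfl fun i _ => mul_avg hh _

lemma mul_grandAvg_cellAvg (hg : g ≠ 0) (hh : h ≠ 0) (hm : m ≠ 0) (f : ℕ → ℕ → ℕ → ℝ) :
    (g : ℝ) * h * m * grandAvg g h (cellAvg m f)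
    = ∑ i ∈ Finset.range g, ∑ j ∈ Finset.range h, ∑ k ∈ Finset.range m, f i j k := by
  rw [mul_comm ((g : ℝ) * h), mul_assoc, mul_grandAvg hg hh, Finset.mul_sum]
  refine Finset.sum_congr rfl fun i _ => ?_
  rw [Finset.mul_sum]
  exact Finset.sum_congr rfl fun j _ => mul_avg hm _

lemma rowVec_dotProduct (v : FixedIdx pa pb pab pw → ℝ) (i : ℕ) :
    rowVec x g h m i ⬝ᵥ Sum.elim (fixA v) (Sum.elim (fixAB v) (fixW v))
      = dotLin (fixA v) (ctr g x.a i) + dotLin (fixAB v) (rowCtr g h x.ab i)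
        + dotLin (fixW v) (rowCtr g h (cellAvg m x.w) i) := by
  simp [rowVec, dotLin_apply, dotProduct, add_assoc]

lemma colVec_dotProduct (v : FixedIdx pa pb pab pw → ℝ) (j : ℕ) :
    colVec x g h m j ⬝ᵥ Sum.elim (fixB v) (Sum.elim (fixAB v) (fixW v))
      = dotLin (fixB v) (ctr h x.b j) + dotLin (fixAB v) (colCtr g h x.ab j)
        + dotLin (fixW v) (colCtr g h (cellAvg m x.w) j) := by
  simp [colVec, dotLin_apply, dotProduct, add_assoc]

lemma intVec_dotProduct (v : FixedIdx pa pb pab pw → ℝ) (i j : ℕ) :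
    intVec x g h m i j ⬝ᵥ Sum.elim (fixAB v) (fixW v)
      = dotLin (fixAB v) (intCtr g h x.ab i j)
        + dotLin (fixW v) (intCtr g h (cellAvg m x.w) i j) := by
  simp [intVec, dotLin_apply, dotProduct]

/-- The norm of a vector of coefficients. -/
noncomputable def enorm2 {p : ℕ} (v : Fin p → ℝ) : ℝ := ‖WithLp.toLp 2 v‖

lemma enorm2_sq {p : ℕ} (v : Fin p → ℝ) : enorm2 v ^ 2 = v ⬝ᵥ v := norm_sq_eq_dotProduct _

lemma enorm2_nonneg {p : ℕ} (v : Fin p → ℝ) : 0 ≤ enorm2 v := norm_nonneg _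

/-- The energy of a regression function controls the coefficients. -/
lemma MomentBounds.le_wForm (hM : MomentBounds x c C g h m) (hc : 0 < c) (hg : g ≠ 0) (hh : h ≠ 0)
    (hm : m ≠ 0) {θ : VarComp} (hθ : ∀ k, 0 < θ k) (v : FixedIdx pa pb pab pw → ℝ) {R : ℝ}
    (hR : (θ 0 + θ 1 + θ 2 + θ 3) * wForm g h m θ (regMean x v) (regMean x v) ≤ R) :
    c * g * enorm2 (fixA v) ^ 2 ≤ R ∧ c * h * enorm2 (fixB v) ^ 2 ≤ R ∧
      c * (g * h) * enorm2 (fixAB v) ^ 2 ≤ R ∧ c * (g * h * m) * enorm2 (fixW v) ^ 2 ≤ R ∧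
      grandAvg g h (cellAvg m (regMean x v)) ^ 2 ≤ R * (1 / g + 1 / h) := by
  have hl := fun b => lam_pos (g := g) (h := h) (m := m) hθ b
  set Q := wForm g h m θ (regMean x v) (regMean x v) with hQ
  have hQ0 : 0 ≤ Q := wForm_nonneg hl _
  have hb := fun b => stratForm_le_wForm hl (regMean x v) b
  simp only [← hQ] at hb
  have hg' : (0 : ℝ) < g := by positivity
  have hh' : (0 : ℝ) < h := by positivity
  have hm' : (0 : ℝ) < m := by positivity
  have hg1 : (1 : ℝ) ≤ g := by exact_mod_cast Nat.one_le_iff_ne_zero.2 hg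
  have hh1 : (1 : ℝ) ≤ h := by exact_mod_cast Nat.one_le_iff_ne_zero.2 hh
  have hm1 : (1 : ℝ) ≤ m := by exact_mod_cast Nat.one_le_iff_ne_zero.2 hm
  have t0 := hθ 0
  have t1 := hθ 1
  have t2 := hθ 2
  have t3 := hθ 3
  have key : ∀ {a b d : ℝ}, 0 < a → a * b ≤ d * Q → d ≤ a * (θ 0 + θ 1 + θ 2 + θ 3) → b ≤ R := by
    intro a b d ha h1 h2
    refine le_trans ?_ hR
    refine le_of_mul_le_mul_left ?_ ha
    rw [← mul_assoc]
    exact h1.trans (mul_le_mul_of_nonneg_right h2 hQ0)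
  have b0 := hb 0
  have b1 := hb 1
  have b2 := hb 2
  have b3 := hb 3
  have b4 := hb 4
  rw [stratForm_grand] at b0
  rw [stratForm_row] at b1
  rw [stratForm_col] at b2
  rw [stratForm_int] at b3
  rw [stratForm_within] at b4
  simp only [rowCtr_regMean x hg hh hm, ← rowVec_dotProduct, ← sq] at b1
  simp only [colCtr_regMean x hg hh hm, ← colVec_dotProduct, ← sq] at b2
  simp only [intCtr_regMean x hg hh hm, ← intVec_dotProduct, ← sq] at b3
  simp only [withinCtr_regMean x hm, dotLin_apply, ← sq] at b4
  rw [← mul_avg hg] at b1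
  rw [← mul_avg hh] at b2
  rw [← mul_grandAvg hg hh (fun i j => _)] at b3
  rw [← mul_grandAvg_cellAvg hg hh hm (fun i j k => _)] at b4
  have m1 := hM.row_lower (Sum.elim (fixA v) (Sum.elim (fixAB v) (fixW v)))
  have m2 := hM.col_lower (Sum.elim (fixB v) (Sum.elim (fixAB v) (fixW v)))
  have m3 := hM.int_lower (Sum.elim (fixAB v) (fixW v))
  have m4 := hM.within_lower (fixW v)
  simp only [sumElim_dotProduct_self, ← enorm2_sq] at m1 m2 m3 m4
  have nA := sq_nonneg (enorm2 (fixA v))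
  have nB := sq_nonneg (enorm2 (fixB v))
  have nAB := sq_nonneg (enorm2 (fixAB v))
  have nW := sq_nonneg (enorm2 (fixW v))
  simp only [lam, lam₁, lam₂, lam₃, lam₄, Matrix.cons_val_zero, Matrix.cons_val_one,
    Matrix.cons_val] at b0 b1 b2 b3 b4
  have hhm : (1 : ℝ) ≤ h * m := one_le_mul_of_one_le_of_one_le hh1 hm1
  have hgm : (1 : ℝ) ≤ g * m := one_le_mul_of_one_le_of_one_le hg1 hm1
  have hhm' : (m : ℝ) ≤ h * m := le_mul_of_one_le_left hm'.le hh1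
  have hgm' : (m : ℝ) ≤ g * m := le_mul_of_one_le_left hm'.le hg1
  refine ⟨key (a := h * m) (by positivity) (le_trans ?_ b1) ?_,
    key (a := g * m) (by positivity) (le_trans ?_ b2) ?_, key hm' (le_trans ?_ b3) ?_,
    key one_pos (le_trans ?_ b4) ?_, ?_⟩
  · have : c * enorm2 (fixA v) ^ 2 ≤ c * (enorm2 (fixA v) ^ 2 + (enorm2 (fixAB v) ^ 2
      + enorm2 (fixW v) ^ 2)) := mul_le_mul_of_nonneg_left (by linarith) hc.le
    rw [show (h * m : ℝ) * (c * g * enorm2 (fixA v) ^ 2)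
      = h * m * (g * (c * enorm2 (fixA v) ^ 2)) by ring]
    gcongr
    exact this.trans m1
  · linarith [mul_le_mul_of_nonneg_right hhm t3.le, mul_le_mul_of_nonneg_right hhm' t2.le,
      mul_pos (mul_pos hh' hm') t1]
  · have : c * enorm2 (fixB v) ^ 2 ≤ c * (enorm2 (fixB v) ^ 2 + (enorm2 (fixAB v) ^ 2
      + enorm2 (fixW v) ^ 2)) := mul_le_mul_of_nonneg_left (by linarith) hc.le
    rw [show (g * m : ℝ) * (c * h * enorm2 (fixB v) ^ 2)
      = g * m * (h * (c * enorm2 (fixB v) ^ 2)) by ring]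
    gcongr
    exact this.trans m2
  · linarith [mul_le_mul_of_nonneg_right hgm t3.le, mul_le_mul_of_nonneg_right hgm' t2.le,
      mul_pos (mul_pos hg' hm') t0]
  · have : c * enorm2 (fixAB v) ^ 2 ≤ c * (enorm2 (fixAB v) ^ 2 + enorm2 (fixW v) ^ 2) :=
      mul_le_mul_of_nonneg_left (by linarith) hc.le
    rw [show (m : ℝ) * (c * (g * h) * enorm2 (fixAB v) ^ 2)
      = m * (g * h * (c * enorm2 (fixAB v) ^ 2)) by ring]
    gcongr
    exact this.trans m3
  · linarith [mul_le_mul_of_nonneg_right hm1 t3.le, mul_pos hm' t0, mul_pos hm' t1]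
  · rw [show 1 * (c * (g * h * m) * enorm2 (fixW v) ^ 2)
      = g * h * m * (c * enorm2 (fixW v) ^ 2) by ring]
    gcongr
  · linarith
  · rw [← sq] at b0
    have h3 : θ 3 + m * θ 2 + h * m * θ 0 + g * m * θ 1
        ≤ (g * m + h * m) * (θ 0 + θ 1 + θ 2 + θ 3) := by
      linarith [mul_le_mul_of_nonneg_right hgm t3.le, mul_le_mul_of_nonneg_right hgm' t2.le,
        mul_pos (mul_pos hg' hm') t0, mul_pos (mul_pos hh' hm') t1, mul_pos (mul_pos hh' hm') t2,
        mul_pos (mul_pos hh' hm') t3]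
    have h4 : (g * h * m : ℝ) * (R * (1 / g + 1 / h)) = (g * m + h * m) * R := by
      field_simp
      ring
    refine le_of_mul_le_mul_left ?_ (show (0 : ℝ) < g * h * m by positivity)
    rw [h4]
    refine b0.trans ((mul_le_mul_of_nonneg_right h3 hQ0).trans ?_)
    rw [mul_assoc]
    gcongr

lemma MomentBounds.info_posDef (hM : MomentBounds x c C g h m) (hc : 0 < c) (hg : g ≠ 0)
    (hh : h ≠ 0) (hm : m ≠ 0) {θ : VarComp} (hθ : ∀ k, 0 < θ k) : (info x g h m θ).PosDef := by
  have hl := fun b => lam_pos (g := g) (h := h) (m := m) hθ b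
  refine Matrix.PosDef.of_dotProduct_mulVec_pos
    (by rw [Matrix.IsHermitian, Matrix.conjTranspose_eq_transpose_of_trivial, info_transpose]) ?_
  intro v hv
  rw [star_trivial, info_quadForm fun b => (hl b).ne']
  refine (wForm_nonneg hl _).lt_of_ne fun h0 => hv ?_
  obtain ⟨hA, hB, hAB, hW, hG⟩ := hM.le_wForm hc hg hh hm hθ v
    (R := 0) (by rw [← h0, mul_zero])
  have hg' : (0 : ℝ) < g := by positivity
  have hh' : (0 : ℝ) < h := by positivity
  have hm' : (0 : ℝ) < m := by positivity
  have z : ∀ {p : ℕ} {a : ℝ} (w : Fin p → ℝ), 0 < a → a * enorm2 w ^ 2 ≤ 0 → w = 0 := by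
    intro p a w ha hw
    have h1 : enorm2 w ^ 2 = 0 :=
      le_antisymm (by_contra fun h => absurd (mul_pos ha (not_le.1 h)) (not_lt.2 hw)) (sq_nonneg _)
    rw [enorm2_sq] at h1
    exact dotProduct_self_eq_zero.1 h1
  have zA := z _ (by positivity) hA
  have zB := z _ (by positivity) hB
  have zAB := z _ (by positivity) hAB
  have zW := z _ (by positivity) hW
  have zG : grandAvg g h (cellAvg m (regMean x v)) = 0 := by
    rw [zero_mul] at hG
    exact pow_eq_zero_iff two_ne_zero |>.1 (le_antisymm hG (sq_nonneg _))
  rw [grandAvg_regMean x hg hh hm, zA, zB, zAB, zW] at zG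
  simp only [dotLin_apply, dotProduct_zero, add_zero] at zG
  ext r
  rcases r with r | r | r | r | r
  · exact zG
  · exact congrFun zA r
  · exact congrFun zB r
  · exact congrFun zAB r
  · exact congrFun zW r

end EnergyBounds

/-! ### Rates of convergence of the fixed effects -/

section Rates

variable {S : Type*} [MeasurableSpace S] {P : Measure S}
  {pa pb pab pw : ℕ} {x : Covariates pa pb pab pw} {ω₀ : Param pa pb pab pw}
  {α β : ℕ → S → ℝ} {γ : ℕ → ℕ → S → ℝ} {e : ℕ → ℕ → ℕ → S → ℝ}
  {g h m : ℕ → ℕ} {η η₁ η₂ : ℝ≥0∞}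

lemma IsBoundedInProb.tendsto_of_le {B Y : ℕ × S → ℝ} (hB : IsBoundedInProb P B) {a : ℕ → ℝ}
    (ha : Tendsto a atTop (𝓝 0)) (hY : ∀ᶠ q in probFilter P, |Y q| ≤ a q.1 * B q) :
    Tendsto Y (probFilter P) (𝓝 0) := by
  rw [tendsto_zero_iff_abs_tendsto_zero]
  exact tendsto_of_tendsto_of_tendsto_of_le_of_le' tendsto_const_nhds (hB a ha)
    (Eventually.of_forall fun q => abs_nonneg _) hY

/-- The sum `αᵢ + βⱼ + γᵢⱼ + e_{ijk}` of the random terms. -/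
noncomputable abbrev noise {S : Type*} (α β : ℕ → S → ℝ) (γ : ℕ → ℕ → S → ℝ) (e : ℕ → ℕ → ℕ → S → ℝ)
    (s : S) : ℕ → ℕ → ℕ → ℝ := randPart (fun _ => 1) α β γ e s

/-- `v` is the error of the estimator of the fixed effects, which solves the normal equations
with the variance components `θ`, and `θ` is in the box around the true variance components. -/
structure IsGLSError (P : Measure S) (x : Covariates pa pb pab pw) (ω₀ : Param pa pb pab pw)
    (α β : ℕ → S → ℝ) (γ : ℕ → ℕ → S → ℝ) (e : ℕ → ℕ → ℕ → S → ℝ) (g h m : ℕ → ℕ)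
    (θ : ℕ × S → VarComp) (v : ℕ × S → FixedIdx pa pb pab pw → ℝ) : Prop where
  mem_box : ∀ᶠ q in probFilter P, θ q ∈ box ω₀.2
  normal : ∀ᶠ q in probFilter P, ∀ w, wForm (g q.1) (h q.1) (m q.1) (θ q) (regMean x w)
    (noise α β γ e q.2 - regMean x (v q)) = 0

/-- Bounds of the optimal orders for the errors of the fixed effects. -/
structure RateBounds (x : Covariates pa pb pab pw) (g h m : ℕ) (v : FixedIdx pa pb pab pw → ℝ)
    (B : ℝ) : Prop where
  fixA : enorm2 (fixA v) ≤ (√g)⁻¹ * B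
  fixB : enorm2 (fixB v) ≤ (√h)⁻¹ * B
  fixAB : enorm2 (fixAB v) ≤ (√g)⁻¹ * (√h)⁻¹ * B
  fixW : enorm2 (fixW v) ≤ (√g)⁻¹ * (√h)⁻¹ * (√m)⁻¹ * B
  grand : |grandAvg g h (cellAvg m (regMean x v))| ≤ ((√g)⁻¹ + (√h)⁻¹) * B

lemma le_inv_mul_sqrt {n a c R : ℝ} (hn : 0 < n) (hc : 0 < c)
    (h : c * n * a ^ 2 ≤ R) : a ≤ (√n)⁻¹ * √((1 + c⁻¹) * R) := by
  have hR : 0 ≤ R := le_trans (by positivity) h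
  rw [← Real.sqrt_inv, ← Real.sqrt_mul (by positivity)]
  refine Real.le_sqrt_of_sq_le ?_
  rw [inv_mul_eq_div, le_div_iff₀ hn]
  have h1 : a ^ 2 * n = c⁻¹ * (c * n * a ^ 2) := by field_simp
  rw [h1]
  have h2 := mul_le_mul_of_nonneg_left h (inv_pos.2 hc).le
  linarith

lemma MomentBounds.rateBounds {c C : ℝ} {g h m : ℕ} (hM : MomentBounds x c C g h m) (hc : 0 < c)
    (hg : g ≠ 0) (hh : h ≠ 0) (hm : m ≠ 0) {θ : VarComp} (hθ : ∀ k, 0 < θ k)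
    (v : FixedIdx pa pb pab pw → ℝ) {R : ℝ}
    (hR : (θ 0 + θ 1 + θ 2 + θ 3) * wForm g h m θ (regMean x v) (regMean x v) ≤ R) :
    RateBounds x g h m v (√((1 + c⁻¹) * R)) := by
  obtain ⟨hA, hB, hAB, hW, hG⟩ := hM.le_wForm hc hg hh hm hθ v hR
  have hg' : (0 : ℝ) < g := by positivity
  have hh' : (0 : ℝ) < h := by positivity
  have hm' : (0 : ℝ) < m := by positivity
  have hR0 : 0 ≤ R := le_trans (by positivity) hA
  have e1 : (√(g : ℝ))⁻¹ * (√(h : ℝ))⁻¹ = (√((g : ℝ) * h))⁻¹ := by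
    rw [Real.sqrt_mul hg'.le, mul_inv]
  have e2 : (√(g : ℝ))⁻¹ * (√(h : ℝ))⁻¹ * (√(m : ℝ))⁻¹ = (√((g : ℝ) * h * m))⁻¹ := by
    rw [e1, ← mul_inv, ← Real.sqrt_mul (by positivity)]
  refine ⟨le_inv_mul_sqrt hg' hc hA, le_inv_mul_sqrt hh' hc hB, ?_, ?_, ?_⟩
  · rw [e1]
    exact le_inv_mul_sqrt (by positivity) hc hAB
  · rw [e2]
    exact le_inv_mul_sqrt (by positivity) hc hW
  · refine abs_le_of_sq_le_sq ?_ (by positivity)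
    refine hG.trans ?_
    rw [mul_pow, Real.sq_sqrt (by positivity), mul_comm]
    have h1 : (1 / g + 1 / h : ℝ) ≤ ((√g)⁻¹ + (√h)⁻¹) ^ 2 := by
      rw [add_sq, inv_pow, inv_pow, Real.sq_sqrt hg'.le, Real.sq_sqrt hh'.le, one_div, one_div]
      have : 0 ≤ 2 * (√(g : ℝ))⁻¹ * (√(h : ℝ))⁻¹ := by positivity
      linarith
    have h2 : R ≤ (1 + c⁻¹) * R := by
      have := mul_nonneg (inv_pos.2 hc).le hR0
      linarith
    gcongr

lemma tendsto_inv_sqrt {g : ℕ → ℕ} (hg : Tendsto g atTop atTop) :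
    Tendsto (fun N => (√(g N : ℝ))⁻¹) atTop (𝓝 0) :=
  tendsto_inv_atTop_zero.comp (tendsto_sqrt_natCast hg)

lemma abs_le_enorm2 {p : ℕ} (v : Fin p → ℝ) (r : Fin p) : |v r| ≤ enorm2 v := by
  have := PiLp.norm_apply_le (WithLp.toLp 2 v) r
  simpa [enorm2] using this

namespace RegularityConditions

variable (hB : RegularityConditions x P ω₀ α β γ e g h m η η₁ η₂)

include hB

lemma var_pos (k : Fin 4) : 0 < ω₀.2 k := by
  have hi := hB.interior
  rw [mem_interior_iff_mem_nhds, Metric.mem_nhds_iff] at hi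
  obtain ⟨ε, hε, hball⟩ := hi
  have h1 : (ω₀.1, fun k => ω₀.2 k - ε / 2) ∈ Metric.ball ω₀ ε := by
    rw [Metric.mem_ball, Prod.dist_eq, max_lt_iff]
    refine ⟨by simpa using hε, ?_⟩
    refine (dist_pi_lt_iff hε).2 fun k => ?_
    rw [Real.dist_eq, abs_lt]
    constructor <;> linarith
  obtain ⟨h0, h2, h3, h4⟩ := hball h1
  fin_cases k <;> simp at * <;> linarith

lemma eventually_momentBounds : ∃ c C : ℝ, 0 < c ∧ ∀ᶠ N in atTop,
    MomentBounds x c C (g N) (h N) (m N) ∧ g N ≠ 0 ∧ h N ≠ 0 ∧ m N ≠ 0 := by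
  obtain ⟨c, C, hc, N₀, hN₀, hM⟩ := hB.momentBounds
  refine ⟨c, C, hc, ?_⟩
  filter_upwards [hB.g_top.eventually_ge_atTop N₀, hB.h_top.eventually_ge_atTop N₀,
    hB.m_top.eventually_ge_atTop N₀] with N h1 h2 h3
  exact ⟨hM _ h1 _ h2 _ h3, by omega, by omega, by omega⟩

lemma eventually_info_posDef :
    ∀ᶠ N in atTop, ∀ θ : VarComp, (∀ k, 0 < θ k) → (info x (g N) (h N) (m N) θ).PosDef := by
  obtain ⟨c, C, hc, hM⟩ := hB.eventually_momentBounds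
  filter_upwards [hM] with N ⟨h1, h2, h3, h4⟩ θ hθ
  exact h1.info_posDef hc h2 h3 h4 hθ

variable [IsProbabilityMeasure P]

lemma energyBound_isBoundedInProb : IsBoundedInProb P (fun q => energyBound x (g q.1) (h q.1)
    (m q.1) ω₀.2 (table (g q.1) (h q.1) (m q.1) (noise α β γ e q.2))) := by
  -- the energy bound is nonnegative only for large tables
  obtain ⟨N₀, hN₀⟩ := eventually_atTop.1 hB.eventually_info_posDef
  have h1 := IsBoundedInProb.of_integral (P := P) (C := Fintype.card (FixedIdx pa pb pab pw))
    (X := fun N s => if N₀ ≤ N then energyBound x (g N) (h N) (m N) ω₀.2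
      (table (g N) (h N) (m N) (noise α β γ e s)) else 0) ?_ ?_ ?_
  · refine h1.mono ?_
    filter_upwards [eventually_fst_probFilter (eventually_ge_atTop N₀)] with q hq
    rw [if_pos hq]
  · intro N s
    split_ifs with hN
    · refine Finset.sum_nonneg fun b _ => mul_nonneg (by positivity) ?_
      simpa using (hN₀ N hN ω₀.2 hB.var_pos).inv.posSemidef.dotProduct_mulVec_nonneg
        (stratScore x (g N) (h N) (m N) b (table (g N) (h N) (m N) (noise α β γ e s)))
    · exact le_rfl
  · intro N
    split_ifs with hN
    · exact hB.integrable_energyBound _ _ _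
    · exact integrable_zero _ _ _
  · filter_upwards [eventually_ge_atTop N₀] with N hN
    simp only [hN, if_true]
    exact (hB.integral_energyBound hB.var_pos (hN₀ N hN ω₀.2 hB.var_pos)).le

variable {θ : ℕ × S → VarComp} {v : ℕ × S → FixedIdx pa pb pab pw → ℝ}

lemma exists_rateBounds (hv : IsGLSError P x ω₀ α β γ e g h m θ v) :
    ∃ B : ℕ × S → ℝ, IsBoundedInProb P B ∧
      ∀ᶠ q in probFilter P, RateBounds x (g q.1) (h q.1) (m q.1) (v q) (B q) := by
  obtain ⟨c, C, hc, hM⟩ := hB.eventually_momentBounds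
  set T := ω₀.2 0 + ω₀.2 1 + ω₀.2 2 + ω₀.2 3
  have hT : 0 < T := by
    have := hB.var_pos
    have h0 := this 0
    have h1 := this 1
    have h2 := this 2
    have h3 := this 3
    positivity
  refine ⟨_, ((hB.energyBound_isBoundedInProb.const_mul (T * 45)).const_mul (1 + c⁻¹)).sqrt, ?_⟩
  filter_upwards [eventually_fst_probFilter hM, hv.mem_box, hv.normal] with q ⟨h1, h2, h3, h4⟩ h5 h6
  refine h1.rateBounds hc h2 h3 h4 hB.var_pos (v q) ?_
  rw [mul_assoc]
  exact mul_le_mul_of_nonneg_left (wForm_regMean_le hB.var_pos h5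
    (h1.info_posDef hc h2 h3 h4 hB.var_pos) (h6 (v q))).2 hT.le

/-- The estimation error of the fixed effects converges to zero. -/
lemma tendsto_glsError (hv : IsGLSError P x ω₀ α β γ e g h m θ v) :
    Tendsto v (probFilter P) (𝓝 0) := by
  obtain ⟨B, hBP, hr⟩ := hB.exists_rateBounds hv
  obtain ⟨c, C, hc, hM⟩ := hB.eventually_momentBounds
  have ig := tendsto_inv_sqrt hB.g_top
  have ih := tendsto_inv_sqrt hB.h_top
  have im := tendsto_inv_sqrt hB.m_top
  have igh : Tendsto (fun N => (√(g N : ℝ))⁻¹ * (√(h N : ℝ))⁻¹) atTop (𝓝 0) := by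
    simpa using ig.mul ih
  have ighm : Tendsto (fun N => (√(g N : ℝ))⁻¹ * (√(h N : ℝ))⁻¹ * (√(m N : ℝ))⁻¹) atTop (𝓝 0) := by
    simpa using igh.mul im
  rw [tendsto_pi_nhds]
  rintro (r | r | r | r | r)
  · obtain ⟨la, hla⟩ := hB.lim_a
    obtain ⟨lb, hlb⟩ := hB.lim_b
    have ta : Tendsto (fun N => ‖avg (g N) x.a‖ * (√(g N : ℝ))⁻¹) atTop (𝓝 0) := by
      simpa using ((hla.comp hB.g_top).norm).mul ig
    have tb : Tendsto (fun N => ‖avg (h N) x.b‖ * (√(h N : ℝ))⁻¹) atTop (𝓝 0) := by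
      simpa using ((hlb.comp hB.h_top).norm).mul ih
    have sg := tendsto_sqrt_natCast hB.g_top
    have sh := tendsto_sqrt_natCast hB.h_top
    have sm := tendsto_sqrt_natCast hB.m_top
    have tab : Tendsto (fun N => ‖grandAvg (g N) (h N) x.ab‖ *
        ((√(g N : ℝ))⁻¹ * (√(h N : ℝ))⁻¹)) atTop (𝓝 0) := by
      have h1 := (hB.almostBounded_grandAvg_ab.tendsto (fun _ => norm_nonneg _)
        (sg.atTop_add_atTop sh)).mul (ig.add ih)
      simp only [add_zero, mul_zero] at h1
      refine h1.congr' ?_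
      filter_upwards [sg.eventually_gt_atTop 0, sh.eventually_gt_atTop 0] with N h2 h3
      field_simp
      ring
    have tw : Tendsto (fun N => ‖grandAvg (g N) (h N) (cellAvg (m N) x.w)‖ *
        ((√(g N : ℝ))⁻¹ * (√(h N : ℝ))⁻¹ * (√(m N : ℝ))⁻¹)) atTop (𝓝 0) := by
      have h1 := (hB.almostBounded_grandAvg_w.tendsto (fun _ => norm_nonneg _)
        ((sg.atTop_add_atTop sh).atTop_add_atTop sm)).mul
        ((igh.add (ih.mul im)).add (ig.mul im))
      simp only [add_zero, mul_zero] at h1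
      refine h1.congr' ?_
      filter_upwards [sg.eventually_gt_atTop 0, sh.eventually_gt_atTop 0,
        sm.eventually_gt_atTop 0] with N h2 h3 h4
      field_simp
      ring
    have tt := ((ig.add ih).add ta).add (tb.add (tab.add tw))
    simp only [add_zero] at tt
    refine hBP.tendsto_of_le tt ?_
    filter_upwards [eventually_fst_probFilter hM, hr] with q ⟨_, h2, h3, h4⟩ hq
    have e0 := grandAvg_regMean x h2 h3 h4 (v q)
    have e1 : v q (.inl r) = grandAvg (g q.1) (h q.1) (cellAvg (m q.1) (regMean x (v q)))
        - dotLin (fixA (v q)) (avg (g q.1) x.a) - dotLin (fixB (v q)) (avg (h q.1) x.b)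
        - dotLin (fixAB (v q)) (grandAvg (g q.1) (h q.1) x.ab)
        - dotLin (fixW (v q)) (grandAvg (g q.1) (h q.1) (cellAvg (m q.1) x.w)) := by
      rw [e0]
      ring
    have k : ∀ {p : ℕ} {u : Fin p → ℝ} {a : ℝ} (z : EuclideanSpace ℝ (Fin p)),
        enorm2 u ≤ a * B q → |dotLin u z| ≤ ‖z‖ * a * B q := fun z hu =>
      (norm_dotLin_le _ z).trans ((mul_le_mul_of_nonneg_left hu (norm_nonneg z)).trans
        (mul_assoc _ _ _).ge)
    have k0 := abs_le.1 hq.grand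
    have k1 := abs_le.1 (k (avg (g q.1) x.a) hq.fixA)
    have k2 := abs_le.1 (k (avg (h q.1) x.b) hq.fixB)
    have k3 := abs_le.1 (k (grandAvg (g q.1) (h q.1) x.ab) hq.fixAB)
    have k4 := abs_le.1 (k (grandAvg (g q.1) (h q.1) (cellAvg (m q.1) x.w)) hq.fixW)
    rw [e1, abs_le]
    constructor <;> linarith [k0.1, k0.2, k1.1, k1.2, k2.1, k2.2, k3.1, k3.2, k4.1, k4.2]
  · exact hBP.tendsto_of_le ig (hr.mono fun q hq => (abs_le_enorm2 _ r).trans hq.fixA)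
  · exact hBP.tendsto_of_le ih (hr.mono fun q hq => (abs_le_enorm2 _ r).trans hq.fixB)
  · exact hBP.tendsto_of_le igh (hr.mono fun q hq => (abs_le_enorm2 _ r).trans hq.fixAB)
  · exact hBP.tendsto_of_le ighm (hr.mono fun q hq => (abs_le_enorm2 _ r).trans hq.fixW)

end RegularityConditions

end Rates

/-! ### The normal equations -/

section NormalEquations

variable {pa pb pab pw : ℕ} {x : Covariates pa pb pab pw} {g h m : ℕ}

lemma lam_pos_of_mem_paramSpace {ω : Param pa pb pab pw} (hω : ω ∈ paramSpace pa pb pab pw)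
    (b : Fin 5) : 0 < lam g h m ω.2 b := by
  obtain ⟨h0, h1, h2, h3⟩ := hω
  fin_cases b <;> simp [lam, lam₁, lam₂, lam₃, lam₄] <;> positivity

lemma V_inv_form_comm (θ : VarComp) (a b : Obs g h m → ℝ) :
    a ⬝ᵥ ((V g h m θ)⁻¹ *ᵥ b) = b ⬝ᵥ ((V g h m θ)⁻¹ *ᵥ a) := by
  rw [Matrix.dotProduct_mulVec, ← Matrix.mulVec_transpose, V_inv_transpose, dotProduct_comm]

lemma sub_smul_dotProduct_mulVec {ι : Type*} [Fintype ι] {W : Matrix ι ι ℝ}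
    (hW : ∀ a b, a ⬝ᵥ (W *ᵥ b) = b ⬝ᵥ (W *ᵥ a)) (r z : ι → ℝ) (t : ℝ) :
    (r - t • z) ⬝ᵥ (W *ᵥ (r - t • z)) = r ⬝ᵥ (W *ᵥ r) - 2 * t * (z ⬝ᵥ (W *ᵥ r))
      + t ^ 2 * (z ⬝ᵥ (W *ᵥ z)) := by
  rw [Matrix.mulVec_sub, dotProduct_sub, sub_dotProduct, sub_dotProduct, Matrix.mulVec_smul,
    smul_dotProduct, smul_dotProduct, dotProduct_smul, dotProduct_smul, hW r z]
  simp only [smul_eq_mul]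
  ring

lemma hasDerivAt_logLik_line (y : Obs g h m → ℝ) (θ : VarComp) (ξ w : FixedIdx pa pb pab pw → ℝ) :
    HasDerivAt (fun t : ℝ => logLik x g h m y (ξ + t • w, θ))
      ((design x g h m *ᵥ w) ⬝ᵥ ((V g h m θ)⁻¹ *ᵥ (y - design x g h m *ᵥ ξ))) 0 := by
  set R := y - design x g h m *ᵥ ξ with hR
  set Z := design x g h m *ᵥ w with hZ
  set W := (V g h m θ)⁻¹ with hW
  have h1 : ∀ t : ℝ, logLik x g h m y (ξ + t • w, θ) = logLik x g h m y (ξ, θ)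
      + t * (Z ⬝ᵥ (W *ᵥ R)) - t ^ 2 * ((1 / 2) * (Z ⬝ᵥ (W *ᵥ Z))) := by
    intro t
    have h2 : y - design x g h m *ᵥ (ξ + t • w) = R - t • Z := by
      rw [Matrix.mulVec_add, Matrix.mulVec_smul, hR, hZ, sub_add_eq_sub_sub]
    simp only [logLik, h2]
    rw [← hR, ← hW, sub_smul_dotProduct_mulVec (V_inv_form_comm θ)]
    ring
  have h3 := (((hasDerivAt_id (0 : ℝ)).mul_const (Z ⬝ᵥ (W *ᵥ R))).const_add
    (logLik x g h m y (ξ, θ))).sub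
    (((hasDerivAt_id (0 : ℝ)).pow 2).mul_const ((1 / 2) * (Z ⬝ᵥ (W *ᵥ Z))))
  have h4 : HasDerivAt (fun t : ℝ => logLik x g h m y (ξ, θ)
      + t * (Z ⬝ᵥ (W *ᵥ R)) - t ^ 2 * ((1 / 2) * (Z ⬝ᵥ (W *ᵥ Z)))) (Z ⬝ᵥ (W *ᵥ R)) 0 := by
    refine h3.congr_deriv ?_
    simp
  exact h4.congr_of_eventuallyEq (Eventually.of_forall h1)

/-- The maximum likelihood equations for the fixed effects are the normal equations. -/
lemma wForm_eq_zero_of_hasFDerivAt {θ : VarComp} (hθ : ∀ b, 0 < lam g h m θ b)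
    {y : ℕ → ℕ → ℕ → ℝ} {ξ : FixedIdx pa pb pab pw → ℝ}
    (hd : HasFDerivAt (fun ξ => logLik x g h m (table g h m y) (ξ, θ))
      (0 : (FixedIdx pa pb pab pw → ℝ) →L[ℝ] ℝ) ξ) (w : FixedIdx pa pb pab pw → ℝ) :
    wForm g h m θ (regMean x w) (y - regMean x ξ) = 0 := by
  have h1 : HasDerivAt (fun t : ℝ => ξ + t • w) w 0 := by
    have := ((hasDerivAt_id (0 : ℝ)).smul_const w).const_add ξ
    simpa using this
  have h2 : HasFDerivAt (fun ξ => logLik x g h m (table g h m y) (ξ, θ))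
      (0 : (FixedIdx pa pb pab pw → ℝ) →L[ℝ] ℝ) (ξ + (0 : ℝ) • w) := by simpa using hd
  have h3 := h2.comp_hasDerivAt (0 : ℝ) h1
  have h4 := h3.unique (hasDerivAt_logLik_line (x := x) (table g h m y) θ ξ w)
  rw [← dotProduct_V_inv_mulVec fun b => (hθ b).ne']
  exact h4.symm

/-- The estimating equations contain the normal equations. -/
lemma SolvesML.hasFDerivAt {y : Obs g h m → ℝ} {ω : Param pa pb pab pw}
    (hω : SolvesML x g h m y ω) : HasFDerivAt (fun ξ => logLik x g h m y (ξ, ω.2))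
      (0 : (FixedIdx pa pb pab pw → ℝ) →L[ℝ] ℝ) ω.1 := by
  have h1 := HasFDerivAt.comp (g := logLik x g h m y) (f := fun ξ => (ξ, ω.2)) ω.1 hω.2
    (hasFDerivAt_prodMk_left ω.1 ω.2)
  simpa [Function.comp_def] using h1

end NormalEquations

lemma response_sub_regMean {S : Type*} {pa pb pab pw : ℕ} {x : Covariates pa pb pab pw}
    {α β : ℕ → S → ℝ} {γ : ℕ → ℕ → S → ℝ} {e : ℕ → ℕ → ℕ → S → ℝ}
    (ξ ξ' : FixedIdx pa pb pab pw → ℝ) (s : S) :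
    response x ξ α β γ e s - regMean x ξ' = noise α β γ e s - regMean x (ξ' - ξ) := by
  ext i j k
  simp only [regMean_sub, Pi.sub_apply, response, noise, randPart]
  ring

section Roots

variable {S : Type*} [MeasurableSpace S] {P : Measure S}
  {pa pb pab pw : ℕ} {x : Covariates pa pb pab pw} {ω₀ : Param pa pb pab pw}
  {α β : ℕ → S → ℝ} {γ : ℕ → ℕ → S → ℝ} {e : ℕ → ℕ → ℕ → S → ℝ}
  {g h m : ℕ → ℕ} {η η₁ η₂ : ℝ≥0∞}

lemma box_mem_nhds {θ : VarComp} (hθ : ∀ k, 0 < θ k) : box θ ∈ 𝓝 θ := by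
  have h1 : Set.pi Set.univ (fun k => Set.Icc (θ k / 2) (3 / 2 * θ k)) ∈ 𝓝 θ :=
    set_pi_mem_nhds Set.finite_univ fun k _ =>
      Icc_mem_nhds (by linarith [hθ k]) (by linarith [hθ k])
  exact mem_of_superset h1 fun θ' h' k => h' k (Set.mem_univ k)

/-- The errors of the fixed effects in a consistent sequence of roots. -/
lemma IsConsistentRoot.isGLSError
    {Solves : ∀ g h m : ℕ, (Obs g h m → ℝ) → Param pa pb pab pw → Prop}
    (hS : ∀ g h m y ω, Solves g h m y ω → ω ∈ paramSpace pa pb pab pw ∧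
      HasFDerivAt (fun ξ => logLik x g h m y (ξ, ω.2))
        (0 : (FixedIdx pa pb pab pw → ℝ) →L[ℝ] ℝ) ω.1)
    {est : ∀ N, (Obs (g N) (h N) (m N) → ℝ) → Param pa pb pab pw}
    (hest : IsConsistentRoot P Solves ω₀ (response x ω₀.1 α β γ e) g h m est)
    (hθ : ∀ k, 0 < ω₀.2 k) : IsGLSError P x ω₀ α β γ e g h m
      (fun q => (est q.1 (table (g q.1) (h q.1) (m q.1) (response x ω₀.1 α β γ e q.2))).2)
      (fun q => (est q.1 (table (g q.1) (h q.1) (m q.1) (response x ω₀.1 α β γ e q.2))).1 - ω₀.1) := by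
  constructor
  · have h1 := tendsto_probFilter_iff.1 hest.consistent
    exact ((continuous_snd.tendsto _).comp h1).eventually (box_mem_nhds hθ)
  · have h1 : ∀ᶠ q in probFilter P, Solves (g q.1) (h q.1) (m q.1)
        (table (g q.1) (h q.1) (m q.1) (response x ω₀.1 α β γ e q.2))
        (est q.1 (table (g q.1) (h q.1) (m q.1) (response x ω₀.1 α β γ e q.2))) := hest.solves
    filter_upwards [h1] with q hq w
    obtain ⟨h2, h3⟩ := hS _ _ _ _ _ hq
    rw [← response_sub_regMean]
    exact wForm_eq_zero_of_hasFDerivAt (fun b => lam_pos_of_mem_paramSpace h2 b) h3 w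

/-! ### The residuals -/

variable {θ : VarComp} {G H M : ℕ} {v : FixedIdx pa pb pab pw → ℝ} {u : ℕ → ℕ → ℕ → ℝ}

/-- The vector of fixed effects with given intercept and given row effects. -/
def rowDirection (c : ℝ) (a : Fin pa → ℝ) : FixedIdx pa pb pab pw → ℝ :=
  Sum.elim (fun _ => c) (Sum.elim a 0)

/-- The vector of fixed effects with given column effects. -/
def colDirection (b : Fin pb → ℝ) : FixedIdx pa pb pab pw → ℝ :=
  Sum.elim 0 (Sum.elim 0 (Sum.elim b 0))

/-- The residuals of a solution of the normal equations have mean zero. -/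
lemma grandAvg_eq_zero_of_normal (hg : G ≠ 0) (hh : H ≠ 0) (hm : M ≠ 0)
    (hθ : ∀ b, 0 < lam G H M θ b)
    (hn : ∀ w : FixedIdx pa pb pab pw → ℝ, wForm G H M θ (regMean x w) u = 0) :
    grandAvg G H (cellAvg M u) = 0 := by
  have h1 := hn (rowDirection 1 0)
  have z1 : fixA (rowDirection 1 0 : FixedIdx pa pb pab pw → ℝ) = 0 := rfl
  have z2 : fixB (rowDirection 1 0 : FixedIdx pa pb pab pw → ℝ) = 0 := rfl
  have z3 : fixAB (rowDirection 1 0 : FixedIdx pa pb pab pw → ℝ) = 0 := rfl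
  have z4 : fixW (rowDirection 1 0 : FixedIdx pa pb pab pw → ℝ) = 0 := rfl
  have z5 : (rowDirection 1 0 : FixedIdx pa pb pab pw → ℝ) (.inl ()) = 1 := rfl
  rw [wForm, Fin.sum_univ_five, stratForm_grand, stratForm_row, stratForm_col, stratForm_int,
    stratForm_within] at h1
  simp only [rowCtr_regMean x hg hh hm, colCtr_regMean x hg hh hm, intCtr_regMean x hg hh hm,
    withinCtr_regMean x hm, grandAvg_regMean x hg hh hm, z1, z2, z3, z4, z5, dotLin_apply,
    dotProduct_zero, add_zero, zero_mul, Finset.sum_const_zero, mul_zero, one_mul] at h1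
  have h0 := (hθ 0).ne'
  have hg' : (G : ℝ) ≠ 0 := by positivity
  have hh' : (H : ℝ) ≠ 0 := by positivity
  have hm' : (M : ℝ) ≠ 0 := by positivity
  simpa [h0, hg', hh', hm'] using h1

/-- The residuals of a solution of the normal equations are orthogonal to the row covariates. -/
lemma sum_row_eq_zero_of_normal (hg : G ≠ 0) (hh : H ≠ 0) (hm : M ≠ 0)
    (hθ : ∀ b, 0 < lam G H M θ b)
    (hn : ∀ w : FixedIdx pa pb pab pw → ℝ, wForm G H M θ (regMean x w) u = 0) (a : Fin pa → ℝ) :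
    ∑ i ∈ Finset.range G, dotLin a (ctr G x.a i) * rowCtr G H (cellAvg M u) i = 0 := by
  have h1 := hn (rowDirection 0 a)
  have z1 : fixA (rowDirection 0 a : FixedIdx pa pb pab pw → ℝ) = a := rfl
  have z2 : fixB (rowDirection 0 a : FixedIdx pa pb pab pw → ℝ) = 0 := rfl
  have z3 : fixAB (rowDirection 0 a : FixedIdx pa pb pab pw → ℝ) = 0 := rfl
  have z4 : fixW (rowDirection 0 a : FixedIdx pa pb pab pw → ℝ) = 0 := rfl
  rw [wForm, Fin.sum_univ_five, stratForm_grand, stratForm_row, stratForm_col, stratForm_int,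
    stratForm_within, grandAvg_eq_zero_of_normal hg hh hm hθ hn] at h1
  simp only [rowCtr_regMean x hg hh hm, colCtr_regMean x hg hh hm, intCtr_regMean x hg hh hm,
    withinCtr_regMean x hm, z1, z2, z3, z4, dotLin_apply,
    dotProduct_zero, add_zero, zero_mul, Finset.sum_const_zero, mul_zero, zero_add] at h1
  have h0 := (hθ 1).ne'
  have hh' : (H : ℝ) ≠ 0 := by positivity
  have hm' : (M : ℝ) ≠ 0 := by positivity
  simpa [h0, hh', hm', dotLin_apply] using h1

/-- The residuals of a solution of the normal equations are orthogonal to the column covariates. -/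
lemma sum_col_eq_zero_of_normal (hg : G ≠ 0) (hh : H ≠ 0) (hm : M ≠ 0)
    (hθ : ∀ b, 0 < lam G H M θ b)
    (hn : ∀ w : FixedIdx pa pb pab pw → ℝ, wForm G H M θ (regMean x w) u = 0) (b : Fin pb → ℝ) :
    ∑ j ∈ Finset.range H, dotLin b (ctr H x.b j) * colCtr G H (cellAvg M u) j = 0 := by
  have h1 := hn (colDirection b)
  have z1 : fixA (colDirection b : FixedIdx pa pb pab pw → ℝ) = 0 := rfl
  have z2 : fixB (colDirection b : FixedIdx pa pb pab pw → ℝ) = b := rfl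
  have z3 : fixAB (colDirection b : FixedIdx pa pb pab pw → ℝ) = 0 := rfl
  have z4 : fixW (colDirection b : FixedIdx pa pb pab pw → ℝ) = 0 := rfl
  rw [wForm, Fin.sum_univ_five, stratForm_grand, stratForm_row, stratForm_col, stratForm_int,
    stratForm_within, grandAvg_eq_zero_of_normal hg hh hm hθ hn] at h1
  simp only [rowCtr_regMean x hg hh hm, colCtr_regMean x hg hh hm, intCtr_regMean x hg hh hm,
    withinCtr_regMean x hm, z1, z2, z3, z4, dotLin_apply,
    dotProduct_zero, add_zero, zero_mul, Finset.sum_const_zero, mul_zero, zero_add] at h1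
  have h0 := (hθ 2).ne'
  have hg' : (G : ℝ) ≠ 0 := by positivity
  have hm' : (M : ℝ) ≠ 0 := by positivity
  simpa [h0, hg', hm', dotLin_apply] using h1

end Roots

/-! ### Averages of the random effects -/

section NoiseAverages

variable {S : Type*} {α β : ℕ → S → ℝ} {γ : ℕ → ℕ → S → ℝ} {e : ℕ → ℕ → ℕ → S → ℝ} {G H M : ℕ}

lemma cellAvg_noise (hm : M ≠ 0) (s : S) (i j : ℕ) : cellAvg M (noise α β γ e s) i j
    = α i s + β j s + γ i j s + cellAvg M (fun i j k => e i j k s) i j := by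
  simp only [cellAvg]
  rw [show noise α β γ e s i j = fun k => (α i s + β j s + γ i j s) + e i j k s from
    funext fun k => by simp [noise, randPart], avg_add, avg_const hm]

lemma rowAvg_noise (hh : H ≠ 0) (hm : M ≠ 0) (s : S) (i : ℕ) :
    rowAvg H (cellAvg M (noise α β γ e s)) i = α i s + avg H (fun j => β j s)
      + avg H (fun j => γ i j s) + avg H (fun j => avg M (fun k => e i j k s)) := by
  rw [rowAvg, show cellAvg M (noise α β γ e s) i = fun j => α i s + β j s + γ i j s
    + cellAvg M (fun i j k => e i j k s) i j from funext fun j => cellAvg_noise hm s i j,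
    avg_add, avg_add, avg_add, avg_const hh]
  rfl

lemma colAvg_noise (hg : G ≠ 0) (hm : M ≠ 0) (s : S) (j : ℕ) :
    colAvg G (cellAvg M (noise α β γ e s)) j = avg G (fun i => α i s) + β j s
      + avg G (fun i => γ i j s) + avg G (fun i => avg M (fun k => e i j k s)) := by
  rw [colAvg, show (fun i => cellAvg M (noise α β γ e s) i j) = fun i => α i s + β j s + γ i j s
    + cellAvg M (fun i j k => e i j k s) i j from funext fun i => cellAvg_noise hm s i j,
    avg_add, avg_add, avg_add, avg_const hg]
  rfl

lemma grandAvg_noise (hg : G ≠ 0) (hh : H ≠ 0) (hm : M ≠ 0) (s : S) :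
    grandAvg G H (cellAvg M (noise α β γ e s)) = avg G (fun i => α i s) + avg H (fun j => β j s)
      + avg G (fun i => avg H (fun j => γ i j s))
      + avg G (fun i => avg H (fun j => avg M (fun k => e i j k s))) := by
  rw [show grandAvg G H (cellAvg M (noise α β γ e s))
    = avg G (fun i => rowAvg H (cellAvg M (noise α β γ e s)) i) from rfl]
  simp_rw [rowAvg_noise hh hm]
  rw [avg_add, avg_add, avg_add, avg_const hg]

lemma rowCtr_noise (hg : G ≠ 0) (hh : H ≠ 0) (hm : M ≠ 0) (s : S) (i : ℕ) :
    rowCtr G H (cellAvg M (noise α β γ e s)) i = α i s - avg G (fun i => α i s)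
      + (avg H (fun j => γ i j s) - avg G (fun i => avg H (fun j => γ i j s)))
      + (avg H (fun j => avg M (fun k => e i j k s))
        - avg G (fun i => avg H (fun j => avg M (fun k => e i j k s)))) := by
  rw [rowCtr, rowAvg_noise hh hm, grandAvg_noise hg hh hm]
  ring

lemma colCtr_noise (hg : G ≠ 0) (hh : H ≠ 0) (hm : M ≠ 0) (s : S) (j : ℕ) :
    colCtr G H (cellAvg M (noise α β γ e s)) j = β j s - avg H (fun j => β j s)
      + (avg G (fun i => γ i j s) - avg G (fun i => avg H (fun j => γ i j s)))
      + (avg G (fun i => avg M (fun k => e i j k s))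
        - avg G (fun i => avg H (fun j => avg M (fun k => e i j k s)))) := by
  rw [colCtr, colAvg_noise hg hm, grandAvg_noise hg hh hm]
  ring

lemma intCtr_noise (hg : G ≠ 0) (hh : H ≠ 0) (hm : M ≠ 0) (s : S) (i j : ℕ) :
    intCtr G H (cellAvg M (noise α β γ e s)) i j = γ i j s - avg H (fun j => γ i j s)
      - avg G (fun i => γ i j s) + avg G (fun i => avg H (fun j => γ i j s))
      + (avg M (fun k => e i j k s) - avg H (fun j => avg M (fun k => e i j k s))
        - avg G (fun i => avg M (fun k => e i j k s))
        + avg G (fun i => avg H (fun j => avg M (fun k => e i j k s)))) := by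
  rw [intCtr, colAvg_noise hg hm, rowAvg_noise hh hm, grandAvg_noise hg hh hm, cellAvg_noise hm,
    cellAvg]
  ring

end NoiseAverages

section SmallAverages

variable {S : Type*} [MeasurableSpace S] {P : Measure S} [IsProbabilityMeasure P]
  {pa pb pab pw : ℕ} {x : Covariates pa pb pab pw} {ω₀ : Param pa pb pab pw}
  {α β : ℕ → S → ℝ} {γ : ℕ → ℕ → S → ℝ} {e : ℕ → ℕ → ℕ → S → ℝ}
  {g h m : ℕ → ℕ} {η η₁ η₂ : ℝ≥0∞}

namespace RegularityConditions

variable (hB : RegularityConditions x P ω₀ α β γ e g h m η η₁ η₂)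

include hB

lemma tendsto_sum_effects {J : Type*} [DecidableEq J] {f : J → EffIdx} (hf : f.Injective)
    {t : Fin 4} (ht : ∀ c, effType (f c) = t) (T : ℕ → Finset J) (a : ℕ → J → ℝ)
    (ha : Tendsto (fun N => ∑ c ∈ T N, a N c ^ 2) atTop (𝓝 0)) :
    Tendsto (fun q : ℕ × S => ∑ c ∈ T q.1, a q.1 c * allEffects α β γ e (f c) q.2)
      (probFilter P) (𝓝 0) := by
  refine tendsto_sum_of_variance (Z := fun c => allEffects α β γ e (f c)) (v := fun _ => ω₀.2 t)
    (fun c => hB.memLp_two (f c)) (fun c c' => ?_) T a ?_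
  · rw [hB.integral_mul, ht]
    simp only [hf.eq_iff]
  · simp_rw [← Finset.sum_mul]
    simpa using ha.mul_const (ω₀.2 t)

lemma tendsto_weighted_avg {f : ℕ → EffIdx} (hf : f.Injective) {t : Fin 4}
    (ht : ∀ c, effType (f c) = t) {b : ℕ → ℝ} {w : ℕ → ℕ → ℝ} {n : ℕ → ℕ}
    (hb : Tendsto (fun N => b N ^ 2 * avg (n N) (fun i => w N i ^ 2) * (n N : ℝ)⁻¹) atTop (𝓝 0)) :
    Tendsto (fun q : ℕ × S => b q.1 * avg (n q.1)
      (fun i => w q.1 i * allEffects α β γ e (f i) q.2)) (probFilter P) (𝓝 0) := by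
  refine (hB.tendsto_sum_effects hf ht (fun N => Finset.range (n N))
    (fun N i => b N * (n N : ℝ)⁻¹ * w N i) ?_).congr fun q => ?_
  · refine hb.congr fun N => ?_
    simp only [avg, smul_eq_mul, mul_pow, ← Finset.mul_sum]
    ring
  · simp only [avg, smul_eq_mul, ← mul_assoc, Finset.mul_sum]

lemma tendsto_weighted_avg_avg {f : ℕ → ℕ → EffIdx} (hf : (Function.uncurry f).Injective)
    {t : Fin 4} (ht : ∀ i j, effType (f i j) = t) {b : ℕ → ℝ} {w : ℕ → ℕ → ℝ} {n n' : ℕ → ℕ}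
    (hb : Tendsto (fun N => b N ^ 2 * avg (n N) (fun i => w N i ^ 2) * (n N : ℝ)⁻¹
      * (n' N : ℝ)⁻¹) atTop (𝓝 0)) :
    Tendsto (fun q : ℕ × S => b q.1 * avg (n q.1) (fun i => w q.1 i *
      avg (n' q.1) (fun j => allEffects α β γ e (f i j) q.2))) (probFilter P) (𝓝 0) := by
  refine (hB.tendsto_sum_effects hf (fun c => ht c.1 c.2)
    (fun N => Finset.range (n N) ×ˢ Finset.range (n' N))
    (fun N c => b N * (n N : ℝ)⁻¹ * w N c.1 * (n' N : ℝ)⁻¹) ?_).congr fun q => ?_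
  · refine hb.congr fun N => ?_
    simp only [avg, smul_eq_mul, mul_pow, Finset.sum_product, Finset.sum_const, Finset.card_range,
      nsmul_eq_mul, ← Finset.mul_sum, ← Finset.sum_mul]
    rcases Nat.eq_zero_or_pos (n' N) with h0 | h0
    · simp [h0]
    · have : (n' N : ℝ) ≠ 0 := by positivity
      field_simp
  · simp only [avg, smul_eq_mul, ← mul_assoc, Finset.mul_sum, Finset.sum_product]
    rfl

lemma tendsto_weighted_avg_avg_avg {f : ℕ → ℕ → ℕ → EffIdx}
    (hf : (fun c : ℕ × ℕ × ℕ => f c.1 c.2.1 c.2.2).Injective)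
    {t : Fin 4} (ht : ∀ i j k, effType (f i j k) = t) {b : ℕ → ℝ} {w : ℕ → ℕ → ℝ} {n n' n'' : ℕ → ℕ}
    (hb : Tendsto (fun N => b N ^ 2 * avg (n N) (fun i => w N i ^ 2) * (n N : ℝ)⁻¹
      * (n' N : ℝ)⁻¹ * (n'' N : ℝ)⁻¹) atTop (𝓝 0)) :
    Tendsto (fun q : ℕ × S => b q.1 * avg (n q.1) (fun i => w q.1 i *
      avg (n' q.1) (fun j => avg (n'' q.1) fun k => allEffects α β γ e (f i j k) q.2)))
      (probFilter P) (𝓝 0) := by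
  refine (hB.tendsto_sum_effects hf (fun c => ht c.1 c.2.1 c.2.2)
    (fun N => Finset.range (n N) ×ˢ Finset.range (n' N) ×ˢ Finset.range (n'' N))
    (fun N c => b N * (n N : ℝ)⁻¹ * w N c.1 * (n' N : ℝ)⁻¹ * (n'' N : ℝ)⁻¹) ?_).congr fun q => ?_
  · refine hb.congr fun N => ?_
    simp only [avg, smul_eq_mul, mul_pow, Finset.sum_product, Finset.sum_const, Finset.card_product,
      Finset.card_range, Nat.cast_mul, nsmul_eq_mul, ← Finset.mul_sum, ← Finset.sum_mul]
    rcases Nat.eq_zero_or_pos (n' N) with h0 | h0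
    · simp [h0]
    rcases Nat.eq_zero_or_pos (n'' N) with h1 | h1
    · simp [h1]
    have : (n' N : ℝ) ≠ 0 := by positivity
    have : (n'' N : ℝ) ≠ 0 := by positivity
    field_simp
  · simp only [avg, smul_eq_mul, ← mul_assoc, Finset.mul_sum, Finset.sum_product]

end RegularityConditions

/-- The normalisation by `r`, relative to the sizes of the tables. -/
structure IsScale (r g h m : ℕ → ℕ) (κ₁ κ₂ κ₃ : ℝ) : Prop where
  top : Tendsto r atTop atTop
  div_g : Tendsto (fun N => (r N : ℝ) * (g N : ℝ)⁻¹) atTop (𝓝 κ₁)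
  div_h : Tendsto (fun N => (r N : ℝ) * (h N : ℝ)⁻¹) atTop (𝓝 κ₂)
  div_m : Tendsto (fun N => (r N : ℝ) * (m N : ℝ)⁻¹) atTop (𝓝 κ₃)

lemma tendsto_inv_natCast {n : ℕ → ℕ} (hn : Tendsto n atTop atTop) :
    Tendsto (fun N => (n N : ℝ)⁻¹) atTop (𝓝 0) :=
  tendsto_inv_atTop_zero.comp (tendsto_natCast_atTop_atTop.comp hn)

namespace RegularityConditions

variable (hB : RegularityConditions x P ω₀ α β γ e g h m η η₁ η₂)
  {r : ℕ → ℕ}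

include hB

/-- A weighted double average in which one factor compensates the normalisation. -/
lemma tendsto_scaled_avg_avg {f : ℕ → ℕ → EffIdx} (hf : (Function.uncurry f).Injective)
    {t : Fin 4} (ht : ∀ i j, effType (f i j) = t) {w : ℕ → ℕ → ℝ} {n n' : ℕ → ℕ} {κ C : ℝ}
    (hn : Tendsto (fun N => (r N : ℝ) * (n N : ℝ)⁻¹) atTop (𝓝 κ))
    (hn' : Tendsto n' atTop atTop)
    (hw : Tendsto (fun N => avg (n N) (fun i => w N i ^ 2)) atTop (𝓝 C)) :
    Tendsto (fun q : ℕ × S => √(r q.1) * avg (n q.1) (fun i => w q.1 i *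
      avg (n' q.1) (fun j => allEffects α β γ e (f i j) q.2))) (probFilter P) (𝓝 0) := by
  refine hB.tendsto_weighted_avg_avg (b := fun N => √(r N)) hf ht ?_
  have h1 := (hn.mul hw).mul (tendsto_inv_natCast hn')
  rw [mul_zero] at h1
  refine h1.congr fun N => ?_
  rw [Real.sq_sqrt (by positivity)]
  ring

lemma tendsto_scaled_avg_avg_avg {f : ℕ → ℕ → ℕ → EffIdx}
    (hf : (fun c : ℕ × ℕ × ℕ => f c.1 c.2.1 c.2.2).Injective)
    {t : Fin 4} (ht : ∀ i j k, effType (f i j k) = t) {w : ℕ → ℕ → ℝ} {n n' n'' : ℕ → ℕ} {κ C : ℝ}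
    (hn : Tendsto (fun N => (r N : ℝ) * (n N : ℝ)⁻¹) atTop (𝓝 κ))
    (hn' : Tendsto n' atTop atTop) (hn'' : Tendsto n'' atTop atTop)
    (hw : Tendsto (fun N => avg (n N) (fun i => w N i ^ 2)) atTop (𝓝 C)) :
    Tendsto (fun q : ℕ × S => √(r q.1) * avg (n q.1) (fun i => w q.1 i *
      avg (n' q.1) (fun j => avg (n'' q.1) fun k => allEffects α β γ e (f i j k) q.2)))
      (probFilter P) (𝓝 0) := by
  refine hB.tendsto_weighted_avg_avg_avg (b := fun N => √(r N)) hf ht ?_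
  have h1 := ((hn.mul hw).mul (tendsto_inv_natCast hn')).mul (tendsto_inv_natCast hn'')
  rw [mul_zero] at h1
  refine h1.congr fun N => ?_
  rw [Real.sq_sqrt (by positivity)]
  ring

end RegularityConditions

end SmallAverages

/-! ### Expansion of the coefficients of the row and column covariates -/

section Coefficients

variable {S : Type*} [MeasurableSpace S] {P : Measure S} {p : ℕ} {z : ℕ → EuclideanSpace ℝ (Fin p)}
  {D : Matrix (Fin p) (Fin p) ℝ}

lemma dotLin_sq_avg (n : ℕ) (f : ℕ → EuclideanSpace ℝ (Fin p)) (a : Fin p → ℝ) :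
    avg n (fun i => dotLin a (f i) ^ 2) = a ⬝ᵥ (avg n (fun i => outer (f i).ofLp) *ᵥ a) := by
  rw [avg_outer_quadForm]
  rfl

lemma tendsto_avg_dotLin_sq {n : ℕ → ℕ} (hn : Tendsto n atTop atTop)
    (hD : Tendsto (fun n => avg n (fun i => outer (ctr n z i).ofLp)) atTop (𝓝 D)) (a : Fin p → ℝ) :
    Tendsto (fun N => avg (n N) (fun i => dotLin a (ctr (n N) z i) ^ 2)) atTop
      (𝓝 (a ⬝ᵥ (D *ᵥ a))) := by
  simp_rw [dotLin_sq_avg]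
  have h1 : Continuous fun A : Matrix (Fin p) (Fin p) ℝ => a ⬝ᵥ (A *ᵥ a) :=
    continuous_const.dotProduct (continuous_id.matrix_mulVec continuous_const)
  exact (h1.tendsto D).comp (hD.comp hn)

/-- The estimating equations of the coefficients `v` of a centred covariate determine the leading
term of `v`. -/
lemma tendsto_coefficients {n : ℕ → ℕ} (hn : Tendsto n atTop atTop)
    (hD : Tendsto (fun n => avg n (fun i => outer (ctr n z i).ofLp)) atTop (𝓝 D))
    (hdet : IsUnit D.det) {R : ℕ → ℝ} {v : ℕ × S → Fin p → ℝ} {ε : ℕ × S → ℕ → ℝ}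
    (hv : IsBoundedInProb P (fun q => R q.1 * enorm2 (v q)))
    (hE : ∀ a, Tendsto (fun q : ℕ × S => R q.1 * avg (n q.1) (fun i => dotLin a (ctr (n q.1) z i)
      * (ε q i - dotLin (v q) (ctr (n q.1) z i)))) (probFilter P) (𝓝 0))
    {y : ℕ → EuclideanSpace ℝ (Fin p)} {y₀ : EuclideanSpace ℝ (Fin p)}
    (hy : Tendsto y atTop (𝓝 y₀)) :
    Tendsto (fun q : ℕ × S => R q.1 * (dotLin (v q) (y q.1) - avg (n q.1) (fun i =>
      dotLin (D⁻¹ *ᵥ y₀.ofLp) (ctr (n q.1) z i) * ε q i))) (probFilter P) (𝓝 0) := by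
  set a := D⁻¹ *ᵥ y₀.ofLp with ha
  set A : ℕ → Matrix (Fin p) (Fin p) ℝ :=
    fun N => avg (n N) (fun i => outer (ctr (n N) z i).ofLp) with hA
  have hDa : D *ᵥ a = y₀.ofLp := by
    rw [ha, Matrix.mulVec_mulVec, Matrix.mul_nonsing_inv _ hdet, Matrix.one_mulVec]
  have hlim : Tendsto (fun N => ‖y N - WithLp.toLp 2 (A N *ᵥ a)‖) atTop (𝓝 0) := by
    have h1 : Tendsto (fun N => A N *ᵥ a) atTop (𝓝 (D *ᵥ a)) :=
      ((continuous_id.matrix_mulVec continuous_const).tendsto D).comp (hD.comp hn)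
    have h2 : Tendsto (fun N => WithLp.toLp 2 (A N *ᵥ a)) atTop (𝓝 (WithLp.toLp 2 (D *ᵥ a))) :=
      ((PiLp.continuous_toLp 2 _).tendsto _).comp h1
    rw [hDa] at h2
    have h3 := (hy.sub h2).norm
    simpa using h3
  have h4 : Tendsto (fun q : ℕ × S => R q.1 * dotLin (v q) (y q.1 - WithLp.toLp 2 (A q.1 *ᵥ a)))
      (probFilter P) (𝓝 0) := by
    have h5 := hv _ hlim
    rw [tendsto_zero_iff_abs_tendsto_zero] at h5 ⊢
    refine tendsto_of_tendsto_of_tendsto_of_le_of_le tendsto_const_nhds h5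
      (fun q => abs_nonneg _) fun q => ?_
    simp only [Function.comp_apply, abs_mul]
    rw [abs_of_nonneg (norm_nonneg _), abs_of_nonneg (enorm2_nonneg _)]
    calc |R q.1| * |dotLin (v q) (y q.1 - WithLp.toLp 2 (A q.1 *ᵥ a))|
        ≤ |R q.1| * (‖y q.1 - WithLp.toLp 2 (A q.1 *ᵥ a)‖ * enorm2 (v q)) :=
          mul_le_mul_of_nonneg_left (norm_dotLin_le _ _) (abs_nonneg _)
      _ = _ := by ring
  have h6 := h4.sub (hE a)
  rw [sub_zero] at h6
  refine h6.congr fun q => ?_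
  have h7 : dotLin (v q) (WithLp.toLp 2 (A q.1 *ᵥ a))
      = avg (n q.1) (fun i => dotLin a (ctr (n q.1) z i) * dotLin (v q) (ctr (n q.1) z i)) := by
    let φ : Matrix (Fin p) (Fin p) ℝ →ₗ[ℝ] ℝ :=
      { toFun := fun B => (B *ᵥ a) ⬝ᵥ v q
        map_add' := fun B C => by rw [Matrix.add_mulVec, add_dotProduct]
        map_smul' := fun c B => by simp [Matrix.smul_mulVec, smul_dotProduct] }
    change φ (A q.1) = _
    rw [hA]
    dsimp only
    rw [← avg_map φ]
    refine congrArg (avg (n q.1)) (funext fun i => ?_)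
    simp only [φ, LinearMap.coe_mk, AddHom.coe_mk, outer, dotLin_apply]
    rw [Matrix.vecMulVec_mulVec]
    simp
  rw [map_sub, h7]
  simp_rw [mul_sub]
  rw [avg_sub]
  ring

end Coefficients

/-! ### Negligible terms -/

/-- Convergence to zero with the normalisation implies convergence to zero. -/
lemma tendsto_of_sqrt_mul {S : Type*} [MeasurableSpace S] {P : Measure S} {r : ℕ → ℕ}
    (hr : Tendsto r atTop atTop)
    {X : ℕ × S → ℝ} (hX : Tendsto (fun q => √(r q.1) * X q) (probFilter P) (𝓝 0)) :
    Tendsto X (probFilter P) (𝓝 0) := by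
  refine ((IsBoundedInProb.of_tendsto hX) _ (tendsto_inv_sqrt hr)).congr' ?_
  filter_upwards [eventually_fst_probFilter ((tendsto_sqrt_natCast hr).eventually_gt_atTop 0)]
    with q hq
  field_simp

section Negligible

variable {S : Type*} [MeasurableSpace S] {P : Measure S} [IsProbabilityMeasure P]
  {pa pb pab pw : ℕ} {x : Covariates pa pb pab pw} {ω₀ : Param pa pb pab pw}
  {α β : ℕ → S → ℝ} {γ : ℕ → ℕ → S → ℝ} {e : ℕ → ℕ → ℕ → S → ℝ}
  {g h m : ℕ → ℕ} {η η₁ η₂ : ℝ≥0∞} {r : ℕ → ℕ} {κ₁ κ₂ κ₃ : ℝ}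

lemma tendsto_sqrt_mul_inv_sqrt {n : ℕ → ℕ} {κ : ℝ}
    (h : Tendsto (fun N => (r N : ℝ) * (n N : ℝ)⁻¹) atTop (𝓝 κ)) :
    Tendsto (fun N => √(r N : ℝ) * (√(n N : ℝ))⁻¹) atTop (𝓝 √κ) := by
  refine ((Real.continuous_sqrt.tendsto κ).comp h).congr fun N => ?_
  rw [Function.comp_apply, Real.sqrt_mul (by positivity), Real.sqrt_inv]

lemma tendsto_sqrt_mul_inv {n : ℕ → ℕ} (hn : Tendsto n atTop atTop) {κ : ℝ}
    (h : Tendsto (fun N => (r N : ℝ) * (n N : ℝ)⁻¹) atTop (𝓝 κ)) :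
    Tendsto (fun N => √(r N : ℝ) * (n N : ℝ)⁻¹) atTop (𝓝 0) := by
  have h1 := (tendsto_sqrt_mul_inv_sqrt h).mul (tendsto_inv_sqrt hn)
  rw [mul_zero] at h1
  refine h1.congr fun N => ?_
  rw [mul_assoc, ← mul_inv, Real.mul_self_sqrt (by positivity)]

lemma tendsto_avg_one {n : ℕ → ℕ} (hn : Tendsto n atTop atTop) :
    Tendsto (fun N => avg (n N) (fun _ => (1 : ℝ) ^ 2)) atTop (𝓝 1) := by
  refine tendsto_const_nhds.congr' ?_
  filter_upwards [hn.eventually_ge_atTop 1] with N hN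
  rw [avg_const (by omega), one_pow]

lemma abs_avg_mul_dotLin_le {p p' n : ℕ} {z : ℕ → EuclideanSpace ℝ (Fin p)}
    {z' : ℕ → EuclideanSpace ℝ (Fin p')} {C : ℝ} (hz : avg n (fun i => ‖z i‖ ^ 2) ≤ C)
    (hz' : avg n (fun i => ‖z' i‖ ^ 2) ≤ C) (a : Fin p → ℝ) (u : Fin p' → ℝ) :
    |avg n (fun i => dotLin a (z i) * dotLin u (z' i))| ≤ enorm2 a * C * enorm2 u := by
  have h1 : ∀ i, |dotLin a (z i) * dotLin u (z' i)|
      ≤ (enorm2 a * enorm2 u) • ((1 / 2 : ℝ) • (‖z i‖ ^ 2 + ‖z' i‖ ^ 2)) := by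
    intro i
    rw [abs_mul, smul_eq_mul, smul_eq_mul]
    have h2 := mul_le_mul (norm_dotLin_le a (z i)) (norm_dotLin_le u (z' i)) (abs_nonneg _)
      (mul_nonneg (norm_nonneg _) (norm_nonneg _))
    refine h2.trans ?_
    have h3 : ‖z i‖ * ‖z' i‖ ≤ 1 / 2 * (‖z i‖ ^ 2 + ‖z' i‖ ^ 2) := by
      nlinarith [sq_nonneg (‖z i‖ - ‖z' i‖)]
    have h4 := mul_le_mul_of_nonneg_left h3 (mul_nonneg (enorm2_nonneg a) (enorm2_nonneg u))
    unfold enorm2 at *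
    linarith
  have h5 : |avg n (fun i => dotLin a (z i) * dotLin u (z' i))|
      ≤ avg n (fun i => |dotLin a (z i) * dotLin u (z' i)|) := by
    simp only [avg, smul_eq_mul]
    rw [abs_mul, abs_of_nonneg (by positivity : (0 : ℝ) ≤ (n : ℝ)⁻¹)]
    exact mul_le_mul_of_nonneg_left (Finset.abs_sum_le_sum_abs _ _) (by positivity)
  refine h5.trans ((avg_mono h1).trans ?_)
  rw [avg_smul, avg_smul, avg_add, smul_eq_mul, smul_eq_mul]
  have h6 : 1 / 2 * (avg n (fun i => ‖z i‖ ^ 2) + avg n (fun i => ‖z' i‖ ^ 2)) ≤ C := by linarith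
  have h7 := mul_le_mul_of_nonneg_left h6 (mul_nonneg (enorm2_nonneg a) (enorm2_nonneg u))
  linarith

namespace RegularityConditions

variable (hB : RegularityConditions x P ω₀ α β γ e g h m η η₁ η₂)

section

include hB

lemma tendsto_avg_effects {f : ℕ → EffIdx} (hf : f.Injective) {t : Fin 4}
    (ht : ∀ c, effType (f c) = t) {n : ℕ → ℕ} (hn : Tendsto n atTop atTop) :
    Tendsto (fun q : ℕ × S => avg (n q.1) (fun i => allEffects α β γ e (f i) q.2))
      (probFilter P) (𝓝 0) := by
  have h1 := hB.tendsto_weighted_avg hf ht (b := fun _ => 1) (w := fun _ _ => 1) (n := n) (by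
    have h2 := ((tendsto_avg_one hn).const_mul (1 ^ 2)).mul (tendsto_inv_natCast hn)
    simpa using h2)
  simpa using h1

lemma tendsto_avg_α : Tendsto (fun q : ℕ × S => avg (g q.1) (fun i => α i q.2)) (probFilter P)
    (𝓝 0) := hB.tendsto_avg_effects (f := fun i => .inl i) (fun _ _ h => by simpa using h)
      (t := 0) (fun _ => rfl) hB.g_top

lemma tendsto_avg_β : Tendsto (fun q : ℕ × S => avg (h q.1) (fun j => β j q.2)) (probFilter P)
    (𝓝 0) := hB.tendsto_avg_effects (f := fun i => .inr (.inl i)) (fun _ _ h => by simpa using h)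
      (t := 1) (fun _ => rfl) hB.h_top

lemma tendsto_rowAvg_γ (i : ℕ) : Tendsto (fun q : ℕ × S => avg (h q.1) (fun j => γ i j q.2))
    (probFilter P) (𝓝 0) := hB.tendsto_avg_effects (f := fun j => .inr (.inr (.inl (i, j))))
      (fun _ _ h => by simpa using h) (t := 2) (fun _ => rfl) hB.h_top

lemma tendsto_colAvg_γ (j : ℕ) : Tendsto (fun q : ℕ × S => avg (g q.1) (fun i => γ i j q.2))
    (probFilter P) (𝓝 0) := hB.tendsto_avg_effects (f := fun i => .inr (.inr (.inl (i, j))))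
      (fun _ _ h => by simpa using h) (t := 2) (fun _ => rfl) hB.g_top

lemma tendsto_cellAvg_e (i j : ℕ) : Tendsto (fun q : ℕ × S => avg (m q.1) (fun k => e i j k q.2))
    (probFilter P) (𝓝 0) :=
  hB.tendsto_avg_effects (f := fun k => .inr (.inr (.inr (i, j, k))))
      (fun _ _ h => by simpa using h) (t := 3) (fun _ => rfl) hB.m_top

variable {w : ℕ → ℕ → ℝ} {C : ℝ}

lemma tendsto_scaled_row_γ (hr : IsScale r g h m κ₁ κ₂ κ₃)
    (hw : Tendsto (fun N => avg (g N) (fun i => w N i ^ 2)) atTop (𝓝 C)) :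
    Tendsto (fun q : ℕ × S => √(r q.1) * avg (g q.1) (fun i => w q.1 i *
      avg (h q.1) (fun j => γ i j q.2))) (probFilter P) (𝓝 0) :=
  hB.tendsto_scaled_avg_avg (f := fun i j => .inr (.inr (.inl (i, j))))
    (by rintro ⟨a, b⟩ ⟨a', b'⟩ h; simpa using h) (t := 2) (fun _ _ => rfl) hr.div_g hB.h_top hw

lemma tendsto_scaled_col_γ (hr : IsScale r g h m κ₁ κ₂ κ₃)
    (hw : Tendsto (fun N => avg (h N) (fun i => w N i ^ 2)) atTop (𝓝 C)) :
    Tendsto (fun q : ℕ × S => √(r q.1) * avg (h q.1) (fun j => w q.1 j *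
      avg (g q.1) (fun i => γ i j q.2))) (probFilter P) (𝓝 0) :=
  hB.tendsto_scaled_avg_avg (f := fun j i => .inr (.inr (.inl (i, j))))
    (by rintro ⟨a, b⟩ ⟨a', b'⟩ h; simpa [and_comm] using h) (t := 2) (fun _ _ => rfl) hr.div_h
    hB.g_top hw

lemma tendsto_scaled_row_e (hr : IsScale r g h m κ₁ κ₂ κ₃)
    (hw : Tendsto (fun N => avg (g N) (fun i => w N i ^ 2)) atTop (𝓝 C)) :
    Tendsto (fun q : ℕ × S => √(r q.1) * avg (g q.1) (fun i => w q.1 i *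
      avg (h q.1) (fun j => avg (m q.1) fun k => e i j k q.2))) (probFilter P) (𝓝 0) :=
  hB.tendsto_scaled_avg_avg_avg (f := fun i j k => .inr (.inr (.inr (i, j, k))))
    (fun _ _ h => by simpa [Prod.ext_iff] using h) (t := 3) (fun _ _ _ => rfl) hr.div_g hB.h_top
    hB.m_top hw

lemma tendsto_scaled_col_e (hr : IsScale r g h m κ₁ κ₂ κ₃)
    (hw : Tendsto (fun N => avg (h N) (fun i => w N i ^ 2)) atTop (𝓝 C)) :
    Tendsto (fun q : ℕ × S => √(r q.1) * avg (h q.1) (fun j => w q.1 j *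
      avg (g q.1) (fun i => avg (m q.1) fun k => e i j k q.2))) (probFilter P) (𝓝 0) :=
  hB.tendsto_scaled_avg_avg_avg (f := fun j i k => .inr (.inr (.inr (i, j, k))))
    (fun c c' h => by
      simp only [Sum.inr.injEq, Prod.mk.injEq] at h
      ext <;> simp [h]) (t := 3) (fun _ _ _ => rfl) hr.div_h hB.g_top hB.m_top hw

lemma tendsto_scaled_grand_γ (hr : IsScale r g h m κ₁ κ₂ κ₃) :
    Tendsto (fun q : ℕ × S => √(r q.1) * avg (g q.1) (fun i =>
      avg (h q.1) (fun j => γ i j q.2))) (probFilter P) (𝓝 0) := by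
  simpa using hB.tendsto_scaled_row_γ hr (tendsto_avg_one hB.g_top)

lemma tendsto_scaled_grand_e (hr : IsScale r g h m κ₁ κ₂ κ₃) :
    Tendsto (fun q : ℕ × S => √(r q.1) * avg (g q.1) (fun i =>
      avg (h q.1) (fun j => avg (m q.1) fun k => e i j k q.2))) (probFilter P) (𝓝 0) := by
  simpa using hB.tendsto_scaled_row_e hr (tendsto_avg_one hB.g_top)

lemma tendsto_scaled_rowAvg_e (hr : IsScale r g h m κ₁ κ₂ κ₃) (i : ℕ) :
    Tendsto (fun q : ℕ × S => √(r q.1) *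
      avg (h q.1) (fun j => avg (m q.1) fun k => e i j k q.2)) (probFilter P) (𝓝 0) := by
  have h1 := hB.tendsto_scaled_avg_avg (f := fun j k => .inr (.inr (.inr (i, j, k))))
    (by rintro ⟨a, b⟩ ⟨a', b'⟩ h; simpa using h) (t := 3) (fun _ _ => rfl) hr.div_h
    hB.m_top (tendsto_avg_one hB.h_top)
  simpa [allEffects] using h1

lemma tendsto_scaled_colAvg_e (hr : IsScale r g h m κ₁ κ₂ κ₃) (j : ℕ) :
    Tendsto (fun q : ℕ × S => √(r q.1) *
      avg (g q.1) (fun i => avg (m q.1) fun k => e i j k q.2)) (probFilter P) (𝓝 0) := by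
  have h1 := hB.tendsto_scaled_avg_avg (f := fun i k => .inr (.inr (.inr (i, j, k))))
    (by rintro ⟨a, b⟩ ⟨a', b'⟩ h; simpa using h) (t := 3) (fun _ _ => rfl) hr.div_g
    hB.m_top (tendsto_avg_one hB.g_top)
  simpa [allEffects] using h1

end

end RegularityConditions

end Negligible

/-! ### The contribution of the interaction and within-cell covariates -/

lemma rowCtr_cellAvg_sub (G H M : ℕ) (u z : ℕ → ℕ → ℕ → ℝ) (i : ℕ) :
    rowCtr G H (cellAvg M (u - z)) i
      = rowCtr G H (cellAvg M u) i - rowCtr G H (cellAvg M z) i := by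
  have h1 : ∀ i j, cellAvg M (u - z) i j = cellAvg M u i j - cellAvg M z i j :=
    fun i j => avg_sub M (u i j) (z i j)
  simp only [rowCtr, rowAvg, grandAvg]
  simp only [show cellAvg M (u - z) = fun i j => cellAvg M u i j - cellAvg M z i j from
    funext fun i => funext fun j => h1 i j, avg_sub]
  ring

lemma colCtr_cellAvg_sub (G H M : ℕ) (u z : ℕ → ℕ → ℕ → ℝ) (j : ℕ) :
    colCtr G H (cellAvg M (u - z)) j
      = colCtr G H (cellAvg M u) j - colCtr G H (cellAvg M z) j := by
  have h1 : ∀ i j, cellAvg M (u - z) i j = cellAvg M u i j - cellAvg M z i j :=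
    fun i j => avg_sub M (u i j) (z i j)
  simp only [colCtr, colAvg, grandAvg]
  simp only [show cellAvg M (u - z) = fun i j => cellAvg M u i j - cellAvg M z i j from
    funext fun i => funext fun j => h1 i j, avg_sub]
  ring

lemma intCtr_cellAvg_sub (G H M : ℕ) (u z : ℕ → ℕ → ℕ → ℝ) (i j : ℕ) :
    intCtr G H (cellAvg M (u - z)) i j
      = intCtr G H (cellAvg M u) i j - intCtr G H (cellAvg M z) i j := by
  have h1 : ∀ i j, cellAvg M (u - z) i j = cellAvg M u i j - cellAvg M z i j :=
    fun i j => avg_sub M (u i j) (z i j)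
  simp only [intCtr, rowAvg, colAvg, grandAvg]
  simp only [show cellAvg M (u - z) = fun i j => cellAvg M u i j - cellAvg M z i j from
    funext fun i => funext fun j => h1 i j, avg_sub]
  ring

section Rest

variable {S : Type*} [MeasurableSpace S] {P : Measure S}
  {pa pb pab pw : ℕ} {x : Covariates pa pb pab pw} {ω₀ : Param pa pb pab pw}
  {α β : ℕ → S → ℝ} {γ : ℕ → ℕ → S → ℝ} {e : ℕ → ℕ → ℕ → S → ℝ}
  {g h m : ℕ → ℕ} {η η₁ η₂ : ℝ≥0∞} {r : ℕ → ℕ} {κ₁ κ₂ κ₃ : ℝ}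
  {θ : ℕ × S → VarComp} {v : ℕ × S → FixedIdx pa pb pab pw → ℝ}

lemma tendsto_scaled_dotLin {B : ℕ × S → ℝ} (hB : IsBoundedInProb P B) {p : ℕ}
    {u : ℕ × S → Fin p → ℝ} {z : ℕ → EuclideanSpace ℝ (Fin p)} {a : ℕ → ℝ}
    (hu : ∀ᶠ q in probFilter P, enorm2 (u q) ≤ a q.1 * B q)
    (ha : Tendsto (fun N => √(r N) * ‖z N‖ * a N) atTop (𝓝 0)) :
    Tendsto (fun q => √(r q.1) * dotLin (u q) (z q.1)) (probFilter P) (𝓝 0) := by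
  refine hB.tendsto_of_le ha (hu.mono fun q hq => ?_)
  rw [abs_mul, abs_of_nonneg (Real.sqrt_nonneg _), mul_assoc, mul_assoc]
  refine mul_le_mul_of_nonneg_left ?_ (Real.sqrt_nonneg _)
  exact (norm_dotLin_le _ _).trans (mul_le_mul_of_nonneg_left hq (norm_nonneg _))

variable [IsProbabilityMeasure P]

namespace RegularityConditions

variable (hB : RegularityConditions x P ω₀ α β γ e g h m η η₁ η₂)

include hB

lemma tendsto_scaled_row_rest (hv : IsGLSError P x ω₀ α β γ e g h m θ v)
    (hr : IsScale r g h m κ₁ κ₂ κ₃) (i : ℕ) :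
    Tendsto (fun q => √(r q.1) * (dotLin (fixAB (v q)) (rowCtr (g q.1) (h q.1) x.ab i)
      + dotLin (fixW (v q)) (rowCtr (g q.1) (h q.1) (cellAvg (m q.1) x.w) i)))
      (probFilter P) (𝓝 0) := by
  obtain ⟨B, hBP, hb⟩ := hB.exists_rateBounds hv
  have sg := tendsto_sqrt_natCast hB.g_top
  have rh := tendsto_sqrt_mul_inv_sqrt hr.div_h
  have im := tendsto_inv_sqrt hB.m_top
  have h1 := ((hB.rowBounded_ab.rowCtr hB.g_top hB.h_top i).tendsto
    (fun _ => norm_nonneg _) sg).mul rh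
  have h2 := ((((hB.rowBounded_w).rowCtr hB.g_top hB.h_top i).tendsto
    (fun _ => norm_nonneg _) sg).mul rh).mul im
  simp only [zero_mul] at h1 h2
  have t1 := tendsto_scaled_dotLin (r := r) (u := fun q => fixAB (v q))
    (a := fun N => (√(g N))⁻¹ * (√(h N))⁻¹) hBP (hb.mono fun q hq => hq.fixAB)
    (z := fun N => rowCtr (g N) (h N) x.ab i) (h1.congr fun N => by simp only [div_eq_mul_inv]; ring)
  have t2 := tendsto_scaled_dotLin (r := r) (u := fun q => fixW (v q))
    (a := fun N => (√(g N))⁻¹ * (√(h N))⁻¹ * (√(m N))⁻¹) hBP (hb.mono fun q hq => hq.fixW)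
    (z := fun N => rowCtr (g N) (h N) (cellAvg (m N) x.w) i)
    (h2.congr fun N => by simp only [div_eq_mul_inv]; ring)
  have t3 := t1.add t2
  rw [add_zero] at t3
  exact t3.congr fun q => (mul_add _ _ _).symm

lemma tendsto_scaled_col_rest (hv : IsGLSError P x ω₀ α β γ e g h m θ v)
    (hr : IsScale r g h m κ₁ κ₂ κ₃) (j : ℕ) :
    Tendsto (fun q => √(r q.1) * (dotLin (fixAB (v q)) (colCtr (g q.1) (h q.1) x.ab j)
      + dotLin (fixW (v q)) (colCtr (g q.1) (h q.1) (cellAvg (m q.1) x.w) j)))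
      (probFilter P) (𝓝 0) := by
  obtain ⟨B, hBP, hb⟩ := hB.exists_rateBounds hv
  have sh := tendsto_sqrt_natCast hB.h_top
  have rg := tendsto_sqrt_mul_inv_sqrt hr.div_g
  have im := tendsto_inv_sqrt hB.m_top
  have h1 := ((hB.rowBounded_transp_ab.rowCtr hB.h_top hB.g_top j).tendsto
    (fun _ => norm_nonneg _) sh).mul rg
  have h2 := ((((hB.rowBounded_transp_w).rowCtr hB.h_top hB.g_top j).tendsto
    (fun _ => norm_nonneg _) sh).mul rg).mul im
  simp only [zero_mul] at h1 h2
  have t1 := tendsto_scaled_dotLin (r := r) (u := fun q => fixAB (v q))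
    (a := fun N => (√(g N))⁻¹ * (√(h N))⁻¹) hBP (hb.mono fun q hq => hq.fixAB)
    (z := fun N => colCtr (g N) (h N) x.ab j) (h1.congr fun N => by
      rw [colCtr_eq_rowCtr, show (fun j i => x.ab i j) = transp (fun _ => x.ab) N from rfl]
      simp only [div_eq_mul_inv]
      ring)
  have t2 := tendsto_scaled_dotLin (r := r) (u := fun q => fixW (v q))
    (a := fun N => (√(g N))⁻¹ * (√(h N))⁻¹ * (√(m N))⁻¹) hBP (hb.mono fun q hq => hq.fixW)
    (z := fun N => colCtr (g N) (h N) (cellAvg (m N) x.w) j) (h2.congr fun N => by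
      rw [colCtr_eq_rowCtr, show (fun j i => cellAvg (m N) x.w i j)
        = transp (fun N => cellAvg (m N) x.w) N from rfl]
      simp only [div_eq_mul_inv]
      ring)
  have t3 := t1.add t2
  rw [add_zero] at t3
  exact t3.congr fun q => (mul_add _ _ _).symm

lemma tendsto_scaled_int_rest (hv : IsGLSError P x ω₀ α β γ e g h m θ v)
    (hr : IsScale r g h m κ₁ κ₂ κ₃) (i j : ℕ) :
    Tendsto (fun q => √(r q.1) * (dotLin (fixAB (v q)) (intCtr (g q.1) (h q.1) x.ab i j)
      + dotLin (fixW (v q)) (intCtr (g q.1) (h q.1) (cellAvg (m q.1) x.w) i j)))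
      (probFilter P) (𝓝 0) := by
  obtain ⟨B, hBP, hb⟩ := hB.exists_rateBounds hv
  have sg := tendsto_sqrt_natCast hB.g_top
  have sh := tendsto_sqrt_natCast hB.h_top
  have rgh := (tendsto_sqrt_mul_inv_sqrt hr.div_g).add (tendsto_sqrt_mul_inv_sqrt hr.div_h)
  have im := tendsto_inv_sqrt hB.m_top
  have h1 := ((hB.intBounded_ab.intCtr hB.rowBounded_ab hB.rowBounded_transp_ab hB.g_top hB.h_top
    i j).tendsto (fun _ => norm_nonneg _) (sg.atTop_add_atTop sh)).mul rgh
  have h2 := (((hB.intBounded_w.intCtr hB.rowBounded_w hB.rowBounded_transp_w hB.g_top hB.h_top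
    i j).tendsto (fun _ => norm_nonneg _) (sg.atTop_add_atTop sh)).mul rgh).mul im
  simp only [zero_mul] at h1 h2
  have t1 := tendsto_scaled_dotLin (r := r) (u := fun q => fixAB (v q))
    (a := fun N => (√(g N))⁻¹ * (√(h N))⁻¹) hBP (hb.mono fun q hq => hq.fixAB)
    (z := fun N => intCtr (g N) (h N) x.ab i j) (h1.congr' (by
      filter_upwards [sg.eventually_gt_atTop 0, sh.eventually_gt_atTop 0] with N h3 h4
      field_simp
      ring))
  have t2 := tendsto_scaled_dotLin (r := r) (u := fun q => fixW (v q))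
    (a := fun N => (√(g N))⁻¹ * (√(h N))⁻¹ * (√(m N))⁻¹) hBP (hb.mono fun q hq => hq.fixW)
    (z := fun N => intCtr (g N) (h N) (cellAvg (m N) x.w) i j) (h2.congr' (by
      filter_upwards [sg.eventually_gt_atTop 0, sh.eventually_gt_atTop 0,
        (tendsto_sqrt_natCast hB.m_top).eventually_gt_atTop 0] with N h3 h4 h5
      field_simp
      ring))
  have t3 := t1.add t2
  rw [add_zero] at t3
  exact t3.congr fun q => (mul_add _ _ _).symm

lemma tendsto_scaled_avg_row_rest (hv : IsGLSError P x ω₀ α β γ e g h m θ v)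
    (hr : IsScale r g h m κ₁ κ₂ κ₃) (a : Fin pa → ℝ) :
    Tendsto (fun q => √(r q.1) * avg (g q.1) (fun i => dotLin a (ctr (g q.1) x.a i) *
      (dotLin (fixAB (v q)) (rowCtr (g q.1) (h q.1) x.ab i)
      + dotLin (fixW (v q)) (rowCtr (g q.1) (h q.1) (cellAvg (m q.1) x.w) i))))
      (probFilter P) (𝓝 0) := by
  obtain ⟨B, hBP, hb⟩ := hB.exists_rateBounds hv
  obtain ⟨c, C, hc, hM⟩ := hB.eventually_momentBounds
  have rg := tendsto_sqrt_mul_inv_sqrt hr.div_g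
  have ih := tendsto_inv_sqrt hB.h_top
  have im := tendsto_inv_sqrt hB.m_top
  have h1 := ((rg.mul ih).add ((rg.mul ih).mul im)).const_mul (enorm2 a * C)
  simp only [mul_zero, add_zero] at h1
  refine hBP.tendsto_of_le h1 ?_
  filter_upwards [hb, eventually_fst_probFilter hM] with q hq ⟨hM, _⟩
  have hC : 0 ≤ C := le_trans (by
    rw [avg, smul_eq_mul]
    positivity) hM.row_a
  have k1 := abs_avg_mul_dotLin_le hM.row_a hM.row_ab a (fixAB (v q))
  have k2 := abs_avg_mul_dotLin_le hM.row_a hM.row_w a (fixW (v q))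
  have e0 := enorm2_nonneg a
  have k3 := k1.trans (mul_le_mul_of_nonneg_left hq.fixAB (mul_nonneg e0 hC))
  have k4 := k2.trans (mul_le_mul_of_nonneg_left hq.fixW (mul_nonneg e0 hC))
  simp_rw [mul_add]
  rw [avg_add, abs_mul, abs_of_nonneg (Real.sqrt_nonneg _)]
  refine (mul_le_mul_of_nonneg_left ((abs_add_le _ _).trans (add_le_add k3 k4))
    (Real.sqrt_nonneg _)).trans (le_of_eq ?_)
  ring

lemma tendsto_scaled_avg_col_rest (hv : IsGLSError P x ω₀ α β γ e g h m θ v)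
    (hr : IsScale r g h m κ₁ κ₂ κ₃) (a : Fin pb → ℝ) :
    Tendsto (fun q => √(r q.1) * avg (h q.1) (fun j => dotLin a (ctr (h q.1) x.b j) *
      (dotLin (fixAB (v q)) (colCtr (g q.1) (h q.1) x.ab j)
      + dotLin (fixW (v q)) (colCtr (g q.1) (h q.1) (cellAvg (m q.1) x.w) j))))
      (probFilter P) (𝓝 0) := by
  obtain ⟨B, hBP, hb⟩ := hB.exists_rateBounds hv
  obtain ⟨c, C, hc, hM⟩ := hB.eventually_momentBounds
  have rg := tendsto_sqrt_mul_inv_sqrt hr.div_g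
  have ih := tendsto_inv_sqrt hB.h_top
  have im := tendsto_inv_sqrt hB.m_top
  have h1 := ((rg.mul ih).add ((rg.mul ih).mul im)).const_mul (enorm2 a * C)
  simp only [mul_zero, add_zero] at h1
  refine hBP.tendsto_of_le h1 ?_
  filter_upwards [hb, eventually_fst_probFilter hM] with q hq ⟨hM, _⟩
  have hC : 0 ≤ C := le_trans (by
    rw [avg, smul_eq_mul]
    positivity) hM.col_b
  have k1 := abs_avg_mul_dotLin_le hM.col_b hM.col_ab a (fixAB (v q))
  have k2 := abs_avg_mul_dotLin_le hM.col_b hM.col_w a (fixW (v q))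
  have e0 := enorm2_nonneg a
  have k3 := k1.trans (mul_le_mul_of_nonneg_left hq.fixAB (mul_nonneg e0 hC))
  have k4 := k2.trans (mul_le_mul_of_nonneg_left hq.fixW (mul_nonneg e0 hC))
  simp_rw [mul_add]
  rw [avg_add, abs_mul, abs_of_nonneg (Real.sqrt_nonneg _)]
  refine (mul_le_mul_of_nonneg_left ((abs_add_le _ _).trans (add_le_add k3 k4))
    (Real.sqrt_nonneg _)).trans (le_of_eq ?_)
  ring

/-! ### The equations of the row and column coefficients -/

omit [IsProbabilityMeasure P] in
lemma eventually_sizes_ne_zero : ∀ᶠ N in atTop, g N ≠ 0 ∧ h N ≠ 0 ∧ m N ≠ 0 := by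
  obtain ⟨c, C, -, hM⟩ := hB.eventually_momentBounds
  exact hM.mono fun N h => h.2

omit [IsProbabilityMeasure P] in
lemma eventually_normal (hv : IsGLSError P x ω₀ α β γ e g h m θ v) :
    ∀ᶠ q in probFilter P, (g q.1 ≠ 0 ∧ h q.1 ≠ 0 ∧ m q.1 ≠ 0) ∧ θ q ∈ box ω₀.2 ∧
      (∀ b, 0 < lam (g q.1) (h q.1) (m q.1) (θ q) b) ∧
      ∀ w, wForm (g q.1) (h q.1) (m q.1) (θ q) (regMean x w)
        (noise α β γ e q.2 - regMean x (v q)) = 0 := by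
  filter_upwards [eventually_fst_probFilter hB.eventually_sizes_ne_zero, hv.mem_box, hv.normal]
    with q h1 h2 h3
  exact ⟨h1, h2, fun b => lam_pos (box_pos hB.var_pos h2) b, h3⟩

lemma tendsto_row_equation (hv : IsGLSError P x ω₀ α β γ e g h m θ v)
    (hr : IsScale r g h m κ₁ κ₂ κ₃) {D : Matrix (Fin pa) (Fin pa) ℝ}
    (hD : Tendsto (fun n => avg n (fun i => outer (ctr n x.a i).ofLp)) atTop (𝓝 D))
    (a : Fin pa → ℝ) :
    Tendsto (fun q : ℕ × S => √(r q.1) * avg (g q.1) (fun i => dotLin a (ctr (g q.1) x.a i)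
      * (α i q.2 - dotLin (fixA (v q)) (ctr (g q.1) x.a i)))) (probFilter P) (𝓝 0) := by
  have hw := tendsto_avg_dotLin_sq hB.g_top hD a
  have t := ((hB.tendsto_scaled_avg_row_rest hv hr a).sub (hB.tendsto_scaled_row_γ hr hw)).sub
    (hB.tendsto_scaled_row_e hr hw)
  simp only [sub_zero] at t
  refine t.congr' ?_
  filter_upwards [hB.eventually_normal hv] with q ⟨⟨hg, hh, hm⟩, _, hl, hn⟩
  have h1 := sum_row_eq_zero_of_normal hg hh hm hl hn a
  rw [← mul_avg hg] at h1
  have h2 := (mul_eq_zero.1 h1).resolve_left (by exact_mod_cast hg)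
  have h3 : avg (g q.1) (fun i => dotLin a (ctr (g q.1) x.a i)) = 0 := by
    rw [avg_map, avg_ctr hg, map_zero]
  simp_rw [rowCtr_cellAvg_sub, rowCtr_noise hg hh hm, rowCtr_regMean x hg hh hm] at h2
  have h4 : ∀ c : ℝ, avg (g q.1) (fun i => dotLin a (ctr (g q.1) x.a i) * c) = 0 := fun c => by
    simp_rw [mul_comm _ c]
    have := avg_smul (g q.1) c (fun i => dotLin a (ctr (g q.1) x.a i))
    simp only [smul_eq_mul] at this
    rw [this, h3, mul_zero]
  simp only [mul_sub, mul_add, avg_sub, avg_add, h4] at h2 ⊢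
  linear_combination (√(r q.1 : ℝ)) * (-h2)

lemma tendsto_col_equation (hv : IsGLSError P x ω₀ α β γ e g h m θ v)
    (hr : IsScale r g h m κ₁ κ₂ κ₃) {D : Matrix (Fin pb) (Fin pb) ℝ}
    (hD : Tendsto (fun n => avg n (fun i => outer (ctr n x.b i).ofLp)) atTop (𝓝 D))
    (a : Fin pb → ℝ) :
    Tendsto (fun q : ℕ × S => √(r q.1) * avg (h q.1) (fun j => dotLin a (ctr (h q.1) x.b j)
      * (β j q.2 - dotLin (fixB (v q)) (ctr (h q.1) x.b j)))) (probFilter P) (𝓝 0) := by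
  have hw := tendsto_avg_dotLin_sq hB.h_top hD a
  have t := ((hB.tendsto_scaled_avg_col_rest hv hr a).sub (hB.tendsto_scaled_col_γ hr hw)).sub
    (hB.tendsto_scaled_col_e hr hw)
  simp only [sub_zero] at t
  refine t.congr' ?_
  filter_upwards [hB.eventually_normal hv] with q ⟨⟨hg, hh, hm⟩, _, hl, hn⟩
  have h1 := sum_col_eq_zero_of_normal hg hh hm hl hn a
  rw [← mul_avg hh] at h1
  have h2 := (mul_eq_zero.1 h1).resolve_left (by exact_mod_cast hh)
  have h3 : avg (h q.1) (fun i => dotLin a (ctr (h q.1) x.b i)) = 0 := by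
    rw [avg_map, avg_ctr hh, map_zero]
  simp_rw [colCtr_cellAvg_sub, colCtr_noise hg hh hm, colCtr_regMean x hg hh hm] at h2
  have h4 : ∀ c : ℝ, avg (h q.1) (fun i => dotLin a (ctr (h q.1) x.b i) * c) = 0 := fun c => by
    simp_rw [mul_comm _ c]
    have := avg_smul (h q.1) c (fun i => dotLin a (ctr (h q.1) x.b i))
    simp only [smul_eq_mul] at this
    rw [this, h3, mul_zero]
  simp only [mul_sub, mul_add, avg_sub, avg_add, h4] at h2 ⊢
  linear_combination (√(r q.1 : ℝ)) * (-h2)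

end RegularityConditions

end Rest

/-! ### Shrinkage factors -/

section Shrinkage

/-- The factor `λ₁ / λ₂`. -/
noncomputable def shrinkRow (h m : ℕ) (θ : VarComp) : ℝ := lam₁ m θ / lam₂ h m θ
/-- The factor `λ₁ / λ₃`. -/
noncomputable def shrinkCol (g m : ℕ) (θ : VarComp) : ℝ := lam₁ m θ / lam₃ g m θ
/-- The factor `σ_e² / λ₁`. -/
noncomputable def shrinkInt (m : ℕ) (θ : VarComp) : ℝ := θ 3 / lam₁ m θ

variable {pa pb pab pw : ℕ} {x : Covariates pa pb pab pw} {g h m : ℕ} {θ θ₀ : VarComp}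

lemma shrink_ratio_le {n m' a b c a₀ b₀ c₀ : ℝ} (hn : 0 < n) (hm : 1 ≤ m') (ha₀ : 0 < a₀)
    (hb₀ : 0 < b₀) (hc₀ : 0 < c₀) (ha : a₀ / 2 ≤ a) (hb : 0 < b) (hb' : b ≤ 3 / 2 * b₀)
    (hc : 0 < c) (hc' : c ≤ 3 / 2 * c₀) :
    |(b + m' * c) / (b + m' * c + n * m' * a)| ≤ 3 * (b₀ + c₀) / a₀ * n⁻¹ ∧
      |(b + m' * c) / (b + m' * c + n * m' * a)| ≤ 1 := by
  have ha' : 0 < a := (half_pos ha₀).trans_le ha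
  have hm' : 0 < m' := one_pos.trans_le hm
  have hnum : 0 < b + m' * c := by positivity
  have hden : 0 < n * m' * a := by positivity
  rw [abs_of_pos (by positivity)]
  constructor
  · rw [div_le_iff₀ (by positivity)]
    have h1 : b + m' * c ≤ m' * (3 / 2 * (b₀ + c₀)) := by nlinarith
    have h2 : m' * (3 / 2 * (b₀ + c₀)) = 3 * (b₀ + c₀) / a₀ * n⁻¹ * (n * m' * (a₀ / 2)) := by
      field_simp
    have h3 : (0 : ℝ) ≤ 3 * (b₀ + c₀) / a₀ * n⁻¹ := by positivity
    have h4 : n * m' * (a₀ / 2) ≤ b + m' * c + n * m' * a := by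
      have : n * m' * (a₀ / 2) ≤ n * m' * a := mul_le_mul_of_nonneg_left ha (by positivity)
      linarith
    calc b + m' * c ≤ _ := h1
      _ = _ := h2
      _ ≤ _ := mul_le_mul_of_nonneg_left h4 h3
  · rw [div_le_one (by positivity)]
    linarith

lemma shrinkRow_le (hθ : ∀ k, 0 < θ₀ k) (hb : θ ∈ box θ₀) (hh : h ≠ 0) (hm : m ≠ 0) :
    |shrinkRow h m θ| ≤ 3 * (θ₀ 3 + θ₀ 2) / θ₀ 0 * (h : ℝ)⁻¹ ∧ |shrinkRow h m θ| ≤ 1 :=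
  shrink_ratio_le (by positivity) (by exact_mod_cast Nat.one_le_iff_ne_zero.2 hm) (hθ 0) (hθ 3)
    (hθ 2) (hb 0).1 (box_pos hθ hb 3) (hb 3).2 (box_pos hθ hb 2) (hb 2).2

lemma shrinkCol_le (hθ : ∀ k, 0 < θ₀ k) (hb : θ ∈ box θ₀) (hg : g ≠ 0) (hm : m ≠ 0) :
    |shrinkCol g m θ| ≤ 3 * (θ₀ 3 + θ₀ 2) / θ₀ 1 * (g : ℝ)⁻¹ ∧ |shrinkCol g m θ| ≤ 1 :=
  shrink_ratio_le (by positivity) (by exact_mod_cast Nat.one_le_iff_ne_zero.2 hm) (hθ 1) (hθ 3)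
    (hθ 2) (hb 1).1 (box_pos hθ hb 3) (hb 3).2 (box_pos hθ hb 2) (hb 2).2

lemma shrinkInt_le (hθ : ∀ k, 0 < θ₀ k) (hb : θ ∈ box θ₀) (hm : m ≠ 0) :
    |shrinkInt m θ| ≤ 3 * θ₀ 3 / θ₀ 2 * (m : ℝ)⁻¹ := by
  have h3 := box_pos hθ hb 3
  have h2 := box_pos hθ hb 2
  have h2' := hθ 2
  have h3' := hθ 3
  have hm' : (0 : ℝ) < m := by positivity
  rw [shrinkInt, lam₁, abs_of_pos (by positivity), div_le_iff₀ (by positivity)]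
  have h4 : (0 : ℝ) ≤ 3 * θ₀ 3 / θ₀ 2 * (m : ℝ)⁻¹ := by positivity
  calc θ 3 ≤ 3 / 2 * θ₀ 3 := (hb 3).2
    _ = 3 * θ₀ 3 / θ₀ 2 * (m : ℝ)⁻¹ * (m * (θ₀ 2 / 2)) := by
      field_simp
    _ ≤ _ := by
      refine mul_le_mul_of_nonneg_left ?_ h4
      have := mul_le_mul_of_nonneg_left (hb 2).1 hm'.le
      linarith

variable {ω : Param pa pb pab pw} {y : ℕ → ℕ → ℕ → ℝ}

lemma blupα_eq (hl : ∀ b, 0 < lam g h m ω.2 b)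
    (h0 : grandAvg g h (cellAvg m (y - regMean x ω.1)) = 0) (i : ℕ) :
    blupα x g h m ω y i
      = (1 - shrinkRow h m ω.2) * rowCtr g h (cellAvg m (y - regMean x ω.1)) i := by
  have h2 : 0 < lam₂ h m ω.2 := hl 1
  rw [blupα, show resid x m ω.1 y = cellAvg m (y - regMean x ω.1) from rfl, h0, rowCtr, h0,
    shrinkRow, one_sub_div h2.ne', mul_zero, sub_zero, sub_zero]
  congr 2
  simp only [lam₁, lam₂]
  ring

lemma blupβ_eq (hl : ∀ b, 0 < lam g h m ω.2 b)
    (h0 : grandAvg g h (cellAvg m (y - regMean x ω.1)) = 0) (j : ℕ) :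
    blupβ x g h m ω y j
      = (1 - shrinkCol g m ω.2) * colCtr g h (cellAvg m (y - regMean x ω.1)) j := by
  have h2 : 0 < lam₃ g m ω.2 := hl 2
  rw [blupβ, show resid x m ω.1 y = cellAvg m (y - regMean x ω.1) from rfl, h0, colCtr, h0,
    shrinkCol, one_sub_div h2.ne', mul_zero, sub_zero, sub_zero]
  congr 2
  simp only [lam₁, lam₃]
  ring

lemma blupγ_eq (hl : ∀ b, 0 < lam g h m ω.2 b)
    (h0 : grandAvg g h (cellAvg m (y - regMean x ω.1)) = 0) (i j : ℕ) :
    blupγ x g h m ω y i j = (1 - shrinkInt m ω.2) *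
      (intCtr g h (cellAvg m (y - regMean x ω.1)) i j
        + shrinkRow h m ω.2 * rowCtr g h (cellAvg m (y - regMean x ω.1)) i
        + shrinkCol g m ω.2 * colCtr g h (cellAvg m (y - regMean x ω.1)) j) := by
  have h1 : 0 < lam₁ m ω.2 := hl 3
  have h2 : 0 < lam₂ h m ω.2 := hl 1
  have h3 : 0 < lam₃ g m ω.2 := hl 2
  have h4 : m * ω.2 2 = lam₁ m ω.2 - ω.2 3 := by
    rw [lam₁]
    ring
  rw [blupγ, show resid x m ω.1 y = cellAvg m (y - regMean x ω.1) from rfl, h0, colCtr, rowCtr,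
    intCtr, h0, shrinkRow, shrinkCol, shrinkInt, h4]
  field_simp
  ring

end Shrinkage

/-! ### Expansions of the prediction errors -/

section Expansions

variable {S : Type*} [MeasurableSpace S] {P : Measure S}
  {pa pb pab pw : ℕ} {x : Covariates pa pb pab pw} {ω₀ : Param pa pb pab pw}
  {α β : ℕ → S → ℝ} {γ : ℕ → ℕ → S → ℝ} {e : ℕ → ℕ → ℕ → S → ℝ}
  {g h m : ℕ → ℕ} {η η₁ η₂ : ℝ≥0∞} {r : ℕ → ℕ} {κ₁ κ₂ κ₃ : ℝ}
  {θ : ℕ × S → VarComp} {v : ℕ × S → FixedIdx pa pb pab pw → ℝ}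

lemma IsBoundedInProb.mul_convergent {B : ℕ × S → ℝ} (hB : IsBoundedInProb P B) {c : ℕ → ℝ} {l : ℝ}
    (hc : Tendsto c atTop (𝓝 l)) : IsBoundedInProb P (fun q => c q.1 * B q) := by
  intro a ha
  have h1 := ha.mul hc
  rw [zero_mul] at h1
  exact (hB _ h1).congr fun q => mul_assoc _ _ _

lemma tendsto_shrink_mul {n : ℕ → ℕ} {ρ X : ℕ × S → ℝ} {K : ℝ} (hX : IsBoundedInProb P X)
    (hn : Tendsto (fun N => √(r N : ℝ) * (n N : ℝ)⁻¹) atTop (𝓝 0))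
    (hρ : ∀ᶠ q in probFilter P, |ρ q| ≤ K * (n q.1 : ℝ)⁻¹) :
    Tendsto (fun q => √(r q.1) * (ρ q * X q)) (probFilter P) (𝓝 0) := by
  have hX' : IsBoundedInProb P (fun q => |X q|) :=
    hX.mono (Eventually.of_forall fun q => (abs_abs _).le)
  have h1 := hn.const_mul K
  rw [mul_zero] at h1
  refine hX'.tendsto_of_le h1 (hρ.mono fun q hq => ?_)
  rw [abs_mul, abs_mul, abs_of_nonneg (Real.sqrt_nonneg _)]
  calc √(r q.1 : ℝ) * (|ρ q| * |X q|) ≤ √(r q.1 : ℝ) * ((K * (n q.1 : ℝ)⁻¹) * |X q|) := by gcongr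
    _ = _ := by ring

variable [IsProbabilityMeasure P]

namespace RegularityConditions

variable (hB : RegularityConditions x P ω₀ α β γ e g h m η η₁ η₂)

include hB

lemma isBoundedInProb_effect (c : EffIdx) :
    IsBoundedInProb P (fun q => allEffects α β γ e c q.2) := by
  have h1 := IsBoundedInProb.of_integral (P := P) (X := fun _ s => |allEffects α β γ e c s|)
    (C := ∫ s, |allEffects α β γ e c s| ∂P) (fun _ _ => abs_nonneg _)
    (fun _ => ((hB.memLp_two c).integrable (by norm_num)).abs)
    (Eventually.of_forall fun _ => le_rfl)
  exact h1.mono (Eventually.of_forall fun q => (abs_abs _).ge)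

lemma tendsto_dotLin_fixA (hv : IsGLSError P x ω₀ α β γ e g h m θ v) (i : ℕ) :
    Tendsto (fun q => dotLin (fixA (v q)) (ctr (g q.1) x.a i)) (probFilter P) (𝓝 0) := by
  obtain ⟨B, hBP, hb⟩ := hB.exists_rateBounds hv
  obtain ⟨l, hl⟩ := hB.lim_a
  have h1 := ((hl.comp hB.g_top).const_sub (x.a i)).norm.mul (tendsto_inv_sqrt hB.g_top)
  rw [mul_zero] at h1
  refine hBP.tendsto_of_le h1 (hb.mono fun q hq => ?_)
  refine (norm_dotLin_le _ _).trans ((mul_le_mul_of_nonneg_left hq.fixA (norm_nonneg _)).trans ?_)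
  rw [← mul_assoc]
  rfl

lemma tendsto_dotLin_fixB (hv : IsGLSError P x ω₀ α β γ e g h m θ v) (j : ℕ) :
    Tendsto (fun q => dotLin (fixB (v q)) (ctr (h q.1) x.b j)) (probFilter P) (𝓝 0) := by
  obtain ⟨B, hBP, hb⟩ := hB.exists_rateBounds hv
  obtain ⟨l, hl⟩ := hB.lim_b
  have h1 := ((hl.comp hB.h_top).const_sub (x.b j)).norm.mul (tendsto_inv_sqrt hB.h_top)
  rw [mul_zero] at h1
  refine hBP.tendsto_of_le h1 (hb.mono fun q hq => ?_)
  refine (norm_dotLin_le _ _).trans ((mul_le_mul_of_nonneg_left hq.fixB (norm_nonneg _)).trans ?_)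
  rw [← mul_assoc]
  rfl

variable (hv : IsGLSError P x ω₀ α β γ e g h m θ v) (hr : IsScale r g h m κ₁ κ₂ κ₃)

include hv hr

lemma tendsto_rowResid (i : ℕ) : Tendsto (fun q : ℕ × S => √(r q.1) *
    (rowCtr (g q.1) (h q.1) (cellAvg (m q.1) (noise α β γ e q.2 - regMean x (v q))) i
      - α i q.2 + avg (g q.1) (fun i => α i q.2) - avg (h q.1) (fun j => γ i j q.2)
      + dotLin (fixA (v q)) (ctr (g q.1) x.a i))) (probFilter P) (𝓝 0) := by
  have t := (((hB.tendsto_scaled_rowAvg_e hr i).sub (hB.tendsto_scaled_grand_e hr)).sub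
    (hB.tendsto_scaled_grand_γ hr)).sub (hB.tendsto_scaled_row_rest hv hr i)
  simp only [sub_zero] at t
  refine t.congr' ?_
  filter_upwards [hB.eventually_normal hv] with q ⟨⟨hg, hh, hm⟩, _⟩
  rw [rowCtr_cellAvg_sub, rowCtr_noise hg hh hm, rowCtr_regMean x hg hh hm]
  ring

lemma tendsto_colResid (j : ℕ) : Tendsto (fun q : ℕ × S => √(r q.1) *
    (colCtr (g q.1) (h q.1) (cellAvg (m q.1) (noise α β γ e q.2 - regMean x (v q))) j
      - β j q.2 + avg (h q.1) (fun j => β j q.2) - avg (g q.1) (fun i => γ i j q.2)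
      + dotLin (fixB (v q)) (ctr (h q.1) x.b j))) (probFilter P) (𝓝 0) := by
  have t := (((hB.tendsto_scaled_colAvg_e hr j).sub (hB.tendsto_scaled_grand_e hr)).sub
    (hB.tendsto_scaled_grand_γ hr)).sub (hB.tendsto_scaled_col_rest hv hr j)
  simp only [sub_zero] at t
  refine t.congr' ?_
  filter_upwards [hB.eventually_normal hv] with q ⟨⟨hg, hh, hm⟩, _⟩
  rw [colCtr_cellAvg_sub, colCtr_noise hg hh hm, colCtr_regMean x hg hh hm]
  ring

lemma tendsto_intResid (i j : ℕ) : Tendsto (fun q : ℕ × S => √(r q.1) *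
    (intCtr (g q.1) (h q.1) (cellAvg (m q.1) (noise α β γ e q.2 - regMean x (v q))) i j
      - γ i j q.2 + avg (h q.1) (fun j => γ i j q.2) + avg (g q.1) (fun i => γ i j q.2)
      - avg (m q.1) (fun k => e i j k q.2))) (probFilter P) (𝓝 0) := by
  have t := ((((hB.tendsto_scaled_grand_γ hr).add (hB.tendsto_scaled_grand_e hr)).sub
    (hB.tendsto_scaled_rowAvg_e hr i)).sub (hB.tendsto_scaled_colAvg_e hr j)).sub
    (hB.tendsto_scaled_int_rest hv hr i j)
  simp only [sub_zero, add_zero] at t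
  refine t.congr' ?_
  filter_upwards [hB.eventually_normal hv] with q ⟨⟨hg, hh, hm⟩, _⟩
  rw [intCtr_cellAvg_sub, intCtr_noise hg hh hm, intCtr_regMean x hg hh hm]
  ring

lemma isBoundedInProb_rowResid (i : ℕ) : IsBoundedInProb P (fun q : ℕ × S =>
    rowCtr (g q.1) (h q.1) (cellAvg (m q.1) (noise α β γ e q.2 - regMean x (v q))) i) := by
  have t1 := tendsto_of_sqrt_mul hr.top (hB.tendsto_rowResid hv hr i)
  have t2 := ((t1.sub hB.tendsto_avg_α).add (hB.tendsto_rowAvg_γ i)).sub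
    (hB.tendsto_dotLin_fixA hv i)
  refine ((IsBoundedInProb.of_tendsto t2).add (hB.isBoundedInProb_effect (.inl i))).mono
    (Eventually.of_forall fun q => le_of_eq (congrArg _ ?_))
  change _ = _ + α i q.2
  ring

lemma isBoundedInProb_colResid (j : ℕ) : IsBoundedInProb P (fun q : ℕ × S =>
    colCtr (g q.1) (h q.1) (cellAvg (m q.1) (noise α β γ e q.2 - regMean x (v q))) j) := by
  have t1 := tendsto_of_sqrt_mul hr.top (hB.tendsto_colResid hv hr j)
  have t2 := ((t1.sub hB.tendsto_avg_β).add (hB.tendsto_colAvg_γ j)).sub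
    (hB.tendsto_dotLin_fixB hv j)
  refine ((IsBoundedInProb.of_tendsto t2).add (hB.isBoundedInProb_effect (.inr (.inl j)))).mono
    (Eventually.of_forall fun q => le_of_eq (congrArg _ ?_))
  change _ = _ + β j q.2
  ring

lemma isBoundedInProb_intResid (i j : ℕ) : IsBoundedInProb P (fun q : ℕ × S =>
    intCtr (g q.1) (h q.1) (cellAvg (m q.1) (noise α β γ e q.2 - regMean x (v q))) i j) := by
  have t1 := tendsto_of_sqrt_mul hr.top (hB.tendsto_intResid hv hr i j)
  have t2 := ((t1.sub (hB.tendsto_rowAvg_γ i)).sub (hB.tendsto_colAvg_γ j)).add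
    (hB.tendsto_cellAvg_e i j)
  refine ((IsBoundedInProb.of_tendsto t2).add
    (hB.isBoundedInProb_effect (.inr (.inr (.inl (i, j)))))).mono
    (Eventually.of_forall fun q => le_of_eq (congrArg _ ?_))
  change _ = _ + γ i j q.2
  ring

omit [IsProbabilityMeasure P] in
lemma tendsto_shrinkRow_mul {X : ℕ × S → ℝ} (hX : IsBoundedInProb P X) :
    Tendsto (fun q => √(r q.1) * (shrinkRow (h q.1) (m q.1) (θ q) * X q)) (probFilter P) (𝓝 0) :=
  tendsto_shrink_mul hX (tendsto_sqrt_mul_inv hB.h_top hr.div_h) <| by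
    filter_upwards [hB.eventually_normal hv] with q ⟨⟨hg, hh, hm⟩, hb, _⟩
    exact (shrinkRow_le hB.var_pos hb hh hm).1

omit [IsProbabilityMeasure P] in
lemma tendsto_shrinkCol_mul {X : ℕ × S → ℝ} (hX : IsBoundedInProb P X) :
    Tendsto (fun q => √(r q.1) * (shrinkCol (g q.1) (m q.1) (θ q) * X q)) (probFilter P) (𝓝 0) :=
  tendsto_shrink_mul hX (tendsto_sqrt_mul_inv hB.g_top hr.div_g) <| by
    filter_upwards [hB.eventually_normal hv] with q ⟨⟨hg, hh, hm⟩, hb, _⟩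
    exact (shrinkCol_le hB.var_pos hb hg hm).1

omit [IsProbabilityMeasure P] in
lemma tendsto_shrinkInt_mul {X : ℕ × S → ℝ} (hX : IsBoundedInProb P X) :
    Tendsto (fun q => √(r q.1) * (shrinkInt (m q.1) (θ q) * X q)) (probFilter P) (𝓝 0) :=
  tendsto_shrink_mul hX (tendsto_sqrt_mul_inv hB.m_top hr.div_m) <| by
    filter_upwards [hB.eventually_normal hv] with q ⟨⟨hg, hh, hm⟩, hb, _⟩
    exact shrinkInt_le hB.var_pos hb hm

lemma tendsto_row_coefficients {D : Matrix (Fin pa) (Fin pa) ℝ} (hdet : IsUnit D.det)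
    (hD : Tendsto (fun n => avg n (fun i => outer (ctr n x.a i).ofLp)) atTop (𝓝 D))
    {c : EuclideanSpace ℝ (Fin pa)} (hc : Tendsto (fun n => avg n x.a) atTop (𝓝 c)) (i : ℕ) :
    Tendsto (fun q : ℕ × S => √(r q.1) * (dotLin (fixA (v q)) (ctr (g q.1) x.a i)
      - avg (g q.1) (fun s => dotLin (D⁻¹ *ᵥ (x.a i - c).ofLp) (ctr (g q.1) x.a s) * α s q.2)))
      (probFilter P) (𝓝 0) := by
  obtain ⟨B, hBP, hb⟩ := hB.exists_rateBounds hv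
  refine tendsto_coefficients (R := fun N => √(r N)) (v := fun q => fixA (v q))
    (ε := fun q s => α s q.2) (y := fun N => ctr (g N) x.a i) hB.g_top hD hdet ?_
    (hB.tendsto_row_equation hv hr hD) ((hc.comp hB.g_top).const_sub (x.a i))
  refine (hBP.mul_convergent (tendsto_sqrt_mul_inv_sqrt hr.div_g)).mono (hb.mono fun q hq => ?_)
  rw [abs_of_nonneg (mul_nonneg (Real.sqrt_nonneg _) (enorm2_nonneg _))]
  refine le_trans ?_ (le_abs_self _)
  rw [mul_assoc]
  exact mul_le_mul_of_nonneg_left hq.fixA (Real.sqrt_nonneg _)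

lemma tendsto_col_coefficients {D : Matrix (Fin pb) (Fin pb) ℝ} (hdet : IsUnit D.det)
    (hD : Tendsto (fun n => avg n (fun i => outer (ctr n x.b i).ofLp)) atTop (𝓝 D))
    {c : EuclideanSpace ℝ (Fin pb)} (hc : Tendsto (fun n => avg n x.b) atTop (𝓝 c)) (j : ℕ) :
    Tendsto (fun q : ℕ × S => √(r q.1) * (dotLin (fixB (v q)) (ctr (h q.1) x.b j)
      - avg (h q.1) (fun s => dotLin (D⁻¹ *ᵥ (x.b j - c).ofLp) (ctr (h q.1) x.b s) * β s q.2)))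
      (probFilter P) (𝓝 0) := by
  obtain ⟨B, hBP, hb⟩ := hB.exists_rateBounds hv
  refine tendsto_coefficients (R := fun N => √(r N)) (v := fun q => fixB (v q))
    (ε := fun q s => β s q.2) (y := fun N => ctr (h N) x.b j) hB.h_top hD hdet ?_
    (hB.tendsto_col_equation hv hr hD) ((hc.comp hB.h_top).const_sub (x.b j))
  refine (hBP.mul_convergent (tendsto_sqrt_mul_inv_sqrt hr.div_h)).mono (hb.mono fun q hq => ?_)
  rw [abs_of_nonneg (mul_nonneg (Real.sqrt_nonneg _) (enorm2_nonneg _))]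
  refine le_trans ?_ (le_abs_self _)
  rw [mul_assoc]
  exact mul_le_mul_of_nonneg_left hq.fixB (Real.sqrt_nonneg _)

end RegularityConditions

/-! ### The leading terms of the prediction errors -/

/-- The leading term of the prediction error of a row effect; `a` is the standardised covariate. -/
noncomputable def leadα (z : ℕ → EuclideanSpace ℝ (Fin pa)) (a : Fin pa → ℝ) (α : ℕ → S → ℝ)
    (γ : ℕ → ℕ → S → ℝ) (G H i : ℕ) (s : S) : ℝ :=
  avg H (fun j => γ i j s) - avg G (fun i' => (1 + dotLin a (ctr G z i')) * α i' s)

/-- The leading term of the prediction error of an interaction. -/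
noncomputable def leadγ (γ : ℕ → ℕ → S → ℝ) (e : ℕ → ℕ → ℕ → S → ℝ) (G H M i j : ℕ) (s : S) : ℝ :=
  avg M (fun k => e i j k s) - avg H (fun j => γ i j s) - avg G (fun i => γ i j s)

namespace RegularityConditions

variable (hB : RegularityConditions x P ω₀ α β γ e g h m η η₁ η₂) {ω : ℕ × S → Param pa pb pab pw}
  (hv : IsGLSError P x ω₀ α β γ e g h m (fun q => (ω q).2) (fun q => (ω q).1 - ω₀.1))
  (hr : IsScale r g h m κ₁ κ₂ κ₃)

include hB hv hr

lemma tendsto_predError_α {D : Matrix (Fin pa) (Fin pa) ℝ} (hdet : IsUnit D.det)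
    (hD : Tendsto (fun n => avg n (fun i => outer (ctr n x.a i).ofLp)) atTop (𝓝 D))
    {c : EuclideanSpace ℝ (Fin pa)} (hc : Tendsto (fun n => avg n x.a) atTop (𝓝 c)) (i : ℕ) :
    Tendsto (fun q : ℕ × S => √(r q.1) *
      (blupα x (g q.1) (h q.1) (m q.1) (ω q) (response x ω₀.1 α β γ e q.2) i - α i q.2)
      - √(r q.1) * leadα x.a (D⁻¹ *ᵥ (x.a i - c).ofLp) α γ (g q.1) (h q.1) i q.2)
      (probFilter P) (𝓝 0) := by
  have t := ((hB.tendsto_rowResid hv hr i).sub (hB.tendsto_row_coefficients hv hr hdet hD hc i)).sub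
    (hB.tendsto_shrinkRow_mul hv hr (hB.isBoundedInProb_rowResid hv hr i))
  simp only [sub_zero] at t
  refine t.congr' ?_
  filter_upwards [hB.eventually_normal hv] with q ⟨⟨hg, hh, hm⟩, _, hl, hn⟩
  have h0 := grandAvg_eq_zero_of_normal hg hh hm hl hn
  rw [← response_sub_regMean] at h0
  rw [blupα_eq hl h0, response_sub_regMean, leadα]
  simp_rw [add_mul, one_mul]
  rw [avg_add]
  ring

lemma tendsto_predError_β {D : Matrix (Fin pb) (Fin pb) ℝ} (hdet : IsUnit D.det)
    (hD : Tendsto (fun n => avg n (fun i => outer (ctr n x.b i).ofLp)) atTop (𝓝 D))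
    {c : EuclideanSpace ℝ (Fin pb)} (hc : Tendsto (fun n => avg n x.b) atTop (𝓝 c)) (j : ℕ) :
    Tendsto (fun q : ℕ × S => √(r q.1) *
      (blupβ x (g q.1) (h q.1) (m q.1) (ω q) (response x ω₀.1 α β γ e q.2) j - β j q.2)
      - √(r q.1) * leadα x.b (D⁻¹ *ᵥ (x.b j - c).ofLp) β (fun j i => γ i j) (h q.1) (g q.1) j q.2)
      (probFilter P) (𝓝 0) := by
  have t := ((hB.tendsto_colResid hv hr j).sub (hB.tendsto_col_coefficients hv hr hdet hD hc j)).sub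
    (hB.tendsto_shrinkCol_mul hv hr (hB.isBoundedInProb_colResid hv hr j))
  simp only [sub_zero] at t
  refine t.congr' ?_
  filter_upwards [hB.eventually_normal hv] with q ⟨⟨hg, hh, hm⟩, _, hl, hn⟩
  have h0 := grandAvg_eq_zero_of_normal hg hh hm hl hn
  rw [← response_sub_regMean] at h0
  rw [blupβ_eq hl h0, response_sub_regMean, leadα]
  simp_rw [add_mul, one_mul]
  rw [avg_add]
  ring

lemma tendsto_predError_γ (i j : ℕ) :
    Tendsto (fun q : ℕ × S => √(r q.1) *
      (blupγ x (g q.1) (h q.1) (m q.1) (ω q) (response x ω₀.1 α β γ e q.2) i j - γ i j q.2)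
      - √(r q.1) * leadγ γ e (g q.1) (h q.1) (m q.1) i j q.2) (probFilter P) (𝓝 0) := by
  have bR := hB.isBoundedInProb_rowResid hv hr i
  have bC := hB.isBoundedInProb_colResid hv hr j
  have tR := hB.tendsto_shrinkRow_mul hv hr bR
  have tC := hB.tendsto_shrinkCol_mul hv hr bC
  have b1 := ((hB.isBoundedInProb_intResid hv hr i j).add
    (IsBoundedInProb.of_tendsto (tendsto_of_sqrt_mul hr.top tR))).add
    (IsBoundedInProb.of_tendsto (tendsto_of_sqrt_mul hr.top tC))
  have t := (((hB.tendsto_intResid hv hr i j).add tR).add tC).sub (hB.tendsto_shrinkInt_mul hv hr b1)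
  simp only [sub_zero, add_zero] at t
  refine t.congr' ?_
  filter_upwards [hB.eventually_normal hv] with q ⟨⟨hg, hh, hm⟩, _, hl, hn⟩
  have h0 := grandAvg_eq_zero_of_normal hg hh hm hl hn
  rw [← response_sub_regMean] at h0
  rw [blupγ_eq hl h0, response_sub_regMean, leadγ]
  ring

end RegularityConditions

end Expansions

/-! ### The quadratic form of the limiting covariance matrix -/

section LimitCov

variable {κ₁ κ₂ κ₃ : ℝ} {θ : VarComp} {Ha Hb : ℕ → ℕ → ℝ} {i i' j j' : ℕ}

lemma limitCov_quadForm (t : (Fin 2 ⊕ Fin 2) ⊕ Fin 4 → ℝ) :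
    t ⬝ᵥ (limitCov κ₁ κ₂ κ₃ θ Ha Hb i i' j j' *ᵥ t)
      = κ₁ * θ 0 * (t (.inl (.inl 0)) * t (.inl (.inl 0)) * Ha i i
          + t (.inl (.inl 0)) * t (.inl (.inl 1)) * Ha i i'
          + t (.inl (.inl 1)) * t (.inl (.inl 0)) * Ha i' i
          + t (.inl (.inl 1)) * t (.inl (.inl 1)) * Ha i' i')
        + κ₂ * θ 1 * (t (.inl (.inr 0)) * t (.inl (.inr 0)) * Hb j j
          + t (.inl (.inr 0)) * t (.inl (.inr 1)) * Hb j j'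
          + t (.inl (.inr 1)) * t (.inl (.inr 0)) * Hb j' j
          + t (.inl (.inr 1)) * t (.inl (.inr 1)) * Hb j' j')
        + θ 2 * (κ₂ * ((t (.inl (.inl 0)) - t (.inr 0) - t (.inr 2)) ^ 2
            + (t (.inl (.inl 1)) - t (.inr 1) - t (.inr 3)) ^ 2)
          + κ₁ * ((t (.inl (.inr 0)) - t (.inr 0) - t (.inr 1)) ^ 2
            + (t (.inl (.inr 1)) - t (.inr 2) - t (.inr 3)) ^ 2))
        + κ₃ * θ 3 * (t (.inr 0) ^ 2 + t (.inr 1) ^ 2 + t (.inr 2) ^ 2 + t (.inr 3) ^ 2) := by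
  simp only [limitCov, blockFG, Matrix.mulVec, dotProduct, Fintype.sum_sum_type, Fin.sum_univ_two,
    Fin.sum_univ_four, Matrix.fromBlocks_apply₁₁, Matrix.fromBlocks_apply₁₂,
    Matrix.fromBlocks_apply₂₁, Matrix.fromBlocks_apply₂₂, Matrix.of_apply, Matrix.cons_val_zero,
    Matrix.cons_val_one, Matrix.cons_val, Matrix.smul_apply, Matrix.fromRows_apply_inl,
    Matrix.fromRows_apply_inr, Matrix.transpose_apply, Matrix.add_apply, Matrix.one_apply,
    Matrix.zero_apply, smul_eq_mul]
  simp
  ring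

variable {p : ℕ}

/-- The standardised covariates. -/
noncomputable def stdCov (z : ℕ → EuclideanSpace ℝ (Fin p)) (c : EuclideanSpace ℝ (Fin p))
    (D : Matrix (Fin p) (Fin p) ℝ) (i : ℕ) : Fin p → ℝ := D⁻¹ *ᵥ (z i - c).ofLp

lemma leverage_eq {z : ℕ → EuclideanSpace ℝ (Fin p)} {c : EuclideanSpace ℝ (Fin p)}
    {D : Matrix (Fin p) (Fin p) ℝ} (hD : IsUnit D.det) (hs : Dᵀ = D) (s u : ℕ) :
    leverage z c D s u = 1 + stdCov z c D s ⬝ᵥ (D *ᵥ stdCov z c D u) := by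
  have h1 : (D⁻¹)ᵀ = D⁻¹ := by rw [Matrix.transpose_nonsing_inv, hs]
  rw [leverage, stdCov, stdCov, Matrix.mulVec_mulVec, Matrix.mul_nonsing_inv _ hD,
    Matrix.one_mulVec, ← Matrix.dotProduct_transpose_mulVec, h1, dotProduct_comm]

lemma leverage_form {z : ℕ → EuclideanSpace ℝ (Fin p)} {c : EuclideanSpace ℝ (Fin p)}
    {D : Matrix (Fin p) (Fin p) ℝ} (hD : IsUnit D.det) (hs : Dᵀ = D) (a b : ℝ) (s u : ℕ) :
    a * a * leverage z c D s s + a * b * leverage z c D s u + b * a * leverage z c D u s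
      + b * b * leverage z c D u u
    = (a + b) ^ 2 + (a • stdCov z c D s + b • stdCov z c D u) ⬝ᵥ
        (D *ᵥ (a • stdCov z c D s + b • stdCov z c D u)) := by
  simp only [leverage_eq hD hs, Matrix.mulVec_add, Matrix.mulVec_smul, add_dotProduct,
    dotProduct_add, smul_dotProduct, dotProduct_smul, smul_eq_mul]
  ring

lemma leverage_comm {z : ℕ → EuclideanSpace ℝ (Fin p)} {c : EuclideanSpace ℝ (Fin p)}
    {D : Matrix (Fin p) (Fin p) ℝ} (hs : Dᵀ = D) (s u : ℕ) :
    leverage z c D s u = leverage z c D u s := by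
  have h1 : (D⁻¹)ᵀ = D⁻¹ := by rw [Matrix.transpose_nonsing_inv, hs]
  rw [leverage, leverage, ← Matrix.dotProduct_transpose_mulVec, h1]

lemma limitCov_posSemidef {p p' : ℕ} (h₁ : 0 ≤ κ₁) (h₂ : 0 ≤ κ₂) (h₃ : 0 ≤ κ₃) (hθ : ∀ k, 0 ≤ θ k)
    {z : ℕ → EuclideanSpace ℝ (Fin p)} {c : EuclideanSpace ℝ (Fin p)}
    {z' : ℕ → EuclideanSpace ℝ (Fin p')} {c' : EuclideanSpace ℝ (Fin p')}
    {D : Matrix (Fin p) (Fin p) ℝ} {D' : Matrix (Fin p') (Fin p') ℝ} (hD : D.PosDef)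
    (hD' : D'.PosDef) : (limitCov κ₁ κ₂ κ₃ θ (leverage z c D) (leverage z' c' D') i i' j j').PosSemidef := by
  have hs : Dᵀ = D := by simpa [Matrix.IsHermitian] using hD.isHermitian
  have hs' : D'ᵀ = D' := by simpa [Matrix.IsHermitian] using hD'.isHermitian
  refine Matrix.PosSemidef.of_dotProduct_mulVec_nonneg ?_ fun t => ?_
  · rw [Matrix.IsHermitian, Matrix.conjTranspose_eq_transpose_of_trivial]
    ext r r'
    rcases r with (r | r) | r <;> rcases r' with (r' | r') | r' <;> fin_cases r <;> fin_cases r' <;>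
      simp [limitCov, blockFG, leverage_comm hs i' i, leverage_comm hs' j' j]
  · rw [star_trivial, limitCov_quadForm, leverage_form hD.det_pos.ne'.isUnit hs,
      leverage_form hD'.det_pos.ne'.isUnit hs']
    have q1 : ∀ a : Fin p → ℝ, 0 ≤ a ⬝ᵥ (D *ᵥ a) := fun a => by
      simpa using hD.posSemidef.dotProduct_mulVec_nonneg a
    have q2 : ∀ a : Fin p' → ℝ, 0 ≤ a ⬝ᵥ (D' *ᵥ a) := fun a => by
      simpa using hD'.posSemidef.dotProduct_mulVec_nonneg a
    have t0 := hθ 0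
    have t1 := hθ 1
    have t2 := hθ 2
    have t3 := hθ 3
    have k1 := q1 (t (.inl (.inl 0)) • stdCov z c D i + t (.inl (.inl 1)) • stdCov z c D i')
    have k2 := q2 (t (.inl (.inr 0)) • stdCov z' c' D' j + t (.inl (.inr 1)) • stdCov z' c' D' j')
    positivity

end LimitCov

section Blocks

variable {S : Type*} [MeasurableSpace S] {P : Measure S}
  {pa pb pab pw : ℕ} {x : Covariates pa pb pab pw} {ω₀ : Param pa pb pab pw}
  {α β : ℕ → S → ℝ} {γ : ℕ → ℕ → S → ℝ} {e : ℕ → ℕ → ℕ → S → ℝ}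
  {g h m : ℕ → ℕ} {η η₁ η₂ : ℝ≥0∞}

lemma posDef_of_block {ι κ : Type*} [Fintype ι] [Fintype κ] [DecidableEq ι] [DecidableEq κ]
    {M : Matrix (ι ⊕ κ) (ι ⊕ κ) ℝ} (hM : M.PosDef) : (M.submatrix Sum.inl Sum.inl).PosDef := by
  refine Matrix.PosDef.of_dotProduct_mulVec_pos (hM.isHermitian.submatrix _) fun v hv => ?_
  have h1 : (Sum.elim v 0 : ι ⊕ κ → ℝ) ≠ 0 := fun h => hv (funext fun r => congrFun h (.inl r))
  have h2 := hM.dotProduct_mulVec_pos h1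
  simpa [dotProduct, Matrix.mulVec] using h2

lemma tendsto_diag₃ : Tendsto (fun n : ℕ => (n, n, n)) atTop atTop :=
  tendsto_atTop.2 fun q => by
    filter_upwards [eventually_ge_atTop q.1, eventually_ge_atTop q.2.1,
      eventually_ge_atTop q.2.2] with n h1 h2 h3
    exact ⟨h1, h2, h3⟩

namespace RegularityConditions

lemma posDef_D₁ (hB : RegularityConditions x P ω₀ α β γ e g h m η η₁ η₂)
    {D : Matrix (Fin pa) (Fin pa) ℝ}
    (hD : Tendsto (fun n => avg n (fun i => outer (ctr n x.a i).ofLp)) atTop (𝓝 D)) :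
    D.PosDef := by
  obtain ⟨M, hM, hl⟩ := hB.lim_row
  have h1 := tendsto_diag₃
  have hc : Continuous fun A : Matrix (Fin pa ⊕ Fin pab ⊕ Fin pw) (Fin pa ⊕ Fin pab ⊕ Fin pw) ℝ =>
      (A.submatrix Sum.inl Sum.inl : Matrix (Fin pa) (Fin pa) ℝ) := continuous_id.matrix_submatrix _ _
  have h2 := (hc.tendsto M).comp (hl.comp h1)
  have h3 : ∀ n : ℕ, ((avg n (fun i => outer (rowVec x n n n i))).submatrix Sum.inl Sum.inl :
      Matrix (Fin pa) (Fin pa) ℝ) = avg n (fun i => outer (ctr n x.a i).ofLp) := by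
    intro n
    ext r r'
    simp [avg, Matrix.sum_apply, outer, Matrix.vecMulVec_apply, rowVec]
  rw [tendsto_nhds_unique hD (h2.congr h3)]
  exact posDef_of_block hM

lemma posDef_D₂ (hB : RegularityConditions x P ω₀ α β γ e g h m η η₁ η₂)
    {D : Matrix (Fin pb) (Fin pb) ℝ}
    (hD : Tendsto (fun n => avg n (fun i => outer (ctr n x.b i).ofLp)) atTop (𝓝 D)) :
    D.PosDef := by
  obtain ⟨M, hM, hl⟩ := hB.lim_col
  have h1 := tendsto_diag₃
  have hc : Continuous fun A : Matrix (Fin pb ⊕ Fin pab ⊕ Fin pw) (Fin pb ⊕ Fin pab ⊕ Fin pw) ℝ =>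
      (A.submatrix Sum.inl Sum.inl : Matrix (Fin pb) (Fin pb) ℝ) := continuous_id.matrix_submatrix _ _
  have h2 := (hc.tendsto M).comp (hl.comp h1)
  have h3 : ∀ n : ℕ, ((avg n (fun i => outer (colVec x n n n i))).submatrix Sum.inl Sum.inl :
      Matrix (Fin pb) (Fin pb) ℝ) = avg n (fun i => outer (ctr n x.b i).ofLp) := by
    intro n
    ext r r'
    simp [avg, Matrix.sum_apply, outer, Matrix.vecMulVec_apply, colVec]
  rw [tendsto_nhds_unique hD (h2.congr h3)]
  exact posDef_of_block hM

end RegularityConditions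

end Blocks

/-! ### The asymptotic normality of the leading terms -/

section Coefficients

/-- The array with the entries `a` at `i`, `a'` at `i'` and `0` elsewhere. -/
def pick (i i' : ℕ) (a a' : ℝ) (s : ℕ) : ℝ := if s = i then a else if s = i' then a' else 0

variable {n i i' : ℕ}

lemma sum_pick_mul (hi : i < n) (hi' : i' < n) (hne : i ≠ i') (a a' : ℝ) (f : ℕ → ℝ) :
    ∑ s ∈ Finset.range n, pick i i' a a' s * f s = a * f i + a' * f i' := by
  have h1 : ∑ s ∈ ({i, i'} : Finset ℕ), pick i i' a a' s * f s
      = ∑ s ∈ Finset.range n, pick i i' a a' s * f s := by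
    refine Finset.sum_subset ?_ fun s _ hs => ?_
    · intro s hs
      simp only [Finset.mem_insert, Finset.mem_singleton] at hs
      rcases hs with rfl | rfl <;> simpa
    · simp only [Finset.mem_insert, Finset.mem_singleton, not_or] at hs
      simp [pick, hs.1, hs.2]
  rw [← h1, Finset.sum_pair hne]
  simp [pick, hne.symm]

lemma sum_pick (hi : i < n) (hi' : i' < n) (hne : i ≠ i') (a a' : ℝ) :
    ∑ s ∈ Finset.range n, pick i i' a a' s = a + a' := by
  simpa using sum_pick_mul hi hi' hne a a' fun _ => 1

lemma sum_pick_sq (hi : i < n) (hi' : i' < n) (hne : i ≠ i') (a a' : ℝ) :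
    ∑ s ∈ Finset.range n, pick i i' a a' s ^ 2 = a ^ 2 + a' ^ 2 := by
  simp_rw [sq, sum_pick_mul hi hi' hne]
  simp [pick, hne.symm]

lemma abs_pick_le (i i' : ℕ) (a a' : ℝ) (s : ℕ) : |pick i i' a a' s| ≤ |a| + |a'| := by
  have h1 := abs_nonneg a
  have h2 := abs_nonneg a'
  unfold pick
  split_ifs
  · linarith
  · linarith
  · simpa using add_nonneg h1 h2

/-- The indices of the random effects of a table. -/
def effRange (G H M : ℕ) : Finset EffIdx :=
  (Finset.range G).disjSum ((Finset.range H).disjSum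
    ((Finset.range G ×ˢ Finset.range H).disjSum (Finset.range G ×ˢ Finset.range H ×ˢ Finset.range M)))

lemma sum_effRange (G H M : ℕ) (f : EffIdx → ℝ) : ∑ c ∈ effRange G H M, f c
    = ∑ s ∈ Finset.range G, f (.inl s) + (∑ v ∈ Finset.range H, f (.inr (.inl v))
      + (∑ s ∈ Finset.range G, ∑ v ∈ Finset.range H, f (.inr (.inr (.inl (s, v))))
      + ∑ s ∈ Finset.range G, ∑ v ∈ Finset.range H, ∑ k ∈ Finset.range M,
          f (.inr (.inr (.inr (s, v, k)))))) := by
  simp only [effRange, Finset.sum_disjSum, Finset.sum_product]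

/-- The coefficients of the random effects in a linear combination of the leading terms. -/
noncomputable def leadCoef (A : ℕ → ℕ → ℝ) (A' : ℕ → ℕ → ℝ) (B B' : ℕ → ℝ) (E : ℕ → ℕ → ℝ)
    (R G H M : ℕ) : EffIdx → ℝ :=
  Sum.elim (fun s => -(√R * ((G : ℝ)⁻¹ * A G s))) (Sum.elim (fun v => -(√R * ((H : ℝ)⁻¹ * A' H v)))
    (Sum.elim (fun c => √R * ((H : ℝ)⁻¹ * B c.1 + (G : ℝ)⁻¹ * B' c.2))
      (fun c => √R * ((M : ℝ)⁻¹ * E c.1 c.2.1))))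

variable (A A' : ℕ → ℕ → ℝ) (B B' : ℕ → ℝ) (E : ℕ → ℕ → ℝ) (R G H M : ℕ)


lemma sum_leadCoef_sq (θ : VarComp) :
    ∑ c ∈ effRange G H M, leadCoef A A' B B' E R G H M c ^ 2 * θ (effType c)
      = R * (G : ℝ)⁻¹ * avg G (fun s => A G s ^ 2) * θ 0
        + (R * (H : ℝ)⁻¹ * avg H (fun v => A' H v ^ 2) * θ 1
        + ((R * (H : ℝ)⁻¹ * ((H : ℝ)⁻¹ * H) * ∑ s ∈ Finset.range G, B s ^ 2
          + R * (G : ℝ)⁻¹ * ((G : ℝ)⁻¹ * G) * ∑ v ∈ Finset.range H, B' v ^ 2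
          + 2 * (R * (H : ℝ)⁻¹ * (G : ℝ)⁻¹ * ((∑ s ∈ Finset.range G, B s)
            * ∑ v ∈ Finset.range H, B' v))) * θ 2
        + R * (M : ℝ)⁻¹ * ((M : ℝ)⁻¹ * M)
          * (∑ s ∈ Finset.range G, ∑ v ∈ Finset.range H, E s v ^ 2) * θ 3)) := by
  have hR : √(R : ℝ) ^ 2 = R := Real.sq_sqrt (by positivity)
  rw [sum_effRange]
  simp only [leadCoef, effType, Sum.elim_inl, Sum.elim_inr, avg, smul_eq_mul, neg_sq, mul_pow, hR,
    Finset.sum_const, Finset.card_range, nsmul_eq_mul]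
  congr 1
  · simp only [Finset.mul_sum, Finset.sum_mul]
    exact Finset.sum_congr rfl fun s _ => by ring
  congr 1
  · simp only [Finset.mul_sum, Finset.sum_mul]
    exact Finset.sum_congr rfl fun s _ => by ring
  congr 1
  · have h1 : ∀ s v, (R : ℝ) * ((H : ℝ)⁻¹ * B s + (G : ℝ)⁻¹ * B' v) ^ 2 * θ 2
        = R * (H : ℝ)⁻¹ * (H : ℝ)⁻¹ * θ 2 * B s ^ 2 + R * (G : ℝ)⁻¹ * (G : ℝ)⁻¹ * θ 2 * B' v ^ 2
          + 2 * R * (H : ℝ)⁻¹ * (G : ℝ)⁻¹ * θ 2 * (B s * B' v) := fun s v => by ring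
    simp only [h1, Finset.sum_add_distrib, Finset.sum_const, Finset.card_range, nsmul_eq_mul,
      ← Finset.mul_sum, ← Finset.sum_mul]
    ring
  · simp only [Finset.mul_sum, Finset.sum_mul]
    exact Finset.sum_congr rfl fun s _ => Finset.sum_congr rfl fun v _ => by ring

variable {S : Type*} {α β : ℕ → S → ℝ} {γ : ℕ → ℕ → S → ℝ} {e : ℕ → ℕ → ℕ → S → ℝ}

lemma sum_leadCoef_mul (s : S) :
    ∑ c ∈ effRange G H M, leadCoef A A' B B' E R G H M c * allEffects α β γ e c s
      = √R * (-avg G (fun i => A G i * α i s) - avg H (fun j => A' H j * β j s)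
        + (∑ i ∈ Finset.range G, B i * avg H (fun j => γ i j s)
        + ∑ j ∈ Finset.range H, B' j * avg G (fun i => γ i j s))
        + ∑ i ∈ Finset.range G, ∑ j ∈ Finset.range H, E i j * avg M (fun k => e i j k s)) := by
  rw [sum_effRange]
  simp only [leadCoef, allEffects, Sum.elim_inl, Sum.elim_inr, avg, smul_eq_mul]
  have h1 : ∑ i ∈ Finset.range G, ∑ j ∈ Finset.range H,
      √(R : ℝ) * ((H : ℝ)⁻¹ * B i + (G : ℝ)⁻¹ * B' j) * γ i j s
      = √R * (∑ i ∈ Finset.range G, B i * ((H : ℝ)⁻¹ * ∑ j ∈ Finset.range H, γ i j s)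
        + ∑ j ∈ Finset.range H, B' j * ((G : ℝ)⁻¹ * ∑ i ∈ Finset.range G, γ i j s)) := by
    have h2 : ∑ j ∈ Finset.range H, B' j * ((G : ℝ)⁻¹ * ∑ i ∈ Finset.range G, γ i j s)
        = ∑ i ∈ Finset.range G, ∑ j ∈ Finset.range H, B' j * ((G : ℝ)⁻¹ * γ i j s) := by
      simp only [Finset.mul_sum]
      exact Finset.sum_comm
    rw [h2, ← Finset.sum_add_distrib, Finset.mul_sum]
    refine Finset.sum_congr rfl fun i _ => ?_
    rw [Finset.mul_sum, Finset.mul_sum, ← Finset.sum_add_distrib, Finset.mul_sum]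
    exact Finset.sum_congr rfl fun j _ => by ring
  have h3 : ∑ i ∈ Finset.range G, -(√(R : ℝ) * ((G : ℝ)⁻¹ * A G i)) * α i s
      = √R * -((G : ℝ)⁻¹ * ∑ i ∈ Finset.range G, A G i * α i s) := by
    rw [Finset.mul_sum, ← Finset.sum_neg_distrib, Finset.mul_sum]
    exact Finset.sum_congr rfl fun j _ => by ring
  have h4 : ∑ i ∈ Finset.range H, -(√(R : ℝ) * ((H : ℝ)⁻¹ * A' H i)) * β i s
      = √R * -((H : ℝ)⁻¹ * ∑ i ∈ Finset.range H, A' H i * β i s) := by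
    rw [Finset.mul_sum, ← Finset.sum_neg_distrib, Finset.mul_sum]
    exact Finset.sum_congr rfl fun j _ => by ring
  have h5 : ∑ i ∈ Finset.range G, ∑ j ∈ Finset.range H, ∑ k ∈ Finset.range M,
      √(R : ℝ) * ((M : ℝ)⁻¹ * E i j) * e i j k s
      = √R * ∑ i ∈ Finset.range G, ∑ j ∈ Finset.range H,
          E i j * ((M : ℝ)⁻¹ * ∑ k ∈ Finset.range M, e i j k s) := by
    simp only [Finset.mul_sum]
    exact Finset.sum_congr rfl fun i _ => Finset.sum_congr rfl fun j _ =>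
      Finset.sum_congr rfl fun k _ => by ring
  rw [h1, h3, h4, h5]
  ring

lemma tendsto_avg_add_dotLin_sq {p : ℕ} {z : ℕ → EuclideanSpace ℝ (Fin p)}
    {D : Matrix (Fin p) (Fin p) ℝ} {n : ℕ → ℕ} (hn : Tendsto n atTop atTop)
    (hD : Tendsto (fun n => avg n (fun i => outer (ctr n z i).ofLp)) atTop (𝓝 D)) (c : ℝ)
    (a : Fin p → ℝ) :
    Tendsto (fun N => avg (n N) (fun i => (c + dotLin a (ctr (n N) z i)) ^ 2)) atTop
      (𝓝 (c ^ 2 + a ⬝ᵥ (D *ᵥ a))) := by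
  refine ((tendsto_avg_dotLin_sq hn hD a).const_add (c ^ 2)).congr' ?_
  filter_upwards [hn.eventually_ge_atTop 1] with N hN
  have h1 : ∀ i, (c + dotLin a (ctr (n N) z i)) ^ 2
      = (c ^ 2 + (2 * c) • dotLin a (ctr (n N) z i)) + dotLin a (ctr (n N) z i) ^ 2 := fun i => by
    rw [smul_eq_mul]
    ring
  simp only [h1]
  rw [avg_add, avg_add, avg_const (by omega), avg_smul, avg_map, avg_ctr (by omega), map_zero,
    smul_zero, add_zero]

lemma eventually_abs_add_dotLin_lt {p : ℕ} {z : ℕ → EuclideanSpace ℝ (Fin p)} {δ l κ : ℝ}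
    (hδ : 0 < δ)
    (hl : Tendsto (fun n : ℕ => avg n (fun i => ‖ctr n z i‖ ^ (2 + δ))) atTop (𝓝 l))
    {r n : ℕ → ℕ} (hn : Tendsto n atTop atTop)
    (hr : Tendsto (fun N => (r N : ℝ) * (n N : ℝ)⁻¹) atTop (𝓝 κ)) (c : ℝ) (a : Fin p → ℝ) {ε : ℝ}
    (hε : 0 < ε) : ∀ᶠ N in atTop, ∀ s < n N,
      |-(√(r N) * ((n N : ℝ)⁻¹ * (c + dotLin a (ctr (n N) z s))))| < ε := by
  obtain ⟨τ, hτ, hτ'⟩ : ∃ τ : ℝ, 0 < τ ∧ √κ * (enorm2 a * τ) < ε := by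
    refine ⟨ε / (√κ * enorm2 a + 1), by have := enorm2_nonneg a; positivity, ?_⟩
    have := enorm2_nonneg a
    rw [← mul_assoc, mul_div_assoc', div_lt_iff₀ (by positivity)]
    nlinarith [Real.sqrt_nonneg κ]
  have h1 : Tendsto (fun N => √(r N : ℝ) * (n N : ℝ)⁻¹ * |c|
      + √(r N : ℝ) * (√(n N : ℝ))⁻¹ * (enorm2 a * τ)) atTop (𝓝 (0 * |c| + √κ * (enorm2 a * τ))) :=
    ((tendsto_sqrt_mul_inv hn hr).mul_const _).add ((tendsto_sqrt_mul_inv_sqrt hr).mul_const _)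
  rw [zero_mul, zero_add] at h1
  filter_upwards [h1.eventually_lt_const hτ', hn.eventually (eventually_norm_ctr_le hδ hl hτ),
    hn.eventually_gt_atTop 0] with N h2 h3 h4 s hs
  refine lt_of_le_of_lt ?_ h2
  have h4' : (0 : ℝ) < n N := by exact_mod_cast h4
  have h5 : |c + dotLin a (ctr (n N) z s)| ≤ |c| + τ * √(n N) * enorm2 a :=
    (abs_add_le _ _).trans (add_le_add le_rfl ((norm_dotLin_le _ _).trans
      (mul_le_mul_of_nonneg_right (h3 s hs) (enorm2_nonneg a))))
  rw [abs_neg, abs_mul, abs_mul, abs_of_nonneg (Real.sqrt_nonneg _), abs_of_nonneg (by positivity)]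
  calc √(r N : ℝ) * ((n N : ℝ)⁻¹ * |c + dotLin a (ctr (n N) z s)|)
      ≤ √(r N : ℝ) * ((n N : ℝ)⁻¹ * (|c| + τ * √(n N) * enorm2 a)) := by gcongr
    _ = √(r N : ℝ) * (n N : ℝ)⁻¹ * |c| + √(r N : ℝ) * ((n N : ℝ)⁻¹ * √(n N)) * (enorm2 a * τ) := by
      ring
    _ = _ := by
      congr 3
      rw [inv_mul_eq_div, Real.sqrt_div_self]


end Coefficients

/-! ### The asymptotic normality of the prediction errors -/

section Lead

variable {S : Type*} {pa pb : ℕ}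

/-- The vector of the leading terms of the prediction errors. -/
noncomputable def leadVec (za : ℕ → EuclideanSpace ℝ (Fin pa)) (zb : ℕ → EuclideanSpace ℝ (Fin pb))
    (a : ℕ → Fin pa → ℝ) (b : ℕ → Fin pb → ℝ) (α β : ℕ → S → ℝ) (γ : ℕ → ℕ → S → ℝ) (e : ℕ → ℕ → ℕ → S → ℝ)
    (i i' j j' R G H M : ℕ) (s : S) : EuclideanSpace ℝ ((Fin 2 ⊕ Fin 2) ⊕ Fin 4) :=
  √(R : ℝ) • WithLp.toLp 2 (Sum.elim
    (Sum.elim ![leadα za (a i) α γ G H i s, leadα za (a i') α γ G H i' s]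
      ![leadα zb (b j) β (fun j i => γ i j) H G j s, leadα zb (b j') β (fun j i => γ i j) H G j' s])
    ![leadγ γ e G H M i j s, leadγ γ e G H M i' j s, leadγ γ e G H M i j' s,
      leadγ γ e G H M i' j' s])

variable {za : ℕ → EuclideanSpace ℝ (Fin pa)} {zb : ℕ → EuclideanSpace ℝ (Fin pb)}
    {a : ℕ → Fin pa → ℝ} {b : ℕ → Fin pb → ℝ} {α β : ℕ → S → ℝ} {γ : ℕ → ℕ → S → ℝ}
    {e : ℕ → ℕ → ℕ → S → ℝ} {i i' j j' R G H M : ℕ}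

lemma avg_add_dotLin_mul (n : ℕ) (z : ℕ → EuclideanSpace ℝ (Fin pa)) (c c' : ℝ) (u u' : Fin pa → ℝ)
    (f : ℕ → ℝ) : avg n (fun s => (c + c' + dotLin (c • u + c' • u') (z s)) * f s)
      = c * avg n (fun s => (1 + dotLin u (z s)) * f s)
        + c' * avg n (fun s => (1 + dotLin u' (z s)) * f s) := by
  rw [← smul_eq_mul c, ← smul_eq_mul c', ← avg_smul, ← avg_smul, ← avg_add]
  congr 1
  ext s
  simp only [dotLin_apply, dotProduct_add, dotProduct_smul, smul_eq_mul]
  ring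

lemma sum_pick_pick_mul (hi : i < G) (hi' : i' < G) (hj : j < H) (hj' : j' < H) (hne : i ≠ i')
    (hne' : j ≠ j') (w₀ w₁ w₂ w₃ : ℝ) (f : ℕ → ℕ → ℝ) :
    ∑ s ∈ Finset.range G, ∑ v ∈ Finset.range H,
      pick i i' (pick j j' w₀ w₂ v) (pick j j' w₁ w₃ v) s * f s v
      = w₀ * f i j + w₁ * f i' j + w₂ * f i j' + w₃ * f i' j' := by
  rw [Finset.sum_comm]
  simp only [sum_pick_mul hi hi' hne, Finset.sum_add_distrib, sum_pick_mul hj hj' hne']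
  ring

lemma sum_pick_pick_sq (hi : i < G) (hi' : i' < G) (hj : j < H) (hj' : j' < H) (hne : i ≠ i')
    (hne' : j ≠ j') (w₀ w₁ w₂ w₃ : ℝ) :
    ∑ s ∈ Finset.range G, ∑ v ∈ Finset.range H,
      pick i i' (pick j j' w₀ w₂ v) (pick j j' w₁ w₃ v) s ^ 2
      = w₀ ^ 2 + w₁ ^ 2 + w₂ ^ 2 + w₃ ^ 2 := by
  rw [Finset.sum_comm]
  simp only [sum_pick_sq hi hi' hne, Finset.sum_add_distrib, sum_pick_sq hj hj' hne']
  ring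

/-- The coefficients of the random effects in the linear combination with the coefficients `t` of
the leading terms. -/
noncomputable def lincombCoef (za : ℕ → EuclideanSpace ℝ (Fin pa))
    (zb : ℕ → EuclideanSpace ℝ (Fin pb)) (a : ℕ → Fin pa → ℝ) (b : ℕ → Fin pb → ℝ)
    (i i' j j' : ℕ) (t : (Fin 2 ⊕ Fin 2) ⊕ Fin 4 → ℝ) : ℕ → ℕ → ℕ → ℕ → EffIdx → ℝ :=
  leadCoef
    (fun G s => t (.inl (.inl 0)) + t (.inl (.inl 1))
      + dotLin (t (.inl (.inl 0)) • a i + t (.inl (.inl 1)) • a i') (ctr G za s))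
    (fun H s => t (.inl (.inr 0)) + t (.inl (.inr 1))
      + dotLin (t (.inl (.inr 0)) • b j + t (.inl (.inr 1)) • b j') (ctr H zb s))
    (pick i i' (t (.inl (.inl 0)) - t (.inr 0) - t (.inr 2))
      (t (.inl (.inl 1)) - t (.inr 1) - t (.inr 3)))
    (pick j j' (t (.inl (.inr 0)) - t (.inr 0) - t (.inr 1))
      (t (.inl (.inr 1)) - t (.inr 2) - t (.inr 3)))
    (fun s v => pick i i' (pick j j' (t (.inr 0)) (t (.inr 2)) v)
      (pick j j' (t (.inr 1)) (t (.inr 3)) v) s)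

lemma sum_mul_leadVec (hi : i < G) (hi' : i' < G) (hj : j < H) (hj' : j' < H) (hne : i ≠ i')
    (hne' : j ≠ j') (t : (Fin 2 ⊕ Fin 2) ⊕ Fin 4 → ℝ) (s : S) :
    ∑ r, t r * leadVec za zb a b α β γ e i i' j j' R G H M s r
      = ∑ c ∈ effRange G H M, lincombCoef za zb a b i i' j j' t R G H M c
        * allEffects α β γ e c s := by
  rw [lincombCoef, sum_leadCoef_mul, sum_pick_pick_mul hi hi' hj hj' hne hne',
    sum_pick_mul hi hi' hne, sum_pick_mul hj hj' hne', avg_add_dotLin_mul, avg_add_dotLin_mul]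
  simp only [Fintype.sum_sum_type, Fin.sum_univ_two, Fin.sum_univ_four, leadVec, PiLp.smul_apply,
    Sum.elim_inl, Sum.elim_inr, Matrix.cons_val_zero, Matrix.cons_val_one, Matrix.cons_val,
    smul_eq_mul, leadα, leadγ]
  ring

end Lead

section Conclusion

variable {S : Type*} [MeasurableSpace S] {P : Measure S} [IsProbabilityMeasure P]
  {pa pb pab pw : ℕ} {x : Covariates pa pb pab pw} {ω₀ : Param pa pb pab pw}
  {α β : ℕ → S → ℝ} {γ : ℕ → ℕ → S → ℝ} {e : ℕ → ℕ → ℕ → S → ℝ}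
  {g h m r : ℕ → ℕ} {η η₁ η₂ : ℝ≥0∞} {κ₁ κ₂ κ₃ : ℝ}

lemma effType_effRep (t : Fin 4) : effType (effRep t) = t := by
  fin_cases t <;> rfl

namespace RegularityConditions

variable (hB : RegularityConditions x P ω₀ α β γ e g h m η η₁ η₂)
  (hr : IsScale r g h m κ₁ κ₂ κ₃)

include hB hr

omit [IsProbabilityMeasure P] in
lemma eventually_lincombCoef_lt (a : ℕ → Fin pa → ℝ) (b : ℕ → Fin pb → ℝ) (i i' j j' : ℕ)
    (t : (Fin 2 ⊕ Fin 2) ⊕ Fin 4 → ℝ) {ε : ℝ} (hε : 0 < ε) : ∀ᶠ N in atTop,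
    ∀ c ∈ effRange (g N) (h N) (m N),
      |lincombCoef x.a x.b a b i i' j j' t (r N) (g N) (h N) (m N) c| < ε := by
  obtain ⟨δ, hδ, ⟨l, hl⟩, ⟨l', hl'⟩, -⟩ := hB.lim_moments
  have hγ : ∀ C C' : ℝ, Tendsto (fun N => √(r N : ℝ) * (h N : ℝ)⁻¹ * C
      + √(r N : ℝ) * (g N : ℝ)⁻¹ * C') atTop (𝓝 0) := fun C C' => by
    simpa using ((tendsto_sqrt_mul_inv hB.h_top hr.div_h).mul_const C).add
      ((tendsto_sqrt_mul_inv hB.g_top hr.div_g).mul_const C')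
  have he : ∀ C : ℝ, Tendsto (fun N => √(r N : ℝ) * (m N : ℝ)⁻¹ * C) atTop (𝓝 0) := fun C => by
    simpa using (tendsto_sqrt_mul_inv hB.m_top hr.div_m).mul_const C
  filter_upwards [eventually_abs_add_dotLin_lt hδ hl hB.g_top hr.div_g
      (t (.inl (.inl 0)) + t (.inl (.inl 1)))
      (t (.inl (.inl 0)) • a i + t (.inl (.inl 1)) • a i') hε,
    eventually_abs_add_dotLin_lt hδ hl' hB.h_top hr.div_h
      (t (.inl (.inr 0)) + t (.inl (.inr 1)))
      (t (.inl (.inr 0)) • b j + t (.inl (.inr 1)) • b j') hε,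
    (hγ (|t (.inl (.inl 0)) - t (.inr 0) - t (.inr 2)|
        + |t (.inl (.inl 1)) - t (.inr 1) - t (.inr 3)|)
      (|t (.inl (.inr 0)) - t (.inr 0) - t (.inr 1)|
        + |t (.inl (.inr 1)) - t (.inr 2) - t (.inr 3)|)).eventually_lt_const hε,
    (he ((|t (.inr 0)| + |t (.inr 2)|) + (|t (.inr 1)| + |t (.inr 3)|))).eventually_lt_const hε]
    with N h1 h2 h3 h4 c hc
  rcases c with s | s | ⟨s, v⟩ | ⟨s, v, k⟩
  · exact h1 s (by simpa [effRange] using hc)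
  · exact h2 s (by simpa [effRange] using hc)
  · refine lt_of_le_of_lt ?_ h3
    simp only [lincombCoef, leadCoef, Sum.elim_inl, Sum.elim_inr]
    rw [abs_mul, abs_of_nonneg (Real.sqrt_nonneg _), mul_assoc, mul_assoc, ← mul_add]
    refine mul_le_mul_of_nonneg_left ((abs_add_le _ _).trans ?_) (Real.sqrt_nonneg _)
    rw [abs_mul, abs_mul, abs_of_nonneg (by positivity : (0 : ℝ) ≤ (h N : ℝ)⁻¹),
      abs_of_nonneg (by positivity : (0 : ℝ) ≤ (g N : ℝ)⁻¹)]
    exact add_le_add (mul_le_mul_of_nonneg_left (abs_pick_le _ _ _ _ _) (by positivity))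
      (mul_le_mul_of_nonneg_left (abs_pick_le _ _ _ _ _) (by positivity))
  · refine lt_of_le_of_lt ?_ h4
    simp only [lincombCoef, leadCoef, Sum.elim_inr]
    rw [abs_mul, abs_of_nonneg (Real.sqrt_nonneg _), mul_assoc, abs_mul,
      abs_of_nonneg (by positivity : (0 : ℝ) ≤ (m N : ℝ)⁻¹)]
    refine mul_le_mul_of_nonneg_left (mul_le_mul_of_nonneg_left ?_ (by positivity))
      (Real.sqrt_nonneg _)
    exact (abs_pick_le _ _ _ _ _).trans (add_le_add (abs_pick_le _ _ _ _ _)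
      (abs_pick_le _ _ _ _ _))

variable {ca : EuclideanSpace ℝ (Fin pa)} {cb : EuclideanSpace ℝ (Fin pb)}
  {D₁ : Matrix (Fin pa) (Fin pa) ℝ} {D₂ : Matrix (Fin pb) (Fin pb) ℝ}
  (hD₁ : Tendsto (fun n => avg n (fun i => outer (ctr n x.a i).ofLp)) atTop (𝓝 D₁))
  (hD₂ : Tendsto (fun n => avg n (fun j => outer (ctr n x.b j).ofLp)) atTop (𝓝 D₂))

include hD₁ hD₂

omit [IsProbabilityMeasure P] in
lemma tendsto_sum_lincombCoef_sq {i i' j j' : ℕ} (hne : i ≠ i') (hne' : j ≠ j')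
    (t : (Fin 2 ⊕ Fin 2) ⊕ Fin 4 → ℝ) :
    Tendsto (fun N => ∑ c ∈ effRange (g N) (h N) (m N),
      lincombCoef x.a x.b (stdCov x.a ca D₁) (stdCov x.b cb D₂) i i' j j' t (r N) (g N) (h N) (m N) c
        ^ 2 * ω₀.2 (effType c)) atTop
      (𝓝 (t ⬝ᵥ (limitCov κ₁ κ₂ κ₃ ω₀.2 (leverage x.a ca D₁) (leverage x.b cb D₂) i i' j j' *ᵥ t))) := by
  have p₁ := hB.posDef_D₁ hD₁
  have p₂ := hB.posDef_D₂ hD₂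
  have s₁ : D₁ᵀ = D₁ := by simpa [Matrix.IsHermitian] using p₁.isHermitian
  have s₂ : D₂ᵀ = D₂ := by simpa [Matrix.IsHermitian] using p₂.isHermitian
  rw [limitCov_quadForm, leverage_form p₁.det_pos.ne'.isUnit s₁,
    leverage_form p₂.det_pos.ne'.isUnit s₂]
  have k1 := (hr.div_g.mul (tendsto_avg_add_dotLin_sq hB.g_top hD₁
    (t (.inl (.inl 0)) + t (.inl (.inl 1))) (t (.inl (.inl 0)) • stdCov x.a ca D₁ i
      + t (.inl (.inl 1)) • stdCov x.a ca D₁ i'))).mul_const (ω₀.2 0)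
  have k2 := (hr.div_h.mul (tendsto_avg_add_dotLin_sq hB.h_top hD₂
    (t (.inl (.inr 0)) + t (.inl (.inr 1))) (t (.inl (.inr 0)) • stdCov x.b cb D₂ j
      + t (.inl (.inr 1)) • stdCov x.b cb D₂ j'))).mul_const (ω₀.2 1)
  set A₀ := t (.inl (.inl 0)) - t (.inr 0) - t (.inr 2) with hA₀
  set A₁ := t (.inl (.inl 1)) - t (.inr 1) - t (.inr 3) with hA₁
  set B₀ := t (.inl (.inr 0)) - t (.inr 0) - t (.inr 1) with hB₀
  set B₁ := t (.inl (.inr 1)) - t (.inr 2) - t (.inr 3) with hB₁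
  have k3 := (((hr.div_h.mul_const (A₀ ^ 2 + A₁ ^ 2)).add
    (hr.div_g.mul_const (B₀ ^ 2 + B₁ ^ 2))).add
    (((hr.div_h.mul (tendsto_inv_natCast hB.g_top)).mul_const
      ((A₀ + A₁) * (B₀ + B₁))).const_mul 2)).mul_const (ω₀.2 2)
  have k4 := (hr.div_m.mul_const
    (t (.inr 0) ^ 2 + t (.inr 1) ^ 2 + t (.inr 2) ^ 2 + t (.inr 3) ^ 2)).mul_const (ω₀.2 3)
  refine ((k1.add (k2.add (k3.add k4))).congr' ?_).trans (le_of_eq (congrArg 𝓝 (by ring)))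
  filter_upwards [hB.g_top.eventually_gt_atTop i, hB.g_top.eventually_gt_atTop i',
    hB.h_top.eventually_gt_atTop j, hB.h_top.eventually_gt_atTop j',
    hB.m_top.eventually_gt_atTop 0] with N n1 n2 n3 n4 n5
  rw [lincombCoef, sum_leadCoef_sq, sum_pick_sq n1 n2 hne, sum_pick_sq n3 n4 hne',
    sum_pick_pick_sq n1 n2 n3 n4 hne hne', sum_pick n1 n2 hne, sum_pick n3 n4 hne']
  have z1 : (g N : ℝ)⁻¹ * g N = 1 := inv_mul_cancel₀ (by exact_mod_cast (Nat.zero_lt_of_lt n1).ne')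
  have z2 : (h N : ℝ)⁻¹ * h N = 1 := inv_mul_cancel₀ (by exact_mod_cast (Nat.zero_lt_of_lt n3).ne')
  have z3 : (m N : ℝ)⁻¹ * m N = 1 := inv_mul_cancel₀ (by exact_mod_cast n5.ne')
  rw [z1, z2, z3, mul_one, mul_one, mul_one]

lemma tendsto_charFun_leadVec {i i' j j' : ℕ} (hne : i ≠ i') (hne' : j ≠ j')
    (t : (Fin 2 ⊕ Fin 2) ⊕ Fin 4 → ℝ) :
    Tendsto (fun N => charFun (P.map fun s => ∑ k, t k * leadVec x.a x.b (stdCov x.a ca D₁)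
      (stdCov x.b cb D₂) α β γ e i i' j j' (r N) (g N) (h N) (m N) s k) 1) atTop
      (𝓝 (Complex.exp (-((t ⬝ᵥ (limitCov κ₁ κ₂ κ₃ ω₀.2 (leverage x.a ca D₁) (leverage x.b cb D₂)
        i i' j j' *ᵥ t) : ℝ) / 2)))) := by
  have h1 := tendsto_charFun_sum hB.measurable hB.indep hB.ident hB.memLp_two hB.integral_eq_zero
    (v := ω₀.2) (fun k => (hB.integral_sq (effRep k)).trans (by rw [effType_effRep])) hB.var_pos
    (fun N => effRange (g N) (h N) (m N))
    (fun N => lincombCoef x.a x.b (stdCov x.a ca D₁) (stdCov x.b cb D₂) i i' j j' t (r N) (g N) (h N)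
      (m N)) (fun ε hε => hB.eventually_lincombCoef_lt hr _ _ i i' j j' t hε)
    (hB.tendsto_sum_lincombCoef_sq hr hD₁ hD₂ hne hne' t)
  refine h1.congr' ?_
  filter_upwards [hB.g_top.eventually_gt_atTop i, hB.g_top.eventually_gt_atTop i',
    hB.h_top.eventually_gt_atTop j, hB.h_top.eventually_gt_atTop j'] with N n1 n2 n3 n4
  simp_rw [sum_mul_leadVec n1 n2 n3 n4 hne hne' t]

end RegularityConditions

end Conclusion

/-! ### The limiting distribution of the prediction errors -/

section PredError

variable {S : Type*} [MeasurableSpace S] {pa pb pab pw : ℕ} {x : Covariates pa pb pab pw}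

lemma Measurable.avg {n : ℕ} {f : S → ℕ → ℝ} (hf : ∀ i, Measurable fun s => f s i) :
    Measurable fun s => avg n (f s) := by
  simp only [CrossedEffects.avg, smul_eq_mul]
  exact (Finset.measurable_sum _ fun i _ => hf i).const_mul _

lemma measurable_regMean {ξ : S → FixedIdx pa pb pab pw → ℝ} (hξ : Measurable ξ) (i j k : ℕ) :
    Measurable fun s => regMean x (ξ s) i j k := by
  simp only [regMean, dotProduct]
  exact Finset.measurable_sum _ fun r _ => ((measurable_pi_apply r).comp hξ).const_mul _

variable {y : S → ℕ → ℕ → ℕ → ℝ} {ω : S → Param pa pb pab pw} {α β : ℕ → S → ℝ}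
  {γ : ℕ → ℕ → S → ℝ} {e : ℕ → ℕ → ℕ → S → ℝ}

lemma measurable_resid (hy : ∀ i j k, Measurable fun s => y s i j k) (hω : Measurable ω)
    (m i j : ℕ) : Measurable fun s => resid x m (ω s).1 (y s) i j :=
  Measurable.avg fun k => (hy i j k).sub (measurable_regMean hω.fst i j k)

lemma measurable_predError (hy : ∀ i j k, Measurable fun s => y s i j k) (hω : Measurable ω)
    (hm : ∀ c, Measurable (allEffects α β γ e c)) (g h m i i' j j' : ℕ) :
    Measurable fun s => predError x g h m (ω s) (y s) α β γ i i' j j' s := by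
  have hr := measurable_resid (x := x) hy hω m
  have h0 : ∀ k, Measurable fun s => (ω s).2 k := fun k => (measurable_pi_apply k).comp hω.snd
  have hR : ∀ i, Measurable fun s => rowAvg h (resid x m (ω s).1 (y s)) i :=
    fun i => Measurable.avg fun j => hr i j
  have hC : ∀ j, Measurable fun s => colAvg g (resid x m (ω s).1 (y s)) j :=
    fun j => Measurable.avg fun i => hr i j
  have hG : Measurable fun s => grandAvg g h (resid x m (ω s).1 (y s)) :=
    Measurable.avg fun i => Measurable.avg fun j => hr i j
  have l1 : Measurable fun s => lam₁ m (ω s).2 := by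
    unfold lam₁
    fun_prop
  have l2 : Measurable fun s => lam₂ h m (ω s).2 := by
    unfold lam₂
    fun_prop
  have l3 : Measurable fun s => lam₃ g m (ω s).2 := by
    unfold lam₃
    fun_prop
  have l4 : Measurable fun s => lam₄ g h m (ω s).2 := by
    unfold lam₄
    fun_prop
  have mα : ∀ i, Measurable fun s => blupα x g h m (ω s) (y s) i - α i s := fun i => by
    have := hm (.inl i)
    simp only [allEffects, Sum.elim_inl] at this
    unfold blupα
    fun_prop
  have mβ : ∀ j, Measurable fun s => blupβ x g h m (ω s) (y s) j - β j s := fun j => by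
    have := hm (.inr (.inl j))
    simp only [allEffects, Sum.elim_inl, Sum.elim_inr] at this
    unfold blupβ
    fun_prop
  have mγ : ∀ i j, Measurable fun s => blupγ x g h m (ω s) (y s) i j - γ i j s := fun i j => by
    have := hm (.inr (.inr (.inl (i, j))))
    simp only [allEffects, Sum.elim_inl, Sum.elim_inr] at this
    unfold blupγ
    fun_prop
  refine (WithLp.measurable_toLp 2 _).comp (measurable_pi_lambda _ fun r => ?_)
  rcases r with (r | r) | r <;> fin_cases r
  · exact mα i
  · exact mα i'
  · exact mβ j
  · exact mβ j'
  · exact mγ i j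
  · exact mγ i' j
  · exact mγ i j'
  · exact mγ i' j'

lemma measurable_leadVec {za : ℕ → EuclideanSpace ℝ (Fin pa)} {zb : ℕ → EuclideanSpace ℝ (Fin pb)}
    {a : ℕ → Fin pa → ℝ} {b : ℕ → Fin pb → ℝ} (hm : ∀ c, Measurable (allEffects α β γ e c))
    (i i' j j' R G H M : ℕ) : Measurable (leadVec za zb a b α β γ e i i' j j' R G H M) := by
  have mγ : ∀ i j, Measurable (γ i j) := fun i j => hm (.inr (.inr (.inl (i, j))))
  have mα : ∀ i, Measurable (leadα za (a i) α γ G H i) := fun i =>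
    (Measurable.avg fun j => mγ i j).sub (Measurable.avg fun s => (hm (.inl s)).const_mul _)
  have mβ : ∀ j, Measurable (leadα zb (b j) β (fun j i => γ i j) H G j) := fun j =>
    (Measurable.avg fun i => mγ i j).sub (Measurable.avg fun s => (hm (.inr (.inl s))).const_mul _)
  have mg : ∀ i j, Measurable (leadγ γ e G H M i j) := fun i j =>
    ((Measurable.avg fun k => hm (.inr (.inr (.inr (i, j, k))))).sub
      (Measurable.avg fun j => mγ i j)).sub (Measurable.avg fun i => mγ i j)
  unfold leadVec
  refine Measurable.fun_const_smul ((WithLp.measurable_toLp 2 _).comp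
    (measurable_pi_lambda _ fun r => ?_)) _
  rcases r with (r | r) | r <;> fin_cases r
  · exact mα i
  · exact mα i'
  · exact mβ j
  · exact mβ j'
  · exact mg i j
  · exact mg i' j
  · exact mg i j'
  · exact mg i' j'

lemma measurable_response {ξ : FixedIdx pa pb pab pw → ℝ}
    (hm : ∀ c, Measurable (allEffects α β γ e c)) (i j k : ℕ) :
    Measurable fun s => response x ξ α β γ e s i j k :=
  ((((measurable_const (a := regMean x ξ i j k)).add (hm (.inl i))).add (hm (.inr (.inl j)))).add
    (hm (.inr (.inr (.inl (i, j)))))).add (hm (.inr (.inr (.inr (i, j, k)))))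

lemma measurable_table (hy : ∀ i j k, Measurable fun s => y s i j k) (g h m : ℕ) :
    Measurable fun s => table g h m (y s) :=
  measurable_pi_lambda _ fun _ => hy _ _ _

end PredError

section Conclusion

variable {S : Type*} [MeasurableSpace S] {P : Measure S} [IsProbabilityMeasure P]
  {pa pb pab pw : ℕ} {x : Covariates pa pb pab pw} {ω₀ : Param pa pb pab pw}
  {α β : ℕ → S → ℝ} {γ : ℕ → ℕ → S → ℝ} {e : ℕ → ℕ → ℕ → S → ℝ}
  {g h m r : ℕ → ℕ} {η η₁ η₂ : ℝ≥0∞} {κ₁ κ₂ κ₃ : ℝ}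

lemma IsScale.nonneg (hr : IsScale r g h m κ₁ κ₂ κ₃) : 0 ≤ κ₁ ∧ 0 ≤ κ₂ ∧ 0 ≤ κ₃ :=
  ⟨ge_of_tendsto' hr.div_g fun N => by positivity, ge_of_tendsto' hr.div_h fun N => by positivity,
    ge_of_tendsto' hr.div_m fun N => by positivity⟩

/-- The limiting distribution of the prediction errors of the empirical best linear unbiased
predictors, for the normalisation by the square root of a sequence `r`. -/
theorem RegularityConditions.convergesToNormal_predError
    (hB : RegularityConditions x P ω₀ α β γ e g h m η η₁ η₂) (hr : IsScale r g h m κ₁ κ₂ κ₃)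
    {ω : ℕ → S → Param pa pb pab pw} (hω : ∀ N, Measurable (ω N))
    (hv : IsGLSError P x ω₀ α β γ e g h m (fun q => (ω q.1 q.2).2) (fun q => (ω q.1 q.2).1 - ω₀.1))
    {ca : EuclideanSpace ℝ (Fin pa)} {cb : EuclideanSpace ℝ (Fin pb)}
    (hca : Tendsto (fun n => avg n x.a) atTop (𝓝 ca))
    (hcb : Tendsto (fun n => avg n x.b) atTop (𝓝 cb))
    {D₁ : Matrix (Fin pa) (Fin pa) ℝ} {D₂ : Matrix (Fin pb) (Fin pb) ℝ}
    (hD₁ : Tendsto (fun n => avg n (fun i => outer (ctr n x.a i).ofLp)) atTop (𝓝 D₁))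
    (hD₂ : Tendsto (fun n => avg n (fun j => outer (ctr n x.b j).ofLp)) atTop (𝓝 D₂))
    {i i' j j' : ℕ} (hne : i ≠ i') (hne' : j ≠ j') :
    ConvergesToNormal P (fun N s => √(r N : ℝ) • predError x (g N) (h N) (m N) (ω N s)
        (response x ω₀.1 α β γ e s) α β γ i i' j j' s)
      (limitCov κ₁ κ₂ κ₃ ω₀.2 (leverage x.a ca D₁) (leverage x.b cb D₂) i i' j j') := by
  obtain ⟨n1, n2, n3⟩ := hr.nonneg
  have p₁ := hB.posDef_D₁ hD₁
  have p₂ := hB.posDef_D₂ hD₂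
  have d₁ := p₁.det_pos.ne'.isUnit
  have d₂ := p₂.det_pos.ne'.isUnit
  refine convergesToNormal_of_charFun
    (limitCov_posSemidef n1 n2 n3 (fun k => (hB.var_pos k).le) p₁ p₂)
    (fun N => (measurable_predError (measurable_response hB.measurable) (hω N) hB.measurable
      (g N) (h N) (m N) i i' j j').fun_const_smul _)
    (fun N => measurable_leadVec (za := x.a) (zb := x.b) (a := stdCov x.a ca D₁)
      (b := stdCov x.b cb D₂) hB.measurable i i' j j' (r N) (g N) (h N) (m N)) ?_
    (fun t => hB.tendsto_charFun_leadVec hr hD₁ hD₂ hne hne' t)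
  have tα := hB.tendsto_predError_α (ω := fun q => ω q.1 q.2) hv hr d₁ hD₁ hca
  have tβ := hB.tendsto_predError_β (ω := fun q => ω q.1 q.2) hv hr d₂ hD₂ hcb
  have tγ := hB.tendsto_predError_γ (ω := fun q => ω q.1 q.2) hv hr
  intro k
  rcases k with (k | k) | k <;> fin_cases k
  · exact tα i
  · exact tα i'
  · exact tβ j
  · exact tβ j'
  · exact tγ i j
  · exact tγ i' j
  · exact tγ i j'
  · exact tγ i' j'

end Conclusion

/-! ### The normalisations -/

section Scales

lemma tendsto_mul_inv_toReal {r n : ℕ → ℕ} {κ : ℝ≥0∞} (hκ : κ ≠ ∞)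
    (h : Tendsto (fun N => (r N : ℝ≥0∞) / (n N : ℝ≥0∞)) atTop (𝓝 κ)) :
    Tendsto (fun N => (r N : ℝ) * (n N : ℝ)⁻¹) atTop (𝓝 κ.toReal) := by
  refine ((ENNReal.tendsto_toReal hκ).comp h).congr fun N => ?_
  simp [div_eq_mul_inv]

lemma tendsto_inv_div {r n : ℕ → ℕ} {κ : ℝ≥0∞} (hr : Tendsto r atTop atTop)
    (h : Tendsto (fun N => (r N : ℝ≥0∞) / (n N : ℝ≥0∞)) atTop (𝓝 κ)) :
    Tendsto (fun N => (n N : ℝ≥0∞) / (r N : ℝ≥0∞)) atTop (𝓝 κ⁻¹) := by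
  refine (tendsto_inv_iff.2 h).congr' ?_
  filter_upwards [hr.eventually_ge_atTop 1] with N hN
  rw [ENNReal.inv_div (Or.inl (ENNReal.natCast_ne_top _))
    (Or.inr (by simpa using Nat.one_le_iff_ne_zero.1 hN))]

lemma tendsto_mul_inv_self {r : ℕ → ℕ} (hr : Tendsto r atTop atTop) :
    Tendsto (fun N => (r N : ℝ) * (r N : ℝ)⁻¹) atTop (𝓝 1) := by
  refine tendsto_const_nhds.congr' ?_
  filter_upwards [hr.eventually_ge_atTop 1] with N hN
  rw [mul_inv_cancel₀]
  exact_mod_cast Nat.one_le_iff_ne_zero.1 hN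

variable {S : Type*} [MeasurableSpace S] {P : Measure S}
  {pa pb pab pw : ℕ} {x : Covariates pa pb pab pw} {ω₀ : Param pa pb pab pw}
  {α β : ℕ → S → ℝ} {γ : ℕ → ℕ → S → ℝ} {e : ℕ → ℕ → ℕ → S → ℝ}
  {g h m : ℕ → ℕ} {η η₁ η₂ : ℝ≥0∞}

namespace RegularityConditions

variable (hB : RegularityConditions x P ω₀ α β γ e g h m η η₁ η₂)

include hB

lemma isScale_row (h₁ : η < ∞) (h₂ : η₁ < ∞) : IsScale g g h m 1 η.toReal η₁.toReal where
  top := hB.g_top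
  div_g := tendsto_mul_inv_self hB.g_top
  div_h := tendsto_mul_inv_toReal h₁.ne hB.g_div_h
  div_m := tendsto_mul_inv_toReal h₂.ne hB.g_div_m

lemma isScale_col (h₁ : 0 < η) (h₂ : η₂ < ∞) : IsScale h g h m η⁻¹.toReal 1 η₂.toReal where
  top := hB.h_top
  div_g := tendsto_mul_inv_toReal (by simpa using h₁.ne') (tendsto_inv_div hB.g_top hB.g_div_h)
  div_h := tendsto_mul_inv_self hB.h_top
  div_m := tendsto_mul_inv_toReal h₂.ne hB.h_div_m

lemma isScale_rep (h₁ : 0 < η₁) (h₂ : 0 < η₂) : IsScale m g h m η₁⁻¹.toReal η₂⁻¹.toReal 1 where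
  top := hB.m_top
  div_g := tendsto_mul_inv_toReal (by simpa using h₁.ne') (tendsto_inv_div hB.g_top hB.g_div_m)
  div_h := tendsto_mul_inv_toReal (by simpa using h₂.ne') (tendsto_inv_div hB.h_top hB.h_div_m)
  div_m := tendsto_mul_inv_self hB.m_top

end RegularityConditions

end Scales

/-! ### The sums of squares of the strata -/

section StrataOrders

variable {g h m : ℕ}

/-- The number of replicates of the effects of each type. -/
noncomputable def numEff (g h m : ℕ) : Fin 4 → ℝ := ![g, h, g * h, g * h * m]

/-- The strata, other than `k.succ`, whose variance depends on the `k`-th variance component. -/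
def lowerStrata : Fin 4 → Finset (Fin 5) := ![{0}, {0}, {0, 1, 2}, {0, 1, 2, 3}]

/-- The sum of the reciprocals of the sizes of a table. -/
noncomputable def invSize (g h m : ℕ) : ℝ := (g : ℝ)⁻¹ + (h : ℝ)⁻¹ + (m : ℝ)⁻¹

/-- The part of the normalised variance of the stratum `k.succ` which does not come from the
`k`-th variance component. -/
noncomputable def excess (g h m : ℕ) (θ : VarComp) : Fin 4 → ℝ :=
  ![θ 2 * (h : ℝ)⁻¹ + θ 3 * ((h : ℝ)⁻¹ * (m : ℝ)⁻¹), θ 2 * (g : ℝ)⁻¹ + θ 3 * ((g : ℝ)⁻¹ * (m : ℝ)⁻¹),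
    θ 3 * (m : ℝ)⁻¹, 0]

lemma invSize_nonneg : 0 ≤ invSize g h m := by
  unfold invSize
  positivity

lemma numEff_pos (hg : g ≠ 0) (hh : h ≠ 0) (hm : m ≠ 0) (k : Fin 4) : 0 < numEff g h m k := by
  fin_cases k <;> simp [numEff] <;> positivity

lemma lam_update (θ : VarComp) (k : Fin 4) (t : ℝ) {b : Fin 5} (hb : b ≠ k.succ)
    (hb' : b ∉ lowerStrata k) : lam g h m (Function.update θ k t) b = lam g h m θ b := by
  fin_cases k <;> fin_cases b <;> simp [lowerStrata, lam, lam₁, lam₂, lam₃, lam₄] at hb hb' ⊢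

lemma lam_single_of_notMem (k : Fin 4) (t : ℝ) {b : Fin 5} (hb : b ≠ k.succ)
    (hb' : b ∉ lowerStrata k) : lam g h m (Pi.single k t) b = 0 := by
  fin_cases k <;> fin_cases b <;> simp [lowerStrata, lam, lam₁, lam₂, lam₃, lam₄] at hb hb' ⊢

lemma lam_single_mul (k : Fin 4) (t : ℝ) {b : Fin 5} (hb : b ∈ lowerStrata k) :
    lam g h m (Pi.single k t) b * numEff g h m k = g * h * m * t := by
  fin_cases k <;> fin_cases b <;>
    simp [lowerStrata, lam, lam₁, lam₂, lam₃, lam₄, numEff] at hb ⊢ <;> ring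

lemma lam_succ_mul (hg : g ≠ 0) (hh : h ≠ 0) (hm : m ≠ 0) (θ : VarComp) (k : Fin 4) :
    lam g h m θ k.succ * numEff g h m k = g * h * m * (θ k + excess g h m θ k) := by
  have hg' : (g : ℝ) ≠ 0 := by exact_mod_cast hg
  have hh' : (h : ℝ) ≠ 0 := by exact_mod_cast hh
  have hm' : (m : ℝ) ≠ 0 := by exact_mod_cast hm
  fin_cases k <;> simp [lam, lam₁, lam₂, lam₃, numEff, excess] <;> field_simp <;> ring

lemma excess_update (θ : VarComp) (k : Fin 4) (t : ℝ) :
    excess g h m (Function.update θ k t) k = excess g h m θ k := by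
  fin_cases k <;> simp [excess]

lemma inv_natCast_le_one (n : ℕ) : (n : ℝ)⁻¹ ≤ 1 := by
  rcases Nat.eq_zero_or_pos n with rfl | hn
  · simp
  · exact inv_le_one_of_one_le₀ (by exact_mod_cast hn)

lemma excess_nonneg {θ : VarComp} (hθ : ∀ k, 0 ≤ θ k) (k : Fin 4) : 0 ≤ excess g h m θ k := by
  have h2 := hθ 2
  have h3 := hθ 3
  fin_cases k <;> simp [excess] <;> positivity

lemma excess_le {θ : VarComp} (hθ : ∀ k, 0 ≤ θ k) (k : Fin 4) :
    excess g h m θ k ≤ invSize g h m * (θ 2 + θ 3) := by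
  have h2 := hθ 2
  have h3 := hθ 3
  have g0 : (0 : ℝ) ≤ (g : ℝ)⁻¹ := by positivity
  have h0 : (0 : ℝ) ≤ (h : ℝ)⁻¹ := by positivity
  have m0 : (0 : ℝ) ≤ (m : ℝ)⁻¹ := by positivity
  have k1 := mul_le_of_le_one_right h0 (inv_natCast_le_one m)
  have k2 := mul_le_of_le_one_right g0 (inv_natCast_le_one m)
  fin_cases k <;> simp [excess, invSize] <;> nlinarith [mul_nonneg h2 g0, mul_nonneg h2 h0,
    mul_nonneg h2 m0, mul_nonneg h3 g0, mul_nonneg h3 h0, mul_nonneg h3 m0]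

lemma stratDim_nonneg (hg : g ≠ 0) (hh : h ≠ 0) (hm : m ≠ 0) (b : Fin 5) :
    0 ≤ stratDim g h m b := by
  have g1 : (1 : ℝ) ≤ g := by exact_mod_cast Nat.one_le_iff_ne_zero.2 hg
  have h1 : (1 : ℝ) ≤ h := by exact_mod_cast Nat.one_le_iff_ne_zero.2 hh
  have m1 : (1 : ℝ) ≤ m := by exact_mod_cast Nat.one_le_iff_ne_zero.2 hm
  have k1 := mul_nonneg (sub_nonneg.2 g1) (sub_nonneg.2 h1)
  have k2 : 0 ≤ (g : ℝ) * h * (m - 1) := mul_nonneg (by positivity) (sub_nonneg.2 m1)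
  fin_cases b <;> simp only [stratDim, Fin.reduceFinMk, Fin.zero_eta, Fin.mk_one, Fin.isValue,
    Matrix.cons_val_zero, Matrix.cons_val_one, Matrix.cons_val] <;> linarith

lemma stratDim_le_of_mem (hg : g ≠ 0) (hh : h ≠ 0) (hm : m ≠ 0) {k : Fin 4} {b : Fin 5}
    (hb : b ∈ lowerStrata k) : stratDim g h m b ≤ invSize g h m * numEff g h m k := by
  have g1 : (1 : ℝ) ≤ g := by exact_mod_cast Nat.one_le_iff_ne_zero.2 hg
  have h1 : (1 : ℝ) ≤ h := by exact_mod_cast Nat.one_le_iff_ne_zero.2 hh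
  have m1 : (1 : ℝ) ≤ m := by exact_mod_cast Nat.one_le_iff_ne_zero.2 hm
  have g0 : (g : ℝ) ≠ 0 := by positivity
  have h0 : (h : ℝ) ≠ 0 := by positivity
  have m0 : (m : ℝ) ≠ 0 := by positivity
  have gh : (g : ℝ) ≤ g * h := le_mul_of_one_le_right (by positivity) h1
  have hg' : (h : ℝ) ≤ g * h := le_mul_of_one_le_left (by positivity) g1
  have gm : (g : ℝ) ≤ g * m := le_mul_of_one_le_right (by positivity) m1
  have hm' : (h : ℝ) ≤ h * m := le_mul_of_one_le_right (by positivity) m1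
  have q1 : invSize g h m * (g * h * m) = h * m + g * m + g * h := by
    unfold invSize
    field_simp
  have q2 : invSize g h m * (g * h) = h + g + g * h * (m : ℝ)⁻¹ := by
    unfold invSize
    field_simp
  have q3 : invSize g h m * g = 1 + g * (h : ℝ)⁻¹ + g * (m : ℝ)⁻¹ := by
    unfold invSize
    field_simp
  have q4 : invSize g h m * h = h * (g : ℝ)⁻¹ + 1 + h * (m : ℝ)⁻¹ := by
    unfold invSize
    field_simp
  have p1 : (0 : ℝ) ≤ g * (h : ℝ)⁻¹ := by positivity
  have p2 : (0 : ℝ) ≤ g * (m : ℝ)⁻¹ := by positivity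
  have p3 : (0 : ℝ) ≤ h * (g : ℝ)⁻¹ := by positivity
  have p4 : (0 : ℝ) ≤ h * (m : ℝ)⁻¹ := by positivity
  have p5 : (0 : ℝ) ≤ g * h * (m : ℝ)⁻¹ := by positivity
  fin_cases k <;> fin_cases b <;> simp [lowerStrata] at hb <;>
    simp [stratDim, numEff, q1, q2, q3, q4] <;> linarith

lemma stratDim_succ_le (hg : g ≠ 0) (hh : h ≠ 0) (hm : m ≠ 0) (k : Fin 4) :
    (1 - invSize g h m) * numEff g h m k ≤ stratDim g h m k.succ ∧
      stratDim g h m k.succ ≤ numEff g h m k := by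
  have g1 : (1 : ℝ) ≤ g := by exact_mod_cast Nat.one_le_iff_ne_zero.2 hg
  have h1 : (1 : ℝ) ≤ h := by exact_mod_cast Nat.one_le_iff_ne_zero.2 hh
  have m1 : (1 : ℝ) ≤ m := by exact_mod_cast Nat.one_le_iff_ne_zero.2 hm
  have g0 : (g : ℝ) ≠ 0 := by positivity
  have h0 : (h : ℝ) ≠ 0 := by positivity
  have m0 : (m : ℝ) ≠ 0 := by positivity
  have q1 : (1 - invSize g h m) * (g * h * m) = g * h * m - h * m - g * m - g * h := by
    unfold invSize
    field_simp
    ring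
  have q2 : (1 - invSize g h m) * (g * h) = g * h - h - g - g * h * (m : ℝ)⁻¹ := by
    unfold invSize
    field_simp
    ring
  have q3 : (1 - invSize g h m) * g = g - 1 - g * (h : ℝ)⁻¹ - g * (m : ℝ)⁻¹ := by
    unfold invSize
    field_simp
    ring
  have q4 : (1 - invSize g h m) * h = h - h * (g : ℝ)⁻¹ - 1 - h * (m : ℝ)⁻¹ := by
    unfold invSize
    field_simp
    ring
  have p1 : (0 : ℝ) ≤ g * (h : ℝ)⁻¹ := by positivity
  have p2 : (0 : ℝ) ≤ g * (m : ℝ)⁻¹ := by positivity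
  have p3 : (0 : ℝ) ≤ h * (g : ℝ)⁻¹ := by positivity
  have p4 : (0 : ℝ) ≤ h * (m : ℝ)⁻¹ := by positivity
  have p5 : (0 : ℝ) ≤ g * h * (m : ℝ)⁻¹ := by positivity
  have p6 : (0 : ℝ) ≤ h * m := by positivity
  have p7 : (0 : ℝ) ≤ g * m := by positivity
  have p8 : (0 : ℝ) ≤ g * h := by positivity
  fin_cases k <;> simp [stratDim, numEff, q1, q2, q3, q4] <;> first | constructor | skip
  all_goals linarith

end StrataOrders

section BilinearForms

variable {g h m : ℕ} {z z' : ℕ → ℕ → ℕ → ℝ}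

lemma stratForm_add_self (b : Fin 5) : stratForm g h m b (z + z') (z + z')
    = stratForm g h m b z z + 2 * stratForm g h m b z z' + stratForm g h m b z' z' := by
  have h1 := stratForm_comm (g := g) (h := h) (m := m) (z := z') (z' := z) b
  unfold stratForm at *
  rw [show table g h m (z + z') = table g h m z + table g h m z' from rfl, Matrix.mulVec_add,
    dotProduct_add, add_dotProduct, add_dotProduct, h1]
  ring

lemma stratForm_sq_le (b : Fin 5) : stratForm g h m b z z' ^ 2
    ≤ stratForm g h m b z z * stratForm g h m b z' z' := by
  unfold stratForm
  rw [dotProduct_strat_mulVec, dotProduct_strat_mulVec _ (table g h m z) (table g h m z),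
    dotProduct_strat_mulVec _ (table g h m z') (table g h m z')]
  simp only [dotProduct]
  refine (Finset.sum_mul_sq_le_sq_mul_sq _ _ _).trans (le_of_eq ?_)
  simp only [sq]

lemma sum_stratForm : ∑ b, stratForm g h m b z z
    = ∑ i ∈ Finset.range g, ∑ j ∈ Finset.range h, ∑ k ∈ Finset.range m, z i j k ^ 2 := by
  simp only [stratForm]
  rw [← dotProduct_sum, ← Matrix.sum_mulVec, (strat_idem g h m).complete, Matrix.one_mulVec,
    ← sum_obs (fun i j k => z i j k ^ 2), dotProduct]
  simp only [sq]
  rfl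

end BilinearForms

section MeanSquares

variable {S : Type*} [MeasurableSpace S] {P : Measure S} [IsProbabilityMeasure P]
  {pa pb pab pw : ℕ} {x : Covariates pa pb pab pw} {ω₀ : Param pa pb pab pw}
  {α β : ℕ → S → ℝ} {γ : ℕ → ℕ → S → ℝ} {e : ℕ → ℕ → ℕ → S → ℝ}
  {g h m : ℕ → ℕ} {η η₁ η₂ : ℝ≥0∞}

namespace RegularityConditions

variable (hB : RegularityConditions x P ω₀ α β γ e g h m η η₁ η₂)

include hB

lemma integrable_stratForm (κ : Fin 4 → ℝ) (G H M : ℕ) (b : Fin 5) : Integrable (fun s =>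
    stratForm G H M b (randPart κ α β γ e s) (randPart κ α β γ e s)) P :=
  hB.integrable_quadForm κ _

lemma integral_stratForm (κ : Fin 4 → ℝ) {G H M : ℕ} (hG : G ≠ 0) (hH : H ≠ 0) (hM : M ≠ 0)
    (b : Fin 5) : ∫ s, stratForm G H M b (randPart κ α β γ e s) (randPart κ α β γ e s) ∂P
      = stratDim G H M b * lam G H M (fun k => κ k ^ 2 * ω₀.2 k) b := by
  have h2 : ∀ θ, strat G H M b * V G H M θ = lam G H M θ b • strat G H M b := by
    intro θ
    rw [V_eq_sum, Finset.mul_sum, Finset.sum_eq_single b]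
    · rw [mul_smul_comm, (strat_idem G H M).idem b]
    · intro b' _ hb
      rw [mul_smul_comm, (strat_idem G H M).ortho hb.symm, smul_zero]
    · simp
  simp only [stratForm]
  rw [hB.integral_quadForm, h2, Matrix.trace_smul, trace_strat hG hH hM, smul_eq_mul, mul_comm]

omit [IsProbabilityMeasure P] in
lemma tendsto_invSize : Tendsto (fun N => invSize (g N) (h N) (m N)) atTop (𝓝 0) := by
  simpa [invSize] using ((tendsto_inv_natCast hB.g_top).add (tendsto_inv_natCast hB.h_top)).add
    (tendsto_inv_natCast hB.m_top)

/-- The sums of squares of the lower strata are negligible. -/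
lemma tendsto_lowerStrata {k : Fin 4} {b : Fin 5} (hb : b ∈ lowerStrata k) :
    Tendsto (fun q : ℕ × S => (numEff (g q.1) (h q.1) (m q.1) k)⁻¹ *
      ((lam (g q.1) (h q.1) (m q.1) ω₀.2 b)⁻¹ * stratForm (g q.1) (h q.1) (m q.1) b
        (noise α β γ e q.2) (noise α β γ e q.2))) (probFilter P) (𝓝 0) := by
  have hl := fun N => lam_pos (g := g N) (h := h N) (m := m N) hB.var_pos b
  have hn : ∀ N, 0 ≤ numEff (g N) (h N) (m N) k := fun N => by
    fin_cases k <;> simp [numEff] <;> positivity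
  refine tendsto_probFilter_of_integral (X := fun N s => (numEff (g N) (h N) (m N) k)⁻¹ *
    ((lam (g N) (h N) (m N) ω₀.2 b)⁻¹ * stratForm (g N) (h N) (m N) b
        (noise α β γ e s) (noise α β γ e s))) (fun N s => ?_) (fun N => ?_) ?_
  · exact mul_nonneg (inv_nonneg.2 (hn N)) (mul_nonneg (inv_pos.2 (hl N)).le (stratForm_nonneg _ _))
  · exact ((hB.integrable_stratForm _ _ _ _ _).const_mul _).const_mul _
  · refine squeeze_zero' (Eventually.of_forall fun N => integral_nonneg fun s => mul_nonneg
      (inv_nonneg.2 (hn N)) (mul_nonneg (inv_pos.2 (hl N)).le (stratForm_nonneg _ _))) ?_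
      hB.tendsto_invSize
    filter_upwards [hB.eventually_sizes_ne_zero] with N ⟨h1, h2, h3⟩
    rw [integral_const_mul, integral_const_mul, hB.integral_stratForm _ h1 h2 h3]
    simp only [one_pow, one_mul]
    rw [mul_comm (stratDim _ _ _ _), inv_mul_cancel_left₀ (hl N).ne',
      inv_mul_le_iff₀ (numEff_pos h1 h2 h3 k), mul_comm]
    exact stratDim_le_of_mem h1 h2 h3 hb

lemma tendsto_sum_stratForm_single (k : Fin 4) :
    Tendsto (fun q : ℕ × S => ((g q.1 : ℝ) * h q.1 * m q.1)⁻¹ *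
      ∑ b, stratForm (g q.1) (h q.1) (m q.1) b (randPart (Pi.single k 1) α β γ e q.2)
        (randPart (Pi.single k 1) α β γ e q.2)) (probFilter P) (𝓝 (ω₀.2 k)) := by
  have hgh := hB.g_top.atTop_mul_atTop₀ hB.h_top
  have hghm := hgh.atTop_mul_atTop₀ hB.m_top
  have key : ∀ T : ℕ → Finset EffIdx, (∀ N, ∀ c ∈ T N, effType c = k) →
      Tendsto (fun N => (T N).card) atTop atTop →
      (∀ N s, g N ≠ 0 → h N ≠ 0 → m N ≠ 0 →
        (g N * h N * m N : ℝ) * ∑ c ∈ T N, allEffects α β γ e c s ^ 2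
          = (T N).card * ∑ b, stratForm (g N) (h N) (m N) b (randPart (Pi.single k 1) α β γ e s)
            (randPart (Pi.single k 1) α β γ e s)) →
      Tendsto (fun q : ℕ × S => ((g q.1 : ℝ) * h q.1 * m q.1)⁻¹ *
        ∑ b, stratForm (g q.1) (h q.1) (m q.1) b (randPart (Pi.single k 1) α β γ e q.2)
          (randPart (Pi.single k 1) α β γ e q.2)) (probFilter P) (𝓝 (ω₀.2 k)) := by
    intro T hT hc hs
    refine (hB.tendsto_sum_sq k T hT hc).congr' ?_
    filter_upwards [eventually_fst_probFilter hB.eventually_sizes_ne_zero,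
      eventually_fst_probFilter (hc.eventually_gt_atTop 0)] with q ⟨h1, h2, h3⟩ h4
    have h5 := hs q.1 q.2 h1 h2 h3
    have h4' : ((T q.1).card : ℝ) ≠ 0 := by exact_mod_cast h4.ne'
    have h6 : (g q.1 * h q.1 * m q.1 : ℝ) ≠ 0 := by positivity
    rw [inv_mul_eq_div, inv_mul_eq_div, div_eq_div_iff h4' h6, mul_comm, h5, mul_comm]
  fin_cases k
  · refine key (fun N => (Finset.range (g N)).map ⟨Sum.inl, Sum.inl_injective⟩) ?_ ?_ ?_
    · intro N c hc
      obtain ⟨s, -, rfl⟩ := Finset.mem_map.1 hc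
      rfl
    · simpa using hB.g_top
    · intro N s h1 h2 h3
      rw [sum_stratForm]
      simp [randPart, allEffects, ← Finset.mul_sum]
      ring
  · refine key (fun N => (Finset.range (h N)).map
      ⟨fun j => .inr (.inl j), Sum.inr_injective.comp Sum.inl_injective⟩) ?_ ?_ ?_
    · intro N c hc
      obtain ⟨s, -, rfl⟩ := Finset.mem_map.1 hc
      rfl
    · simpa using hB.h_top
    · intro N s h1 h2 h3
      rw [sum_stratForm]
      simp [randPart, allEffects, ← Finset.mul_sum]
      ring
  · refine key (fun N => (Finset.range (g N) ×ˢ Finset.range (h N)).map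
      ⟨fun c => .inr (.inr (.inl c)),
        Sum.inr_injective.comp (Sum.inr_injective.comp Sum.inl_injective)⟩) ?_ ?_ ?_
    · intro N c hc
      obtain ⟨s, -, rfl⟩ := Finset.mem_map.1 hc
      rfl
    · simpa using hgh
    · intro N s h1 h2 h3
      rw [sum_stratForm]
      simp [randPart, allEffects, ← Finset.mul_sum, Finset.sum_product]
      ring
  · refine key (fun N => (Finset.range (g N) ×ˢ Finset.range (h N) ×ˢ Finset.range (m N)).map
      ⟨fun c => .inr (.inr (.inr c)),
        Sum.inr_injective.comp (Sum.inr_injective.comp Sum.inr_injective)⟩) ?_ ?_ ?_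
    · intro N c hc
      obtain ⟨s, -, rfl⟩ := Finset.mem_map.1 hc
      rfl
    · simpa [mul_assoc] using hghm
    · intro N s h1 h2 h3
      rw [sum_stratForm]
      simp only [Finset.sum_map, Function.Embedding.coeFn_mk, allEffects, Sum.elim_inr,
        Finset.sum_product, Finset.card_map, Finset.card_product, Finset.card_range, randPart]
      simp [mul_assoc]

lemma tendsto_stratForm_single_of_ne {k : Fin 4} {b : Fin 5} (hb : b ≠ k.succ) :
    Tendsto (fun q : ℕ × S => ((g q.1 : ℝ) * h q.1 * m q.1)⁻¹ *
      stratForm (g q.1) (h q.1) (m q.1) b (randPart (Pi.single k 1) α β γ e q.2)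
        (randPart (Pi.single k 1) α β γ e q.2)) (probFilter P) (𝓝 0) := by
  refine tendsto_probFilter_of_integral (X := fun N s => ((g N : ℝ) * h N * m N)⁻¹ *
    stratForm (g N) (h N) (m N) b (randPart (Pi.single k 1) α β γ e s)
        (randPart (Pi.single k 1) α β γ e s)) (fun N s => ?_) (fun N => ?_) ?_
  · exact mul_nonneg (by positivity) (stratForm_nonneg _ _)
  · exact (hB.integrable_stratForm _ _ _ _ _).const_mul _
  · have h0 := hB.tendsto_invSize.mul_const (ω₀.2 k)
    rw [zero_mul] at h0
    refine squeeze_zero' (Eventually.of_forall fun N => integral_nonneg fun s => mul_nonneg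
      (by positivity) (stratForm_nonneg _ _)) ?_ h0
    filter_upwards [hB.eventually_sizes_ne_zero] with N ⟨h1, h2, h3⟩
    rw [integral_const_mul, hB.integral_stratForm _ h1 h2 h3]
    have e1 : (fun r => (Pi.single k (1 : ℝ) : Fin 4 → ℝ) r ^ 2 * ω₀.2 r)
        = Pi.single k (ω₀.2 k) := by
      ext r
      rcases eq_or_ne r k with rfl | hr
      · simp
      · simp [hr]
    rw [e1]
    have hv := (hB.var_pos k).le
    by_cases hl : b ∈ lowerStrata k
    · have e2 := lam_single_mul (g := g N) (h := h N) (m := m N) k (ω₀.2 k) hl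
      have e3 := stratDim_le_of_mem h1 h2 h3 hl
      have e4 := numEff_pos h1 h2 h3 k
      have e5 : (0 : ℝ) < g N * h N * m N := by positivity
      have e6 : lam (g N) (h N) (m N) (Pi.single k (ω₀.2 k)) b
          = g N * h N * m N * ω₀.2 k / numEff (g N) (h N) (m N) k := by
        rw [← e2, mul_div_cancel_right₀ _ e4.ne']
      rw [e6, inv_mul_le_iff₀ e5, mul_div_assoc', div_le_iff₀ e4]
      calc stratDim (g N) (h N) (m N) b * (g N * h N * m N * ω₀.2 k)
          ≤ (invSize (g N) (h N) (m N) * numEff (g N) (h N) (m N) k)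
            * (g N * h N * m N * ω₀.2 k) := by gcongr
        _ = _ := by ring
    · rw [lam_single_of_notMem k _ hb hl, mul_zero, mul_zero]
      exact mul_nonneg invSize_nonneg hv

lemma tendsto_stratForm_rest (k : Fin 4) :
    Tendsto (fun q : ℕ × S => ((g q.1 : ℝ) * h q.1 * m q.1)⁻¹ *
      stratForm (g q.1) (h q.1) (m q.1) k.succ
        (randPart (Function.update (fun _ => 1) k 0) α β γ e q.2)
        (randPart (Function.update (fun _ => 1) k 0) α β γ e q.2)) (probFilter P) (𝓝 0) := by
  refine tendsto_probFilter_of_integral (X := fun N s => ((g N : ℝ) * h N * m N)⁻¹ *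
    stratForm (g N) (h N) (m N) k.succ
        (randPart (Function.update (fun _ => 1) k 0) α β γ e s)
        (randPart (Function.update (fun _ => 1) k 0) α β γ e s)) (fun N s => ?_) (fun N => ?_) ?_
  · exact mul_nonneg (by positivity) (stratForm_nonneg _ _)
  · exact (hB.integrable_stratForm _ _ _ _ _).const_mul _
  · set θ : VarComp := Function.update ω₀.2 k 0 with hθ
    have h0 := hB.tendsto_invSize.mul_const (θ 2 + θ 3)
    rw [zero_mul] at h0
    refine squeeze_zero' (Eventually.of_forall fun N => integral_nonneg fun s => mul_nonneg
      (by positivity) (stratForm_nonneg _ _)) ?_ h0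
    filter_upwards [hB.eventually_sizes_ne_zero] with N ⟨h1, h2, h3⟩
    rw [integral_const_mul, hB.integral_stratForm _ h1 h2 h3]
    have e1 : (fun r => (Function.update (fun _ => (1 : ℝ)) k 0 : Fin 4 → ℝ) r ^ 2 * ω₀.2 r)
        = θ := by
      ext r
      rcases eq_or_ne r k with rfl | hr
      · simp [hθ]
      · simp [hθ, hr]
    have hθ0 : ∀ r, 0 ≤ θ r := by
      intro r
      rcases eq_or_ne r k with rfl | hr
      · simp [hθ]
      · simpa [hθ, hr] using (hB.var_pos r).le
    rw [e1]
    have e2 := lam_succ_mul h1 h2 h3 θ k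
    rw [show θ k = 0 by simp [hθ], zero_add] at e2
    have e3 := stratDim_succ_le h1 h2 h3 k
    have e4 := numEff_pos h1 h2 h3 k
    have e5 : (0 : ℝ) < g N * h N * m N := by positivity
    have e6 : lam (g N) (h N) (m N) θ k.succ
        = g N * h N * m N * excess (g N) (h N) (m N) θ k / numEff (g N) (h N) (m N) k := by
      rw [← e2, mul_div_cancel_right₀ _ e4.ne']
    have e7 := excess_nonneg (g := g N) (h := h N) (m := m N) hθ0 k
    have e8 := excess_le (g := g N) (h := h N) (m := m N) hθ0 k
    refine le_trans ?_ e8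
    rw [e6, inv_mul_le_iff₀ e5, mul_div_assoc', div_le_iff₀ e4, mul_comm]
    gcongr
    exact e3.2

/-- The normalised sum of squares of the stratum `k.succ` estimates the `k`-th variance
component. -/
lemma tendsto_stratForm_succ (k : Fin 4) :
    Tendsto (fun q : ℕ × S => ((g q.1 : ℝ) * h q.1 * m q.1)⁻¹ *
      stratForm (g q.1) (h q.1) (m q.1) k.succ (noise α β γ e q.2) (noise α β γ e q.2))
      (probFilter P) (𝓝 (ω₀.2 k)) := by
  have t1 : Tendsto (fun q : ℕ × S => ((g q.1 : ℝ) * h q.1 * m q.1)⁻¹ *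
      stratForm (g q.1) (h q.1) (m q.1) k.succ (randPart (Pi.single k 1) α β γ e q.2)
        (randPart (Pi.single k 1) α β γ e q.2)) (probFilter P) (𝓝 (ω₀.2 k)) := by
    have h1 := (hB.tendsto_sum_stratForm_single k).sub
      (tendsto_finsetSum (Finset.univ.erase k.succ) fun b hb =>
        hB.tendsto_stratForm_single_of_ne (Finset.ne_of_mem_erase hb))
    rw [Finset.sum_const_zero, sub_zero] at h1
    refine h1.congr fun q => ?_
    rw [← Finset.mul_sum, ← mul_sub, ← Finset.add_sum_erase _ _ (Finset.mem_univ k.succ)]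
    ring
  have t2 := hB.tendsto_stratForm_rest k
  set w := fun q : ℕ × S => randPart (Pi.single k 1) α β γ e q.2
  set r := fun q : ℕ × S => randPart (Function.update (fun _ => 1) k 0) α β γ e q.2
  have t3 : Tendsto (fun q : ℕ × S => ((g q.1 : ℝ) * h q.1 * m q.1)⁻¹ *
      stratForm (g q.1) (h q.1) (m q.1) k.succ (w q) (r q)) (probFilter P) (𝓝 0) := by
    have h1 := (Real.continuous_sqrt.tendsto _).comp (t1.mul t2)
    rw [mul_zero, Real.sqrt_zero] at h1
    refine squeeze_zero_norm (fun q => ?_) h1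
    refine Real.abs_le_sqrt ?_
    rw [mul_pow]
    refine le_of_le_of_eq ?_ (mul_mul_mul_comm _ _ _ _)
    rw [← sq]
    exact mul_le_mul_of_nonneg_left (stratForm_sq_le _) (sq_nonneg _)
  have t4 := (t1.add (t3.const_mul 2)).add t2
  rw [mul_zero, add_zero, add_zero] at t4
  refine t4.congr fun q => ?_
  have e1 : noise α β γ e q.2 = w q + r q := by
    ext i j l
    fin_cases k <;> simp [noise, randPart, w, r] <;> ring
  rw [e1, stratForm_add_self]
  ring

end RegularityConditions

end MeanSquares

/-! ### Monotonicity of the determinant -/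

section DetMono

variable {ι : Type*} [Fintype ι] [DecidableEq ι]

lemma one_le_det_one_add {F : Matrix ι ι ℝ} (hF : F.PosSemidef) : 1 ≤ (1 + F).det := by
  have hH : (1 + F).IsHermitian := Matrix.isHermitian_one.add hF.isHermitian
  rw [hH.det_eq_prod_eigenvalues]
  refine Finset.one_le_prod fun i _ => ?_
  have h1 := hH.eigenvalues_eq i
  have h2 : star (hH.eigenvectorBasis i).ofLp ⬝ᵥ (hH.eigenvectorBasis i).ofLp = 1 := by
    have := hH.eigenvectorBasis.orthonormal.1 i
    have h3 := EuclideanSpace.real_norm_sq_eq (hH.eigenvectorBasis i)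
    rw [this] at h3
    simp only [star_trivial, dotProduct, ← sq]
    rw [← h3, one_pow]
  rw [Matrix.add_mulVec, Matrix.one_mulVec, dotProduct_add, h2] at h1
  have h3 := hF.dotProduct_mulVec_nonneg (hH.eigenvectorBasis i).ofLp
  simp only [RCLike.ofReal_real_eq_id, id_eq, RCLike.re_to_real] at h1 ⊢
  rw [h1]
  linarith

open scoped MatrixOrder in
lemma det_le_det_of_posSemidef_sub {A B : Matrix ι ι ℝ} (hB : B.PosDef) (hAB : (A - B).PosSemidef) :
    B.det ≤ A.det := by
  obtain ⟨C, hC⟩ := CStarAlgebra.nonneg_iff_eq_star_mul_self.1 hB.posSemidef.nonneg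
  rw [Matrix.star_eq_conjTranspose, Matrix.conjTranspose_eq_transpose_of_trivial] at hC
  have hdB : B.det = C.det * C.det := by rw [hC, Matrix.det_mul, Matrix.det_transpose]
  have hu : IsUnit C.det := by
    refine isUnit_iff_ne_zero.2 fun h0 => hB.det_pos.ne' ?_
    rw [hdB, h0, mul_zero]
  have hu' : IsUnit (Cᵀ).det := by rwa [Matrix.det_transpose]
  have hF := hAB.conjTranspose_mul_mul_same C⁻¹
  rw [Matrix.conjTranspose_eq_transpose_of_trivial] at hF
  have hA : A = Cᵀ * (1 + (C⁻¹)ᵀ * (A - B) * C⁻¹) * C := by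
    rw [Matrix.mul_add, Matrix.mul_one, Matrix.add_mul, ← hC, Matrix.transpose_nonsing_inv]
    simp only [Matrix.mul_assoc]
    rw [Matrix.nonsing_inv_mul _ hu, Matrix.mul_one, ← Matrix.mul_assoc,
      Matrix.mul_nonsing_inv _ hu', Matrix.one_mul]
    abel
  rw [hA, Matrix.det_mul, Matrix.det_mul, Matrix.det_transpose, hdB]
  nlinarith [one_le_det_one_add hF, mul_self_nonneg C.det]

end DetMono

/-! ### The criteria and their minimisers -/

lemma sq_sub_one_le {x : ℝ} (hx : 0 < x) (hx3 : x ≤ 3) : (x - 1) ^ 2 / 8 ≤ x - 1 - Real.log x := by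
  have h1 : Real.log x = 2 * Real.log √x := by rw [Real.log_sqrt hx.le]; ring
  have h2 := Real.log_le_sub_one_of_pos (Real.sqrt_pos.2 hx)
  have h3 := Real.sq_sqrt hx.le
  have h4 := Real.sqrt_nonneg x
  set s := √x
  have h5 : s ≤ 9 / 5 := by nlinarith
  have h6 : (s + 1) ^ 2 ≤ 8 := by nlinarith
  have h7 := mul_le_mul_of_nonneg_left h6 (sq_nonneg (s - 1))
  rw [h1, ← h3]
  nlinarith

section Criterion

variable {pa pb pab pw : ℕ} (x : Covariates pa pb pab pw) (g h m : ℕ)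

/-- The criterion functions: minus two times the profile log-likelihood for `τ = 0`, minus two times
the REML criterion for `τ = 1`, up to additive constants. -/
noncomputable def crit (τ : ℝ) (y : Obs g h m → ℝ) (θ : VarComp) : ℝ :=
  Real.log (V g h m θ).det + τ * Real.log (info x g h m θ).det + y ⬝ᵥ (projP x g h m θ *ᵥ y)

variable {x g h m} {θ θ' θ₀ : VarComp}

lemma wForm_gls (hθ : ∀ b, lam g h m θ b ≠ 0) (hM : (info x g h m θ).PosDef) (y : ℕ → ℕ → ℕ → ℝ)
    (w : FixedIdx pa pb pab pw → ℝ) :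
    wForm g h m θ (regMean x w) (y - regMean x (gls x g h m θ (table g h m y))) = 0 := by
  rw [wForm_sub_right, ← info_quadForm hθ, info_mulVec_gls hM, transpose_mulVec_dotProduct,
    design_mulVec, dotProduct_V_inv_mulVec hθ, sub_self]

/-- The profiled weighted residual sum of squares. -/
lemma dotProduct_projP (hθ₀ : ∀ k, 0 < θ₀ k) (hb : θ ∈ box θ₀)
    (hM : ∀ θ : VarComp, (∀ k, 0 < θ k) → (info x g h m θ).PosDef)
    (u : ℕ → ℕ → ℕ → ℝ) (ξ₀ : FixedIdx pa pb pab pw → ℝ) :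
    ∃ c, 0 ≤ c ∧ c ≤ 30 * energyBound x g h m θ₀ (table g h m u) ∧
      table g h m (regMean x ξ₀ + u) ⬝ᵥ (projP x g h m θ *ᵥ table g h m (regMean x ξ₀ + u))
        = wForm g h m θ u u - c := by
  have hθ := box_pos hθ₀ hb
  have hl := fun b => lam_pos (g := g) (h := h) (m := m) hθ b
  set y := regMean x ξ₀ + u
  set v := gls x g h m θ (table g h m y) - ξ₀ with hv
  have h1 := weighted_rss_eq (hM θ hθ) (table g h m y) ξ₀
  have h2 : table g h m y - design x g h m *ᵥ ξ₀ = table g h m u := by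
    rw [design_mulVec]
    ext o
    simp [table, y]
  have h3 : ξ₀ - gls x g h m θ (table g h m y) = -v := by rw [hv]; abel
  rw [h2, dotProduct_V_inv_mulVec fun b => (hl b).ne', h3, Matrix.mulVec_neg, neg_dotProduct_neg,
    info_quadForm fun b => (hl b).ne'] at h1
  refine ⟨_, wForm_nonneg hl (regMean x v), ?_, by rw [h1]; ring⟩
  refine (wForm_regMean_le hθ₀ hb (hM θ₀ hθ₀) (z := u) ?_).1
  have h4 := wForm_gls (fun b => (hl b).ne') (hM θ hθ) y v
  rw [← h4]
  congr 1
  ext i j k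
  simp only [y, hv, regMean_sub, Pi.sub_apply, Pi.add_apply]
  ring

lemma log_det_info_le (hθ₀ : ∀ k, 0 < θ₀ k) (hb : θ ∈ box θ₀) (hb' : θ' ∈ box θ₀)
    (hM : ∀ θ : VarComp, (∀ k, 0 < θ k) → (info x g h m θ).PosDef) :
    Real.log (info x g h m θ').det ≤ Real.log (info x g h m θ).det
      + 2 * Fintype.card (FixedIdx pa pb pab pw) := by
  have hl := fun b => lam_pos (g := g) (h := h) (m := m) (box_pos hθ₀ hb) b
  have hl' := fun b => lam_pos (g := g) (h := h) (m := m) (box_pos hθ₀ hb') b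
  have p1 := hM θ (box_pos hθ₀ hb)
  have p2 := hM θ' (box_pos hθ₀ hb')
  have h1 : ((3 : ℝ) • info x g h m θ - info x g h m θ').PosSemidef := by
    refine Matrix.PosSemidef.of_dotProduct_mulVec_nonneg ?_ fun v => ?_
    · rw [Matrix.IsHermitian, Matrix.conjTranspose_eq_transpose_of_trivial, Matrix.transpose_sub,
        Matrix.transpose_smul, info_transpose, info_transpose]
    · rw [star_trivial, Matrix.sub_mulVec, Matrix.smul_mulVec, dotProduct_sub, dotProduct_smul,
        info_quadForm fun b => (hl b).ne', info_quadForm fun b => (hl' b).ne', smul_eq_mul, wForm,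
        wForm, Finset.mul_sum, ← Finset.sum_sub_distrib]
      refine Finset.sum_nonneg fun b _ => ?_
      rw [← mul_assoc, ← sub_mul]
      refine mul_nonneg (sub_nonneg.2 ?_) (stratForm_nonneg _ _)
      have k1 := (lam_mem_of_box (g := g) (h := h) (m := m) hb b).2
      have k2 := (lam_mem_of_box (g := g) (h := h) (m := m) hb' b).1
      rw [← div_eq_mul_inv, inv_le_iff_one_le_mul₀ (hl' b), mul_comm, mul_div_assoc',
        le_div_iff₀ (hl b)]
      linarith
  have h2 := det_le_det_of_posSemidef_sub p2 h1
  rw [Matrix.det_smul] at h2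
  have h3 := Real.log_le_log p2.det_pos h2
  rw [Real.log_mul (by positivity) p1.det_pos.ne', Real.log_pow] at h3
  have h4 : Real.log 3 ≤ 2 := by
    have := Real.log_le_sub_one_of_pos (by norm_num : (0 : ℝ) < 3)
    linarith
  have h5 := mul_le_mul_of_nonneg_left h4
    (Nat.cast_nonneg (α := ℝ) (Fintype.card (FixedIdx pa pb pab pw)))
  linarith

variable {τ : ℝ}

lemma abs_log_lam_sub_le (hθ₀ : ∀ k, 0 < θ₀ k) (hb : θ ∈ box θ₀) (hb' : θ' ∈ box θ₀) (b : Fin 5) :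
    Real.log (lam g h m θ b) - Real.log (lam g h m θ' b) ≤ 2 := by
  have hl := lam_pos (g := g) (h := h) (m := m) (box_pos hθ₀ hb) b
  have hl' := lam_pos (g := g) (h := h) (m := m) (box_pos hθ₀ hb') b
  have k1 := (lam_mem_of_box (g := g) (h := h) (m := m) hb b).2
  have k2 := (lam_mem_of_box (g := g) (h := h) (m := m) hb' b).1
  rw [← Real.log_div hl.ne' hl'.ne']
  refine (Real.log_le_sub_one_of_pos (by positivity)).trans ?_
  rw [sub_le_iff_le_add, div_le_iff₀ hl']
  linarith

/-- The excess of the main stratum, from the comparison of a minimiser of a criterion with the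
point whose `k`-th coordinate is the true one. -/
lemma main_stratum_le (hg : g ≠ 0) (hh : h ≠ 0) (hm : m ≠ 0) (hθ₀ : ∀ k, 0 < θ₀ k)
    (hM : ∀ θ : VarComp, (∀ k, 0 < θ k) → (info x g h m θ).PosDef) (hτ : 0 ≤ τ) (hτ1 : τ ≤ 1)
    (hb : θ ∈ box θ₀) {k : Fin 4} (hθ' : θ' = Function.update θ k (θ₀ k))
    {u : ℕ → ℕ → ℕ → ℝ} {ξ₀ : FixedIdx pa pb pab pw → ℝ}
    (hmin : crit x g h m τ (table g h m (regMean x ξ₀ + u)) θ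
      ≤ crit x g h m τ (table g h m (regMean x ξ₀ + u)) θ') :
    stratDim g h m k.succ * (Real.log (lam g h m θ k.succ) - Real.log (lam g h m θ' k.succ))
      + stratForm g h m k.succ u u * ((lam g h m θ k.succ)⁻¹ - (lam g h m θ' k.succ)⁻¹)
      ≤ 8 * invSize g h m * numEff g h m k
        + 2 * ∑ b ∈ lowerStrata k, (lam g h m θ₀ b)⁻¹ * stratForm g h m b u u
        + (2 * Fintype.card (FixedIdx pa pb pab pw)
          + 30 * energyBound x g h m θ₀ (table g h m u)) := by
  have hb' : θ' ∈ box θ₀ := by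
    intro r
    rw [hθ']
    rcases eq_or_ne r k with rfl | hr
    · have := hθ₀ r
      simp only [Function.update_self]
      constructor <;> linarith
    · simpa [hr] using hb r
  have hl := fun b => lam_pos (g := g) (h := h) (m := m) (box_pos hθ₀ hb) b
  have hl' := fun b => lam_pos (g := g) (h := h) (m := m) (box_pos hθ₀ hb') b
  have hl₀ := fun b => lam_pos (g := g) (h := h) (m := m) hθ₀ b
  obtain ⟨c, hc, hc', e1⟩ := dotProduct_projP hθ₀ hb hM u ξ₀
  obtain ⟨c₁, hc₁, hc₁', e2⟩ := dotProduct_projP hθ₀ hb' hM u ξ₀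
  rw [crit, crit, e1, e2, log_det_V hg hh hm hl, log_det_V hg hh hm hl', wForm, wForm] at hmin
  have h1 := log_det_info_le hθ₀ hb hb' hM
  set Λ := Real.log (info x g h m θ).det
  set Λ' := Real.log (info x g h m θ').det
  set p : ℝ := 2 * Fintype.card (FixedIdx pa pb pab pw) with hp
  have hp0 : 0 ≤ p := by positivity
  have h2 : τ * (Λ' - Λ) ≤ p := by
    rcases le_total (Λ' - Λ) 0 with hΛ | hΛ
    · nlinarith
    · nlinarith
  set T : Fin 5 → ℝ := fun b => stratDim g h m b * (Real.log (lam g h m θ b)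
    - Real.log (lam g h m θ' b)) + stratForm g h m b u u * ((lam g h m θ b)⁻¹
    - (lam g h m θ' b)⁻¹) with hT
  have h3 : ∑ b, T b ≤ p + 30 * energyBound x g h m θ₀ (table g h m u) := by
    have : ∑ b, T b = (∑ b, stratDim g h m b * Real.log (lam g h m θ b)
        + ∑ b, (lam g h m θ b)⁻¹ * stratForm g h m b u u)
        - (∑ b, stratDim g h m b * Real.log (lam g h m θ' b)
        + ∑ b, (lam g h m θ' b)⁻¹ * stratForm g h m b u u) := by
      rw [← Finset.sum_add_distrib, ← Finset.sum_add_distrib, ← Finset.sum_sub_distrib]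
      exact Finset.sum_congr rfl fun b _ => by simp only [hT]; ring
    rw [this]
    linarith
  have h4 : ∑ b, T b = T k.succ + ∑ b ∈ lowerStrata k, T b := by
    have hnm : k.succ ∉ lowerStrata k := by fin_cases k <;> decide
    rw [← Finset.sum_insert hnm]
    refine (Finset.sum_subset (Finset.subset_univ _) fun b _ hb => ?_).symm
    rw [Finset.mem_insert, not_or] at hb
    simp only [hT, hθ', lam_update θ k (θ₀ k) hb.1 hb.2, sub_self, mul_zero, add_zero]
  have h5 : ∀ b ∈ lowerStrata k, -(2 * (invSize g h m * numEff g h m k)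
      + 2 * ((lam g h m θ₀ b)⁻¹ * stratForm g h m b u u)) ≤ T b := by
    intro b hbl
    have k1 := abs_log_lam_sub_le (g := g) (h := h) (m := m) hθ₀ hb' hb b
    have k2 := stratDim_le_of_mem hg hh hm hbl
    have k3 := stratDim_nonneg hg hh hm b
    have k4 := stratForm_nonneg (g := g) (h := h) (m := m) u b
    have k5 : (lam g h m θ' b)⁻¹ - (lam g h m θ b)⁻¹ ≤ 2 * (lam g h m θ₀ b)⁻¹ := by
      have k6 := (lam_mem_of_box (g := g) (h := h) (m := m) hb' b).1
      have k7 : (lam g h m θ' b)⁻¹ ≤ 2 * (lam g h m θ₀ b)⁻¹ := by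
        rw [← div_eq_mul_inv, inv_le_iff_one_le_mul₀ (hl' b), mul_comm, mul_div_assoc',
          le_div_iff₀ (hl₀ b)]
        linarith
      have := (inv_pos.2 (hl b)).le
      linarith
    have k6 := mul_le_mul_of_nonneg_left k1 k3
    have k7 := mul_le_mul_of_nonneg_left k5 k4
    simp only [hT]
    linarith
  have h6 := Finset.sum_le_sum h5
  rw [Finset.sum_neg_distrib, Finset.sum_add_distrib, Finset.sum_const, ← Finset.mul_sum,
    nsmul_eq_mul] at h6
  have h7 : ((lowerStrata k).card : ℝ) ≤ 4 := by
    have : (lowerStrata k).card ≤ 4 := by fin_cases k <;> decide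
    exact_mod_cast this
  have h8 := mul_le_mul_of_nonneg_right h7 (mul_nonneg (zero_le_two (α := ℝ))
    (mul_nonneg (invSize_nonneg (g := g) (h := h) (m := m)) (numEff_pos hg hh hm k).le))
  change T k.succ ≤ _
  linarith

end Criterion

/-! ### Consistency of the minimisers -/

section Deterministic

variable {pa pb pab pw : ℕ} {x : Covariates pa pb pab pw} {g h m : ℕ} {θ θ₀ : VarComp} {τ : ℝ}

/-- A bound for the deviation of the `k`-th coordinate of a minimiser of a criterion. -/
noncomputable def devBound (x : Covariates pa pb pab pw) (g h m : ℕ) (θ₀ : VarComp)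
    (u : ℕ → ℕ → ℕ → ℝ) (k : Fin 4) : ℝ :=
  (10 + 3 * (θ₀ 2 + θ₀ 3) / θ₀ k) * invSize g h m
    + 2 * ∑ b ∈ lowerStrata k, (numEff g h m k)⁻¹ *
      ((lam g h m θ₀ b)⁻¹ * stratForm g h m b u u)
    + (numEff g h m k)⁻¹ * (2 * Fintype.card (FixedIdx pa pb pab pw)
      + 30 * energyBound x g h m θ₀ (table g h m u))
    + 2 / θ₀ k * |((g : ℝ) * h * m)⁻¹ * stratForm g h m k.succ u u - θ₀ k|

lemma sq_sub_le_devBound (hg : g ≠ 0) (hh : h ≠ 0) (hm : m ≠ 0) (hθ₀ : ∀ k, 0 < θ₀ k)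
    (hM : ∀ θ : VarComp, (∀ k, 0 < θ k) → (info x g h m θ).PosDef) (hτ : 0 ≤ τ) (hτ1 : τ ≤ 1)
    (hb : θ ∈ box θ₀) {u : ℕ → ℕ → ℕ → ℝ} {ξ₀ : FixedIdx pa pb pab pw → ℝ}
    (hmin : ∀ θ' ∈ box θ₀, crit x g h m τ (table g h m (regMean x ξ₀ + u)) θ
      ≤ crit x g h m τ (table g h m (regMean x ξ₀ + u)) θ') (k : Fin 4) :
    (θ k - θ₀ k) ^ 2 ≤ 8 * (3 / 2 * θ₀ k + 9 / 2 * (θ₀ 2 + θ₀ 3)) ^ 2 * devBound x g h m θ₀ u k := by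
  set θ' : VarComp := Function.update θ k (θ₀ k) with hθ'
  have hb' : θ' ∈ box θ₀ := by
    intro r
    rw [hθ']
    rcases eq_or_ne r k with rfl | hr
    · have := hθ₀ r
      simp only [Function.update_self]
      constructor <;> linarith
    · simpa [hr] using hb r
  have h1 := main_stratum_le hg hh hm hθ₀ hM hτ hτ1 hb hθ' (hmin θ' hb')
  have hθ := box_pos hθ₀ hb
  have hD := numEff_pos hg hh hm k
  have hn : (0 : ℝ) < g * h * m := by positivity
  have hex := excess_update (g := g) (h := h) (m := m) θ k (θ₀ k)
  have hex0 := excess_nonneg (g := g) (h := h) (m := m) (fun r => (hθ r).le) k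
  have hex1 := excess_le (g := g) (h := h) (m := m) (fun r => (hθ r).le) k
  have e1 := lam_succ_mul hg hh hm θ k
  have e2 := lam_succ_mul hg hh hm θ' k
  rw [← hθ'] at hex
  rw [hex, show θ' k = θ₀ k by simp [hθ']] at e2
  have hρ0 := invSize_nonneg (g := g) (h := h) (m := m)
  have hρ3 : invSize g h m ≤ 3 := by
    have := inv_natCast_le_one g
    have := inv_natCast_le_one h
    have := inv_natCast_le_one m
    unfold invSize
    linarith
  obtain ⟨d1, d2⟩ := stratDim_succ_le hg hh hm k
  set D := numEff g h m k
  set n : ℝ := g * h * m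
  set ρ := invSize g h m
  set ex := excess g h m θ k
  set S := stratForm g h m k.succ u u with hS
  set d := stratDim g h m k.succ
  have hS0 : 0 ≤ S := stratForm_nonneg u _
  have hT : θ 2 + θ 3 ≤ 3 / 2 * (θ₀ 2 + θ₀ 3) := by linarith [(hb 2).2, (hb 3).2]
  have hT0 : 0 < θ₀ 2 + θ₀ 3 := add_pos (hθ₀ 2) (hθ₀ 3)
  have hex2 : ex ≤ ρ * (3 / 2 * (θ₀ 2 + θ₀ 3)) :=
    hex1.trans (mul_le_mul_of_nonneg_left hT hρ0)
  have hex3 : ex ≤ 9 / 2 * (θ₀ 2 + θ₀ 3) := by nlinarith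
  set ℓ := θ k + ex with hℓ
  set ℓ' := θ₀ k + ex with hℓ'
  have k0 := hθ₀ k
  have k1 := hb k
  have hℓ0 : 0 < ℓ := by have := hθ k; positivity
  have hℓ'0 : 0 < ℓ' := by positivity
  have f1 : lam g h m θ k.succ = n * ℓ / D := by rw [← e1, mul_div_cancel_right₀ _ hD.ne']
  have f2 : lam g h m θ' k.succ = n * ℓ' / D := by rw [← e2, mul_div_cancel_right₀ _ hD.ne']
  set r := ℓ' / ℓ with hr
  have hr0 : 0 < r := by positivity
  have hr3 : r ≤ 3 := by
    rw [hr, div_le_iff₀ hℓ0]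
    linarith [k1.1]
  have hr4 : 1 / 3 ≤ r := by
    rw [hr, div_le_div_iff₀ (by norm_num) hℓ0]
    linarith [k1.2]
  set Q := n⁻¹ * S with hQ
  have g1 : Real.log (lam g h m θ k.succ) - Real.log (lam g h m θ' k.succ) = -Real.log r := by
    rw [f1, f2, ← Real.log_div (by positivity) (by positivity), ← Real.log_inv]
    congr 1
    rw [hr]
    field_simp
  have g2 : S * ((lam g h m θ k.succ)⁻¹ - (lam g h m θ' k.succ)⁻¹) = D * (Q / ℓ' * (r - 1)) := by
    rw [f1, f2, hQ, hr]
    field_simp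
  rw [g1, g2] at h1
  have hlog : |Real.log r| ≤ 2 := by
    have a1 := Real.log_le_sub_one_of_pos hr0
    have a2 := Real.one_sub_inv_le_log_of_pos hr0
    have a3 : r⁻¹ ≤ 3 := by
      rw [inv_le_iff_one_le_mul₀ hr0]
      linarith
    rw [abs_le]
    constructor <;> linarith
  have hr1 : |r - 1| ≤ 2 := by
    rw [abs_le]
    constructor <;> linarith
  -- the deviation of the sum of squares
  have g3 : |Q / ℓ' - 1| ≤ (|Q - θ₀ k| + ρ * (3 / 2 * (θ₀ 2 + θ₀ 3))) / θ₀ k := by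
    rw [div_sub_one hℓ'0.ne', abs_div, abs_of_pos hℓ'0]
    refine div_le_div₀ (by positivity) ?_ k0 (by linarith)
    calc |Q - ℓ'| = |(Q - θ₀ k) - ex| := by rw [hℓ']; congr 1; ring
      _ ≤ |Q - θ₀ k| + |ex| := abs_sub _ _
      _ ≤ _ := by rw [abs_of_nonneg hex0]; linarith
  have g4 : -((Q / ℓ' - 1) * (r - 1)) ≤ |Q / ℓ' - 1| * 2 := by
    refine (neg_le_abs _).trans ?_
    rw [abs_mul]
    exact mul_le_mul_of_nonneg_left hr1 (abs_nonneg _)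
  have g5 : -((1 - d / D) * Real.log r) ≤ ρ * 2 := by
    refine (neg_le_abs _).trans ?_
    rw [abs_mul]
    have a1 : 0 ≤ 1 - d / D := by
      rw [sub_nonneg, div_le_one hD]
      exact d2
    have a2 : 1 - d / D ≤ ρ := by
      rw [sub_le_comm, le_div_iff₀ hD]
      exact d1
    rw [abs_of_nonneg a1]
    exact mul_le_mul a2 hlog (abs_nonneg _) hρ0
  have g6 := mul_le_mul_of_nonneg_left h1 (inv_pos.2 hD).le
  have g7 := sq_sub_one_le hr0 hr3
  have g8 : D⁻¹ * (d * -Real.log r + D * (Q / ℓ' * (r - 1)))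
      = r - 1 - Real.log r + (1 - d / D) * Real.log r + (Q / ℓ' - 1) * (r - 1) := by
    field_simp
    ring
  have g9 : (r - 1) ^ 2 / 8 ≤ devBound x g h m θ₀ u k := by
    have a1 : 2 * ((|Q - θ₀ k| + ρ * (3 / 2 * (θ₀ 2 + θ₀ 3))) / θ₀ k)
        = 2 / θ₀ k * |Q - θ₀ k| + 3 * (θ₀ 2 + θ₀ 3) / θ₀ k * ρ := by
      field_simp
      try ring
    have a2 : D⁻¹ * (8 * ρ * D) = 8 * ρ := by
      field_simp
    rw [g8, mul_add, mul_add, a2, mul_left_comm D⁻¹ 2, Finset.mul_sum] at g6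
    rw [devBound]
    linarith
  have g10 : (θ k - θ₀ k) ^ 2 = ℓ ^ 2 * (r - 1) ^ 2 := by
    have : θ k - θ₀ k = -(ℓ * (r - 1)) := by
      rw [mul_sub, hr, mul_div_cancel₀ _ hℓ0.ne', hℓ, hℓ']
      ring
    rw [this, neg_sq, mul_pow]
  rw [g10]
  have g11 : ℓ ^ 2 ≤ (3 / 2 * θ₀ k + 9 / 2 * (θ₀ 2 + θ₀ 3)) ^ 2 :=
    pow_le_pow_left₀ hℓ0.le (by linarith [k1.2]) 2
  calc ℓ ^ 2 * (r - 1) ^ 2 ≤ (3 / 2 * θ₀ k + 9 / 2 * (θ₀ 2 + θ₀ 3)) ^ 2 * (r - 1) ^ 2 := by gcongr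
    _ = 8 * (3 / 2 * θ₀ k + 9 / 2 * (θ₀ 2 + θ₀ 3)) ^ 2 * ((r - 1) ^ 2 / 8) := by ring
    _ ≤ _ := by gcongr

end Deterministic

section Consistency

variable {S : Type*} [MeasurableSpace S] {P : Measure S} [IsProbabilityMeasure P]
  {pa pb pab pw : ℕ} {x : Covariates pa pb pab pw} {ω₀ : Param pa pb pab pw}
  {α β : ℕ → S → ℝ} {γ : ℕ → ℕ → S → ℝ} {e : ℕ → ℕ → ℕ → S → ℝ}
  {g h m : ℕ → ℕ} {η η₁ η₂ : ℝ≥0∞}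

namespace RegularityConditions

variable (hB : RegularityConditions x P ω₀ α β γ e g h m η η₁ η₂)

include hB

lemma tendsto_devBound (k : Fin 4) : Tendsto (fun q : ℕ × S =>
    devBound x (g q.1) (h q.1) (m q.1) ω₀.2 (noise α β γ e q.2) k) (probFilter P) (𝓝 0) := by
  have tD : Tendsto (fun N => (numEff (g N) (h N) (m N) k)⁻¹) atTop (𝓝 0) := by
    have ig := tendsto_inv_natCast hB.g_top
    have ih := tendsto_inv_natCast hB.h_top
    have im := tendsto_inv_natCast hB.m_top
    fin_cases k
    · exact ig
    · exact ih
    · simpa [numEff, mul_comm] using ig.mul ih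
    · simpa [numEff, mul_comm] using im.mul (ig.mul ih)
  have t1 := (hB.tendsto_invSize.comp (tendsto_fst_probFilter (P := P))).const_mul
    (10 + 3 * (ω₀.2 2 + ω₀.2 3) / ω₀.2 k)
  have t2 := (tendsto_finsetSum (lowerStrata k) fun b hb => hB.tendsto_lowerStrata hb).const_mul 2
  have t3 := ((IsBoundedInProb.of_tendsto (P := P) (X := fun _ : ℕ × S =>
    2 * (Fintype.card (FixedIdx pa pb pab pw) : ℝ)) tendsto_const_nhds).add
    (hB.energyBound_isBoundedInProb.const_mul 30)).mul_tendsto tD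
  have t4 := (((hB.tendsto_stratForm_succ k).sub_const (ω₀.2 k)).abs).const_mul (2 / ω₀.2 k)
  have t := ((t1.add t2).add t3).add t4
  simp only [mul_zero, Finset.sum_const_zero, add_zero, sub_self, abs_zero] at t
  exact t

/-- The minimisers of the criteria over the box are consistent. -/
lemma tendsto_argmin {τ : ℝ} (hτ : 0 ≤ τ) (hτ1 : τ ≤ 1) {θ : ℕ × S → VarComp}
    (hθ : ∀ᶠ q in probFilter P, θ q ∈ box ω₀.2 ∧ ∀ θ' ∈ box ω₀.2,
      crit x (g q.1) (h q.1) (m q.1) τ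
          (table (g q.1) (h q.1) (m q.1) (response x ω₀.1 α β γ e q.2)) (θ q)
        ≤ crit x (g q.1) (h q.1) (m q.1) τ
          (table (g q.1) (h q.1) (m q.1) (response x ω₀.1 α β γ e q.2)) θ') :
    Tendsto θ (probFilter P) (𝓝 ω₀.2) := by
  have hresp : ∀ s, response x ω₀.1 α β γ e s = regMean x ω₀.1 + noise α β γ e s := by
    intro s
    ext i j k
    simp only [response, noise, randPart, Pi.add_apply]
    ring
  simp only [hresp] at hθ
  rw [tendsto_pi_nhds]
  intro k
  have t := (Real.continuous_sqrt.tendsto _).comp ((hB.tendsto_devBound k).const_mul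
    (8 * (3 / 2 * ω₀.2 k + 9 / 2 * (ω₀.2 2 + ω₀.2 3)) ^ 2))
  rw [mul_zero, Real.sqrt_zero] at t
  have t2 : Tendsto (fun q => θ q k - ω₀.2 k) (probFilter P) (𝓝 0) := by
    refine squeeze_zero_norm' ?_ t
    filter_upwards [hθ, eventually_fst_probFilter hB.eventually_sizes_ne_zero,
      eventually_fst_probFilter hB.eventually_info_posDef] with q ⟨h1, h2⟩ ⟨h3, h4, h5⟩ h6
    exact Real.abs_le_sqrt (sq_sub_le_devBound h3 h4 h5 hB.var_pos h6 hτ hτ1 h1 h2 k)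
  simpa using t2.add_const (ω₀.2 k)

end RegularityConditions

end Consistency

/-! ### Differentiability and measurability of matrix functions -/

section MatrixCalculus

variable {ι κ μ : Type*} [Fintype ι] [DecidableEq ι] [Fintype κ]

lemma inv_apply_eq (A : Matrix ι ι ℝ) (i j : ι) : A⁻¹ i j
    = (A.det)⁻¹ * ∑ σ : Equiv.Perm ι, ((Equiv.Perm.sign σ : ℤ) : ℝ) *
      ∏ r, (A.updateRow j (Pi.single i 1)) (σ r) r := by
  rw [Matrix.inv_def, Matrix.smul_apply, smul_eq_mul, Ring.inverse_eq_inv', Matrix.adjugate_apply,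
    Matrix.det_apply' (A.updateRow _ _)]

section Differentiable

variable {F : Type*} [NormedAddCommGroup F] [NormedSpace ℝ F] {t : F}

lemma differentiableAt_prod {f : ι → F → ℝ} (hf : ∀ i, DifferentiableAt ℝ (f i) t) :
    DifferentiableAt ℝ (fun t => ∏ i, f i t) t :=
  (HasFDerivAt.finsetProd (u := Finset.univ) fun i _ => (hf i).hasFDerivAt).differentiableAt

lemma differentiableAt_det {A : F → Matrix ι ι ℝ}
    (hA : ∀ i j, DifferentiableAt ℝ (fun t => A t i j) t) :
    DifferentiableAt ℝ (fun t => (A t).det) t := by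
  simp only [Matrix.det_apply']
  exact DifferentiableAt.fun_sum fun σ _ =>
    (differentiableAt_prod (f := fun r t => A t (σ r) r) fun r => hA _ _).const_mul _

lemma differentiableAt_inv_apply {A : F → Matrix ι ι ℝ}
    (hA : ∀ i j, DifferentiableAt ℝ (fun t => A t i j) t) (h0 : (A t).det ≠ 0) (i j : ι) :
    DifferentiableAt ℝ (fun t => (A t)⁻¹ i j) t := by
  simp only [inv_apply_eq]
  refine ((differentiableAt_det hA).inv h0).mul (DifferentiableAt.fun_sum fun σ _ =>
    (differentiableAt_prod
      (f := fun r t => ((A t).updateRow j (Pi.single i 1)) (σ r) r) fun r => ?_).const_mul _)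
  simp only [Matrix.updateRow_apply]
  split_ifs
  · exact differentiableAt_const _
  · exact hA _ _

omit [DecidableEq ι] [Fintype κ] in
lemma differentiableAt_mul_apply {A : F → Matrix κ ι ℝ} {B : F → Matrix ι μ ℝ}
    (hA : ∀ i j, DifferentiableAt ℝ (fun t => A t i j) t)
    (hB : ∀ i j, DifferentiableAt ℝ (fun t => B t i j) t) (i : κ) (j : μ) :
    DifferentiableAt ℝ (fun t => (A t * B t) i j) t := by
  simp only [Matrix.mul_apply]
  exact DifferentiableAt.fun_sum fun r _ => (hA _ _).mul (hB _ _)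

omit [DecidableEq ι] in
lemma differentiableAt_bilin {A : F → Matrix κ ι ℝ} {u : F → κ → ℝ} {v : F → ι → ℝ}
    (hu : ∀ i, DifferentiableAt ℝ (fun t => u t i) t)
    (hA : ∀ i j, DifferentiableAt ℝ (fun t => A t i j) t)
    (hv : ∀ i, DifferentiableAt ℝ (fun t => v t i) t) :
    DifferentiableAt ℝ (fun t => u t ⬝ᵥ (A t *ᵥ v t)) t := by
  simp only [dotProduct, Matrix.mulVec]
  exact DifferentiableAt.fun_sum fun r _ => (hu r).mul
    (DifferentiableAt.fun_sum fun r' _ => (hA r r').mul (hv r'))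

end Differentiable

section Measurable

variable {Y : Type*} [MeasurableSpace Y]

lemma measurable_inv_apply {A : Y → Matrix ι ι ℝ} (hA : ∀ i j, Measurable fun t => A t i j)
    (i j : ι) : Measurable fun t => (A t)⁻¹ i j := by
  simp only [inv_apply_eq, Matrix.det_apply']
  refine Measurable.mul (Measurable.inv (Finset.measurable_fun_sum _ fun σ _ =>
    (Finset.measurable_fun_prod _ fun r _ => hA _ _).const_mul _))
    (Finset.measurable_fun_sum _ fun σ _ =>
      (Finset.measurable_fun_prod _ fun r _ => ?_).const_mul _)
  simp only [Matrix.updateRow_apply]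
  split_ifs
  · exact measurable_const
  · exact hA _ _

omit [DecidableEq ι] [Fintype κ] in
lemma measurable_mulVec_apply {A : Y → Matrix κ ι ℝ} {v : Y → ι → ℝ}
    (hA : ∀ i j, Measurable fun t => A t i j) (hv : ∀ i, Measurable fun t => v t i) (i : κ) :
    Measurable fun t => (A t *ᵥ v t) i := by
  simp only [Matrix.mulVec, dotProduct]
  exact Finset.measurable_fun_sum _ fun r _ => (hA _ _).mul (hv _)

omit [DecidableEq ι] [Fintype κ] in
lemma measurable_mul_apply {A : Y → Matrix κ ι ℝ} {B : Y → Matrix ι μ ℝ}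
    (hA : ∀ i j, Measurable fun t => A t i j) (hB : ∀ i j, Measurable fun t => B t i j) (i : κ)
    (j : μ) : Measurable fun t => (A t * B t) i j := by
  simp only [Matrix.mul_apply]
  exact Finset.measurable_fun_sum _ fun r _ => (hA _ _).mul (hB _ _)

end Measurable

end MatrixCalculus

/-! ### The criteria are smooth -/

section Smooth

variable {pa pb pab pw : ℕ} {x : Covariates pa pb pab pw} {g h m : ℕ}
  {F : Type*} [NormedAddCommGroup F] [NormedSpace ℝ F] {θ : F → VarComp} {t : F}

lemma det_V_pos {θ : VarComp} (hθ : ∀ k, 0 < θ k) : 0 < (V g h m θ).det := by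
  rw [V_eq_sum]
  exact (log_det_sum_smul (strat_idem g h m) (strat_transpose g h m) fun b => lam_pos hθ b).1

section

variable (hθ : ∀ k, DifferentiableAt ℝ (fun t => θ t k) t) (h0 : ∀ k, 0 < θ t k)

include hθ in
lemma differentiableAt_V_apply (o o' : Obs g h m) :
    DifferentiableAt ℝ (fun t => V g h m (θ t) o o') t := by
  have h0 := hθ 0
  have h1 := hθ 1
  have h2 := hθ 2
  have h3 := hθ 3
  simp only [V, Matrix.add_apply, Matrix.smul_apply, smul_eq_mul]
  fun_prop

include hθ h0

lemma differentiableAt_V_inv_apply (o o' : Obs g h m) :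
    DifferentiableAt ℝ (fun t => (V g h m (θ t))⁻¹ o o') t :=
  differentiableAt_inv_apply (differentiableAt_V_apply hθ) (det_V_pos h0).ne' o o'

lemma differentiableAt_log_det_V :
    DifferentiableAt ℝ (fun t => Real.log (V g h m (θ t)).det) t :=
  (differentiableAt_det (differentiableAt_V_apply hθ)).log (det_V_pos h0).ne'

lemma differentiableAt_info_apply (r r' : FixedIdx pa pb pab pw) :
    DifferentiableAt ℝ (fun t => info x g h m (θ t) r r') t := by
  have h1 := differentiableAt_mul_apply (A := fun _ : F => (design x g h m)ᵀ)
    (B := fun t => (V g h m (θ t))⁻¹) (fun _ _ => differentiableAt_const _)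
    (differentiableAt_V_inv_apply hθ h0)
  exact differentiableAt_mul_apply (A := fun t => (design x g h m)ᵀ * (V g h m (θ t))⁻¹)
    (B := fun _ => design x g h m) h1 (fun _ _ => differentiableAt_const _) r r'

lemma differentiableAt_projP_apply (hM : (info x g h m (θ t)).PosDef) (o o' : Obs g h m) :
    DifferentiableAt ℝ (fun t => projP x g h m (θ t) o o') t := by
  have hV := differentiableAt_V_inv_apply (g := g) (h := h) (m := m) hθ h0
  have hI := differentiableAt_inv_apply (A := fun t => info x g h m (θ t))
    (differentiableAt_info_apply hθ h0) hM.det_pos.ne'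
  have h1 := differentiableAt_mul_apply (A := fun t => (V g h m (θ t))⁻¹)
    (B := fun _ => design x g h m) hV (fun _ _ => differentiableAt_const _)
  have h2 := differentiableAt_mul_apply (A := fun t => (V g h m (θ t))⁻¹ * design x g h m)
    (B := fun t => (info x g h m (θ t))⁻¹) h1 hI
  have h3 := differentiableAt_mul_apply
    (A := fun t => (V g h m (θ t))⁻¹ * design x g h m * (info x g h m (θ t))⁻¹)
    (B := fun _ => (design x g h m)ᵀ) h2 (fun _ _ => differentiableAt_const _)
  have h4 := differentiableAt_mul_apply
    (A := fun t => (V g h m (θ t))⁻¹ * design x g h m * (info x g h m (θ t))⁻¹ * (design x g h m)ᵀ)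
    (B := fun t => (V g h m (θ t))⁻¹) h3 hV
  exact (hV o o').sub (h4 o o')

lemma differentiableAt_crit (hM : (info x g h m (θ t)).PosDef) (τ : ℝ) (y : Obs g h m → ℝ) :
    DifferentiableAt ℝ (fun t => crit x g h m τ y (θ t)) t := by
  have h1 := (differentiableAt_det (A := fun t => info x g h m (θ t))
    (differentiableAt_info_apply hθ h0)).log hM.det_pos.ne'
  have h2 := differentiableAt_bilin (u := fun _ : F => y) (A := fun t => projP x g h m (θ t))
    (v := fun _ => y) (fun _ => differentiableAt_const _) (differentiableAt_projP_apply hθ h0 hM)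
    (fun _ => differentiableAt_const _)
  exact ((differentiableAt_log_det_V hθ h0).add (h1.const_mul τ)).add h2

end

lemma differentiableAt_logLik {ω : Param pa pb pab pw} (hω : ∀ k, 0 < ω.2 k) (y : Obs g h m → ℝ) :
    DifferentiableAt ℝ (logLik x g h m y) ω := by
  have hθ : ∀ k, DifferentiableAt ℝ (fun ω : Param pa pb pab pw => ω.2 k) ω := fun k => by fun_prop
  have hr : ∀ o, DifferentiableAt ℝ
      (fun ω : Param pa pb pab pw => (y - design x g h m *ᵥ ω.1) o) ω := fun o => by
    simp only [Pi.sub_apply, Matrix.mulVec, dotProduct]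
    fun_prop
  unfold logLik
  have h1 := differentiableAt_bilin (u := fun ω : Param pa pb pab pw => y - design x g h m *ᵥ ω.1)
    (A := fun ω => (V g h m ω.2)⁻¹) (v := fun ω => y - design x g h m *ᵥ ω.1) hr
    (differentiableAt_V_inv_apply hθ hω) hr
  exact (((differentiableAt_log_det_V hθ hω).const_mul _).const_sub _).sub (h1.const_mul _)

lemma measurable_gls {Y : Type*} [MeasurableSpace Y] {θ : Y → VarComp} {y : Y → Obs g h m → ℝ}
    (hθ : Measurable θ) (hy : Measurable y) : Measurable fun t => gls x g h m (θ t) (y t) := by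
  have h1 : ∀ k, Measurable fun t => θ t k := fun k => (measurable_pi_apply k).comp hθ
  have hV : ∀ o o', Measurable fun t => (V g h m (θ t))⁻¹ o o' := measurable_inv_apply fun o o' => by
    have := h1 0
    have := h1 1
    have := h1 2
    have := h1 3
    simp only [V, Matrix.add_apply, Matrix.smul_apply, smul_eq_mul]
    fun_prop
  have m1 := measurable_mul_apply (A := fun _ : Y => (design x g h m)ᵀ)
    (B := fun t => (V g h m (θ t))⁻¹) (fun _ _ => measurable_const) hV
  have m2 := measurable_mul_apply (A := fun t => (design x g h m)ᵀ * (V g h m (θ t))⁻¹)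
    (B := fun _ => design x g h m) m1 (fun _ _ => measurable_const)
  have m3 := measurable_mulVec_apply (A := fun t => (V g h m (θ t))⁻¹) (v := y) hV
    fun o => (measurable_pi_apply o).comp hy
  have m4 := measurable_mulVec_apply (A := fun _ : Y => (design x g h m)ᵀ)
    (v := fun t => (V g h m (θ t))⁻¹ *ᵥ y t) (fun _ _ => measurable_const) m3
  exact measurable_pi_lambda _ fun r => measurable_mulVec_apply
    (A := fun t => (info x g h m (θ t))⁻¹)
    (v := fun t => (design x g h m)ᵀ *ᵥ ((V g h m (θ t))⁻¹ *ᵥ y t))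
    (measurable_inv_apply (A := fun t => info x g h m (θ t)) m2) m4 r

end Smooth

/-! ### Existence of consistent roots -/

section Roots

variable {pa pb pab pw : ℕ} {x : Covariates pa pb pab pw} {g h m : ℕ} {θ₀ : VarComp}

lemma isCompact_box (θ₀ : VarComp) : IsCompact (box θ₀) := by
  have h1 : box θ₀ = Set.pi Set.univ fun k => Set.Icc (θ₀ k / 2) (3 / 2 * θ₀ k) := by
    ext θ
    simp [box, Pi.le_def, forall_and]
  rw [h1]
  exact isCompact_univ_pi fun k => isCompact_Icc

/-- A measurable minimiser of a criterion over the box. -/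
lemma exists_argmin_crit (hθ₀ : ∀ k, 0 < θ₀ k)
    (hM : ∀ θ : VarComp, (∀ k, 0 < θ k) → (info x g h m θ).PosDef) (τ : ℝ) :
    ∃ T : (Obs g h m → ℝ) → VarComp, Measurable T ∧ ∀ y, T y ∈ box θ₀ ∧
      ∀ θ ∈ box θ₀, crit x g h m τ y (T y) ≤ crit x g h m τ y θ := by
  have : CompactSpace (box θ₀) := isCompact_iff_compactSpace.1 (isCompact_box θ₀)
  have : Nonempty (box θ₀) := ⟨θ₀, mem_of_mem_nhds (box_mem_nhds hθ₀)⟩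
  have hc : ∀ y, Continuous fun θ : box θ₀ => crit x g h m τ y θ := by
    refine fun y => continuous_iff_continuousAt.2 fun θ => ?_
    have h1 := differentiableAt_crit (x := x) (g := g) (h := h) (m := m) (θ := fun θ : VarComp => θ)
      (t := (θ : VarComp)) (fun k => by fun_prop) (box_pos hθ₀ θ.2) (hM _ (box_pos hθ₀ θ.2)) τ y
    exact h1.continuousAt.comp continuous_subtype_val.continuousAt
  have hm : ∀ θ : box θ₀, Measurable fun y => crit x g h m τ y θ := by
    intro θ
    unfold crit
    refine measurable_const.add ?_
    simp only [dotProduct]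
    exact Finset.measurable_fun_sum _ fun o _ => (measurable_pi_apply o).mul
      (measurable_mulVec_apply (A := fun _ => projP x g h m θ) (v := fun y => y)
        (fun _ _ => measurable_const) measurable_pi_apply o)
  obtain ⟨T, hT, hmin⟩ := exists_measurable_argmin _ hc hm
  exact ⟨fun y => T y, measurable_subtype_coe.comp hT, fun y => ⟨(T y).2, fun θ hθ =>
    hmin y ⟨θ, hθ⟩⟩⟩

lemma logLik_eq {θ : VarComp} (hM : (info x g h m θ).PosDef) (y : Obs g h m → ℝ)
    (ξ : FixedIdx pa pb pab pw → ℝ) :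
    logLik x g h m y (ξ, θ) = -(((g * h * m : ℕ) : ℝ) / 2) * Real.log (2 * Real.pi)
      - (1 / 2) * crit x g h m 0 y θ - (1 / 2) * ((ξ - gls x g h m θ y) ⬝ᵥ
        (info x g h m θ *ᵥ (ξ - gls x g h m θ y))) := by
  rw [logLik, weighted_rss_eq hM, crit]
  ring

lemma logLik_le_gls {θ : VarComp} (hM : (info x g h m θ).PosDef) (y : Obs g h m → ℝ)
    (ξ : FixedIdx pa pb pab pw → ℝ) :
    logLik x g h m y (ξ, θ) ≤ logLik x g h m y (gls x g h m θ y, θ) := by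
  have h1 := hM.posSemidef.dotProduct_mulVec_nonneg (ξ - gls x g h m θ y)
  rw [star_trivial] at h1
  rw [logLik_eq hM, logLik_eq hM, sub_self, Matrix.mulVec_zero, dotProduct_zero]
  linarith

variable {θ : VarComp} {y : Obs g h m → ℝ}
  (hM : ∀ θ : VarComp, (∀ k, 0 < θ k) → (info x g h m θ).PosDef) (hθ₀ : ∀ k, 0 < θ₀ k)
  (hb : θ ∈ box θ₀) (hn : box θ₀ ∈ 𝓝 θ)

lemma mem_paramSpace_of_pos {ω : Param pa pb pab pw} (hω : ∀ k, 0 < ω.2 k) :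
    ω ∈ paramSpace pa pb pab pw := ⟨(hω 0).le, (hω 1).le, (hω 2).le, hω 3⟩

include hM hθ₀ hb

lemma hasFDerivAt_logLik_gls : HasFDerivAt (fun ξ => logLik x g h m y (ξ, θ))
    (0 : (FixedIdx pa pb pab pw → ℝ) →L[ℝ] ℝ) (gls x g h m θ y) := by
  have hθ := box_pos hθ₀ hb
  have h1 : DifferentiableAt ℝ (logLik x g h m y) (gls x g h m θ y, θ) := differentiableAt_logLik hθ y
  have h2 : DifferentiableAt ℝ (fun ξ => logLik x g h m y (ξ, θ)) (gls x g h m θ y) :=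
    DifferentiableAt.comp (g := logLik x g h m y) (f := fun ξ => (ξ, θ)) _ h1 (by fun_prop)
  have h3 : IsLocalMax (fun ξ => logLik x g h m y (ξ, θ)) (gls x g h m θ y) :=
    Eventually.of_forall fun ξ => logLik_le_gls (hM θ hθ) y ξ
  have h4 := h2.hasFDerivAt
  rwa [h3.fderiv_eq_zero] at h4

include hn

/-- An interior minimiser of the profile criterion yields a solution of the maximum likelihood
equations. -/
lemma solvesML_of_argmin (hmin : ∀ θ' ∈ box θ₀, crit x g h m 0 y θ ≤ crit x g h m 0 y θ') :
    SolvesML x g h m y (gls x g h m θ y, θ) := by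
  have hθ := box_pos hθ₀ hb
  refine ⟨mem_paramSpace_of_pos hθ, ?_⟩
  have h1 : DifferentiableAt ℝ (logLik x g h m y) (gls x g h m θ y, θ) := differentiableAt_logLik hθ y
  have h3 : IsLocalMax (logLik x g h m y) (gls x g h m θ y, θ) := by
    have h5 : ∀ᶠ ω : Param pa pb pab pw in 𝓝 (gls x g h m θ y, θ), ω.2 ∈ box θ₀ :=
      (continuous_snd.tendsto (gls x g h m θ y, θ)).eventually hn
    filter_upwards [h5] with ω hω
    have p1 := hM ω.2 (box_pos hθ₀ hω)
    refine (logLik_le_gls p1 y ω.1).trans ?_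
    rw [logLik_eq p1, logLik_eq (hM θ hθ), sub_self, sub_self, Matrix.mulVec_zero,
      dotProduct_zero, Matrix.mulVec_zero, dotProduct_zero]
    linarith [hmin ω.2 hω]
  have h4 := h1.hasFDerivAt
  rwa [h3.fderiv_eq_zero] at h4

/-- An interior minimiser of the REML criterion yields a solution of the REML equations. -/
lemma solvesREML_of_argmin (hmin : ∀ θ' ∈ box θ₀, crit x g h m 1 y θ ≤ crit x g h m 1 y θ') :
    SolvesREML x g h m y (gls x g h m θ y, θ) := by
  have hθ := box_pos hθ₀ hb
  refine ⟨mem_paramSpace_of_pos hθ, ?_, hasFDerivAt_logLik_gls hM hθ₀ hb⟩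
  have h0 : remlCrit x g h m y = fun θ => -(1 / 2) * crit x g h m 1 y θ := by
    ext θ
    rw [remlCrit, crit, info]
    ring
  have h1 : DifferentiableAt ℝ (remlCrit x g h m y) θ := by
    rw [h0]
    exact (differentiableAt_crit (θ := fun θ : VarComp => θ) (fun k => by fun_prop) hθ
      (hM θ hθ) 1 y).const_mul _
  have h3 : IsLocalMax (remlCrit x g h m y) θ := by
    filter_upwards [hn] with θ' hθ'
    rw [h0]
    linarith [hmin θ' hθ']
  have h4 := h1.hasFDerivAt
  rwa [h3.fderiv_eq_zero] at h4

end Roots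

section Existence

variable {S : Type*} [MeasurableSpace S] {P : Measure S} [IsProbabilityMeasure P]
  {pa pb pab pw : ℕ} {x : Covariates pa pb pab pw} {ω₀ : Param pa pb pab pw}
  {α β : ℕ → S → ℝ} {γ : ℕ → ℕ → S → ℝ} {e : ℕ → ℕ → ℕ → S → ℝ}
  {g h m : ℕ → ℕ} {η η₁ η₂ : ℝ≥0∞}

namespace RegularityConditions

variable (hB : RegularityConditions x P ω₀ α β γ e g h m η η₁ η₂)

include hB

/-- Consistent roots from the minimisers of a criterion. -/
lemma exists_isConsistentRoot {τ : ℝ} (hτ : 0 ≤ τ) (hτ1 : τ ≤ 1)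
    {Solves : ∀ g h m : ℕ, (Obs g h m → ℝ) → Param pa pb pab pw → Prop}
    (hS : ∀ {g h m : ℕ} {y : Obs g h m → ℝ} {θ : VarComp},
      (∀ θ : VarComp, (∀ k, 0 < θ k) → (info x g h m θ).PosDef) → θ ∈ box ω₀.2 →
      box ω₀.2 ∈ 𝓝 θ → (∀ θ' ∈ box ω₀.2, crit x g h m τ y θ ≤ crit x g h m τ y θ') →
      Solves g h m y (gls x g h m θ y, θ)) :
    ∃ est, IsConsistentRoot P Solves ω₀ (response x ω₀.1 α β γ e) g h m est := by
  have hT : ∀ N, ∃ T : (Obs (g N) (h N) (m N) → ℝ) → VarComp, Measurable T ∧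
      ((∀ θ : VarComp, (∀ k, 0 < θ k) → (info x (g N) (h N) (m N) θ).PosDef) → ∀ y, T y ∈ box ω₀.2 ∧
        ∀ θ ∈ box ω₀.2, crit x (g N) (h N) (m N) τ y (T y) ≤ crit x (g N) (h N) (m N) τ y θ) := by
    intro N
    by_cases hM : ∀ θ : VarComp, (∀ k, 0 < θ k) → (info x (g N) (h N) (m N) θ).PosDef
    · obtain ⟨T, h1, h2⟩ := exists_argmin_crit hB.var_pos hM τ
      exact ⟨T, h1, fun _ => h2⟩
    · exact ⟨fun _ => 0, measurable_const, fun h => absurd h hM⟩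
  choose T hTm hTmin using hT
  set y := response x ω₀.1 α β γ e with hy
  set Y : ∀ q : ℕ × S, Obs (g q.1) (h q.1) (m q.1) → ℝ :=
    fun q => table (g q.1) (h q.1) (m q.1) (y q.2) with hY
  have hpd := eventually_fst_probFilter (P := P) hB.eventually_info_posDef
  have hbox : ∀ᶠ q in probFilter P, T q.1 (Y q) ∈ box ω₀.2 ∧ ∀ θ' ∈ box ω₀.2,
      crit x (g q.1) (h q.1) (m q.1) τ (Y q) (T q.1 (Y q))
        ≤ crit x (g q.1) (h q.1) (m q.1) τ (Y q) θ' :=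
    hpd.mono fun q hq => hTmin q.1 hq (Y q)
  have tθ : Tendsto (fun q => T q.1 (Y q)) (probFilter P) (𝓝 ω₀.2) :=
    hB.tendsto_argmin hτ hτ1 hbox
  have hgls : IsGLSError P x ω₀ α β γ e g h m (fun q => T q.1 (Y q))
      (fun q => gls x (g q.1) (h q.1) (m q.1) (T q.1 (Y q)) (Y q) - ω₀.1) := by
    refine ⟨hbox.mono fun q hq => hq.1, ?_⟩
    filter_upwards [hbox, hpd] with q h1 h2 w
    have hθ := box_pos hB.var_pos h1.1
    rw [← response_sub_regMean (ξ := ω₀.1)]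
    exact wForm_gls (fun b => (lam_pos hθ b).ne') (h2 _ hθ) (y q.2) w
  have tξ := (hB.tendsto_glsError hgls).add_const ω₀.1
  simp only [sub_add_cancel, zero_add] at tξ
  refine ⟨fun N z => (gls x (g N) (h N) (m N) (T N z) z, T N z), ⟨fun N =>
    (measurable_gls (hTm N) measurable_id).prodMk (hTm N), ?_, ?_⟩⟩
  · change ∀ᶠ q in probFilter P, Solves (g q.1) (h q.1) (m q.1) (Y q)
      (gls x (g q.1) (h q.1) (m q.1) (T q.1 (Y q)) (Y q), T q.1 (Y q))
    filter_upwards [hbox, hpd, tθ.eventually (eventually_mem_nhds_iff.2 (box_mem_nhds hB.var_pos))]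
      with q h1 h2 h3
    exact hS h2 h1.1 h3 h1.2
  · exact tendsto_probFilter_iff.2 (tξ.prodMk_nhds tθ)

lemma exists_isConsistentRoot_ml :
    ∃ est, IsConsistentRoot P (SolvesML x) ω₀ (response x ω₀.1 α β γ e) g h m est :=
  hB.exists_isConsistentRoot le_rfl zero_le_one fun hM hb hn hmin =>
    solvesML_of_argmin hM hB.var_pos hb hn hmin

lemma exists_isConsistentRoot_reml :
    ∃ est, IsConsistentRoot P (SolvesREML x) ω₀ (response x ω₀.1 α β γ e) g h m est :=
  hB.exists_isConsistentRoot zero_le_one le_rfl fun hM hb hn hmin =>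
    solvesREML_of_argmin hM hB.var_pos hb hn hmin

end RegularityConditions

end Existence

end CrossedEffects

theorem mainTheorem2 {S : Type*} [MeasurableSpace S] (P : Measure S) [IsProbabilityMeasure P]
    {pa pb pab pw : ℕ} (x : CrossedEffects.Covariates pa pb pab pw)
    (ω₀ : CrossedEffects.Param pa pb pab pw)
    (α β : ℕ → S → ℝ) (γ : ℕ → ℕ → S → ℝ) (e : ℕ → ℕ → ℕ → S → ℝ)
    (g h m : ℕ → ℕ) (η η₁ η₂ : ℝ≥0∞)
    (hB : CrossedEffects.RegularityConditions x P ω₀ α β γ e g h m η η₁ η₂)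
    (y : S → ℕ → ℕ → ℕ → ℝ) (hy : y = CrossedEffects.response x ω₀.1 α β γ e)
    -- the limiting means and second moment matrices of the row and of the column covariates
    (ca : EuclideanSpace ℝ (Fin pa)) (cb : EuclideanSpace ℝ (Fin pb))
    (hca : Tendsto (fun n => CrossedEffects.avg n x.a) atTop (𝓝 ca))
    (hcb : Tendsto (fun n => CrossedEffects.avg n x.b) atTop (𝓝 cb))
    (D₁ : Matrix (Fin pa) (Fin pa) ℝ) (D₂ : Matrix (Fin pb) (Fin pb) ℝ)
    (hD₁ : Tendsto (fun n => CrossedEffects.avg n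
      (fun i => CrossedEffects.outer (CrossedEffects.ctr n x.a i).ofLp)) atTop (𝓝 D₁))
    (hD₂ : Tendsto (fun n => CrossedEffects.avg n
      (fun j => CrossedEffects.outer (CrossedEffects.ctr n x.b j).ofLp)) atTop (𝓝 D₂))
    (Ha Hb : ℕ → ℕ → ℝ)
    (hHa : Ha = CrossedEffects.leverage x.a ca D₁) (hHb : Hb = CrossedEffects.leverage x.b cb D₂) :
    (∃ est, CrossedEffects.IsConsistentRoot P (CrossedEffects.SolvesML x) ω₀ y g h m est) ∧
    (∃ est, CrossedEffects.IsConsistentRoot P (CrossedEffects.SolvesREML x) ω₀ y g h m est) ∧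
    ∀ est : ∀ N, (CrossedEffects.Obs (g N) (h N) (m N) → ℝ) → CrossedEffects.Param pa pb pab pw,
      (CrossedEffects.IsConsistentRoot P (CrossedEffects.SolvesML x) ω₀ y g h m est ∨
        CrossedEffects.IsConsistentRoot P (CrossedEffects.SolvesREML x) ω₀ y g h m est) →
      ∀ χ : ℕ → ℕ → ℕ → ℕ → ℕ → S → EuclideanSpace ℝ ((Fin 2 ⊕ Fin 2) ⊕ Fin 4),
        (χ = fun i i' j j' N s => CrossedEffects.predError x (g N) (h N) (m N)
          (est N (CrossedEffects.table (g N) (h N) (m N) (y s))) (y s) α β γ i i' j j' s) →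
        ∀ i i' j j' : ℕ, i ≠ i' → j ≠ j' →
          (η < ∞ → η₁ < ∞ →
            CrossedEffects.ConvergesToNormal P (fun N s => √(g N : ℝ) • χ i i' j j' N s)
              (CrossedEffects.limitCov 1 η.toReal η₁.toReal ω₀.2 Ha Hb i i' j j')) ∧
          (0 < η → η₂ < ∞ →
            CrossedEffects.ConvergesToNormal P (fun N s => √(h N : ℝ) • χ i i' j j' N s)
              (CrossedEffects.limitCov η⁻¹.toReal 1 η₂.toReal ω₀.2 Ha Hb i i' j j')) ∧
          (0 < η₁ → 0 < η₂ →
            CrossedEffects.ConvergesToNormal P (fun N s => √(m N : ℝ) • χ i i' j j' N s)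
              (CrossedEffects.limitCov η₁⁻¹.toReal η₂⁻¹.toReal 1 ω₀.2 Ha Hb i i' j j')) := by
  subst hy hHa hHb
  refine ⟨hB.exists_isConsistentRoot_ml, hB.exists_isConsistentRoot_reml, ?_⟩
  rintro est hest χ rfl i i' j j' hne hne'
  have hy := CrossedEffects.measurable_response (x := x) (ξ := ω₀.1) hB.measurable
  have key : ∀ {r : ℕ → ℕ} {κ₁ κ₂ κ₃ : ℝ}, CrossedEffects.IsScale r g h m κ₁ κ₂ κ₃ → _ :=
    fun hr => hB.convergesToNormal_predError hr
      (ω := fun N s => est N (CrossedEffects.table (g N) (h N) (m N)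
        (CrossedEffects.response x ω₀.1 α β γ e s)))
      (fun N => (hest.elim (·.measurable N) (·.measurable N)).comp
        (CrossedEffects.measurable_table hy _ _ _))
      (hest.elim
        (fun h' => h'.isGLSError (fun _ _ _ _ _ hs => ⟨hs.1, hs.hasFDerivAt⟩) hB.var_pos)
        (fun h' => h'.isGLSError (fun _ _ _ _ _ hs => ⟨hs.1, hs.2.2⟩) hB.var_pos))
      hca hcb hD₁ hD₂ hne hne'
  exact ⟨fun h₁ h₂ => key (hB.isScale_row h₁ h₂), fun h₁ h₂ => key (hB.isScale_col h₁ h₂),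
    fun h₁ h₂ => key (hB.isScale_rep h₁ h₂)⟩
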